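/- Let $b\ge 5$ be an integer, and let $$\alpha=\eta=[0;\overline{2,b}]^-=\cfrac{1}{2-\cfrac{1}{b-\cfrac{1}{2-\cdots}}}=\tfrac12\left(b-\sqrt{b^2-2b}\right),\qquad \beta=[0;\overline{b,2}]^-=1-\sqrt{1-2/b},\qquad D=\eta\beta .$$ For real $\gamma$ put $M(\alpha,\gamma)=\liminf_{|n|\to\infty}|n|\,\|n\alpha-\gamma\|$, where $n$ runs over the integers and $\|x\|$ is the distance from $x$ to the nearest integer, and put $M^*(\alpha,\gamma)=4(1-D)M(\alpha,\gamma)$. Let $a_i=2$ for $i$ odd, $a_i=b$ for $i$ even, $\alpha_i=\eta$ for $i$ even and $\alpha_i=\beta$ for $i$ odd. The $\alpha$-expansion of $\gamma$ has the digits $b_i$ ($i\ge1$) given by $\gamma_0=\{\gamma\}$, $b_i=\lfloor\gamma_{i-1}/\alpha_{i-1}\rfloor$, $\gamma_i=\{\gamma_{i-1}/\alpha_{i-1}\}$, and $t_i$ is defined by $b_i=\frac12(a_i-2+t_i)$. Say that $\gamma$ has period $w$, for a word $w$ of even length, if the sequence $(t_i)$ is from some odd index on the periodic repetition of $w$. Write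 $u^k$ for the word $u$ repeated $k$ times. Define classes of $\gamma$ as follows. * $S_{0,m}$, with $m$ of the same parity as $b$: period $(2,-m)$ or $(2,m-4)$. * $b$ odd: $S_{-2}$: period $(2,-3,2,-1)$. $S_{-1}$: period $(2,-1)(2,-3,2,-1)(2,-1)$ or $(2,-3)(2,-1,2,-3)(2,-3)$. $S_{2k}$, $k\ge1$: period $(2,-1)(2,-3,2,-1)^k$ or $(2,-3)(2,-1,2,-3)^k$. $S_{2k+1}$, $k\ge0$: period $(2,-1,0,-1)(2,-3,2,-1)^k$ or $(2,-1,0,-1)(2,-1,2,-3)^k$. * $b$ even: $S_{-1}$: period $(0,0)$. $S_{2k}$, $k\ge1$: period $(2,-4)(2,-2)^k$ or $(2,0)(2,-2)^k$. $S_{2k+1}$, $k\ge0$: period $(2,-2,0,0)(2,-2)^k$ or $(2,0,0,-2)(2,-2)^k$. Put $\delta_\infty=\eta\left((1-\beta)^2-\beta^2\right)$ if $b$ is even and $\delta_\infty=\eta\left((1-\beta)^2-\frac14\beta^4\right)$ if $b$ is odd. Let $J$ be the following set of indices: $(0,2)$ if $b$ is even and $(0,3)$ if $b$ is odd; $-1$;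 also $-2$ if $b$ is odd; all integers $k\ge1$; and, if $b\ge8$, the $(0,m)$ with $4\le m\le 2+\lfloor\sqrt{2b-4}\rfloor$ and $m\equiv b \pmod 2$. Then for every $j\in J$ the class $S_j$ is non-empty and disjoint from $\mathbb Z+\alpha\mathbb Z$, and $M^*(\alpha,\cdot)$ has a constant value on it; call this value $\delta_j$. Moreover: 1. The largest value $\rho^*(\alpha)$ of $M^*(\alpha,\gamma)$ over $\gamma\notin\mathbb Z+\alpha\mathbb Z$ exists, and $$\rho^*(\alpha)=\begin{cases}\delta_{0,2}=\eta,& b \text{ even},\\ \delta_{0,3}=\frac23\eta,& b=5,\\ \delta_{0,3}=\eta\left(1-\frac1{b^2-2b}\right),& b\ge7\text{ odd}.\end{cases}$$ 2. The values of $M^*(\alpha,\gamma)$, $\gamma\notin\mathbb Z+\alpha\mathbb Z$, that are greater than $\delta_\infty$ are exactly the $\delta_j$ with $j\in J$. 3. The sequences $(\delta_{2k})_{k\ge1}$ and $(\delta_{2k+1})_{k\ge0}$ are strictly decreasing with limit $\delta_\infty$. 4. For $j\in J$ and $\gamma\notin\mathbb Z+\alpha\mathbb Z$ one has $M^*(\alpha,\gamma)=\delta_j$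 if and only if $\gamma\in S_j$, with one exception: if $b$ is even and $2b-4=(m-2)^2$ for an integer $m\ge 4$, then $\delta_{-1}=\delta_{0,m}$, and this value is attained exactly by the $\gamma\in S_{-1}\cup S_{0,m}$. -/

import Mathlib

open Filter Topology

/-- Finite truncations of a negative continued fraction: `negConvergent a n i` is
`1/(a_i - 1/(a_{i+1} - ⋯ - 1/a_{i+n-1}))`, with value `0` for `n = 0`. -/
noncomputable def negConvergent (a : ℕ → ℕ) : ℕ → ℕ → ℝ
  | 0, _ => 0
  | n + 1, i => 1 / ((a i : ℝ) - negConvergent a n (i + 1))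

/-- `x = [0; a₀, a₁, a₂, …]⁻`, the value of the infinite negative continued fraction. -/
def IsNegCF (a : ℕ → ℕ) (x : ℝ) : Prop :=
  Tendsto (fun n => negConvergent a n 0) atTop (𝓝 x)

/-- The partial quotients `2, b, 2, b, …` (indexed from `0`). -/
def partialQuotient (b : ℕ) (i : ℕ) : ℕ := if Even i then 2 else b

/-- The inhomogeneous approximation constant
`M(α, γ) = liminf_{|n| → ∞} |n| ‖nα - γ‖`, where `n` runs over all integers and
`‖x‖` is the distance from `x` to the nearest integer. -/
noncomputable def approxConst (α γ : ℝ) : ℝ :=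
  liminf (fun n : ℤ => |(n : ℝ)| * |((n : ℝ) * α - γ) - round ((n : ℝ) * α - γ)|) cofinite

/-- The normalised constant `M*(α, γ) = 4 (1 - D) M(α, γ)` with `D = α β`. -/
noncomputable def approxConstStar (α β γ : ℝ) : ℝ :=
  4 * (1 - α * β) * approxConst α γ

/-- The group `ℤ + α ℤ`. -/
def lattice (α : ℝ) : Set ℝ := {γ | ∃ m n : ℤ, γ = (m : ℝ) + (n : ℝ) * α}

/-- The set of values of `M*(α, γ)` for `γ ∉ ℤ + α ℤ`. -/
def spectrumStar (α β : ℝ) : Set ℝ := {v | ∃ γ, γ ∉ lattice α ∧ approxConstStar α β γ = v}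

/-- The complete quotients of `α = [0; 2, b, 2, b, …]⁻`: they alternate between `α` and
`β = [0; b, 2, b, 2, …]⁻`. -/
def completeQuotient (α β : ℝ) (i : ℕ) : ℝ := if Even i then α else β

/-- The successive remainders of the `α`-expansion of `γ`. -/
noncomputable def expansionRem (α β γ : ℝ) : ℕ → ℝ
  | 0 => Int.fract γ
  | i + 1 => Int.fract (expansionRem α β γ i / completeQuotient α β i)

/-- The digits of the `α`-expansion of `γ` (indexed from `0`), so that
`{γ} = ∑ i, digit i * (α₀ α₁ ⋯ αᵢ)` with `αᵢ` the complete quotients. -/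
noncomputable def expansionDigit (α β γ : ℝ) (i : ℕ) : ℤ :=
  ⌊expansionRem α β γ i / completeQuotient α β i⌋

/-- The integers `tᵢ` with `digit i = (aᵢ - 2 + tᵢ) / 2`. -/
noncomputable def expansionT (b : ℕ) (α β γ : ℝ) (i : ℕ) : ℤ :=
  2 * expansionDigit α β γ i - (partialQuotient b i : ℤ) + 2

/-- The sequence `tᵢ` of `γ` is eventually periodic with period the word `w` (of even length),
the word starting at a place whose partial quotient is `2`. -/
def HasPeriod (b : ℕ) (α β γ : ℝ) (w : List ℤ) : Prop :=
  ∃ N : ℕ, ∀ i : ℕ, w[i % w.length]? = some (expansionT b α β γ (2 * N + i))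

/-- The word `u` repeated `k` times. -/
def wordPow (u : List ℤ) (k : ℕ) : List ℤ := (List.replicate k u).flatten

/-- Labels of the classes: `zero m` is `(0, m)`, `negTwo` is `-2`, `negOne` is `-1`,
`even k` is `2k` and `odd k` is `2k + 1`. -/
inductive ClassIndex : Type
  | zero (m : ℕ)
  | negTwo
  | negOne
  | even (k : ℕ)
  | odd (k : ℕ)

/-- The period words of the classes, when `b` is odd. -/
def periodWordsOdd : ClassIndex → Set (List ℤ)
  | .zero m => {[2, -(m : ℤ)], [2, (m : ℤ) - 4]}
  | .negTwo => {[2, -3, 2, -1]}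
  | .negOne => {[2, -1] ++ [2, -3, 2, -1] ++ [2, -1], [2, -3] ++ [2, -1, 2, -3] ++ [2, -3]}
  | .even k => {[2, -1] ++ wordPow [2, -3, 2, -1] k, [2, -3] ++ wordPow [2, -1, 2, -3] k}
  | .odd k => {[2, -1, 0, -1] ++ wordPow [2, -3, 2, -1] k,
      [2, -1, 0, -1] ++ wordPow [2, -1, 2, -3] k}

/-- The period words of the classes, when `b` is even (there is no class `-2`). -/
def periodWordsEven : ClassIndex → Set (List ℤ)
  | .zero m => {[2, -(m : ℤ)], [2, (m : ℤ) - 4]}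
  | .negTwo => ∅
  | .negOne => {[0, 0]}
  | .even k => {[2, -4] ++ wordPow [2, -2] k, [2, 0] ++ wordPow [2, -2] k}
  | .odd k => {[2, -2, 0, 0] ++ wordPow [2, -2] k, [2, 0, 0, -2] ++ wordPow [2, -2] k}

/-- The class `S_j`. -/
def periodClass (b : ℕ) (α β : ℝ) (j : ClassIndex) : Set ℝ :=
  {γ | ∃ w ∈ (if Even b then periodWordsEven j else periodWordsOdd j), HasPeriod b α β γ w}

/-- The label of the largest value: `(0, 2)` for `b` even and `(0, 3)` for `b` odd. -/
def topIndex (b : ℕ) : ClassIndex := .zero (if Even b then 2 else 3)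

/-- The labels, other than `topIndex b`, that occur above the limit point. -/
def IsLowerIndex (b : ℕ) : ClassIndex → Prop
  | .zero m => 8 ≤ b ∧ (Even m ↔ Even b) ∧ 4 ≤ m ∧ m ≤ 2 + Nat.sqrt (2 * b - 4)
  | .negTwo => Odd b
  | .negOne => True
  | .even k => 1 ≤ k
  | .odd _ => True

/-- All labels that occur above the limit point. -/
def indexSet (b : ℕ) : Set ClassIndex := {j | j = topIndex b ∨ IsLowerIndex b j}

/-- The pairs of labels `-1` and `(0, m)` with `b` even and `(m - 2)² = 2b - 4`, whose two
classes share one value. -/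
def Coincident (b : ℕ) (j j' : ClassIndex) : Prop :=
  Even b ∧ ∃ m : ℕ, ((m : ℤ) - 2) ^ 2 = 2 * (b : ℤ) - 4 ∧
    ((j = .negOne ∧ j' = .zero m) ∨ (j = .zero m ∧ j' = .negOne))

/-- The limit point `δ_∞`. -/
noncomputable def deltaInf (b : ℕ) (α β : ℝ) : ℝ :=
  α * ((1 - β) ^ 2 - if Even b then β ^ 2 else β ^ 4 / 4)

/-- The explicit largest value `ρ*(α)`. -/
noncomputable def rhoStar (b : ℕ) (α : ℝ) : ℝ :=
  if Even b then α
  else if b = 5 then 2 / 3 * α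
  else α * (1 - 1 / ((b : ℝ) ^ 2 - 2 * (b : ℝ)))

/-! The numbers `nα - γ` are read off a planar grid: the point belonging to `n` has `Y` equal to `nα
- γ` up to an integer and `X` equal to `(1 - D) n` up to a bounded error. Hence `4|XY|` is
asymptotically `4(1 - D)|n|‖nα - γ‖`, and `M*` is a limit inferior of products of coordinates.

The expansion of `γ` gives, at each level `k`, a unimodular change of basis and an area-preserving
rescaling, after which the grid depends only on the remainder `γ_k` and a conjugate remainder `u_k`.
Grid points with `X` large are controlled by the vertices `(u_k, -γ_k)` and `(u_k + A_{k+1}, 1 -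
γ_k)`: a point below the axis is dominated by a point of a segment joining consecutive vertices,
where the product is concave, and a point above it by a single vertex (`le_of_vertices`). The left
half plane follows by central symmetry.

Digits are grouped in pairs. The digit at the quotient `2` is `τ ∈ {0, 1}`, and the digit at `b`
becomes an integer label `σ`. In centred coordinates `h_j = σ_j + D h_{j+1}` and `g_{j+1} = σ_j + D
g_j`, so that `h` is the sum of the labels on the right weighted by powers of `D`, and `g` its
mirror image. The vertex products become `α` times `(1 ∓ βg)(1 ± βh)` or a side product such as `(1
- 2β - βg)(3 - 2β - βh)` when `τ = 1`, and `(1 - β ∓ βg)(1 - β ∓ βh)` when `τ = 0`. Central symmetry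
changes the signs of `σ`, `g`, `h` together (`value_of_follows`, `exists_aboveOrbit`).

Now let all products exceed `δ_∞ / α`. Since `D < 0.13`, a coordinate is close to its nearest label
and the inequalities become combinatorial. Large labels must repeat for ever. Otherwise the
inequality at a special vertex has cancelling leading terms and compares a deviation of size about
`D ^ k` on the left with one of size about `D ^ k'` on the right. As `D` is small this forces `k =
k'`, so special vertices are equidistant and the code is eventually periodic. This yields
`EvenOrbit.classification` and `OddOrbit.classification`, whose codes are those of the classes
`S_j`.

Conversely the coordinates of a periodic code are geometric sums, which gives the value of each
class exactly (`hasValue_class`). The excesses over the limit are compared through their leading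
powers of `D`, using `β(1 + D) = 2D`. This orders the classes in a strictly decreasing chain, with
the `(0, m)` at or above its first member; equality occurs there only for `b` even and `(m - 2)² =
2b - 4` (`strictAnti_lowerChain`, `lowerChain_zero_le`). -/

/-! ### The quadratic irrationals -/

/-- The algebraic facts about `α = [0; 2, b, …]⁻` and `β = [0; b, 2, …]⁻`. -/
structure CFPair (b : ℕ) (α β : ℝ) : Prop where
  five_le : 5 ≤ b
  beta_pos : 0 < β
  beta_lt : β < 1 / 4
  beta_mul : (b : ℝ) * (β * (2 - β)) = 2
  alpha_mul : α * (2 - β) = 1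

lemma negConvergent_shift (a : ℕ → ℕ) (n i : ℕ) :
    negConvergent a n (i + 1) = negConvergent (fun k => a (k + 1)) n i := by
  induction n generalizing i with
  | zero => rfl
  | succ n ih => simp only [negConvergent, ih]

lemma negConvergent_mem {a : ℕ → ℕ} (ha : ∀ i, 2 ≤ a i) (n i : ℕ) :
    0 ≤ negConvergent a n i ∧ negConvergent a n i ≤ 1 := by
  induction n generalizing i with
  | zero => simp [negConvergent]
  | succ n ih =>
    have h := ih (i + 1)
    have h2 : (2 : ℝ) ≤ a i := by exact_mod_cast ha i
    simp only [negConvergent]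
    constructor
    · apply div_nonneg zero_le_one; linarith
    · rw [div_le_one (by linarith)]; linarith

lemma IsNegCF.mem_Icc {a : ℕ → ℕ} {x : ℝ} (ha : ∀ i, 2 ≤ a i) (h : IsNegCF a x) :
    0 ≤ x ∧ x ≤ 1 :=
  ⟨ge_of_tendsto' h fun n => (negConvergent_mem ha n 0).1,
    le_of_tendsto' h fun n => (negConvergent_mem ha n 0).2⟩

lemma IsNegCF.eq_of_shift {a : ℕ → ℕ} {x y : ℝ} (h : IsNegCF a x)
    (h' : IsNegCF (fun i => a (i + 1)) y) (hy : y < a 0) : x = 1 / ((a 0 : ℝ) - y) := by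
  have h1 : Tendsto (fun n => negConvergent a (n + 1) 0) atTop (𝓝 x) :=
    (tendsto_add_atTop_iff_nat 1).2 h
  have h2 : Tendsto (fun n => negConvergent a (n + 1) 0) atTop (𝓝 (1 / ((a 0 : ℝ) - y))) := by
    simp only [negConvergent, negConvergent_shift]
    exact tendsto_const_nhds.div (tendsto_const_nhds.sub h') (by linarith)
  exact tendsto_nhds_unique h1 h2

lemma CFPair.of_isNegCF {b : ℕ} {α β : ℝ} (hb : 5 ≤ b) (hα : IsNegCF (partialQuotient b) α)
    (hβ : IsNegCF (fun i => partialQuotient b (i + 1)) β) : CFPair b α β := by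
  have hq : ∀ i, 2 ≤ partialQuotient b i := by
    intro i; unfold partialQuotient; split_ifs <;> omega
  have hper : (fun i => partialQuotient b (i + 1 + 1)) = partialQuotient b := by
    funext i; unfold partialQuotient; simp [Nat.even_add]
  have hα1 := hα.mem_Icc hq
  have hβ1 := hβ.mem_Icc fun i => hq (i + 1)
  have hbr : (5 : ℝ) ≤ b := by exact_mod_cast hb
  have e1 : α = 1 / (2 - β) := by
    have := hα.eq_of_shift hβ (by simp [partialQuotient]; linarith)
    simpa [partialQuotient] using this
  have e2 : β = 1 / (b - α) := by
    have := IsNegCF.eq_of_shift (a := fun i => partialQuotient b (i + 1)) hβ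
      (y := α) (by simpa [hper] using hα) (by simp [partialQuotient]; linarith)
    simpa [partialQuotient] using this
  have m1 : α * (2 - β) = 1 := by rw [e1]; field_simp; exact div_self (by linarith)
  have m2 : β * (b - α) = 1 := by
    have : (b : ℝ) - α ≠ 0 := by linarith
    nth_rewrite 1 [e2]; field_simp
  have p : 0 < β := by
    rw [e2]; apply one_div_pos.2; linarith
  have hlt : β < 1 / 4 := by
    have hα' : α < 1 := by
      rcases lt_or_eq_of_le hα1.2 with h | h
      · exact h
      · exfalso; subst h
        have : β = 1 := by linarith
        subst this; linarith
    by_contra hcon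
    push Not at hcon
    nlinarith
  refine ⟨hb, p, hlt, ?_, m1⟩
  linear_combination (2 - β) * m2 + β * m1

namespace CFPair

variable {b : ℕ} {α β : ℝ} (P : CFPair b α β)
include P

lemma b_ge : (5 : ℝ) ≤ b := by exact_mod_cast P.five_le
lemma alpha_pos : 0 < α := by have := P.alpha_mul; have := P.beta_lt; nlinarith
lemma alpha_lt : α < 1 := by
  have := P.alpha_mul; have := P.beta_lt; have := P.alpha_pos; nlinarith
lemma half_lt_alpha : 1 / 2 < α := by
  have := P.alpha_mul; have := P.beta_pos; have := P.alpha_pos; nlinarith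
lemma D_mul : α * β * (2 - β) = β := by linear_combination β * P.alpha_mul
lemma D_add : 1 + α * β = 2 * α := by linear_combination P.alpha_mul * (-1)
lemma D_pos : 0 < α * β := mul_pos P.alpha_pos P.beta_pos
lemma b_mul_beta : (b : ℝ) * β = 1 + α * β := by
  linear_combination α * P.beta_mul - b * β * P.alpha_mul + P.alpha_mul
lemma beta_rel : β * (b - α) = 1 := by linear_combination P.b_mul_beta
-- The extreme case is `b = 5`, where `β = 1 - √(3/5) ≈ 0.2254`. All later numerical constants for
-- odd `b` descend from this bound.
lemma beta_lt' : β < 2255 / 10000 := by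
  by_contra h
  push Not at h
  have h1 := P.beta_mul
  have h2 := P.b_ge
  have h3 := P.beta_lt
  have h4 : 2 / 5 < β * (2 - β) := by nlinarith
  nlinarith
lemma D_lt : α * β < 128 / 1000 := by
  have := P.D_mul; have := P.beta_lt'; have := P.D_pos
  nlinarith

end CFPair

/-! ### Grids and their frames -/

/-- Complete quotients `A k` of period two, with partial quotients `a k`. -/
structure QuotientSeq (A : ℕ → ℝ) (a : ℕ → ℤ) : Prop where
  pos : ∀ k, 0 < A k
  lt_one : ∀ k, A k < 1
  rel : ∀ k, A k * (a k - A (k + 1)) = 1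
  per : ∀ k, A (k + 2) = A k

/-- A sequence of digits `d`, remainders `γ` and conjugate remainders `u`. -/
structure GridFrame (A : ℕ → ℝ) (d : ℕ → ℤ) (γ u : ℕ → ℝ) : Prop where
  rem : ∀ k, γ k = A k * (d k + γ (k + 1))
  conj : ∀ k, u (k + 1) = A k * (d k + u k)
  nonneg : ∀ k, 0 ≤ γ k
  lt_one : ∀ k, γ k < 1

/-- The product of the first `k` complete quotients. -/
noncomputable def quotientScale (A : ℕ → ℝ) (k : ℕ) : ℝ := ∏ i ∈ Finset.range k, A i

/-- `(X, Y)` are the coordinates of a grid point, as seen from level `k`. -/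
def GridPt (A γ u : ℕ → ℝ) (k : ℕ) (X Y : ℝ) : Prop :=
  ∃ x y : ℤ, quotientScale A k * X = u k + x * A (k + 1) + y ∧
    Y = quotientScale A k * (x + y * A k - γ k)

section

variable {A : ℕ → ℝ} {a d : ℕ → ℤ} {γ u : ℕ → ℝ}

lemma quotientScale_succ (A : ℕ → ℝ) (k : ℕ) :
    quotientScale A (k + 1) = quotientScale A k * A k := Finset.prod_range_succ _ _

lemma quotientScale_pos (hA : QuotientSeq A a) (k : ℕ) : 0 < quotientScale A k :=
  Finset.prod_pos fun i _ => hA.pos i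

lemma QuotientSeq.le_max (hA : QuotientSeq A a) (k : ℕ) : A k ≤ max (A 0) (A 1) := by
  induction k using Nat.twoStepInduction with
  | zero => exact le_max_left _ _
  | one => exact le_max_right _ _
  | more k h _ => rw [hA.per]; exact h

lemma tendsto_quotientScale (hA : QuotientSeq A a) :
    Tendsto (quotientScale A) atTop (𝓝 0) := by
  have h0 : 0 ≤ max (A 0) (A 1) := (hA.pos 0).le.trans (le_max_left _ _)
  refine squeeze_zero (fun k => (quotientScale_pos hA k).le) (fun k => ?_)
    (tendsto_pow_atTop_nhds_zero_of_lt_one h0 (max_lt (hA.lt_one 0) (hA.lt_one 1)))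
  calc quotientScale A k ≤ ∏ i ∈ Finset.range k, max (A 0) (A 1) :=
        Finset.prod_le_prod (fun i _ => (hA.pos i).le) fun i _ => hA.le_max i
    _ = max (A 0) (A 1) ^ k := by simp

/-- Passing to the next level is the unimodular substitution `(x, y) ↦ (a x + y - d, -x)`; the
rescaling multiplies one local coordinate by `A k` and divides the other by it, so the same grid is
seen from every level. -/
lemma gridPt_succ_iff (hA : QuotientSeq A a) (hF : GridFrame A d γ u) (k : ℕ) (X Y : ℝ) :
    GridPt A γ u (k + 1) X Y ↔ GridPt A γ u k X Y := by
  have e1 := hA.rel k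
  have e2 := hF.rem k
  have e3 := hF.conj k
  have e4 := hA.per k
  have hpos := (hA.pos k).ne'
  constructor
  · rintro ⟨x, y, hX, hY⟩
    refine ⟨-y, x + a k * y + d k, ?_, ?_⟩
    · rw [quotientScale_succ, e3, show k + 1 + 1 = k + 2 from rfl, e4] at hX
      apply mul_left_cancel₀ hpos
      push_cast
      linear_combination hX + (-y) * e1
    · rw [hY, quotientScale_succ]
      push_cast
      linear_combination quotientScale A k * e2 + (-y) * quotientScale A k * e1
  · rintro ⟨x, y, hX, hY⟩
    refine ⟨a k * x + y - d k, -x, ?_, ?_⟩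
    · rw [quotientScale_succ, e3, show k + 1 + 1 = k + 2 from rfl, e4]
      push_cast
      linear_combination A k * hX - x * e1
    · rw [hY, quotientScale_succ]
      push_cast
      linear_combination -quotientScale A k * e2 - x * quotientScale A k * e1

lemma gridPt_iff (hA : QuotientSeq A a) (hF : GridFrame A d γ u) (k : ℕ) (X Y : ℝ) :
    GridPt A γ u k X Y ↔ GridPt A γ u 0 X Y := by
  induction k with
  | zero => rfl
  | succ k ih => rw [gridPt_succ_iff hA hF, ih]

/-! ### Vertices of the cells and the minimum of the product over a half plane. -/

/-- If the height were smaller then `(x - 1) + yα < 0`. For `x ≤ 0` the positive height forces `y ≥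
d - x + 1`, which pushes the point beyond `u + d + 1`. For `x ≥ 1` the left bound gives `-y ≤ (x -
1) r`, against `x - 1 < -yα`. -/
lemma one_sub_le_of_record {α r u γ : ℝ} {d x y : ℤ} (hα0 : 0 < α) (hα : α < 1)
    (hr : r < 1) (hd : d * α ≤ γ) (hX : u + r ≤ u + x * r + y) (hX' : u + x * r + y < u + d + 1)
    (hY : 0 < x + y * α - γ) : 1 - γ ≤ x + y * α - γ := by
  by_contra hcon
  push Not at hcon
  have h1 : ((x : ℝ) - 1) + y * α < 0 := by linarith
  rcases le_or_gt x 0 with hx | hx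
  · have hx' : (x : ℝ) ≤ 0 := by exact_mod_cast hx
    have h2 : (-(x : ℝ)) < y - d := by
      have : (-(x : ℝ)) * α < (y - d) * α := by nlinarith
      exact lt_of_mul_lt_mul_right this hα0.le
    have h3 : d - x + 1 ≤ y := by
      have : d - x < y := by exact_mod_cast (by push_cast; linarith : ((d - x : ℤ) : ℝ) < y)
      omega
    have h4 : (d : ℝ) - x + 1 ≤ y := by exact_mod_cast h3
    nlinarith
  · have hx' : (1 : ℝ) ≤ x := by exact_mod_cast hx
    have h5 : 0 ≤ (x - 1 : ℝ) * r + y := by linarith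
    have hy : (y : ℝ) < 0 := by
      by_contra hy
      push Not at hy
      nlinarith
    have : (-(y : ℝ)) ≤ (x - 1) * 1 := by nlinarith
    nlinarith

/-- The point is no nearer to either axis than some point `(u + z, γ - zα)`, `0 ≤ z ≤ d`, of the
segment joining two consecutive vertices. On that segment the product is a concave quadratic in `z`,
so it is least at an end. -/
lemma min_le_of_record {α r u γ : ℝ} {d x y : ℤ} (hα0 : 0 < α) (hα : α < 1) (hr0 : 0 < r)
    (hr : r < 1) (hu : 0 < u) (hγ : γ < 1) (hd : d * α ≤ γ)
    (hX : u ≤ u + x * r + y) (hX' : u + x * r + y < u + d) (hY : x + y * α - γ ≤ 0) :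
    min (u * γ) ((u + d) * (γ - d * α)) ≤ (u + x * r + y) * -(x + y * α - γ) := by
  obtain ⟨z, hz0, hzd, hzX, hzY⟩ : ∃ z : ℝ, 0 ≤ z ∧ z ≤ d ∧ u + z ≤ u + x * r + y ∧
      γ - z * α ≤ -(x + y * α - γ) := by
    rcases le_or_gt x 0 with hx | hx
    · have hx' : (x : ℝ) ≤ 0 := by exact_mod_cast hx
      rcases le_or_gt 0 (x + y) with h | h
      · have h' : (0 : ℝ) ≤ x + y := by exact_mod_cast h
        refine ⟨x + y, h', ?_, by nlinarith, by nlinarith⟩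
        have : (x : ℝ) * r ≥ x := by nlinarith
        linarith
      · have h' : (x : ℝ) + y < 0 := by exact_mod_cast h
        refine ⟨0, le_rfl, by linarith, by linarith, ?_⟩
        have : (0 : ℝ) ≤ y := by nlinarith
        nlinarith
    · exfalso
      have hx' : (1 : ℝ) ≤ x := by exact_mod_cast hx
      have hy : (y : ℝ) < 0 := by
        by_contra hy
        push Not at hy
        have hy0 : (y : ℝ) * α ≥ 0 := by positivity
        linarith
      have h1 : (-(y : ℝ)) < x := by nlinarith
      have h2 : -y + 1 ≤ x := by
        have : -y < x := by exact_mod_cast h1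
        omega
      have h3 : -(y : ℝ) + 1 ≤ x := by exact_mod_cast h2
      nlinarith
  have hfin : (u + z) * (γ - z * α) ≤ (u + x * r + y) * -(x + y * α - γ) := by
    apply mul_le_mul hzX hzY
    · nlinarith
    · linarith
  refine le_trans ?_ hfin
  rcases eq_or_lt_of_le (hz0.trans hzd) with hd0 | hd0
  · have : z = 0 := by linarith
    subst this
    exact (min_le_left _ _).trans (by ring_nf; rfl)
  by_contra hcon
  rw [not_le, lt_min_iff] at hcon
  have key : (u + z) * (γ - z * α) * d = (d - z) * (u * γ) + z * ((u + d) * (γ - d * α))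
      + α * z * (d - z) * d := by ring
  have p1 : 0 ≤ α * z * (d - z) * d := by
    have : 0 ≤ (d : ℝ) - z := by linarith
    positivity
  rcases eq_or_lt_of_le hz0 with hz | hz
  · nlinarith
  · nlinarith

/-- If all the vertices of the cells in the right half plane have product at least `c / 4`,
then so have all grid points far to the right. -/
theorem le_of_vertices (hA : QuotientSeq A a) (hF : GridFrame A d γ u) {c : ℝ} (hc : 0 < c)
    (h1 : ∀ k, c ≤ 4 * (u k * γ k)) (h2 : ∀ k, c ≤ 4 * ((u k + A (k + 1)) * (1 - γ k)))
    {X Y : ℝ} (hX : u 0 + A 1 ≤ X) (hp : GridPt A γ u 0 X Y) : c ≤ 4 * (|X| * |Y|) := by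
  have hu : ∀ k, c / 4 ≤ u k := fun k => by
    have := h1 k; have := hF.nonneg k; have := hF.lt_one k
    have : 0 < u k := by
      by_contra hcon
      push Not at hcon
      nlinarith
    nlinarith
  have hS := quotientScale_pos hA
  have hX0 : 0 < X := by have := hu 0; have := hA.pos 1; linarith
  have hdig : ∀ k, (d k : ℝ) * A k ≤ γ k := fun k => by
    have e := hF.rem k; have := hF.nonneg (k + 1); have := hA.pos k
    nlinarith
  -- The scaled abscissa tends to `0` while `u` stays above `c / 4`, so some level overtakes the
  -- point. The first such level locates it between two consecutive vertices.
  have hlarge : ∃ k, quotientScale A (k + 1) * X < u (k + 1) := by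
    have := (tendsto_quotientScale hA).mul_const X
    rw [zero_mul] at this
    obtain ⟨k, hk⟩ := ((tendsto_add_atTop_iff_nat 1).2 this).eventually
      (gt_mem_nhds (show (0 : ℝ) < c / 4 by linarith)) |>.exists
    exact ⟨k, hk.trans_le (hu _)⟩
  have hval : ∀ k (x y : ℤ), quotientScale A k * X = u k + x * A (k + 1) + y →
      Y = quotientScale A k * (x + y * A k - γ k) →
      |X| * |Y| = |u k + x * A (k + 1) + y| * |x + y * A k - γ k| := by
    intro k x y hx hy
    rw [hy, ← hx, abs_mul, abs_mul, abs_of_pos (hS k)]; ring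
  classical
  rcases le_or_gt Y 0 with hY | hY
  · let k := Nat.find hlarge
    have hk : quotientScale A (k + 1) * X < u (k + 1) := Nat.find_spec hlarge
    have hk' : u k ≤ quotientScale A k * X := by
      rcases Nat.eq_zero_or_pos k with h0 | h0
      · rw [h0]; have := hA.pos 1; simp [quotientScale]; linarith
      · have := Nat.find_min hlarge (m := k - 1) (by omega)
        rw [not_lt, Nat.sub_add_cancel h0] at this
        exact this
    obtain ⟨x, y, hx, hy⟩ := (gridPt_iff hA hF k X Y).2 hp
    rw [hval k x y hx hy]
    have hneg : x + y * A k - γ k ≤ 0 := by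
      by_contra hcon
      push Not at hcon
      have := mul_pos (hS k) hcon
      linarith
    have hlt : u k + x * A (k + 1) + y < u k + d k := by
      rw [quotientScale_succ, hF.conj, mul_assoc, mul_comm (A k) X, ← mul_assoc, hx,
        mul_comm (A k)] at hk
      have := lt_of_mul_lt_mul_right hk (hA.pos k).le
      linarith
    have := min_le_of_record (hA.pos k) (hA.lt_one k) (hA.pos (k + 1)) (hA.lt_one _)
      (by have := hu k; linarith) (hF.lt_one k) (hdig k) (by rw [← hx]; exact hk')
      hlt hneg
    rw [abs_of_nonpos hneg, abs_of_nonneg (by rw [← hx]; exact mul_nonneg (hS k).le hX0.le)]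
    -- The far end of the segment is the vertex of level `k + 1`: the two factors `A k` cancel.
    have e : (u k + d k) * (γ k - d k * A k) = u (k + 1) * γ (k + 1) := by
      rw [hF.conj k, hF.rem k]; ring
    rw [e] at this
    have := h1 k
    have := h1 (k + 1)
    rcases min_le_iff.1 ‹min _ _ ≤ _› with h | h <;> linarith
  · have hlarge' : ∃ k, quotientScale A (k + 1) * X < u (k + 1) + A (k + 2) := by
      obtain ⟨k, hk⟩ := hlarge
      exact ⟨k, by have := hA.pos (k + 2); linarith⟩
    let k := Nat.find hlarge'
    have hk : quotientScale A (k + 1) * X < u (k + 1) + A (k + 2) := Nat.find_spec hlarge'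
    have hk' : u k + A (k + 1) ≤ quotientScale A k * X := by
      rcases Nat.eq_zero_or_pos k with h0 | h0
      · rw [h0]; simp [quotientScale]; linarith
      · have := Nat.find_min hlarge' (m := k - 1) (by omega)
        rw [not_lt, show k - 1 + 2 = k - 1 + 1 + 1 from rfl, Nat.sub_add_cancel h0] at this
        exact this
    obtain ⟨x, y, hx, hy⟩ := (gridPt_iff hA hF k X Y).2 hp
    rw [hval k x y hx hy]
    have hpos : 0 < x + y * A k - γ k := by
      by_contra hcon
      push Not at hcon
      have := mul_nonneg (hS k).le (neg_nonneg.2 hcon)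
      linarith
    have hlt : u k + x * A (k + 1) + y < u k + d k + 1 := by
      rw [quotientScale_succ, hF.conj, hA.per, mul_assoc, mul_comm (A k) X, ← mul_assoc, hx] at hk
      have : (u k + x * A (k + 1) + y) * A k < (u k + d k + 1) * A k := by linarith
      exact lt_of_mul_lt_mul_right this (hA.pos k).le
    have := one_sub_le_of_record (hA.pos k) (hA.lt_one k) (hA.lt_one (k + 1))
      (hdig k) (by rw [← hx]; exact hk') hlt hpos
    rw [abs_of_pos hpos, ← hx, abs_of_nonneg (mul_nonneg (hS k).le hX0.le)]
    have h3 := h2 k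
    have h4 : (u k + A (k + 1)) * (1 - γ k) ≤ quotientScale A k * X * (x + y * A k - γ k) :=
      mul_le_mul hk' this (by have := hF.lt_one k; linarith) (mul_nonneg (hS k).le hX0.le)
    linarith

end

/-! ### The approximation constant in terms of frames -/

/-- The partial quotients as integers. -/
def partialQuotientInt (b : ℕ) (k : ℕ) : ℤ := partialQuotient b k

/-- The conjugate remainders of a digit sequence with prescribed initial value. -/
noncomputable def conjRem (A : ℕ → ℝ) (d : ℕ → ℤ) (u₀ : ℝ) : ℕ → ℝ
  | 0 => u₀
  | k + 1 => A k * (d k + conjRem A d u₀ k)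

lemma completeQuotient_even (α β : ℝ) (j : ℕ) : completeQuotient α β (2 * j) = α := by
  simp [completeQuotient]

lemma completeQuotient_odd (α β : ℝ) (j : ℕ) : completeQuotient α β (2 * j + 1) = β := by
  simp [completeQuotient]

namespace CFPair

variable {b : ℕ} {α β : ℝ}

lemma quotientSeq (P : CFPair b α β) :
    QuotientSeq (completeQuotient α β) (partialQuotientInt b) := by
  have h1 := P.alpha_pos
  have h2 := P.beta_pos
  have h3 := P.alpha_lt
  have h4 := P.beta_lt
  refine ⟨fun k => ?_, fun k => ?_, fun k => ?_, fun k => ?_⟩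
  · unfold completeQuotient; split_ifs <;> assumption
  · unfold completeQuotient; split_ifs <;> linarith
  · rcases Nat.even_or_odd' k with ⟨j, rfl | rfl⟩
    · rw [completeQuotient_even, completeQuotient_odd]
      simp [partialQuotientInt, partialQuotient, P.alpha_mul]
    · rw [completeQuotient_odd, show 2 * j + 1 + 1 = 2 * (j + 1) by ring, completeQuotient_even]
      simp [partialQuotientInt, partialQuotient, P.beta_rel]
  · simp [completeQuotient, Nat.even_add]

lemma gridFrame (P : CFPair b α β) (γ u₀ : ℝ) :
    GridFrame (completeQuotient α β) (expansionDigit α β γ) (expansionRem α β γ)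
      (conjRem (completeQuotient α β) (expansionDigit α β γ) u₀) := by
  refine ⟨fun k => ?_, fun k => rfl, fun k => ?_, fun k => ?_⟩
  · have := (P.quotientSeq.pos k).ne'
    simp only [expansionDigit, expansionRem, Int.floor_add_fract]
    field_simp
  · cases k <;> simp [expansionRem, Int.fract_nonneg]
  · cases k <;> simp [expansionRem, Int.fract_lt_one]

end CFPair

/-- The quantity `|n| ‖nα - γ‖`. -/
noncomputable def approxTerm (α γ : ℝ) (n : ℤ) : ℝ :=
  |(n : ℝ)| * |((n : ℝ) * α - γ) - round ((n : ℝ) * α - γ)|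

lemma approxConst_eq (α γ : ℝ) : approxConst α γ = liminf (approxTerm α γ) cofinite := rfl

lemma approxTerm_nonneg (α γ : ℝ) (n : ℤ) : 0 ≤ approxTerm α γ n := by
  unfold approxTerm; positivity

lemma eventually_cofinite_int_of_abs {p : ℤ → Prop} (B : ℝ)
    (h : ∀ n : ℤ, B < |(n : ℝ)| → p n) : ∀ᶠ n in cofinite, p n := by
  rw [eventually_cofinite]
  refine (Set.finite_Icc (-⌈B⌉) ⌈B⌉).subset fun n hn => ?_
  have : |(n : ℝ)| ≤ B := by
    by_contra hcon
    exact hn (h n (not_le.1 hcon))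
  have h2 := abs_le.1 (this.trans (Int.le_ceil B))
  constructor
  · exact_mod_cast h2.1
  · exact_mod_cast h2.2

lemma frequently_cofinite_int_of_abs {p : ℤ → Prop}
    (h : ∀ B : ℕ, ∃ n : ℤ, (B : ℝ) < |(n : ℝ)| ∧ p n) : ∃ᶠ n in cofinite, p n := by
  rw [frequently_cofinite_iff_infinite]
  intro hfin
  obtain ⟨B, hB⟩ := (hfin.image fun n : ℤ => n.natAbs).bddAbove
  obtain ⟨n, hn, hp⟩ := h B
  have h1 := hB ⟨n, hp, rfl⟩
  have h2 : |(n : ℝ)| ≤ B := by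
    rw [← Int.cast_abs, Int.abs_eq_natAbs]; exact_mod_cast h1
  linarith

lemma gridPt_zero_iff {α β γ : ℝ} {u : ℕ → ℝ} {X Y : ℝ} :
    GridPt (completeQuotient α β) (expansionRem α β γ) u 0 X Y ↔
      ∃ x y : ℤ, X = u 0 + x * β + y ∧ Y = x + y * α - Int.fract γ := by
  simp [GridPt, quotientScale, completeQuotient, expansionRem]

section

variable {b : ℕ} {α β γ : ℝ} {u : ℕ → ℝ}

/-- The last identity is the reason for the factor `1 - D` in `M*`: `X` differs from `(1 - D) n` by
a bounded amount, while `|Y|` is the distance to the nearest integer. -/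
lemma exists_gridPt_of_int (α β γ : ℝ) (u : ℕ → ℝ) (n : ℤ) :
    ∃ X Y, GridPt (completeQuotient α β) (expansionRem α β γ) u 0 X Y ∧
      |Y| = |((n : ℝ) * α - γ) - round ((n : ℝ) * α - γ)| ∧
      X = u 0 + β * (Y + Int.fract γ) + n * (1 - α * β) := by
  refine ⟨_, _, gridPt_zero_iff.2 ⟨-(⌊γ⌋ + round ((n : ℝ) * α - γ)), n, rfl, rfl⟩, ?_, ?_⟩
  · congr 1
    rw [Int.fract]; push_cast; ring
  · push_cast; ring

lemma approxTerm_le_of_gridPt {X Y : ℝ}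
    (h : GridPt (completeQuotient α β) (expansionRem α β γ) u 0 X Y) :
    ∃ n : ℤ, |((n : ℝ) * α - γ) - round ((n : ℝ) * α - γ)| ≤ |Y| ∧
      X = u 0 + β * (Y + Int.fract γ) + n * (1 - α * β) := by
  obtain ⟨x, y, hX, hY⟩ := gridPt_zero_iff.1 h
  refine ⟨y, ?_, ?_⟩
  · have := round_le ((y : ℝ) * α - γ) (-(x + ⌊γ⌋))
    refine this.trans_eq ?_
    rw [hY, Int.fract]; congr 1; push_cast; ring
  · rw [hX, hY]; ring

lemma sub_round_pos (hγ : γ ∉ lattice α) (n : ℤ) :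
    0 < |((n : ℝ) * α - γ) - round ((n : ℝ) * α - γ)| := by
  rw [abs_pos]
  intro h
  apply hγ
  refine ⟨-round ((n : ℝ) * α - γ), n, ?_⟩
  push_cast
  linarith

/-- If infinitely many levels see a grid point with small product, then `|n| ‖nα - γ‖` is
small for infinitely many `n`. -/
theorem CFPair.frequently_approxTerm_le (P : CFPair b α β) (hγ : γ ∉ lattice α) {d : ℕ → ℤ}
    (hF : GridFrame (completeQuotient α β) d (expansionRem α β γ) u) {v w C : ℝ} (hvw : v < w)
    (h : ∃ᶠ k in atTop, ∃ x y : ℤ,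
      4 * (|u k + x * completeQuotient α β (k + 1) + y| *
        |x + y * completeQuotient α β k - expansionRem α β γ k|) ≤ v ∧
      |x + y * completeQuotient α β k - expansionRem α β γ k| ≤ C) :
    ∃ᶠ n in cofinite, 4 * (1 - α * β) * approxTerm α γ n ≤ w := by
  have hD : α * β < 128 / 1000 := P.D_lt
  have hβ := P.beta_pos
  have hC : 0 ≤ C := by
    obtain ⟨k, x, y, -, hk⟩ := h.exists
    exact (abs_nonneg _).trans hk
  apply frequently_cofinite_int_of_abs
  intro B
  -- `μ` is the least distance over `|n| ≤ B`, positive because `γ` is off the lattice. A grid point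
  -- with `|Y| < μ` therefore has `|n| > B`.
  obtain ⟨μ, hμ, hμB⟩ : ∃ μ > 0, ∀ n : ℤ, |(n : ℝ)| ≤ B →
      μ ≤ |((n : ℝ) * α - γ) - round ((n : ℝ) * α - γ)| := by
    obtain ⟨n₀, -, hn₀⟩ := Finset.exists_min_image (Finset.Icc (-(B : ℤ)) B)
      (fun n : ℤ => |((n : ℝ) * α - γ) - round ((n : ℝ) * α - γ)|) ⟨0, by simp⟩
    refine ⟨_, sub_round_pos hγ n₀, fun n hn => hn₀ n ?_⟩
    have := abs_le.1 hn
    rw [Finset.mem_Icc]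
    constructor
    · exact_mod_cast this.1
    · exact_mod_cast this.2
  -- `K` bounds the difference of `X` and `(1 - D) n`. The level is taken so deep that `4 K |Y|`
  -- fits into the slack `w - v`.
  let K := |u 0| + β * 2
  have hK : 0 < K := by positivity
  have hsmall : ∀ᶠ k in atTop, quotientScale (completeQuotient α β) k * (C + 1) <
      min (min μ 1) ((w - v) / (4 * K)) := by
    have := (tendsto_quotientScale P.quotientSeq).mul_const (C + 1)
    rw [zero_mul] at this
    apply this.eventually (gt_mem_nhds _)
    have : 0 < w - v := by linarith
    apply lt_min (lt_min hμ one_pos)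
    positivity
  obtain ⟨k, ⟨x, y, hv, hle⟩, hk⟩ := (h.and_eventually hsmall).exists
  have hs := quotientScale_pos P.quotientSeq k
  set X := (u k + x * completeQuotient α β (k + 1) + y) / quotientScale (completeQuotient α β) k
    with hX
  set Y := quotientScale (completeQuotient α β) k *
    (x + y * completeQuotient α β k - expansionRem α β γ k) with hY
  have hg : GridPt (completeQuotient α β) (expansionRem α β γ) u k X Y :=
    ⟨x, y, by rw [hX]; field_simp, hY⟩
  have hXY : 4 * (|X| * |Y|) ≤ v := by
    have : |X| * |Y| = |u k + x * completeQuotient α β (k + 1) + y| *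
        |x + y * completeQuotient α β k - expansionRem α β γ k| := by
      rw [hX, hY, abs_div, abs_mul, abs_of_pos hs]; field_simp
    rw [this]; exact hv
  have hYle : |Y| ≤ quotientScale (completeQuotient α β) k * (C + 1) := by
    rw [hY, abs_mul, abs_of_pos hs]
    apply mul_le_mul_of_nonneg_left _ hs.le
    linarith
  have hY' := hYle.trans_lt hk
  rw [lt_min_iff, lt_min_iff] at hY'
  obtain ⟨n, hn, hXn⟩ := approxTerm_le_of_gridPt ((gridPt_iff P.quotientSeq hF k X Y).1 hg)
  refine ⟨n, ?_, ?_⟩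
  · by_contra hcon
    have := hμB n (not_lt.1 hcon)
    linarith [hY'.1.1]
  · have hnX : (1 - α * β) * |(n : ℝ)| ≤ |X| + K := by
      have e : (1 - α * β) * |(n : ℝ)| = |X - u 0 - β * (Y + Int.fract γ)| := by
        rw [hXn, ← abs_of_pos (show 0 < 1 - α * β by linarith), ← abs_mul,
          abs_of_pos (show 0 < 1 - α * β by linarith)]
        congr 1; ring
      rw [e]
      have hf : |Y + Int.fract γ| ≤ 2 := by
        have h1 := Int.fract_nonneg γ
        have h2 := Int.fract_lt_one γ
        have h3 := abs_le.1 hY'.1.2.le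
        rw [abs_le]; constructor <;> linarith [h3.1, h3.2]
      calc |X - u 0 - β * (Y + Int.fract γ)| ≤ |X - u 0| + |β * (Y + Int.fract γ)| := abs_sub _ _
        _ ≤ |X| + |u 0| + β * 2 := by
          apply add_le_add (abs_sub _ _)
          rw [abs_mul, abs_of_pos hβ]
          exact mul_le_mul_of_nonneg_left hf hβ.le
        _ = |X| + K := by simp only [K]; ring
    have h1 : 4 * (1 - α * β) * approxTerm α γ n ≤ 4 * ((|X| + K) * |Y|) := by
      unfold approxTerm
      have := mul_le_mul hnX hn (abs_nonneg _) (by positivity)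
      linarith
    have h2 : 4 * (K * |Y|) ≤ w - v := by
      have h3 := hY'.2.le
      rw [le_div_iff₀ (by positivity)] at h3
      linarith
    linarith

lemma le_of_forall_gt_frequently {f : ℤ → ℝ} (hf : ∀ n, 0 ≤ f n) {C v : ℝ} (hC : 0 < C)
    (h : ∀ w, v < w → ∃ᶠ n in cofinite, C * f n ≤ w) : C * liminf f cofinite ≤ v := by
  apply le_of_forall_gt_imp_ge_of_dense
  intro w hw
  have h1 : ∃ᶠ n in cofinite, f n ≤ w / C := (h w hw).mono fun n hn => by
    rw [le_div_iff₀ hC]; linarith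
  have := liminf_le_of_frequently_le h1 (isBoundedUnder_of ⟨0, fun n => hf n⟩)
  rw [le_div_iff₀ hC] at this
  linarith

/-- Values of the form at grid points near the levels bound `M*` from above. -/
theorem CFPair.eventually_lt (P : CFPair b α β) (hγ : γ ∉ lattice α) {d : ℕ → ℤ}
    (hF : GridFrame (completeQuotient α β) d (expansionRem α β γ) u) {v : ℝ}
    (hv : v < approxConstStar α β γ) (x y : ℤ) :
    ∀ᶠ k in atTop, v < 4 * (|u k + x * completeQuotient α β (k + 1) + y| *
        |x + y * completeQuotient α β k - expansionRem α β γ k|) := by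
  by_contra hcon
  have hcon' : ∃ᶠ k in atTop, 4 * (|u k + x * completeQuotient α β (k + 1) + y| *
        |x + y * completeQuotient α β k - expansionRem α β γ k|) ≤ v := by
    simpa [Filter.Frequently] using hcon
  have hD := P.D_lt
  refine absurd (le_of_forall_gt_frequently (approxTerm_nonneg α γ)
    (show 0 < 4 * (1 - α * β) by linarith) (v := v) fun w hw => ?_) (not_le.2 hv)
  refine P.frequently_approxTerm_le hγ hF hw (C := |(x : ℝ)| + |(y : ℝ)| + 1)
    (hcon'.mono fun k hk => ⟨x, y, hk, ?_⟩)
  have h1 := hF.nonneg k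
  have h2 := hF.lt_one k
  have h3 := P.quotientSeq.pos k
  have h4 := P.quotientSeq.lt_one k
  calc |x + y * completeQuotient α β k - expansionRem α β γ k|
      ≤ |(x : ℝ) + y * completeQuotient α β k| + |expansionRem α β γ k| := abs_sub _ _
    _ ≤ |(x : ℝ)| + |(y : ℝ) * completeQuotient α β k| + |expansionRem α β γ k| := by
      gcongr; exact abs_add_le _ _
    _ ≤ _ := by
      rw [abs_mul, abs_of_pos h3, abs_of_nonneg h1]
      have := abs_nonneg (y : ℝ)
      nlinarith

/-- `M*` is determined by an asymptotically attained lower bound over the grid. -/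
theorem CFPair.approxConstStar_eq (P : CFPair b α β) (hγ : γ ∉ lattice α) {d : ℕ → ℤ}
    (hF : GridFrame (completeQuotient α β) d (expansionRem α β γ) u) {c C X₀ : ℝ} (hc : 0 < c)
    (hlow : ∀ X Y, GridPt (completeQuotient α β) (expansionRem α β γ) u 0 X Y → X₀ ≤ |X| →
      c ≤ 4 * (|X| * |Y|))
    (hup : ∃ᶠ k in atTop, ∃ x y : ℤ,
      4 * (|u k + x * completeQuotient α β (k + 1) + y| *
        |x + y * completeQuotient α β k - expansionRem α β γ k|) ≤ c ∧
      |x + y * completeQuotient α β k - expansionRem α β γ k| ≤ C) :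
    approxConstStar α β γ = c := by
  have hD := P.D_lt
  have hβ := P.beta_pos
  have hD' : 0 < 1 - α * β := by linarith
  have hfreq : ∀ w, c < w → ∃ᶠ n in cofinite, 4 * (1 - α * β) * approxTerm α γ n ≤ w :=
    fun w hw => P.frequently_approxTerm_le hγ hF hw hup
  apply le_antisymm
  · exact le_of_forall_gt_frequently (approxTerm_nonneg α γ) (by linarith) hfreq
  · apply le_of_forall_lt_imp_le_of_dense
    intro w hw
    -- A lower bound for a `liminf` in `ℝ` needs the terms to be bounded above infinitely often,
    -- which the upper estimate supplies.
    have hcob : IsCoboundedUnder (· ≥ ·) cofinite (approxTerm α γ) := by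
      refine IsCoboundedUnder.of_frequently_le (a := (c + 1) / (4 * (1 - α * β)))
        ((hfreq (c + 1) (by linarith)).mono fun n hn => ?_)
      rw [le_div_iff₀ (by linarith)]; linarith
    let K := |u 0| + β * 2
    have hK : 0 < K := by positivity
    suffices h : ∀ᶠ n in cofinite, w / (4 * (1 - α * β)) ≤ approxTerm α γ n by
      have := le_liminf_of_le hcob h
      rw [div_le_iff₀ (by linarith)] at this
      rw [approxConstStar, approxConst_eq]
      linarith
    -- Beyond the first threshold `|X| ≥ X₀`. Beyond the second the error `K` costs less than the
    -- gap `c - w`.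
    apply eventually_cofinite_int_of_abs
      (max ((X₀ + K) / (1 - α * β)) (c * K / ((1 - α * β) * (c - w))))
    intro n hn
    rw [max_lt_iff, div_lt_iff₀ hD', div_lt_iff₀ (by nlinarith)] at hn
    obtain ⟨X, Y, hg, hY, hX⟩ := exists_gridPt_of_int α β γ u n
    have hY1 : |Y| ≤ 1 / 2 := by rw [hY]; exact abs_sub_round _
    have hf : |Y + Int.fract γ| ≤ 2 := by
      have h1 := Int.fract_nonneg γ
      have h2 := Int.fract_lt_one γ
      have h3 := abs_le.1 hY1
      rw [abs_le]; constructor <;> linarith [h3.1, h3.2]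
    have hKb : |u 0 + β * (Y + Int.fract γ)| ≤ K := by
      refine (abs_add_le _ _).trans ?_
      rw [abs_mul, abs_of_pos hβ]
      simp only [K]
      gcongr
    have e1 : |(n : ℝ) * (1 - α * β)| = (1 - α * β) * |(n : ℝ)| := by
      rw [abs_mul, abs_of_pos hD', mul_comm]
    have hX1 : |X| ≤ (1 - α * β) * |(n : ℝ)| + K := by
      rw [hX]
      refine (abs_add_le _ _).trans ?_
      rw [e1]; linarith
    have hX2 : (1 - α * β) * |(n : ℝ)| - K ≤ |X| := by
      have e0 : (n : ℝ) * (1 - α * β) = X - (u 0 + β * (Y + Int.fract γ)) := by rw [hX]; ring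
      have := abs_sub X (u 0 + β * (Y + Int.fract γ))
      rw [← e0, e1] at this
      linarith
    have hmain := hlow X Y hg (by linarith [hn.1])
    rw [div_le_iff₀ (by linarith)]
    unfold approxTerm
    rw [← hY]
    set N := (1 - α * β) * |(n : ℝ)| with hN
    have hYn := abs_nonneg Y
    have hNn : 0 ≤ N := by positivity
    have h5 : c ≤ 4 * ((N + K) * |Y|) := hmain.trans (by gcongr)
    have h6 : c * K < N * (c - w) := by rw [hN]; linarith [hn.2]
    have goal : w ≤ 4 * (N * |Y|) := by
      by_contra hcon
      push Not at hcon
      have : w * (N + K) < c * N := by nlinarith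
      nlinarith
    calc w ≤ 4 * (N * |Y|) := goal
      _ = _ := by rw [hN]; ring

/-- A lattice point has conjugate remainders accumulating only at the ends of their range. -/
theorem CFPair.notMem_lattice (P : CFPair b α β) {d : ℕ → ℤ}
    (hF : GridFrame (completeQuotient α β) d (expansionRem α β γ) u) {δ : ℝ} (hδ : 0 < δ)
    (h : ∃ᶠ j in atTop, 0 < expansionRem α β γ (2 * j) ∧ δ ≤ u (2 * j) ∧
      u (2 * j) ≤ 1 - β - δ) : γ ∉ lattice α := by
  rintro ⟨m, n, hmn⟩
  -- A lattice point `γ` puts a grid point on the axis `Y = 0`. Seen from deep levels its abscissa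
  -- shrinks to `0`, so `u` is nearly `-(xβ + y)` with `x + yα = γ_{2j} ∈ (0, 1)`. No integers `x,
  -- y` allow this with `u` well inside `(0, 1 - β)`.
  have hg : GridPt (completeQuotient α β) (expansionRem α β γ) u 0
      (u 0 + (m - ⌊γ⌋ : ℤ) * β + n) 0 := by
    refine gridPt_zero_iff.2 ⟨m - ⌊γ⌋, n, rfl, ?_⟩
    rw [Int.fract]; push_cast; linarith
  set X := u 0 + (m - ⌊γ⌋ : ℤ) * β + n
  have hsmall : ∀ᶠ j in atTop, quotientScale (completeQuotient α β) (2 * j) * |X| < δ := by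
    have := ((tendsto_quotientScale P.quotientSeq).comp
      (tendsto_id.const_mul_atTop' (show 0 < 2 by norm_num))).mul_const |X|
    rw [zero_mul] at this
    exact this.eventually (gt_mem_nhds hδ)
  obtain ⟨j, ⟨h0, h1, h2⟩, h3⟩ := (h.and_eventually hsmall).exists
  obtain ⟨x, y, hx, hy⟩ := (gridPt_iff P.quotientSeq hF (2 * j) X 0).2 hg
  have hs := quotientScale_pos P.quotientSeq (2 * j)
  rw [completeQuotient_even] at hy
  rw [completeQuotient_odd] at hx
  have e1 : (x : ℝ) + y * α = expansionRem α β γ (2 * j) := by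
    rcases mul_eq_zero.1 hy.symm with h | h <;> linarith
  have e2 : |u (2 * j) + x * β + y| < δ := by
    rw [← hx, abs_mul, abs_of_pos hs]; exact h3
  have e3 := abs_lt.1 e2
  have h4 := hF.lt_one (2 * j)
  have a1 := P.alpha_pos
  have a2 := P.alpha_lt
  have b1 := P.beta_pos
  have b2 := P.beta_lt
  have D1 := P.D_add
  have D2 := P.D_pos
  have D3 := P.D_lt
  have f1 : (x : ℝ) * β + y < 0 := by linarith
  have f2 : -(1 - β) < (x : ℝ) * β + y := by linarith
  rcases lt_or_ge y 0 with hy0 | hy0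
  · have hy1 : (y : ℝ) ≤ -1 := by exact_mod_cast (by omega : y ≤ -1)
    have hx0 : (0 : ℝ) < x := by nlinarith
    have hx1 : (1 : ℤ) ≤ x := by exact_mod_cast (by exact_mod_cast hx0 : (0 : ℤ) < x)
    have hx1' : (1 : ℝ) ≤ x := by exact_mod_cast hx1
    have hx2 : (x : ℝ) < 2 := by
      by_contra hcon
      push Not at hcon
      nlinarith
    have hx3 : x = 1 := by
      have : x < 2 := by exact_mod_cast hx2
      omega
    subst hx3
    push_cast at f2
    linarith
  · have hy1 : (0 : ℝ) ≤ y := by exact_mod_cast hy0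
    have hx0 : (x : ℝ) < 0 := by nlinarith
    have hx1 : (x : ℝ) ≤ -1 := by
      have : x < 0 := by exact_mod_cast hx0
      exact_mod_cast (by omega : x ≤ -1)
    have : (y : ℝ) < -x := by nlinarith
    nlinarith

end

/-! ### Symbolic orbits -/

/-- The recurrences linking the edge labels `σ` to the left and right coordinates `g`, `h`. -/
structure IsOrbit (D : ℝ) (σ : ℕ → ℤ) (g h : ℕ → ℝ) : Prop where
  right : ∀ j, h j = σ j + D * h (j + 1)
  left : ∀ j, g (j + 1) = σ j + D * g j

/-- Vertex labels `τ` and edge labels `σ` of the right parity. -/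
structure IsCoding (b : ℕ) (τ σ : ℕ → ℤ) : Prop where
  zero_or_one : ∀ j, τ j = 0 ∨ τ j = 1
  parity : ∀ j, Even ((b : ℤ) + σ j + τ j + τ (j + 1))

/-- The expansion of `γ` follows the code `(τ, σ)` from the `2N`-th digit on. -/
def Follows (b : ℕ) (α β γ : ℝ) (N : ℕ) (τ σ : ℕ → ℤ) : Prop :=
  ∀ j, expansionT b α β γ (2 * (N + j)) = 2 * τ j ∧
    expansionT b α β γ (2 * (N + j) + 1) = -σ j - τ j - τ (j + 1)

/-- Lower bounds by `c` at a vertex with label `1`. -/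
structure VertexOne (β c G H : ℝ) : Prop where
  left : |G| ≤ 1 / 2
  right : |H| ≤ 1 / 2
  main : c ≤ (1 - G) * (1 + H)
  main' : c ≤ (1 + G) * (1 - H)
  side : c ≤ (1 - 2 * β - G) * (3 - 2 * β - H)
  side' : c ≤ (3 - 2 * β - G) * (1 - 2 * β - H)
  mirror : c ≤ (1 - 2 * β + G) * (3 - 2 * β + H)
  mirror' : c ≤ (3 - 2 * β + G) * (1 - 2 * β + H)

/-- Lower bounds by `c` at a vertex with label `0`. -/
structure VertexZero (β c G H : ℝ) : Prop where
  left : |G| ≤ 1 / 4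
  right : |H| ≤ 1 / 4
  main : c ≤ (1 - β - G) * (1 - β - H)
  main' : c ≤ (1 - β + G) * (1 - β + H)

lemma VertexOne.neg {β c G H : ℝ} (h : VertexOne β c G H) : VertexOne β c (-G) (-H) :=
  ⟨by rw [abs_neg]; exact h.left, by rw [abs_neg]; exact h.right,
    by simpa [← sub_eq_add_neg] using h.main', by simpa [← sub_eq_add_neg] using h.main,
    by simpa using h.mirror, by simpa using h.mirror', by simpa [← sub_eq_add_neg] using h.side,
    by simpa [← sub_eq_add_neg] using h.side'⟩

lemma VertexZero.neg {β c G H : ℝ} (h : VertexZero β c G H) : VertexZero β c (-G) (-H) :=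
  ⟨by rw [abs_neg]; exact h.left, by rw [abs_neg]; exact h.right,
    by simpa using h.main', by simpa [← sub_eq_add_neg] using h.main⟩

/-- An orbit all of whose vertices satisfy the lower bounds by `c`. -/
structure GoodOrbit (b : ℕ) (β D c : ℝ) (τ σ : ℕ → ℤ) (g h : ℕ → ℝ) : Prop where
  orbit : IsOrbit D σ g h
  coding : IsCoding b τ σ
  one : ∀ j, τ j = 1 → VertexOne β c (β * g j) (β * h j)
  zero : ∀ j, τ j = 0 → VertexZero β c (β * g j) (β * h j)

lemma IsOrbit.neg {D : ℝ} {σ : ℕ → ℤ} {g h : ℕ → ℝ} (O : IsOrbit D σ g h) :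
    IsOrbit D (fun j => -σ j) (fun j => -g j) (fun j => -h j) :=
  ⟨fun j => by rw [O.right j]; push_cast; ring, fun j => by rw [O.left j]; push_cast; ring⟩

lemma IsCoding.neg {b : ℕ} {τ σ : ℕ → ℤ} (C : IsCoding b τ σ) :
    IsCoding b τ fun j => -σ j :=
  ⟨C.zero_or_one, fun j => by have := C.parity j; rw [Int.even_iff] at *; omega⟩

lemma GoodOrbit.neg {b : ℕ} {β D c : ℝ} {τ σ : ℕ → ℤ} {g h : ℕ → ℝ}
    (O : GoodOrbit b β D c τ σ g h) :
    GoodOrbit b β D c τ (fun j => -σ j) (fun j => -g j) fun j => -h j :=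
  ⟨O.orbit.neg, O.coding.neg, fun j hj => by simpa using (O.one j hj).neg,
    fun j hj => by simpa using (O.zero j hj).neg⟩

/-- The remainders attached to an orbit. -/
noncomputable def orbitRem (α β : ℝ) (τ : ℕ → ℤ) (h : ℕ → ℝ) (k : ℕ) : ℝ :=
  if Even k then α * (τ (k / 2) + (1 - β - τ (k / 2) * β - β * h (k / 2)) / 2)
  else (1 - β - τ (k / 2) * β - β * h (k / 2)) / 2

/-- The conjugate remainders attached to an orbit. -/
noncomputable def orbitConj (α β : ℝ) (τ : ℕ → ℤ) (g : ℕ → ℝ) (k : ℕ) : ℝ :=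
  if Even k then (1 - β - τ (k / 2) * β - β * g (k / 2)) / 2
  else α * (τ (k / 2) + (1 - β - τ (k / 2) * β - β * g (k / 2)) / 2)

/-- The digits attached to an orbit. -/
def orbitDigit (b : ℕ) (τ σ : ℕ → ℤ) (k : ℕ) : ℤ :=
  if Even k then τ (k / 2) else ((b : ℤ) - 2 - σ (k / 2) - τ (k / 2) - τ (k / 2 + 1)) / 2

section

variable {b : ℕ} {α β c : ℝ} {τ σ : ℕ → ℤ} {g h : ℕ → ℝ}

lemma orbitRem_even (j : ℕ) : orbitRem α β τ h (2 * j) =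
    α * (τ j + (1 - β - τ j * β - β * h j) / 2) := by simp [orbitRem]

lemma orbitRem_odd (j : ℕ) : orbitRem α β τ h (2 * j + 1) =
    (1 - β - τ j * β - β * h j) / 2 := by
  simp [orbitRem, show (2 * j + 1) / 2 = j by omega]

lemma orbitConj_even (j : ℕ) : orbitConj α β τ g (2 * j) =
    (1 - β - τ j * β - β * g j) / 2 := by simp [orbitConj]

lemma orbitConj_odd (j : ℕ) : orbitConj α β τ g (2 * j + 1) =
    α * (τ j + (1 - β - τ j * β - β * g j) / 2) := by
  simp [orbitConj, show (2 * j + 1) / 2 = j by omega]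

lemma orbitDigit_even (j : ℕ) : orbitDigit b τ σ (2 * j) = τ j := by simp [orbitDigit]

lemma IsCoding.two_mul_orbitDigit (C : IsCoding b τ σ) (j : ℕ) :
    2 * orbitDigit b τ σ (2 * j + 1) = (b : ℤ) - 2 - σ j - τ j - τ (j + 1) := by
  have h := C.parity j
  rw [Int.even_iff] at h
  simp only [orbitDigit, show (2 * j + 1) / 2 = j by omega, Nat.not_even_bit1, if_false]
  omega

lemma IsCoding.orbitDigit_real (C : IsCoding b τ σ) (j : ℕ) :
    (orbitDigit b τ σ (2 * j + 1) : ℝ) = ((b : ℝ) - 2 - σ j - τ j - τ (j + 1)) / 2 := by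
  have : (2 * orbitDigit b τ σ (2 * j + 1) : ℝ) = (b : ℝ) - 2 - σ j - τ j - τ (j + 1) := by
    exact_mod_cast C.two_mul_orbitDigit j
  linarith

/-- The orbit recurrences are the frame recurrences after centring the remainders at `(1 - β - τβ) /
2`. The bounds on `βh` serve only to keep the remainders in `[0, 1)`. -/
lemma CFPair.gridFrame_orbit (P : CFPair b α β) (O : IsOrbit (α * β) σ g h)
    (C : IsCoding b τ σ) (h1 : ∀ j, τ j = 1 → |β * h j| ≤ 1 / 2)
    (h0 : ∀ j, τ j = 0 → |β * h j| ≤ 1 / 4) :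
    GridFrame (completeQuotient α β) (orbitDigit b τ σ) (orbitRem α β τ h)
      (orbitConj α β τ g) := by
  have hb := P.beta_pos
  have hb' := P.beta_lt
  have ha := P.alpha_pos
  have ham := P.alpha_mul
  have hbb := P.b_mul_beta
  have hD := P.D_add
  have hrange : ∀ k, 0 ≤ orbitRem α β τ h k ∧ orbitRem α β τ h k < 1 := by
    intro k
    rcases Nat.even_or_odd' k with ⟨j, rfl | rfl⟩
    · rw [orbitRem_even]
      rcases C.zero_or_one j with hj | hj
      · have := abs_le.1 (h0 j hj)
        rw [hj]; push_cast
        constructor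
        · apply mul_nonneg ha.le; linarith
        · nlinarith
      · have := abs_le.1 (h1 j hj)
        rw [hj]; push_cast
        constructor
        · apply mul_nonneg ha.le; linarith
        · nlinarith
    · rw [orbitRem_odd]
      rcases C.zero_or_one j with hj | hj
      · have := abs_le.1 (h0 j hj)
        rw [hj]; push_cast
        constructor <;> linarith
      · have := abs_le.1 (h1 j hj)
        rw [hj]; push_cast
        constructor <;> linarith
  refine ⟨fun k => ?_, fun k => ?_, fun k => (hrange k).1, fun k => (hrange k).2⟩
  · rcases Nat.even_or_odd' k with ⟨j, rfl | rfl⟩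
    · rw [orbitRem_even, orbitRem_odd, orbitDigit_even, completeQuotient_even]
    · rw [orbitRem_odd, show 2 * j + 1 + 1 = 2 * (j + 1) by ring, orbitRem_even,
        completeQuotient_odd, C.orbitDigit_real, O.right j]
      linear_combination (-1 / 2) * hbb - ((τ (j + 1) : ℝ) * β / 2 + β / 2) * ham
  · rcases Nat.even_or_odd' k with ⟨j, rfl | rfl⟩
    · rw [orbitConj_odd, orbitConj_even, orbitDigit_even, completeQuotient_even]
    · rw [show 2 * j + 1 + 1 = 2 * (j + 1) by ring, orbitConj_even, orbitConj_odd,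
        completeQuotient_odd, C.orbitDigit_real, O.left j]
      linear_combination (-1 / 2) * hbb - ((τ j : ℝ) * β / 2 + β / 2) * ham

lemma GoodOrbit.gridFrame (P : CFPair b α β) (O : GoodOrbit b β (α * β) c τ σ g h) :
    GridFrame (completeQuotient α β) (orbitDigit b τ σ) (orbitRem α β τ h)
      (orbitConj α β τ g) :=
  P.gridFrame_orbit O.orbit O.coding (fun j hj => (O.one j hj).right)
    fun j hj => (O.zero j hj).right

/-- The relation `α(2 - β) = 1` makes each product a multiple of `α`. At label `1` the fields
`side`, `main` and `side'` account for three of the four vertices, at label `0` the field `main` for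
two; the rest exceed `c` because `c ≤ 1`. The remaining fields enter through the negated orbit, for
the left half plane. -/
lemma GoodOrbit.vertices (P : CFPair b α β) (O : GoodOrbit b β (α * β) c τ σ g h) (hc : c ≤ 1)
    (k : ℕ) : α * c ≤ 4 * (orbitConj α β τ g k * orbitRem α β τ h k) ∧
      α * c ≤ 4 * ((orbitConj α β τ g k + completeQuotient α β (k + 1)) *
        (1 - orbitRem α β τ h k)) := by
  have hb := P.beta_pos
  have hb' := P.beta_lt
  have ha := P.alpha_pos
  have ham := P.alpha_mul
  rcases Nat.even_or_odd' k with ⟨j, rfl | rfl⟩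
  · rw [orbitRem_even, orbitConj_even, completeQuotient_odd]
    rcases O.coding.zero_or_one j with hj | hj
    · have V := O.zero j hj
      have h1 := abs_le.1 V.left
      have h2 := abs_le.1 V.right
      rw [hj]; push_cast
      constructor
      · calc α * c ≤ α * ((1 - β - β * g j) * (1 - β - β * h j)) :=
            mul_le_mul_of_nonneg_left V.main ha.le
          _ = _ := by ring
      · have : c ≤ (1 + β - β * g j) * (3 - β + β * h j) := by nlinarith
        calc α * c ≤ α * ((1 + β - β * g j) * (3 - β + β * h j)) :=
            mul_le_mul_of_nonneg_left this ha.le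
          _ = _ := by linear_combination (2 * (1 + β - β * g j)) * ham
    · have V := O.one j hj
      rw [hj]; push_cast
      constructor
      · calc α * c ≤ α * ((1 - 2 * β - β * g j) * (3 - 2 * β - β * h j)) :=
            mul_le_mul_of_nonneg_left V.side ha.le
          _ = _ := by ring
      · calc α * c ≤ α * ((1 - β * g j) * (1 + β * h j)) :=
            mul_le_mul_of_nonneg_left V.main ha.le
          _ = _ := by linear_combination (2 * (1 - β * g j)) * ham
  · rw [orbitRem_odd, orbitConj_odd, show 2 * j + 1 + 1 = 2 * (j + 1) by ring,
      completeQuotient_even]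
    rcases O.coding.zero_or_one j with hj | hj
    · have V := O.zero j hj
      have h1 := abs_le.1 V.left
      have h2 := abs_le.1 V.right
      rw [hj]; push_cast
      constructor
      · calc α * c ≤ α * ((1 - β - β * g j) * (1 - β - β * h j)) :=
            mul_le_mul_of_nonneg_left V.main ha.le
          _ = _ := by ring
      · have : c ≤ (3 - β - β * g j) * (1 + β + β * h j) := by nlinarith
        calc α * c ≤ α * ((3 - β - β * g j) * (1 + β + β * h j)) :=
            mul_le_mul_of_nonneg_left this ha.le
          _ = _ := by ring
    · have V := O.one j hj
      have h1 := abs_le.1 V.left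
      have h2 := abs_le.1 V.right
      rw [hj]; push_cast
      constructor
      · calc α * c ≤ α * ((3 - 2 * β - β * g j) * (1 - 2 * β - β * h j)) :=
            mul_le_mul_of_nonneg_left V.side' ha.le
          _ = _ := by ring
      · have : c ≤ (5 - 2 * β - β * g j) * (1 + 2 * β + β * h j) := by nlinarith
        calc α * c ≤ α * ((5 - 2 * β - β * g j) * (1 + 2 * β + β * h j)) :=
            mul_le_mul_of_nonneg_left this ha.le
          _ = _ := by ring

/-- Two remainder sequences with the same digits differ at level `0` by `quotientScale A m` times
their difference at level `m`, which is at most `1` in absolute value. Hence they agree at level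
`0`, and so everywhere. -/
lemma GridFrame.rem_unique {A : ℕ → ℝ} {a : ℕ → ℤ} (hA : QuotientSeq A a) {d : ℕ → ℤ}
    {γ γ' u u' : ℕ → ℝ} (hF : GridFrame A d γ u) (hF' : GridFrame A d γ' u') (k : ℕ) :
    γ k = γ' k := by
  have key : ∀ m, (γ 0 - γ' 0) = quotientScale A m * (γ m - γ' m) := by
    intro m
    induction m with
    | zero => simp [quotientScale]
    | succ m ih =>
      rw [ih, quotientScale_succ, hF.rem m, hF'.rem m]; ring
  have h0 : γ 0 = γ' 0 := by
    by_contra hne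
    have hpos : 0 < |γ 0 - γ' 0| := abs_pos.2 (sub_ne_zero.2 hne)
    obtain ⟨m, hm⟩ := ((tendsto_quotientScale hA).eventually (gt_mem_nhds hpos)).exists
    have h1 : |γ m - γ' m| ≤ 1 := by
      rw [abs_le]
      have := hF.nonneg m; have := hF.lt_one m; have := hF'.nonneg m; have := hF'.lt_one m
      constructor <;> linarith
    have h2 := key m
    have h3 := quotientScale_pos hA m
    have : |γ 0 - γ' 0| ≤ quotientScale A m := by
      rw [h2, abs_mul, abs_of_pos h3]
      nlinarith
    linarith
  induction k with
  | zero => exact h0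
  | succ k ih =>
    rw [hF.rem k, hF'.rem k] at ih
    have := mul_left_cancel₀ (hA.pos k).ne' ih
    linarith

/-- The recursion for the conjugate remainders can be solved backwards, so that the expansion of `γ`
and a given orbit can be made to agree at the digit where the code begins. -/
lemma exists_conjRem_eq {A : ℕ → ℝ} (hA : ∀ k, 0 < A k) (d : ℕ → ℤ) (k : ℕ) (v : ℝ) :
    ∃ u₀, conjRem A d u₀ k = v := by
  induction k generalizing v with
  | zero => exact ⟨v, rfl⟩
  | succ k ih =>
    obtain ⟨u₀, h⟩ := ih (v / A k - d k)
    refine ⟨u₀, ?_⟩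
    have := (hA k).ne'
    rw [conjRem, h]; field_simp; ring

lemma completeQuotient_shift (α β : ℝ) (N k : ℕ) :
    completeQuotient α β (2 * N + k) = completeQuotient α β k := by
  simp [completeQuotient, Nat.even_add]

lemma GridFrame.shift {d : ℕ → ℤ} {γ u : ℕ → ℝ}
    (hF : GridFrame (completeQuotient α β) d γ u) (N : ℕ) :
    GridFrame (completeQuotient α β) (fun k => d (2 * N + k)) (fun k => γ (2 * N + k))
      (fun k => u (2 * N + k)) :=
  ⟨fun k => by rw [← completeQuotient_shift α β N k]; exact hF.rem _,
    fun k => by rw [← completeQuotient_shift α β N k]; exact hF.conj _,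
    fun k => hF.nonneg _, fun k => hF.lt_one _⟩

lemma Follows.digit_eq {γ : ℝ} {N : ℕ} (hf : Follows b α β γ N τ σ) (C : IsCoding b τ σ)
    (k : ℕ) : expansionDigit α β γ (2 * N + k) = orbitDigit b τ σ k := by
  rcases Nat.even_or_odd' k with ⟨j, rfl | rfl⟩
  · have := (hf j).1
    rw [orbitDigit_even]
    simp only [expansionT, partialQuotient, even_two_mul, if_true] at this
    rw [show 2 * N + 2 * j = 2 * (N + j) by ring]
    push_cast at this
    omega
  · have h1 := (hf j).2
    have h2 := C.two_mul_orbitDigit j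
    simp only [expansionT, partialQuotient, Nat.not_even_bit1, if_false] at h1
    rw [show 2 * N + (2 * j + 1) = 2 * (N + j) + 1 by ring]
    omega

/-- Some product at the vertex `j` of an orbit equals `c`. -/
def AttainedAt (β c : ℝ) (τ : ℕ → ℤ) (g h : ℕ → ℝ) (j : ℕ) : Prop :=
  (τ j = 1 ∧ ((1 - β * g j) * (1 + β * h j) = c ∨ (1 + β * g j) * (1 - β * h j) = c ∨
    (1 - 2 * β - β * g j) * (3 - 2 * β - β * h j) = c ∨
    (1 - 2 * β + β * g j) * (3 - 2 * β + β * h j) = c)) ∨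
  (τ j = 0 ∧ ((1 - β - β * g j) * (1 - β - β * h j) = c ∨
    (1 - β + β * g j) * (1 - β + β * h j) = c))

/-- The products at grid points, at an even level, in orbit coordinates. -/
lemma CFPair.product_eq (P : CFPair b α β) (τ : ℕ → ℤ) (g h : ℕ → ℝ) (j : ℕ) (x y : ℤ) :
    4 * (|orbitConj α β τ g (2 * j) + x * β + y| * |x + y * α - orbitRem α β τ h (2 * j)|) =
      α * |(1 - β - τ j * β - β * g j + 2 * x * β + 2 * y) *
        (2 * x * (2 - β) + 2 * y - 1 + β - 2 * τ j + τ j * β + β * h j)| := by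
  have ha := P.alpha_pos
  have ham := P.alpha_mul
  have h4 : ∀ z : ℝ, 4 * |z| = |4 * z| := fun z => by rw [abs_mul]; norm_num
  have hα : ∀ z : ℝ, α * |z| = |α * z| := fun z => by rw [abs_mul, abs_of_pos ha]
  rw [orbitConj_even, orbitRem_even, ← abs_mul, h4, hα]
  congr 1
  linear_combination (-2 * x * (1 - β - τ j * β - β * g j + 2 * x * β + 2 * y)) * ham

/-- The value of `M*` on expansions following a good orbit. -/
theorem CFPair.value_of_follows (P : CFPair b α β) {γ : ℝ} {N : ℕ}
    (hf : Follows b α β γ N τ σ) (O : GoodOrbit b β (α * β) c τ σ g h) (hc0 : 0 < c)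
    (hc : c ≤ 1) (hatt : ∃ᶠ j in atTop, AttainedAt β c τ g h j) :
    γ ∉ lattice α ∧ approxConstStar α β γ = α * c := by
  have ha := P.alpha_pos
  have hb := P.beta_pos
  have hb' := P.beta_lt'
  have hA := P.quotientSeq
  obtain ⟨u₀, hu₀⟩ := exists_conjRem_eq hA.pos (expansionDigit α β γ) (2 * N)
    (orbitConj α β τ g 0)
  set u := conjRem (completeQuotient α β) (expansionDigit α β γ) u₀ with hu
  have hF : GridFrame _ _ (expansionRem α β γ) u := P.gridFrame γ u₀
  have hFo := O.gridFrame P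
  have hFs := hF.shift N
  have hdig : (fun k => expansionDigit α β γ (2 * N + k)) = orbitDigit b τ σ :=
    funext fun k => hf.digit_eq O.coding k
  rw [hdig] at hFs
  have hrem : ∀ k, expansionRem α β γ (2 * N + k) = orbitRem α β τ h k :=
    fun k => GridFrame.rem_unique hA hFs hFo k
  have hconj : ∀ k, u (2 * N + k) = orbitConj α β τ g k := by
    intro k
    induction k with
    | zero => exact hu₀
    | succ k ih =>
      have := hFs.conj k
      rw [hFo.conj k, ← ih]; exact this
  have hαc : 0 < α * c := mul_pos ha hc0
  have hnot : γ ∉ lattice α := by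
    -- The worst case is label `1`, where `u ≥ (1 - 2β - 1/2) / 2` with `β < 0.2255`, which is more
    -- than `1/50`.
    refine P.notMem_lattice hF (δ := 1 / 50) (by norm_num) (Eventually.frequently ?_)
    filter_upwards [eventually_ge_atTop N] with j hj
    obtain ⟨i, rfl⟩ := Nat.exists_eq_add_of_le hj
    rw [show 2 * (N + i) = 2 * N + 2 * i by ring, hrem, hconj]
    have hu1 : 1 / 50 ≤ orbitConj α β τ g (2 * i) ∧
        orbitConj α β τ g (2 * i) ≤ 1 - β - 1 / 50 := by
      rw [orbitConj_even]
      rcases O.coding.zero_or_one i with hi | hi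
      · have := abs_le.1 (O.zero i hi).left
        rw [hi]; push_cast; constructor <;> linarith
      · have := abs_le.1 (O.one i hi).left
        rw [hi]; push_cast; constructor <;> linarith
    refine ⟨?_, hu1⟩
    have := (O.vertices P hc (2 * i)).1
    by_contra hcon
    push Not at hcon
    nlinarith
  refine ⟨hnot, ?_⟩
  have hs := quotientScale_pos hA (2 * N)
  have hlow1 : ∀ X Y, GridPt (completeQuotient α β) (orbitRem α β τ h) (orbitConj α β τ g) 0 X Y →
      orbitConj α β τ g 0 + β ≤ X → α * c ≤ 4 * (|X| * |Y|) := fun X Y hp hX =>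
    le_of_vertices hA hFo hαc (fun k => (O.vertices P hc k).1) (fun k => (O.vertices P hc k).2)
      (by simpa [completeQuotient] using hX) hp
  have hlow2 : ∀ X Y, GridPt (completeQuotient α β) (orbitRem α β τ fun j => -h j)
      (orbitConj α β τ fun j => -g j) 0 X Y →
      (orbitConj α β τ fun j => -g j) 0 + β ≤ X → α * c ≤ 4 * (|X| * |Y|) := fun X Y hp hX =>
    le_of_vertices hA (O.neg.gridFrame P) hαc (fun k => (O.neg.vertices P hc k).1)
      (fun k => (O.neg.vertices P hc k).2) (by simpa [completeQuotient] using hX) hp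
  refine P.approxConstStar_eq hnot hF (C := 10) hαc
    (X₀ := max (orbitConj α β τ g 0 + β) ((orbitConj α β τ (fun j => -g j)) 0 + β) /
      quotientScale (completeQuotient α β) (2 * N)) ?_ ?_
  · intro X Y hg hX
    rw [div_le_iff₀ hs, max_le_iff] at hX
    obtain ⟨x, y, hx, hy⟩ := (gridPt_iff hA hF (2 * N) X Y).2 hg
    have e1 := hrem 0
    have e2 := hconj 0
    rw [add_zero] at e1 e2
    rw [completeQuotient_odd, e2] at hx
    rw [completeQuotient_even, e1] at hy
    set s := quotientScale (completeQuotient α β) (2 * N) with hsdef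
    have hprod : ∀ ε : ℝ, |ε| = 1 → |ε * (s * X)| * |ε * (Y / s)| = |X| * |Y| := by
      intro ε hε
      simp only [abs_mul, hε, abs_div, abs_of_pos hs, one_mul]; field_simp
    rcases le_or_gt 0 X with hX0 | hX0
    · rw [← hprod 1 (by simp)]
      apply hlow1
      · refine ⟨x, y, ?_, ?_⟩
        · simp [quotientScale, completeQuotient, hx]
        · rw [hy]; simp [quotientScale, completeQuotient]; field_simp
      · rw [abs_of_nonneg hX0] at hX; linarith [hX.1]
    · rw [← hprod (-1) (by simp)]
      apply hlow2
      · have r1 := orbitRem_even (α := α) (β := β) (τ := τ) (h := h) 0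
        have r2 := orbitRem_even (α := α) (β := β) (τ := τ) (h := fun j => -h j) 0
        have c1 := orbitConj_even (α := α) (β := β) (τ := τ) (g := g) 0
        have c2 := orbitConj_even (α := α) (β := β) (τ := τ) (g := fun j => -g j) 0
        rw [mul_zero] at r1 r2 c1 c2
        -- Reflection in the origin carries the grid of the orbit to the grid of the negated orbit.
        -- In integer coordinates it is `(x, y) ↦ (1 + τ 0 - x, -1 - y)`.
        refine ⟨1 + τ 0 - x, -1 - y, ?_, ?_⟩
        · rw [hx, c2, c1]
          simp [quotientScale, completeQuotient]; ring
        · rw [hy, r2, r1]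
          simp only [quotientScale, completeQuotient, Finset.range_zero, Finset.prod_empty,
            Even.zero, if_true]
          push_cast
          field_simp
          linear_combination (2 * (1 + (τ 0 : ℝ))) * P.alpha_mul
      · rw [abs_of_neg hX0] at hX; linarith [hX.2]
  · have hmap : ∃ᶠ k in atTop, ∃ j, k = 2 * N + 2 * j ∧ AttainedAt β c τ g h j := by
      rw [frequently_atTop] at hatt ⊢
      intro n
      obtain ⟨j, hj, hj'⟩ := hatt n
      exact ⟨2 * N + 2 * j, by omega, j, rfl, hj'⟩
    refine hmap.mono ?_
    rintro k ⟨j, rfl, hj⟩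
    have hg1 := hF.nonneg (2 * N + 2 * j)
    have hg2 := hF.lt_one (2 * N + 2 * j)
    have ha1 := P.alpha_lt
    suffices hsuff : ∃ x y : ℤ, |(x : ℝ)| ≤ 2 ∧ |(y : ℝ)| ≤ 2 ∧
        |(1 - β - τ j * β - β * g j + 2 * x * β + 2 * y) *
        (2 * x * (2 - β) + 2 * y - 1 + β - 2 * τ j + τ j * β + β * h j)| = c by
      obtain ⟨x, y, hx, hy, hxy⟩ := hsuff
      refine ⟨x, y, ?_, ?_⟩
      · rw [hrem, hconj, show 2 * N + 2 * j + 1 = 2 * (N + j) + 1 by ring,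
          show 2 * N + 2 * j = 2 * (N + j) by ring, completeQuotient_even, completeQuotient_odd,
          P.product_eq, hxy]
      · rw [show 2 * N + 2 * j = 2 * (N + j) by ring] at *
        rw [completeQuotient_even]
        have := abs_le.1 hx
        have := abs_le.1 hy
        rw [abs_le]; constructor <;> nlinarith
    -- Each product that may be attained belongs to one of the four grid points `(0, 0)`, `(1, 0)`,
    -- `(1, -1)`, `(2, -1)`.
    rcases hj with ⟨hj, h1 | h1 | h1 | h1⟩ | ⟨hj, h1 | h1⟩
    · refine ⟨1, 0, by norm_num, by norm_num, ?_⟩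
      rw [hj, ← abs_of_pos hc0, ← h1]; congr 1; push_cast; ring
    · refine ⟨1, -1, by norm_num, by norm_num, ?_⟩
      rw [hj, ← abs_of_pos hc0, ← h1]; congr 1; push_cast; ring
    · refine ⟨0, 0, by norm_num, by norm_num, ?_⟩
      rw [hj, ← abs_of_pos hc0, ← h1, ← abs_neg]; congr 1; push_cast; ring
    · refine ⟨2, -1, by norm_num, by norm_num, ?_⟩
      rw [hj, ← abs_of_pos hc0, ← h1, ← abs_neg]; congr 1; push_cast; ring
    · refine ⟨0, 0, by norm_num, by norm_num, ?_⟩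
      rw [hj, ← abs_of_pos hc0, ← h1, ← abs_neg]; congr 1; push_cast; ring
    · refine ⟨1, -1, by norm_num, by norm_num, ?_⟩
      rw [hj, ← abs_of_pos hc0, ← h1, ← abs_neg]; congr 1; push_cast; ring

/-- Every good orbit is followed by some expansion. -/
theorem GoodOrbit.exists_follows (P : CFPair b α β) (O : GoodOrbit b β (α * β) c τ σ g h) :
    ∃ γ, Follows b α β γ 0 τ σ := by
  have hF := O.gridFrame P
  have hA := P.quotientSeq
  refine ⟨orbitRem α β τ h 0, ?_⟩
  have hstep : ∀ k, orbitRem α β τ h k / completeQuotient α β k =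
      orbitDigit b τ σ k + orbitRem α β τ h (k + 1) := fun k => by
    rw [hF.rem k]; field_simp [(hA.pos k).ne']
  have hrem : ∀ k, expansionRem α β (orbitRem α β τ h 0) k = orbitRem α β τ h k := by
    intro k
    induction k with
    | zero => exact Int.fract_eq_self.2 ⟨hF.nonneg 0, hF.lt_one 0⟩
    | succ k ih =>
      rw [expansionRem, ih, hstep, Int.fract_intCast_add]
      exact Int.fract_eq_self.2 ⟨hF.nonneg _, hF.lt_one _⟩
  have hdig : ∀ k, expansionDigit α β (orbitRem α β τ h 0) k = orbitDigit b τ σ k := fun k => by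
    rw [expansionDigit, hrem, hstep, Int.floor_intCast_add,
      Int.floor_eq_zero_iff.2 ⟨hF.nonneg _, hF.lt_one _⟩, add_zero]
  intro j
  rw [zero_add]
  constructor
  · simp [expansionT, hdig, orbitDigit_even, partialQuotient]
  · have := O.coding.two_mul_orbitDigit j
    simp only [expansionT, hdig, partialQuotient, Nat.not_even_bit1, if_false]
    omega

end

/-! ### The orbit of a point with large approximation constant -/

/-- An orbit whose coordinates stay in the natural range and all of whose products exceed `c`. -/
structure AboveOrbit (b : ℕ) (β D c : ℝ) (τ σ : ℕ → ℤ) (g h : ℕ → ℝ) : Prop where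
  orbit : IsOrbit D σ g h
  coding : IsCoding b τ σ
  range_left : ∀ j, τ j = 1 → -1 < β * g j ∧ β * g j ≤ 1 - 2 * β
  range_right : ∀ j, τ j = 1 → -1 < β * h j ∧ β * h j ≤ 1 - 2 * β
  range_left' : ∀ j, τ j = 0 → -(1 + β) < β * g j ∧ β * g j ≤ 1 - β
  range_right' : ∀ j, τ j = 0 → -(1 + β) < β * h j ∧ β * h j ≤ 1 - β
  one : ∀ j, τ j = 1 → c < (1 - β * g j) * (1 + β * h j)
  one' : ∀ j, τ j = 1 → c < (1 + β * g j) * (1 - β * h j)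
  side : ∀ j, τ j = 1 → c < |(1 - 2 * β - β * g j) * (3 - 2 * β - β * h j)|
  mirror : ∀ j, τ j = 1 → c < |(1 - 2 * β + β * g j) * (3 - 2 * β + β * h j)|
  zero : ∀ j, τ j = 0 → c < |(1 - β - β * g j) * (1 - β - β * h j)|
  zero' : ∀ j, τ j = 0 → c < |(1 - β + β * g j) * (1 - β + β * h j)|

section

variable {b : ℕ} {α β : ℝ}

lemma expansionDigit_mul_le (P : CFPair b α β) (γ : ℝ) (k : ℕ) :
    (expansionDigit α β γ k : ℝ) * completeQuotient α β k ≤ expansionRem α β γ k := by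
  rw [← le_div_iff₀ (P.quotientSeq.pos k)]
  exact Int.floor_le _

lemma expansionDigit_nonneg (P : CFPair b α β) (γ : ℝ) (k : ℕ) : 0 ≤ expansionDigit α β γ k :=
  Int.floor_nonneg.2 (div_nonneg ((P.gridFrame γ 0).nonneg k) (P.quotientSeq.pos k).le)

lemma conjRem_nonneg (P : CFPair b α β) (γ : ℝ) (k : ℕ) :
    0 ≤ conjRem (completeQuotient α β) (expansionDigit α β γ) 0 k := by
  induction k with
  | zero => exact le_rfl
  | succ k ih =>
    have : (0 : ℝ) ≤ expansionDigit α β γ k := by exact_mod_cast expansionDigit_nonneg P γ k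
    exact mul_nonneg (P.quotientSeq.pos k).le (add_nonneg this ih)

/-- The admissibility of digit sequences, in terms of the conjugate remainders. -/
lemma conjRem_lt (P : CFPair b α β) (γ : ℝ) (k : ℕ) :
    conjRem (completeQuotient α β) (expansionDigit α β γ) 0 k < 1 ∧
      (conjRem (completeQuotient α β) (expansionDigit α β γ) 0 k <
          1 - completeQuotient α β (k + 1) ∨
        expansionRem α β γ k < 1 - completeQuotient α β k) := by
  have hA := P.quotientSeq
  induction k with
  | zero =>
    have := hA.lt_one 1
    simp only [conjRem]
    exact ⟨by norm_num, Or.inl (by simpa using this)⟩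
  | succ k ih =>
    have hF := P.gridFrame γ 0
    have h1 := hA.pos k
    have h2 := hA.lt_one k
    have h3 := hA.pos (k + 1)
    have h4 := hA.lt_one (k + 1)
    have h5 := hA.rel k
    have h6 := hF.rem k
    have h7 := hF.lt_one k
    have h8 := expansionDigit_mul_le P γ k
    have hper : completeQuotient α β (k + 1 + 1) = completeQuotient α β k := hA.per k
    rw [hper, conjRem]
    set d := expansionDigit α β γ k with hd
    set u := conjRem (completeQuotient α β) (expansionDigit α β γ) 0 k
    set a := partialQuotientInt b k
    set A := completeQuotient α β k
    set A' := completeQuotient α β (k + 1)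
    set x := expansionRem α β γ k
    set x' := expansionRem α β γ (k + 1)
    -- This propagates the rule against a block `a - 1, a - 2, …, a - 2, a - 1`. In the first case
    -- the digit may be `a - 1`, and then the next remainder is small. In the second it is at most
    -- `a - 2`, and equality hands the constraint on.
    rcases ih.2 with hu | hx
    · have hda : d ≤ a - 1 := by
        have : (d : ℝ) < a - A' := by nlinarith
        have : (d : ℝ) < a := by linarith
        have : d < a := by exact_mod_cast this
        omega
      have hda' : (d : ℝ) ≤ a - 1 := by exact_mod_cast hda
      refine ⟨by nlinarith, ?_⟩
      rcases eq_or_lt_of_le hda with he | hlt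
      · right
        have he' : (d : ℝ) = a - 1 := by rw [he]; push_cast; ring
        rw [he'] at h6
        nlinarith
      · left
        have : (d : ℝ) ≤ a - 2 := by exact_mod_cast (by omega : d ≤ a - 2)
        nlinarith
    · have hda : d ≤ a - 2 := by
        have : (d : ℝ) < a - A' - 1 := by nlinarith
        have : (d : ℝ) < a - 1 := by linarith
        have : d < a - 1 := by exact_mod_cast this
        omega
      have hda' : (d : ℝ) ≤ a - 2 := by exact_mod_cast hda
      have hu := ih.1
      have hAA : A * A' < A := by nlinarith
      have hmain : A * (d + u) < A * (a - 1) := by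
        apply mul_lt_mul_of_pos_left _ h1; linarith
      refine ⟨by linarith, ?_⟩
      rcases eq_or_lt_of_le hda with he | hlt
      · right
        have he' : (d : ℝ) = a - 2 := by rw [he]; push_cast; ring
        rw [he'] at h6
        nlinarith
      · left
        have h9 : (d : ℝ) ≤ a - 3 := by exact_mod_cast (by omega : d ≤ a - 3)
        have : A * (d + u) < A * (a - 2) := by
          apply mul_lt_mul_of_pos_left _ h1; linarith
        linarith

/-- Points with `M*` above `α c` have expansions following an orbit with all products above `c`. -/
theorem CFPair.exists_aboveOrbit (P : CFPair b α β) {γ c : ℝ} (hγ : γ ∉ lattice α)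
    (hc : α * c < approxConstStar α β γ) :
    ∃ N τ σ g h, Follows b α β γ N τ σ ∧ AboveOrbit b β (α * β) c τ σ g h := by
  have ha := P.alpha_pos
  have ham := P.alpha_mul
  have ha2 := P.half_lt_alpha
  have hb := P.beta_pos
  have hb' := P.beta_lt
  have hbb := P.b_mul_beta
  have hF := P.gridFrame γ 0
  set d := expansionDigit α β γ with hd
  set x := expansionRem α β γ with hx
  set u := conjRem (completeQuotient α β) d 0 with hu
  let τ : ℕ → ℤ := fun j => d (2 * j)
  let σ : ℕ → ℤ := fun j => (b : ℤ) - 2 - 2 * d (2 * j + 1) - τ j - τ (j + 1)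
  let g : ℕ → ℝ := fun j => (1 - β - 2 * u (2 * j)) / β - τ j
  let h : ℕ → ℝ := fun j => (1 - β - 2 * x (2 * j + 1)) / β - τ j
  have eg : ∀ j, β * g j = 1 - β - 2 * u (2 * j) - β * τ j := fun j => by
    simp only [g]; field_simp
  have eh : ∀ j, β * h j = 1 - β - 2 * x (2 * j + 1) - β * τ j := fun j => by
    simp only [h]; field_simp
  have r1 : ∀ j, x (2 * j) = α * (τ j + x (2 * j + 1)) := fun j => by
    have := hF.rem (2 * j); rwa [completeQuotient_even] at this
  have r2 : ∀ j, x (2 * j + 1) = β * (d (2 * j + 1) + x (2 * (j + 1))) := fun j => by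
    have := hF.rem (2 * j + 1); rwa [completeQuotient_odd] at this
  have c1 : ∀ j, u (2 * j + 1) = α * (τ j + u (2 * j)) := fun j => by
    have := hF.conj (2 * j); rwa [completeQuotient_even] at this
  have c2 : ∀ j, u (2 * (j + 1)) = β * (d (2 * j + 1) + u (2 * j + 1)) := fun j => by
    have := hF.conj (2 * j + 1); rwa [completeQuotient_odd] at this
  have hτ : ∀ j, τ j = 0 ∨ τ j = 1 := by
    intro j
    have h1 := expansionDigit_nonneg P γ (2 * j)
    have h2 := expansionDigit_mul_le P γ (2 * j)
    rw [completeQuotient_even] at h2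
    have h3 := hF.lt_one (2 * j)
    have h4 : (τ j : ℝ) < 2 := by
      by_contra hcon
      push Not at hcon
      have : (τ j : ℝ) * α ≤ x (2 * j) := h2
      nlinarith
    have h5 : τ j < 2 := by exact_mod_cast h4
    have h6 : 0 ≤ τ j := h1
    omega
  have hO : IsOrbit (α * β) σ g h := by
    constructor
    · intro j
      apply mul_left_cancel₀ hb.ne'
      rw [show β * (σ j + α * β * h (j + 1)) = β * σ j + α * β * (β * h (j + 1)) by ring, eh, eh,
        r2, r1]
      simp only [σ]; push_cast
      linear_combination (-1 : ℝ) * hbb - (β * τ (j + 1) + β) * ham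
    · intro j
      apply mul_left_cancel₀ hb.ne'
      rw [show β * (σ j + α * β * g j) = β * σ j + α * β * (β * g j) by ring, eg, eg, c2, c1]
      simp only [σ]; push_cast
      linear_combination (-1 : ℝ) * hbb - (β * τ j + β) * ham
  have hC : IsCoding b τ σ := by
    refine ⟨hτ, fun j => ?_⟩
    rw [Int.even_iff]; simp only [σ]; omega
  have hxo : ∀ j, x (2 * j) = orbitRem α β τ h (2 * j) := fun j => by
    rw [orbitRem_even, eh, r1]; ring
  have huo : ∀ j, u (2 * j) = orbitConj α β τ g (2 * j) := fun j => by
    rw [orbitConj_even, eg]; ring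
  have hprod : ∀ x' y' : ℤ, ∀ᶠ j in atTop,
      c < |(1 - β - τ j * β - β * g j + 2 * x' * β + 2 * y') *
        (2 * x' * (2 - β) + 2 * y' - 1 + β - 2 * τ j + τ j * β + β * h j)| := by
    intro x' y'
    have := P.eventually_lt hγ hF hc x' y'
    have h2 := (tendsto_id.const_mul_atTop' (show 0 < 2 by norm_num)).eventually this
    filter_upwards [h2] with j hj
    simp only [id, completeQuotient_even, completeQuotient_odd] at hj
    rw [show expansionRem α β γ (2 * j) = x (2 * j) from rfl, hxo, huo, P.product_eq] at hj
    exact lt_of_mul_lt_mul_left hj ha.le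
  -- Four grid points near each level suffice. Their products eventually exceed `c`, and discarding
  -- the first `N` pairs of digits makes this hold throughout.
  obtain ⟨N, hN⟩ := eventually_atTop.1
    ((hprod 0 0).and ((hprod 1 0).and ((hprod 1 (-1)).and (hprod 2 (-1)))))
  have rg1 : ∀ j, τ j = 1 → -1 < β * g j ∧ β * g j ≤ 1 - 2 * β := by
    intro j hj
    have h1 := conjRem_nonneg P γ (2 * j)
    have h2 := (conjRem_lt P γ (2 * j)).2
    rw [completeQuotient_odd, completeQuotient_even] at h2
    have h3 := hF.nonneg (2 * j + 1)
    have h4 := r1 j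
    rw [eg, hj] at *
    push_cast at *
    -- With digit `1` the remainder is at least `α > 1/2`, so the second alternative of `conjRem_lt`
    -- is impossible.
    have h5 : u (2 * j) < 1 - β := by
      rcases h2 with h2 | h2
      · exact h2
      · exfalso
        have : x (2 * j) < 1 - α := h2
        nlinarith
    have h6 : 0 ≤ u (2 * j) := h1
    constructor <;> linarith
  have rh1 : ∀ j, τ j = 1 → -1 < β * h j ∧ β * h j ≤ 1 - 2 * β := by
    intro j hj
    have h3 := hF.nonneg (2 * j + 1)
    have h5 := hF.lt_one (2 * j)
    have h4 := r1 j
    rw [eh, hj] at *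
    push_cast at *
    have : x (2 * j + 1) < 1 - β := by nlinarith
    constructor <;> linarith
  have rg0 : ∀ j, τ j = 0 → -(1 + β) < β * g j ∧ β * g j ≤ 1 - β := by
    intro j hj
    have h1 : 0 ≤ u (2 * j) := conjRem_nonneg P γ (2 * j)
    have h2 : u (2 * j) < 1 := (conjRem_lt P γ (2 * j)).1
    rw [eg, hj]
    push_cast
    constructor <;> linarith
  have rh0 : ∀ j, τ j = 0 → -(1 + β) < β * h j ∧ β * h j ≤ 1 - β := by
    intro j hj
    have h1 := hF.nonneg (2 * j + 1)
    have h2 := hF.lt_one (2 * j + 1)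
    rw [eh, hj]
    push_cast
    constructor <;> linarith
  refine ⟨N, fun j => τ (N + j), fun j => σ (N + j), fun j => g (N + j), fun j => h (N + j),
    fun j => ⟨?_, ?_⟩, ⟨⟨fun j => hO.right _, fun j => hO.left _⟩, ⟨fun j => hτ _, fun j =>
    hC.parity _⟩, fun j => rg1 _, fun j => rh1 _, fun j => rg0 _, fun j => rh0 _, ?_, ?_, ?_, ?_,
    ?_, ?_⟩⟩
  · simp [expansionT, partialQuotient, τ, hd]
  · simp only [expansionT, partialQuotient, Nat.not_even_bit1, if_false, σ, hd,
      show N + (j + 1) = N + j + 1 from rfl]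
    ring
  · intro j hj
    have := (hN (N + j) (by omega)).2.1
    have r := rg1 _ hj
    have r' := rh1 _ hj
    rw [hj] at this
    rw [← abs_of_nonneg (mul_nonneg (show (0 : ℝ) ≤ 1 - β * g (N + j) by linarith)
      (show (0 : ℝ) ≤ 1 + β * h (N + j) by linarith))]
    refine this.trans_eq ?_
    congr 1; push_cast; ring
  · intro j hj
    have := (hN (N + j) (by omega)).2.2.1
    have r := rg1 _ hj
    have r' := rh1 _ hj
    rw [hj] at this
    rw [← abs_of_nonneg (mul_nonneg (show (0 : ℝ) ≤ 1 + β * g (N + j) by linarith)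
      (show (0 : ℝ) ≤ 1 - β * h (N + j) by linarith))]
    refine this.trans_eq ?_
    congr 1; push_cast; ring
  · intro j hj
    have := (hN (N + j) (by omega)).1
    rw [hj] at this
    refine this.trans_eq ?_
    rw [← abs_neg]; congr 1; push_cast; ring
  · intro j hj
    have := (hN (N + j) (by omega)).2.2.2
    rw [hj] at this
    refine this.trans_eq ?_
    rw [← abs_neg]; congr 1; push_cast; ring
  · intro j hj
    have := (hN (N + j) (by omega)).1
    rw [hj] at this
    refine this.trans_eq ?_
    rw [← abs_neg]; congr 1; push_cast; ring
  · intro j hj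
    have := (hN (N + j) (by omega)).2.2.1
    rw [hj] at this
    refine this.trans_eq ?_
    rw [← abs_neg]; congr 1; push_cast; ring

end

/-! ### Localisation -/

/-- If `P ≤ Q` then `(1 + P)(1 - Q)` is at most both `1 - P²` and `1 - Q²`; if `Q ≤ P` the other
product does the same. -/
lemma sq_lt_of_products {β P Q : ℝ} (hP : |P| < 1) (hQ : |Q| < 1)
    (h1 : 1 - 2 * β < (1 - P) * (1 + Q)) (h2 : 1 - 2 * β < (1 + P) * (1 - Q)) :
    P ^ 2 < 2 * β ∧ Q ^ 2 < 2 * β := by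
  have a1 := abs_lt.1 hP
  have a2 := abs_lt.1 hQ
  constructor
  · rcases le_total P Q with h | h <;> nlinarith
  · rcases le_total P Q with h | h <;> nlinarith

/-- This excludes the part of the range where `1 - β + P ≤ 0`. There that factor is below `2β` in
absolute value, while the first product bounds `Q` above by `1 - β - c/2`. The second product would
then force `c(1 + β) < 4β(1 - β)`. -/
lemma abs_lt_of_products {β c P Q : ℝ} (hβ : 0 < β) (hβ' : β < 1 / 4) (hc : 1 - 2 * β ≤ c)
    (hc' : 4 * β * (1 - β) < c * (1 + β)) (hP : -(1 + β) < P ∧ P ≤ 1 - β)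
    (hQ : -(1 + β) < Q ∧ Q ≤ 1 - β) (h1 : c < |(1 - β - P) * (1 - β - Q)|)
    (h2 : c < |(1 - β + P) * (1 - β + Q)|) : |P| < 1 - β := by
  rw [abs_of_nonneg (mul_nonneg (by linarith) (by linarith))] at h1
  have hP1 : P < 1 - β := by
    by_contra hcon
    have : P = 1 - β := by linarith [hP.2]
    rw [this] at h1
    linarith
  refine abs_lt.2 ⟨?_, hP1⟩
  by_contra hcon
  push Not at hcon
  have hQ2 : 1 - β - Q < 2 := by linarith
  have hP2 : 1 - β - P < 2 := by linarith
  have hc0 : 0 < c := by linarith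
  have hQ3 : c < 2 * (1 - β - Q) := by nlinarith
  rw [abs_mul, abs_of_nonpos (show 1 - β + P ≤ 0 by linarith)] at h2
  have h4 : -(1 - β + P) < 2 * β := by linarith
  have h5 : c < 2 * β * |1 - β + Q| :=
    h2.trans_le (mul_le_mul_of_nonneg_right h4.le (abs_nonneg _))
  rcases le_total 0 (1 - β + Q) with h | h
  · rw [abs_of_nonneg h] at h5
    nlinarith
  · rw [abs_of_nonpos h] at h5
    nlinarith

/-- Suppose `g² ≥ M`. For equal signs `β|gh| ≤ (1 - β)|h|` reduces the inequality to `(1 - β)|g| <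
βM`, so `|g|` is small after all. For opposite signs `M + gh ≤ |g| |g + h|`, and cancelling `|g +
h|` contradicts `|βg| < 1 - β`. -/
lemma sq_lt_of_balance {β M g h : ℝ} (hβ : 0 < β) (hβ' : β < 1 / 4) (hM : 0 < M) (hM' : M ≤ 1)
    (hg : |β * g| < 1 - β) (hb : (1 - β) * |g + h| < β * (M + g * h)) : g ^ 2 < M := by
  have a1 := abs_lt.1 hg
  have b1 : (1 - β) * (g + h) < β * (M + g * h) :=
    lt_of_le_of_lt (mul_le_mul_of_nonneg_left (le_abs_self _) (by linarith)) hb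
  have b2 : (1 - β) * (-(g + h)) < β * (M + g * h) :=
    lt_of_le_of_lt (mul_le_mul_of_nonneg_left (neg_le_abs _) (by linarith)) hb
  have small : ∀ x : ℝ, 0 ≤ x → (1 - β) * x < β * M → x ^ 2 < M := by
    intro x hx h
    have h3 : x < M / 2 := by nlinarith
    nlinarith
  by_contra hcon
  push Not at hcon
  rcases le_total 0 g with h1 | h1 <;> rcases le_total 0 h with h2 | h2
  · have := small g h1 (by nlinarith)
    linarith
  · have hgh : -h < g := by
      by_contra hc
      push Not at hc
      nlinarith [mul_pos hβ hM, mul_nonneg h1 (neg_nonneg.2 h2)]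
    nlinarith
  · have hgh : h < -g := by
      by_contra hc
      push Not at hc
      nlinarith [mul_pos hβ hM, mul_nonneg h2 (neg_nonneg.2 h1)]
    nlinarith
  · have := small (-g) (by linarith) (by nlinarith)
    linarith [neg_sq g]

/-- By `pq ≤ (p + q)² / 4` the hypothesis is quadratic in `p + q`. The bounds `0.606 > √(2β)` keep
the sum below the larger root. -/
lemma add_lt_of_product_lt {β p q : ℝ} (hβ : 0 < β) (hβ' : β < 1836 / 10000)
    (hp' : β * p < 606 / 1000) (hq' : β * q < 606 / 1000)
    (h : p + q - β * (p * q) < 2) : p + q < 233 / 100 := by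
  by_contra hcon
  push Not at hcon
  have e1 : β * (p * q) ≤ β * ((p + q) ^ 2 / 4) :=
    mul_le_mul_of_nonneg_left (by linarith [sq_nonneg (p - q)]) hβ.le
  have e2 : 0 ≤ (p + q - 233 / 100) * (1212 / 1000 - β * (p + q)) :=
    mul_nonneg (by linarith) (by linarith)
  have e3 : β * (p + q) ≤ 1836 / 10000 * (p + q) :=
    mul_le_mul_of_nonneg_right hβ'.le (by linarith)
  have e4 : β * ((p + q) ^ 2 / 4) = (1212 / 1000 * (p + q) - 233 / 100 * (1212 / 1000)
      + 233 / 100 * (β * (p + q)) - (p + q - 233 / 100) * (1212 / 1000 - β * (p + q))) / 4 := by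
    ring
  linarith

/-- The constraints at the vertices of an orbit above the limit point, for even `b`. -/
structure EvenOrbit (β D : ℝ) (τ σ : ℕ → ℤ) (g h : ℕ → ℝ) : Prop where
  beta_pos : 0 < β
  beta_lt : β < 1836 / 10000
  D_mul : D * (2 - β) = β
  orbit : IsOrbit D σ g h
  zero_or_one : ∀ j, τ j = 0 ∨ τ j = 1
  parity : ∀ j, Even (σ j + τ j + τ (j + 1))
  one : ∀ j, τ j = 1 → h j - g j + β * (g j * h j) < 2 ∧ g j - h j + β * (g j * h j) < 2 ∧
    (β * g j) ^ 2 < 2 * β ∧ (β * h j) ^ 2 < 2 * β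
  zero : ∀ j, τ j = 0 → |g j| < 1 ∧ |h j| < 1 ∧
    (1 - β) * |g j + h j| < β * (1 + g j * h j)

/-- Here `c = 1 - 2β`, and `αc` is the limit point for even `b`. Subtracting the constant terms of
the products and dividing by `β` gives the constraints; at label `0` the balance lemma applies with
`M = 1`. -/
lemma AboveOrbit.evenOrbit {b : ℕ} {β D : ℝ} {τ σ : ℕ → ℤ} {g h : ℕ → ℝ} (hb : Even b)
    (h0 : 0 < β) (h1 : β < 1836 / 10000) (hD : D * (2 - β) = β)
    (A : AboveOrbit b β D ((1 - β) ^ 2 - β ^ 2) τ σ g h) : EvenOrbit β D τ σ g h := by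
  refine ⟨h0, h1, hD, A.orbit, A.coding.zero_or_one, fun j => ?_, fun j hj => ?_, fun j hj => ?_⟩
  · have := A.coding.parity j
    have hb' : Even (b : ℤ) := by exact_mod_cast hb
    rw [Int.even_iff] at *; omega
  · have a1 := A.one j hj
    have a2 := A.one' j hj
    have r1 := A.range_left j hj
    have r2 := A.range_right j hj
    have := sq_lt_of_products (β := β) (P := β * g j) (Q := β * h j)
      (abs_lt.2 ⟨r1.1, by linarith⟩) (abs_lt.2 ⟨r2.1, by linarith⟩) (by linarith) (by linarith)
    refine ⟨?_, ?_, this⟩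
    · apply lt_of_mul_lt_mul_left _ h0.le; linarith
    · apply lt_of_mul_lt_mul_left _ h0.le; linarith
  · have a1 := A.zero j hj
    have a2 := A.zero' j hj
    have r1 := A.range_left' j hj
    have r2 := A.range_right' j hj
    have hg := abs_lt_of_products (c := (1 - β) ^ 2 - β ^ 2) h0 (by linarith) (by linarith) (by nlinarith) r1 r2 a1 a2
    have hh := abs_lt_of_products (c := (1 - β) ^ 2 - β ^ 2) h0 (by linarith) (by linarith) (by nlinarith) r2 r1
      (by rwa [mul_comm (1 - β - β * h j)]) (by rwa [mul_comm (1 - β + β * h j)])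
    have hg' := abs_lt.1 hg
    have hh' := abs_lt.1 hh
    rw [abs_of_pos (mul_pos (by linarith) (by linarith))] at a1 a2
    have hbal : (1 - β) * |g j + h j| < β * (1 + g j * h j) := by
      rcases abs_cases (g j + h j) with ⟨e, -⟩ | ⟨e, -⟩ <;> rw [e] <;>
        apply lt_of_mul_lt_mul_left _ h0.le <;> nlinarith
    have s1 := sq_lt_of_balance h0 (by linarith) one_pos le_rfl hg hbal
    have s2 := sq_lt_of_balance h0 (by linarith) one_pos le_rfl hh
      (by rwa [add_comm (h j), mul_comm (h j)])
    exact ⟨by rwa [← sq_lt_one_iff_abs_lt_one], by rwa [← sq_lt_one_iff_abs_lt_one], hbal⟩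

namespace EvenOrbit

variable {β D : ℝ} {τ σ : ℕ → ℤ} {g h : ℕ → ℝ}

lemma neg (O : EvenOrbit β D τ σ g h) :
    EvenOrbit β D τ (fun j => -σ j) (fun j => -g j) fun j => -h j := by
  refine ⟨O.beta_pos, O.beta_lt, O.D_mul, O.orbit.neg, O.zero_or_one, fun j => ?_, fun j hj => ?_,
    fun j hj => ?_⟩
  · have := O.parity j
    rw [Int.even_iff] at *; omega
  · obtain ⟨h1, h2, h3, h4⟩ := O.one j hj
    refine ⟨by linarith, by linarith, by linarith, by linarith⟩
  · obtain ⟨h1, h2, h3⟩ := O.zero j hj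
    rw [abs_neg, abs_neg, neg_mul_neg, ← neg_add, abs_neg]
    exact ⟨h1, h2, h3⟩

lemma shift (O : EvenOrbit β D τ σ g h) (N : ℕ) :
    EvenOrbit β D (fun j => τ (N + j)) (fun j => σ (N + j)) (fun j => g (N + j))
      fun j => h (N + j) :=
  ⟨O.beta_pos, O.beta_lt, O.D_mul, ⟨fun _ => O.orbit.right _, fun _ => O.orbit.left _⟩,
    fun _ => O.zero_or_one _, fun _ => O.parity _, fun _ => O.one _, fun _ => O.zero _⟩

lemma D_pos (O : EvenOrbit β D τ σ g h) : 0 < D := by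
  have := O.D_mul; have := O.beta_pos; have := O.beta_lt
  by_contra hcon
  push Not at hcon
  nlinarith

lemma D_lt (O : EvenOrbit β D τ σ g h) : D < 102 / 1000 := by
  have := O.D_mul; have := O.beta_pos; have := O.beta_lt
  by_contra hcon
  push Not at hcon
  nlinarith

/-- `D g` is what a coordinate contributes beyond the adjacent label. The constant slightly exceeds
`√(2β) / (2 - β)` at the largest admissible `β`. -/
lemma abs_D_mul_lt (O : EvenOrbit β D τ σ g h) (j : ℕ) :
    (|D * g j| < 334 / 1000) ∧ |D * h j| < 334 / 1000 := by
  have h1 := O.D_mul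
  have h2 := O.beta_pos
  have h3 := O.beta_lt
  have h4 := O.D_pos
  have h5 := O.D_lt
  rcases O.zero_or_one j with hj | hj
  · obtain ⟨a, b, -⟩ := O.zero j hj
    rw [abs_mul, abs_mul, abs_of_pos h4]
    constructor <;> nlinarith
  · obtain ⟨-, -, a, b⟩ := O.one j hj
    have key : ∀ x : ℝ, (β * x) ^ 2 < 2 * β → |D * x| < 334 / 1000 := by
      intro x hx
      apply abs_lt_of_sq_lt_sq _ (by norm_num)
      have e : (β * x) ^ 2 = (D * x) ^ 2 * (2 - β) ^ 2 := by
        linear_combination (-(β + D * (2 - β)) * x ^ 2) * h1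
      have e2 : (3299 / 1000 : ℝ) ≤ (2 - β) ^ 2 := by nlinarith
      nlinarith [sq_nonneg (D * x)]
    exact ⟨key _ a, key _ b⟩

lemma right_near (O : EvenOrbit β D τ σ g h) (j : ℕ) :
    (σ j : ℝ) - 334 / 1000 < h j ∧ h j < σ j + 334 / 1000 := by
  have := abs_lt.1 (O.abs_D_mul_lt (j + 1)).2
  have := O.orbit.right j
  constructor <;> linarith

lemma left_near (O : EvenOrbit β D τ σ g h) (j : ℕ) :
    (σ j : ℝ) - 334 / 1000 < g (j + 1) ∧ g (j + 1) < σ j + 334 / 1000 := by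
  have := abs_lt.1 (O.abs_D_mul_lt j).1
  have := O.orbit.left j
  constructor <;> linarith

lemma abs_label_le_right (O : EvenOrbit β D τ σ g h) {j : ℕ} (hj : τ j = 0) :
    -1 ≤ σ j ∧ σ j ≤ 1 := by
  have h1 := abs_lt.1 (O.zero j hj).2.1
  have h2 := O.right_near j
  have a : (σ j : ℝ) < 2 := by linarith
  have b : (-2 : ℝ) < σ j := by linarith
  have a' : σ j < 2 := by exact_mod_cast a
  have b' : -2 < σ j := by exact_mod_cast b
  omega

lemma abs_label_le_left (O : EvenOrbit β D τ σ g h) {j : ℕ} (hj : τ (j + 1) = 0) :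
    -1 ≤ σ j ∧ σ j ≤ 1 := by
  have h1 := abs_lt.1 (O.zero _ hj).1
  have h2 := O.left_near j
  have a : (σ j : ℝ) < 2 := by linarith
  have b : (-2 : ℝ) < σ j := by linarith
  have a' : σ j < 2 := by exact_mod_cast a
  have b' : -2 < σ j := by exact_mod_cast b
  omega

/-- The two coordinates at the vertex differ by less than `2.33` and each is within `0.334` of its
label; `2.33 + 0.668 < 3`. -/
lemma label_diff (O : EvenOrbit β D τ σ g h) {j : ℕ} (hj : τ (j + 1) = 1) :
    σ (j + 1) - σ j ≤ 2 ∧ σ j - σ (j + 1) ≤ 2 := by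
  obtain ⟨h1, h2, h3, h4⟩ := O.one _ hj
  have hb := O.beta_pos
  have hb' := O.beta_lt
  have r := O.right_near (j + 1)
  have l := O.left_near j
  have key : |h (j + 1) - g (j + 1)| < 233 / 100 := by
    have hbg : |β * g (j + 1)| < 606 / 1000 :=
      abs_lt_of_sq_lt_sq (by linarith) (by norm_num)
    have hbh : |β * h (j + 1)| < 606 / 1000 :=
      abs_lt_of_sq_lt_sq (by linarith) (by norm_num)
    have a1 := abs_lt.1 hbg
    have a2 := abs_lt.1 hbh
    rw [abs_lt]
    rcases le_total 0 (g (j + 1)) with p | p <;> rcases le_total 0 (h (j + 1)) with q | q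
    · have := mul_nonneg hb.le (mul_nonneg p q)
      constructor <;> linarith
    · have := add_lt_of_product_lt (p := g (j + 1)) (q := -h (j + 1)) hb hb' (by linarith) (by linarith)
        (by linarith)
      constructor <;> linarith
    · have := add_lt_of_product_lt (p := -g (j + 1)) (q := h (j + 1)) hb hb' (by linarith) (by linarith)
        (by linarith)
      constructor <;> linarith
    · have := mul_nonneg_of_nonpos_of_nonpos p q
      have := mul_nonneg hb.le this
      constructor <;> linarith
  have k := abs_lt.1 key
  have a : ((σ (j + 1) - σ j : ℤ) : ℝ) < 3 := by push_cast; linarith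
  have b : ((σ j - σ (j + 1) : ℤ) : ℝ) < 3 := by push_cast; linarith
  have a' : σ (j + 1) - σ j < 3 := by exact_mod_cast a
  have b' : σ j - σ (j + 1) < 3 := by exact_mod_cast b
  omega

end EvenOrbit

/-! ### Classification of the orbits above the limit point, `b` even -/

lemma IsOrbit.right_of_zeros {D : ℝ} {σ : ℕ → ℤ} {g h : ℕ → ℝ} (O : IsOrbit D σ g h) {m k : ℕ}
    (hz : ∀ i < k, σ (m + i) = 0) : h m = D ^ k * h (m + k) := by
  induction k with
  | zero => simp
  | succ k ih =>
    rw [ih fun i hi => hz i (by omega), O.right (m + k), hz k (by omega)]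
    push_cast; rw [add_assoc m k 1]; ring

lemma IsOrbit.left_of_zeros {D : ℝ} {σ : ℕ → ℤ} {g h : ℕ → ℝ} (O : IsOrbit D σ g h) {m k : ℕ}
    (hz : ∀ i < k, σ (m + i) = 0) : g (m + k) = D ^ k * g m := by
  induction k with
  | zero => simp
  | succ k ih =>
    rw [← add_assoc, O.left, ih fun i hi => hz i (by omega), hz k (by omega)]
    push_cast; ring

/-- Zero labels for ever would give `h m = D ^ k * h (m + k)` for all `k`, with the last factor
bounded, hence `h m = 0`. -/
lemma IsOrbit.exists_next {D C : ℝ} {σ : ℕ → ℤ} {g h : ℕ → ℝ} (O : IsOrbit D σ g h)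
    (h0 : 0 < D) (h1 : D < 1) (hC : ∀ j, |D * h j| ≤ C) {m : ℕ} (hm : h m ≠ 0) :
    ∃ k, (∀ i < k, σ (m + i) = 0) ∧ σ (m + k) ≠ 0 := by
  have hex : ∃ k, σ (m + k) ≠ 0 := by
    by_contra hcon
    push Not at hcon
    have h2 : Tendsto (fun k : ℕ => D ^ k * C) atTop (𝓝 0) := by
      simpa using (tendsto_pow_atTop_nhds_zero_of_lt_one h0.le h1).mul_const C
    have h3 : 0 < |D * h m| := abs_pos.2 (mul_ne_zero h0.ne' hm)
    obtain ⟨k, hk⟩ := (h2.eventually (gt_mem_nhds h3)).exists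
    have e := O.right_of_zeros (m := m) (k := k) fun i _ => hcon i
    have : |D * h m| = D ^ k * |D * h (m + k)| := by
      rw [e, show D * (D ^ k * h (m + k)) = D ^ k * (D * h (m + k)) by ring, abs_mul,
        abs_of_pos (pow_pos h0 k)]
    have := mul_le_mul_of_nonneg_left (hC (m + k)) (pow_pos h0 k).le
    linarith
  classical
  exact ⟨Nat.find hex, fun i hi => not_not.1 (Nat.find_min hex hi), Nat.find_spec hex⟩

/-- The hypotheses read `D y < x F` and `D x < y G` with `F, G ≥ 0.6` much larger than `D`. If `y ≤
0` then `x < 0`, and each of `|x|`, `|y|` would be a small multiple of the other; once `y > 0`, the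
first inequality gives `x > 0`. -/
lemma pos_of_coupled {β D x y : ℝ} (h0 : 0 < β) (h1 : β < 1836 / 10000) (hD : 0 < D)
    (hD' : D < 102 / 1000) (hx : |D * x| < 334 / 1000) (hy : |D * y| < 334 / 1000)
    (hxy : D * y + β * x * (2 + D * (D * y)) < x) (hyx : D * x + β * y * (2 + D * (D * x)) < y) :
    0 < x ∧ 0 < y := by
  have key : ∀ z : ℝ, |D * z| < 334 / 1000 → 6 / 10 ≤ 1 - β * (2 + D * (D * z)) := by
    intro z hz
    have := abs_lt.1 hz
    have : D * (D * z) < 1 / 10 := by nlinarith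
    nlinarith
  have f1 := key y hy
  have f2 := key x hx
  have e1 : D * y < x * (1 - β * (2 + D * (D * y))) := by linarith
  have e2 : D * x < y * (1 - β * (2 + D * (D * x))) := by linarith
  set F := 1 - β * (2 + D * (D * y))
  set G := 1 - β * (2 + D * (D * x))
  have hypos : 0 < y := by
    by_contra hcon
    push Not at hcon
    have hx0 : x < 0 := by
      by_contra hc
      push Not at hc
      nlinarith
    nlinarith
  refine ⟨?_, hypos⟩
  by_contra hcon
  push Not at hcon
  nlinarith [mul_pos hD hypos]

namespace EvenOrbit

variable {β D : ℝ} {τ σ : ℕ → ℤ} {g h : ℕ → ℝ}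

lemma exists_next (O : EvenOrbit β D τ σ g h) {m : ℕ} (hm : h m ≠ 0) :
    ∃ k, (∀ i < k, σ (m + i) = 0) ∧ σ (m + k) ≠ 0 :=
  O.orbit.exists_next O.D_pos (by linarith [O.D_lt]) (fun j => (O.abs_D_mul_lt j).2.le) hm

/-- The balance inequality makes `g + h` small, so the two labels have a sum of absolute value less
than `2`. The sum is even unless just one neighbouring vertex has label `0`; then one coordinate is
below `D` and the other above `0.666`, which balance forbids. -/
lemma label_zero_vertex (O : EvenOrbit β D τ σ g h) {j : ℕ} (hj : τ (j + 1) = 0) :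
    σ (j + 1) = -σ j := by
  have hb := O.beta_pos
  have hb' := O.beta_lt
  have hD := O.D_pos
  have hD' := O.D_lt
  obtain ⟨z1, z2, z3⟩ := O.zero _ hj
  have a1 := abs_lt.1 z1
  have a2 := abs_lt.1 z2
  have l1 := O.abs_label_le_left hj
  have l2 := O.abs_label_le_right hj
  have p1 := O.parity j
  have p2 := O.parity (j + 1)
  have r := O.right_near (j + 1)
  have l := O.left_near j
  rw [hj] at p1 p2
  rw [Int.even_iff] at p1 p2
  have hgh : g (j + 1) * h (j + 1) < 1 := by nlinarith
  have hs : |g (j + 1) + h (j + 1)| < 45 / 100 := by nlinarith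
  have b := abs_lt.1 hs
  have c1 : ((σ j + σ (j + 1) : ℤ) : ℝ) < 2 := by push_cast; linarith
  have c2 : (-2 : ℝ) < ((σ j + σ (j + 1) : ℤ) : ℝ) := by push_cast; linarith
  have c1' : σ j + σ (j + 1) < 2 := by exact_mod_cast c1
  have c2' : -2 < σ j + σ (j + 1) := by exact_mod_cast c2
  have step : ∀ x y : ℝ, (|x| < 102 / 1000) → 666 / 1000 < |y| → |y| < 1 →
      (1 - β) * |y + x| < β * (1 + y * x) → False := by
    intro x y hx hy hy' hxy
    have hyx : y * x < 102 / 1000 := by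
      calc y * x ≤ |y * x| := le_abs_self _
        _ = |y| * |x| := abs_mul _ _
        _ < _ := by nlinarith [abs_nonneg x]
    have : |y| - |x| ≤ |y + x| := by
      have := abs_sub_abs_le_abs_sub y (-x)
      rwa [abs_neg, sub_neg_eq_add] at this
    nlinarith
  rcases O.zero_or_one j with t1 | t1
  · have s1 : σ j = 0 := by omega
    rcases O.zero_or_one (j + 1 + 1) with t2 | t2
    · omega
    · exfalso
      have hx : |g (j + 1)| < 102 / 1000 := by
        rw [O.orbit.left j, s1]; push_cast
        rw [zero_add, abs_mul, abs_of_pos hD]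
        have := (O.zero j t1).1
        nlinarith [abs_nonneg (g j)]
      refine step _ _ hx ?_ z2 (by rwa [add_comm (h (j + 1)), mul_comm (h (j + 1))])
      have : σ (j + 1) = 1 ∨ σ (j + 1) = -1 := by omega
      rcases this with e | e <;> rw [e] at r <;> push_cast at r <;> rw [lt_abs]
      · left; linarith
      · right; linarith
  · rcases O.zero_or_one (j + 1 + 1) with t2 | t2
    · exfalso
      have s1 : σ (j + 1) = 0 := by omega
      have hx : |h (j + 1)| < 102 / 1000 := by
        rw [O.orbit.right (j + 1), s1]; push_cast
        rw [zero_add, abs_mul, abs_of_pos hD]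
        have := (O.zero _ t2).2.1
        nlinarith [abs_nonneg (h (j + 1 + 1))]
      refine step _ _ hx ?_ z1 z3
      have : σ j = 1 ∨ σ j = -1 := by omega
      rcases this with e | e <;> rw [e] at l <;> push_cast at l <;> rw [lt_abs]
      · left; linarith
      · right; linarith
    · omega

/-- Between two label-`0` vertices the edge label is even and at most `1` in size, hence `0`. By
`label_zero_vertex` the next edge is `0` too, and parity passes the vertex label `0` on. -/
lemma zero_of_zero_zero (O : EvenOrbit β D τ σ g h) {j : ℕ} (h0 : τ j = 0) (h1 : τ (j + 1) = 0)
    (i : ℕ) : τ (j + i) = 0 ∧ τ (j + i + 1) = 0 ∧ σ (j + i) = 0 := by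
  induction i with
  | zero =>
    have p := O.parity j
    have l := O.abs_label_le_right h0
    rw [h0, h1, Int.even_iff] at p
    exact ⟨h0, h1, by simp only [add_zero]; omega⟩
  | succ i ih =>
    obtain ⟨a, b, c⟩ := ih
    have e := O.label_zero_vertex b
    have p := O.parity (j + i + 1)
    rw [e, c, b, Int.even_iff] at p
    have := O.zero_or_one (j + i + 1 + 1)
    refine ⟨b, ?_, ?_⟩
    · show τ (j + i + 1 + 1) = 0
      omega
    · show σ (j + i + 1) = 0
      omega

/-- The two sides of a vertex with label `0` that is entered by an edge with label `1`. -/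
lemma zero_vertex (O : EvenOrbit β D τ σ g h) {v : ℕ} (hv : τ (v + 1) = 0) (hs : σ v = 1) :
    σ (v + 1) = -1 ∧ g v < 0 ∧ 0 < h (v + 2) ∧ (1 - 2 * β) * h (v + 2) < -g v ∧
      (1 - 2 * β) * (-g v) < h (v + 2) := by
  have hD := O.D_pos
  have hb := O.beta_pos
  have hb' := O.beta_lt
  have e := O.label_zero_vertex hv
  rw [hs] at e
  obtain ⟨z1, z2, z3⟩ := O.zero _ hv
  rw [O.orbit.left v, hs] at z1
  rw [O.orbit.right (v + 1), e] at z2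
  rw [O.orbit.left v, O.orbit.right (v + 1), hs, e] at z3
  push_cast at z1 z2 z3
  have a1 := abs_lt.1 z1
  have a2 := abs_lt.1 z2
  have hg : g v < 0 := by
    by_contra hc
    push Not at hc
    nlinarith
  have hh : 0 < h (v + 2) := by
    by_contra hc
    push Not at hc
    nlinarith [show h (v + 1 + 1) = h (v + 2) from rfl]
  have hprod := mul_pos (neg_pos.2 hg) hh
  rw [show v + 1 + 1 = v + 2 from rfl] at z3
  -- The two coordinates are `1 + D g` and `-1 + D h`. The constants cancel in the balance
  -- inequality, and dividing by `D` leaves a comparison of `-g v` with `h (v + 2)`.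
  have e1 : (1 - β) * (g v + h (v + 2)) < β * (h (v + 2) - g v) := by
    have := (mul_le_mul_of_nonneg_left (le_abs_self
      (1 + D * g v + (-1 + D * h (v + 2)))) (show 0 ≤ 1 - β by linarith)).trans_lt z3
    apply lt_of_mul_lt_mul_left _ hD.le
    linarith [mul_pos hb (mul_pos (mul_pos hD hD) hprod)]
  have e2 : (1 - β) * (-(g v + h (v + 2))) < β * (h (v + 2) - g v) := by
    have := (mul_le_mul_of_nonneg_left (neg_le_abs
      (1 + D * g v + (-1 + D * h (v + 2)))) (show 0 ≤ 1 - β by linarith)).trans_lt z3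
    apply lt_of_mul_lt_mul_left _ hD.le
    linarith [mul_pos hb (mul_pos (mul_pos hD hD) hprod)]
  exact ⟨e, hg, hh, by linarith, by linarith⟩

lemma vertex_one_of_label (O : EvenOrbit β D τ σ g h) {j : ℕ} (hj : 2 ≤ σ j) :
    τ j = 1 ∧ τ (j + 1) = 1 := by
  have h1 := O.zero_or_one j
  have h2 := O.zero_or_one (j + 1)
  constructor
  · rcases h1 with h | h
    · have := O.abs_label_le_right h; omega
    · exact h
  · rcases h2 with h | h
    · have := O.abs_label_le_left h; omega
    · exact h

/-- Large labels are constant. -/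
lemma large_label (O : EvenOrbit β D τ σ g h) {j : ℕ} (hj : 4 ≤ σ (j + 1)) :
    σ (j + 2) = σ (j + 1) := by
  have hb := O.beta_pos
  have hb' := O.beta_lt
  have hD := O.D_pos
  have hm := O.D_mul
  have t1 := O.vertex_one_of_label (j := j + 1) (by omega)
  have d1 := O.label_diff t1.2
  have t2 := O.vertex_one_of_label (j := j + 2) (by show 2 ≤ σ (j + 1 + 1); omega)
  have d0 := O.label_diff t1.1
  have d2 := O.label_diff t2.2
  have p1 := O.parity (j + 1)
  have p2 := O.parity (j + 2)
  rw [t1.1, t1.2, Int.even_iff] at p1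
  rw [t2.1, t2.2, Int.even_iff] at p2
  have e1 : j + 1 + 1 = j + 2 := rfl
  have e2 : j + 2 + 1 = j + 3 := rfl
  rw [e1] at *
  rw [e2] at *
  obtain ⟨o1, o2, -, -⟩ := O.one _ t1.2
  have hg := O.orbit.left (j + 1)
  have hh := O.orbit.right (j + 2)
  have n1 := O.left_near (j + 1)
  have n2 := O.right_near (j + 2)
  have n3 := O.left_near j
  have n4 := O.right_near (j + 3)
  rw [e1] at *
  rw [e2] at *
  -- When the label changes by `±2` the constant terms of the vertex inequality cancel. What is left
  -- is `D (y - x) + β G H < 0`, which fails because `β = D (2 - β)` and `G H` is large.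
  have key : ∀ x y G H : ℝ, 166 / 100 ≤ G → 166 / 100 ≤ H → x - y < 27 / 10 →
      D * (y - x) + β * (G * H) < 0 → False := by
    intro x y G H hG hH hxy hlt
    have h1 : (27 / 10 : ℝ) ≤ G * H := by nlinarith
    have h2 : D * ((y - x) + (2 - β) * (G * H)) < 0 := by
      calc _ = D * (y - x) + β * (G * H) := by linear_combination (G * H) * hm
        _ < 0 := hlt
    have h3 : 0 < (y - x) + (2 - β) * (G * H) := by nlinarith
    nlinarith
  have cs1 : (4 : ℝ) ≤ σ (j + 1) := by exact_mod_cast hj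
  have cs2 : (2 : ℝ) ≤ σ (j + 2) := by
    have : 2 ≤ σ (j + 2) := by omega
    exact_mod_cast this
  have cd0 : (σ j : ℝ) ≤ σ (j + 1) + 2 := by
    have : σ j ≤ σ (j + 1) + 2 := by omega
    exact_mod_cast this
  have cd0' : (σ (j + 1) : ℝ) ≤ σ j + 2 := by
    have : σ (j + 1) ≤ σ j + 2 := by omega
    exact_mod_cast this
  have cd2 : (σ (j + 2) : ℝ) ≤ σ (j + 3) + 2 := by
    have : σ (j + 2) ≤ σ (j + 3) + 2 := by omega
    exact_mod_cast this
  have cd2' : (σ (j + 3) : ℝ) ≤ σ (j + 2) + 2 := by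
    have : σ (j + 3) ≤ σ (j + 2) + 2 := by omega
    exact_mod_cast this
  have : σ (j + 2) = σ (j + 1) + 2 ∨ σ (j + 2) = σ (j + 1) - 2 ∨ σ (j + 2) = σ (j + 1) := by
    omega
  rcases this with e | e | e
  · exfalso
    have ce : (σ (j + 2) : ℝ) = σ (j + 1) + 2 := by rw [e]; push_cast; ring
    exact key (g (j + 1)) (h (j + 3)) (g (j + 2)) (h (j + 2)) (by linarith) (by linarith)
      (by linarith) (by linarith)
  · exfalso
    have ce : (σ (j + 2) : ℝ) = σ (j + 1) - 2 := by rw [e]; push_cast; ring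
    exact key (h (j + 3)) (g (j + 1)) (g (j + 2)) (h (j + 2)) (by linarith) (by linarith)
      (by linarith) (by linarith)
  · exact e

lemma eq_of_large (O : EvenOrbit β D τ σ g h) {j : ℕ} (hj : 4 ≤ σ (j + 1)) (i : ℕ) :
    τ (j + 1 + i) = 1 ∧ σ (j + 1 + i) = σ (j + 1) := by
  induction i with
  | zero => exact ⟨(O.vertex_one_of_label (j := j + 1) (by omega)).1, rfl⟩
  | succ i ih =>
    have e : 4 ≤ σ (j + i + 1) := by
      rw [show j + i + 1 = j + 1 + i by ring, ih.2]; exact hj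
    have := O.large_label e
    rw [show j + i + 1 = j + 1 + i by ring, ih.2] at this
    refine ⟨(O.vertex_one_of_label (j := j + 1 + (i + 1)) ?_).1, ?_⟩ <;>
      rw [show j + 1 + (i + 1) = j + i + 2 by ring, this]
    omega

/-- The two sides of an edge with label `2` preceded by an edge with label `0`. -/
lemma two_edge (O : EvenOrbit β D τ σ g h) (hs : ∀ j, |σ j| ≤ 2) {j : ℕ} (h0 : σ j = 0)
    (h2 : σ (j + 1) = 2) : 0 < g j ∧ (σ (j + 2) = 0 ∨ σ (j + 2) = 2) ∧
      h (j + 2) + β * g j * (2 + D * h (j + 2)) < g j ∧ (σ (j + 2) = 0 → 0 < h (j + 3) ∧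
        D * h (j + 3) + β * g j * (2 + D * (D * h (j + 3))) < g j ∧
        D * g j + β * h (j + 3) * (2 + D * (D * g j)) < h (j + 3)) := by
  have hb := O.beta_pos
  have hb' := O.beta_lt
  have hD := O.D_pos
  have hD' := O.D_lt
  obtain ⟨t1, t2⟩ := O.vertex_one_of_label h2.ge
  have d := O.label_diff t2
  have hs2 := abs_le.1 (hs (j + 2))
  obtain ⟨o1, -, -, -⟩ := O.one _ t1
  obtain ⟨-, o2, -, -⟩ := O.one _ t2
  have l0 := O.orbit.left j
  have l1 := O.orbit.left (j + 1)
  have r1 := O.orbit.right (j + 1)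
  have r2 := O.orbit.right (j + 2)
  have n2 := O.right_near (j + 2)
  have n1 := O.left_near (j + 1)
  have e1 : j + 1 + 1 = j + 2 := rfl
  have e2 : j + 2 + 1 = j + 3 := rfl
  rw [e1] at *
  rw [e2] at *
  rw [h0] at l0
  rw [h2] at l1 r1 n1 d
  push_cast at l0 l1 r1 n1
  rw [zero_add] at l0
  -- This is the inequality at the left end of the edge with label `2`: the `2` cancels against the
  -- bound and a factor `D` comes out.
  have i1 : h (j + 2) + β * g j * (2 + D * h (j + 2)) < g j := by
    apply lt_of_mul_lt_mul_left _ hD.le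
    rw [l0, r1] at o1
    linarith
  have bd := O.abs_D_mul_lt
  have f1 : 1 / 2 ≤ 1 - β * (2 + D * h (j + 2)) := by
    have := abs_lt.1 (bd (j + 2)).2
    nlinarith
  have hcase : σ (j + 2) = 0 ∨ σ (j + 2) = 2 := by
    have p := O.parity (j + 2)
    rw [t2, Int.even_iff] at p
    rcases O.zero_or_one (j + 2 + 1) with t | t
    · have h1 : σ (j + 2) = 1 := by omega
      have := (O.zero_vertex t h1).2.1
      linarith
    · omega
  have hnext : σ (j + 2) = 0 → 0 < g j ∧ 0 < h (j + 3) ∧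
        D * h (j + 3) + β * g j * (2 + D * (D * h (j + 3))) < g j ∧
        D * g j + β * h (j + 3) * (2 + D * (D * g j)) < h (j + 3) := by
    intro hz
    rw [hz] at r2
    push_cast at r2
    rw [zero_add] at r2
    have i2 : D * g j + β * h (j + 3) * (2 + D * (D * g j)) < h (j + 3) := by
      apply lt_of_mul_lt_mul_left _ hD.le
      rw [l1, l0, r2] at o2
      linarith
    have i1' := i1
    rw [r2] at i1'
    have := pos_of_coupled hb hb' hD hD' (bd j).1 (bd (j + 3)).2 i1' i2
    exact ⟨this.1, this.2, i1', i2⟩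
  refine ⟨?_, hcase, i1, fun hz => (hnext hz).2⟩
  rcases hcase with hz | hz
  · exact (hnext hz).1
  · rw [hz] at n2
    push_cast at n2
    by_contra hcon
    push Not at hcon
    nlinarith

/-- After `0, 2` a second `2` would force `g (j + 2)` above `1.66`, so the label before the `0` is
also `2`. Then both sides of the inequality begin with `2`; cancelling these leaves an inequality of
order `D` violated by the term `(2 - β) g (2 + D h)`. -/
lemma two_edge_isolated (O : EvenOrbit β D τ σ g h) (hs : ∀ j, |σ j| ≤ 2) {j : ℕ}
    (h0 : σ (j + 2) = 0) (h2 : σ (j + 3) = 2) : σ (j + 4) = 0 := by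
  have hb := O.beta_pos
  have hb' := O.beta_lt
  have hD := O.D_pos
  have hm := O.D_mul
  obtain ⟨gpos, hc, i1, -⟩ := O.two_edge hs h0 h2
  rw [show j + 2 + 2 = j + 4 from rfl] at *
  rcases hc with hc | hc
  · exact hc
  exfalso
  have bd := fun j => abs_le.1 (hs j)
  have n0 := O.left_near j
  have n1 := O.left_near (j + 1)
  have n3 := O.right_near (j + 4)
  have n4 := O.right_near (j + 5)
  have l0 := O.orbit.left (j + 1)
  have r3 := O.orbit.right (j + 4)
  rw [show j + 1 + 1 = j + 2 from rfl] at *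
  rw [show j + 4 + 1 = j + 5 from rfl] at *
  rw [hc] at n3 r3
  push_cast at n3 r3
  have hpos : 0 < D * h (j + 4) := mul_pos hD (by linarith)
  have gt : h (j + 4) < g (j + 2) := by nlinarith [mul_pos hb gpos]
  have hσ : σ (j + 1) = 2 := by
    have h1 : (1 : ℝ) < σ (j + 1) := by linarith
    have h1' : 1 < σ (j + 1) := by exact_mod_cast h1
    have := bd (j + 1)
    omega
  rw [hσ] at l0
  push_cast at l0
  have b1 : (σ j : ℝ) ≤ 2 := by exact_mod_cast (bd j).2
  have b2 : (-2 : ℝ) ≤ σ (j + 5) := by exact_mod_cast (bd (j + 5)).1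
  have q : D * (h (j + 5) - g (j + 1) + (2 - β) * g (j + 2) * (2 + D * h (j + 4))) < 0 := by
    have : D * (h (j + 5) - g (j + 1) + (2 - β) * g (j + 2) * (2 + D * h (j + 4))) =
        D * h (j + 5) - D * g (j + 1) + β * g (j + 2) * (2 + D * h (j + 4)) := by
      linear_combination g (j + 2) * (2 + D * h (j + 4)) * hm
    rw [this]
    linarith
  have q2 : 0 < h (j + 5) - g (j + 1) + (2 - β) * g (j + 2) * (2 + D * h (j + 4)) := by
    have q3 : 3 ≤ (2 - β) * g (j + 2) := by nlinarith
    nlinarith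
  nlinarith

end EvenOrbit

/-- The code `(τ, σ)` eventually agrees with `(τ₀, σ₀)`. -/
def EventuallyCode (τ σ τ₀ σ₀ : ℕ → ℤ) : Prop :=
  ∃ N, ∀ j, τ (N + j) = τ₀ j ∧ σ (N + j) = σ₀ j

lemma EventuallyCode.of_shift {τ σ τ₀ σ₀ : ℕ → ℤ} {M : ℕ}
    (h : EventuallyCode (fun j => τ (M + j)) (fun j => σ (M + j)) τ₀ σ₀) :
    EventuallyCode τ σ τ₀ σ₀ := by
  obtain ⟨N, hN⟩ := h
  exact ⟨M + N, fun j => by rw [add_assoc]; exact hN j⟩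

lemma EventuallyCode.of_neg {τ σ τ₀ σ₀ : ℕ → ℤ}
    (h : EventuallyCode τ (fun j => -σ j) τ₀ σ₀) : EventuallyCode τ σ τ₀ fun j => -σ₀ j := by
  obtain ⟨N, hN⟩ := h
  exact ⟨N, fun j => ⟨(hN j).1, by simp [← (hN j).2]⟩⟩

/-- The label `a` at the multiples of `n`, and `0` elsewhere. -/
def spikeLabel (n : ℕ) (a : ℤ) (j : ℕ) : ℤ := if j % n = 0 then a else 0

/-- The labels `a, -a` at the beginning of each period `n`, and `0` elsewhere. -/
def pairLabel (n : ℕ) (a : ℤ) (j : ℕ) : ℤ :=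
  if j % n = 0 then a else if j % n = 1 then -a else 0

/-- The vertex label `0` once in each period `n`, and `1` elsewhere. -/
def gapVertex (n : ℕ) (j : ℕ) : ℤ := if j % n = 1 then 0 else 1

lemma neg_spikeLabel (n : ℕ) (a : ℤ) : (fun j => -spikeLabel n a j) = spikeLabel n (-a) := by
  funext j; unfold spikeLabel; split_ifs <;> simp

lemma neg_pairLabel (n : ℕ) (a : ℤ) : (fun j => -pairLabel n a j) = pairLabel n (-a) := by
  funext j; unfold pairLabel; split_ifs <;> simp

lemma periodic_step {Q : ℕ → Prop} {n m : ℕ} (h0 : Q m) (hs : ∀ i, Q (m + i) → Q (m + i + n))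
    (k : ℕ) : Q (m + n * k) := by
  induction k with
  | zero => exact h0
  | succ k ih => rw [mul_add, mul_one, ← add_assoc]; exact hs _ ih

/-- A gap `k' > k` would make the right side smaller by a factor `D`, leaving at best `H < G (1 -
2β)`. Since `G` and `H` are `2` up to `2.34 D` and `β` is nearly `2D`, this is false. Used in both
directions it makes consecutive gaps equal. -/
lemma gap_le_of_ratio {β D G H : ℝ} {k k' : ℕ} (hb : 0 < β) (hb' : β < 1836 / 10000)
    (hD : 0 < D) (hD' : D < 102 / 1000) (hm : D * (2 - β) = β) (hG : G < 2 + 234 / 100 * D)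
    (hG0 : 0 < G) (hH : 2 - 234 / 100 * D < H)
    (h : D * (D ^ k * H) + β * (D ^ k' * G) * (2 + D * (D * (D ^ k * H))) < D ^ k' * G) :
    k' ≤ k := by
  by_contra hcon
  push Not at hcon
  have hH0 : 0 < H := by linarith
  have e1 : D ^ k' * G ≤ D ^ (k + 1) * G :=
    mul_le_mul_of_nonneg_right (pow_le_pow_of_le_one hD.le (by linarith) hcon) hG0.le
  have e2 : 0 ≤ β * (D ^ k' * G) * (D * (D * (D ^ k * H))) := by positivity
  have e3 : D ^ (k + 1) * H < D ^ (k + 1) * (G * (1 - 2 * β)) := by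
    have : D ^ (k + 1) * H < D ^ k' * G * (1 - 2 * β) := by rw [pow_succ]; linarith
    have := mul_le_mul_of_nonneg_right e1 (show 0 ≤ 1 - 2 * β by linarith)
    linarith
  have e4 := lt_of_mul_lt_mul_left e3 (pow_pos hD _).le
  nlinarith

/-- One extra factor `D` on the right cannot be compensated by the constant `1 - 2β` and coordinates
`G, H` near `1`. -/
lemma gap_le_of_ratio' {β D G H : ℝ} {k k' : ℕ} (hb : 0 < β) (hb' : β < 1836 / 10000)
    (hD : 0 < D) (hD' : D < 102 / 1000) (hG : G < 1)
    (hG0 : 0 < G) (hH : 1 - D < H)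
    (h : (1 - 2 * β) * (D ^ k * H) < D ^ k' * G) : k' ≤ k := by
  by_contra hcon
  push Not at hcon
  have e1 : D ^ k' * G ≤ D ^ (k + 1) * G :=
    mul_le_mul_of_nonneg_right (pow_le_pow_of_le_one hD.le (by linarith) hcon) hG0.le
  have e3 : D ^ k * ((1 - 2 * β) * H) < D ^ k * (D * G) := by rw [pow_succ] at e1; linarith
  have e4 := lt_of_mul_lt_mul_left e3 (pow_pos hD _).le
  nlinarith

namespace EvenOrbit

variable {β D : ℝ} {τ σ : ℕ → ℤ} {g h : ℕ → ℝ}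

lemma tau_of_zeros (O : EvenOrbit β D τ σ g h) {m k : ℕ} (hm : τ m = 1)
    (hz : ∀ i < k, σ (m + i) = 0) : ∀ i ≤ k, τ (m + i) = 1 := by
  intro i hi
  induction i with
  | zero => exact hm
  | succ i ih =>
    have h1 := ih (by omega)
    have h2 := hz i (by omega)
    have p := O.parity (m + i)
    have := O.zero_or_one (m + i + 1)
    rw [h1, h2, Int.even_iff] at p
    show τ (m + i + 1) = 1
    omega

lemma label_pos (O : EvenOrbit β D τ σ g h) {m : ℕ} (h0 : σ m ≠ 0) (hm : 0 < h m) :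
    1 ≤ σ m := by
  have := O.right_near m
  have h1 : (-1 : ℝ) < σ m := by linarith
  have : -1 < σ m := by exact_mod_cast h1
  omega

/-- `two_edge` makes the right coordinate positive, so the next nonzero label is `1` or `2`. A label
`1` would enter a label-`0` vertex and need a negative left coordinate, whereas the preceding `2`
makes it positive. -/
lemma next_two (O : EvenOrbit β D τ σ g h) (hs : ∀ j, |σ j| ≤ 2) {j : ℕ}
    (h0 : σ (j + 2) = 0) (h2 : σ (j + 3) = 2) : σ (j + 4) = 0 ∧ ∃ k,
      (∀ i < k, σ (j + 5 + i) = 0) ∧ σ (j + 5 + k) = 2 ∧ h (j + 5) = D ^ k * h (j + 5 + k) := by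
  have h4 := O.two_edge_isolated hs h0 h2
  obtain ⟨-, -, -, hn⟩ := O.two_edge hs h0 h2
  obtain ⟨hpos, -, -⟩ := hn h4
  rw [show j + 2 + 3 = j + 5 from rfl] at hpos
  refine ⟨h4, ?_⟩
  obtain ⟨k, hz, hk⟩ := O.exists_next hpos.ne'
  have e := O.orbit.right_of_zeros hz
  refine ⟨k, hz, ?_, e⟩
  have hk1 := O.label_pos hk (by
    rw [e] at hpos; exact pos_of_mul_pos_right hpos (pow_pos O.D_pos k).le)
  have hk2 := abs_le.1 (hs (j + 5 + k))
  have t4 := (O.vertex_one_of_label h2.ge).2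
  have hz' : ∀ i < k + 1, σ (j + 4 + i) = 0 := by
    intro i hi
    rcases i with _ | i
    · exact h4
    · rw [show j + 4 + (i + 1) = j + 5 + i by ring]; exact hz i (by omega)
  have t5 : τ (j + 5 + k) = 1 := by
    have := O.tau_of_zeros t4 hz' (k + 1) le_rfl
    rwa [show j + 3 + 1 + (k + 1) = j + 5 + k by ring] at this
  have p := O.parity (j + 5 + k)
  rw [t5, Int.even_iff] at p
  rcases O.zero_or_one (j + 5 + k + 1) with t | t
  · exfalso
    have h1 : σ (j + 5 + k) = 1 := by omega
    have hneg := (O.zero_vertex t h1).2.1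
    have el := O.orbit.left_of_zeros hz'
    rw [show j + 4 + (k + 1) = j + 5 + k by ring] at el
    rw [el] at hneg
    have n := O.left_near (j + 3)
    rw [h2] at n
    push_cast at n
    have : 0 < D ^ (k + 1) * g (j + 4) := mul_pos (pow_pos O.D_pos _) (by
      rw [show j + 4 = j + 3 + 1 from rfl]; linarith)
    linarith
  · omega

lemma two_gap (O : EvenOrbit β D τ σ g h) (hs : ∀ j, |σ j| ≤ 2) {m k : ℕ}
    (h1 : σ (m + 1) = 2) (hz : ∀ i < k + 1, σ (m + 2 + i) = 0) (h2 : σ (m + k + 3) = 2) :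
    (∀ i < k + 1, σ (m + k + 4 + i) = 0) ∧ σ (m + k + 5 + k) = 2 := by
  have hb := O.beta_pos
  have hb' := O.beta_lt
  have hD := O.D_pos
  have hD' := O.D_lt
  have h0 : σ (m + k + 2) = 0 := by
    rw [show m + k + 2 = m + 2 + k by ring]; exact hz k (by omega)
  obtain ⟨h4, k', hz', hk', eh⟩ := O.next_two hs h0 h2
  obtain ⟨-, -, -, hn⟩ := O.two_edge hs h0 h2
  obtain ⟨-, i1, i2⟩ := hn h4
  rw [show m + k + 2 + 3 = m + k + 5 from rfl, eh] at i1 i2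
  have eg := O.orbit.left_of_zeros (m := m + 2) (k := k) fun i hi => hz i (by omega)
  rw [show m + 2 + k = m + k + 2 by ring] at eg
  rw [eg] at i1 i2
  have l := O.orbit.left (m + 1)
  have l' := O.left_near m
  have r := O.orbit.right (m + k + 5 + k')
  have r' := O.right_near (m + k + 5 + k' + 1)
  rw [h1] at l
  rw [hk'] at r
  push_cast at l r
  rw [show m + 1 + 1 = m + 2 from rfl] at l
  have c1 : (σ m : ℝ) ≤ 2 := by exact_mod_cast (abs_le.1 (hs m)).2
  have c2 : (-2 : ℝ) ≤ σ m := by exact_mod_cast (abs_le.1 (hs m)).1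
  have c3 : (σ (m + k + 5 + k' + 1) : ℝ) ≤ 2 := by
    exact_mod_cast (abs_le.1 (hs (m + k + 5 + k' + 1))).2
  have c4 : (-2 : ℝ) ≤ σ (m + k + 5 + k' + 1) := by
    exact_mod_cast (abs_le.1 (hs (m + k + 5 + k' + 1))).1
  have G1 : g (m + 2) < 2 + 234 / 100 * D := by nlinarith
  have G2 : 2 - 234 / 100 * D < g (m + 2) := by nlinarith
  have H1 : h (m + k + 5 + k') < 2 + 234 / 100 * D := by nlinarith
  have H2 : 2 - 234 / 100 * D < h (m + k + 5 + k') := by nlinarith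
  have u1 := gap_le_of_ratio hb hb' hD hD' O.D_mul G1 (by linarith) H2 i1
  have u2 := gap_le_of_ratio hb hb' hD hD' O.D_mul H1 (by linarith) G2 i2
  have ek : k' = k := le_antisymm u2 u1
  subst ek
  refine ⟨fun i hi => ?_, hk'⟩
  rcases i with _ | i
  · exact h4
  · rw [show m + k' + 4 + (i + 1) = m + k' + 5 + i by ring]; exact hz' i (by omega)

/-- The right coordinate is positive, so the next nonzero label is `1` or `2`. A `2` immediately
after `-1` is too large a jump, and a `2` after zeros needs a positive left coordinate, while the
label `-1` left a negative one. -/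
lemma next_zero_vertex (O : EvenOrbit β D τ σ g h) (hs : ∀ j, |σ j| ≤ 2)
    (h00 : ∀ j, τ j = 0 → τ (j + 1) = 1) {v : ℕ} (hv : τ (v + 1) = 0) (h1 : σ v = 1) : ∃ k,
      (∀ i < k, σ (v + 2 + i) = 0) ∧ (∀ i ≤ k, τ (v + 2 + i) = 1) ∧ σ (v + 2 + k) = 1 ∧
      τ (v + 2 + k + 1) = 0 ∧ h (v + 2) = D ^ k * h (v + 2 + k) := by
  obtain ⟨hs1, hg, hpos, -, -⟩ := O.zero_vertex hv h1
  obtain ⟨k, hz, hk⟩ := O.exists_next hpos.ne'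
  have e := O.orbit.right_of_zeros hz
  have ht := O.tau_of_zeros (h00 _ hv) hz
  have hk1 := O.label_pos hk (by
    rw [e] at hpos; exact pos_of_mul_pos_right hpos (pow_pos O.D_pos k).le)
  have hk2 := abs_le.1 (hs (v + 2 + k))
  have tk := ht k le_rfl
  rw [show v + 1 + 1 + k = v + 2 + k from rfl] at tk
  have p := O.parity (v + 2 + k)
  rw [tk, Int.even_iff] at p
  have ht1 := O.zero_or_one (v + 2 + k + 1)
  have key : σ (v + 2 + k) ≠ 2 := by
    intro h2
    rcases k with _ | k
    · have d := O.label_diff (j := v + 1) (by simpa using tk)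
      rw [hs1] at d
      simp only [add_zero] at h2
      rw [show v + 1 + 1 = v + 2 from rfl, h2] at d
      omega
    · have hp := (O.two_edge hs (hz k (by omega)) h2).1
      have el := O.orbit.left_of_zeros (m := v + 2) (k := k) fun i hi => hz i (by omega)
      have n := O.left_near (v + 1)
      rw [hs1] at n
      push_cast at n
      rw [show v + 1 + 1 = v + 2 from rfl] at n
      rw [el] at hp
      have := pos_of_mul_pos_right hp (pow_pos O.D_pos k).le
      linarith
  exact ⟨k, hz, ht, by omega, by omega, e⟩

/-- The inequalities at the middle vertex compare `D ^ k` times a number near `1` with `D ^ k'`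
times another, so the two gaps agree. -/
lemma zero_gap (O : EvenOrbit β D τ σ g h) (hs : ∀ j, |σ j| ≤ 2)
    (h00 : ∀ j, τ j = 0 → τ (j + 1) = 1) {v k : ℕ} (hv : τ (v + 1) = 0) (h1 : σ v = 1)
    (hz : ∀ i < k, σ (v + 2 + i) = 0) (h2 : σ (v + 2 + k) = 1) (hv2 : τ (v + 2 + k + 1) = 0) :
    (∀ i < k, σ (v + 2 + k + 2 + i) = 0) ∧ (∀ i ≤ k, τ (v + 2 + k + 2 + i) = 1) ∧
      σ (v + 2 + k + 2 + k) = 1 ∧ τ (v + 2 + k + 2 + k + 1) = 0 := by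
  have hb := O.beta_pos
  have hb' := O.beta_lt
  have hD := O.D_pos
  have hD' := O.D_lt
  obtain ⟨s1, g1, -, -, -⟩ := O.zero_vertex hv h1
  obtain ⟨-, -, -, i1, i2⟩ := O.zero_vertex hv2 h2
  obtain ⟨k', hz', ht', hk', hv', eh⟩ := O.next_zero_vertex hs h00 hv2 h2
  obtain ⟨s3, -, h3, -, -⟩ := O.zero_vertex hv' hk'
  have eg := O.orbit.left_of_zeros hz
  rw [eg, eh] at i1 i2
  have bd := O.abs_D_mul_lt
  have b1 := abs_lt.1 (bd v).1
  have b3 := abs_lt.1 (bd (v + 2 + k + 2 + k' + 2)).2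
  have l1 := O.orbit.left v
  have l2 := O.orbit.left (v + 1)
  have r1 := O.orbit.right (v + 2 + k + 2 + k')
  have r2 := O.orbit.right (v + 2 + k + 2 + k' + 1)
  rw [h1] at l1
  rw [s1] at l2
  rw [hk'] at r1
  rw [s3] at r2
  push_cast at l1 l2 r1 r2
  rw [show v + 1 + 1 = v + 2 from rfl] at l2
  rw [show v + 2 + k + 2 + k' + 1 + 1 = v + 2 + k + 2 + k' + 2 from rfl] at r2
  have q1 : D * g v < 0 := by nlinarith
  have q3 : 0 < D * h (v + 2 + k + 2 + k' + 2) := mul_pos hD h3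
  have G1 : -g (v + 2) < 1 := by nlinarith
  have G2 : 1 - D < -g (v + 2) := by nlinarith
  have H1 : h (v + 2 + k + 2 + k') < 1 := by nlinarith
  have H2 : 1 - D < h (v + 2 + k + 2 + k') := by nlinarith
  have u1 := gap_le_of_ratio' (k' := k) hb hb' hD hD' G1 (by linarith) H2 (by linarith)
  have u2 := gap_le_of_ratio' (k' := k') (k := k) hb hb' hD hD' H1 (by linarith) G2
    (by linarith)
  have ek : k' = k := le_antisymm u2 u1
  subst ek
  exact ⟨hz', ht', hk', hv'⟩

lemma eventuallyCode_pair (O : EvenOrbit β D τ σ g h) (hs : ∀ j, |σ j| ≤ 2)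
    (h00 : ∀ j, τ j = 0 → τ (j + 1) = 1) {v : ℕ} (hv : τ (v + 1) = 0) (h1 : σ v = 1) :
    ∃ k, EventuallyCode τ σ (gapVertex (k + 2)) (pairLabel (k + 2) 1) := by
  obtain ⟨k, hz, ht, h2, hv2, -⟩ := O.next_zero_vertex hs h00 hv h1
  refine ⟨k, v, fun j => ?_⟩
  have hQ := periodic_step (n := k + 2) (m := v)
    (Q := fun m => τ (m + 1) = 0 ∧ σ m = 1 ∧ (∀ i < k, σ (m + 2 + i) = 0) ∧
      (∀ i ≤ k, τ (m + 2 + i) = 1) ∧ σ (m + 2 + k) = 1 ∧ τ (m + 2 + k + 1) = 0)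
    ⟨hv, h1, hz, ht, h2, hv2⟩ (fun i ⟨a1, a2, a3, a4, a5, a6⟩ => by
      rw [show v + i + (k + 2) = v + i + 2 + k by ring]
      exact ⟨a6, a5, O.zero_gap hs h00 a1 a2 a3 a5 a6⟩)
  obtain ⟨b1, b2, b3, b4, b5, b6⟩ := hQ (j / (k + 2))
  have hj : v + j = v + (k + 2) * (j / (k + 2)) + j % (k + 2) := by
    rw [add_assoc, Nat.div_add_mod]
  have hlt := Nat.mod_lt j (show 0 < k + 2 by omega)
  have t0 : τ (v + (k + 2) * (j / (k + 2))) = 1 := by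
    have p := O.parity (v + (k + 2) * (j / (k + 2)))
    have := O.zero_or_one (v + (k + 2) * (j / (k + 2)))
    rw [b1, b2, Int.even_iff] at p
    omega
  have s1 := (O.zero_vertex b1 b2).1
  rw [hj]
  unfold gapVertex pairLabel
  generalize j % (k + 2) = r at *
  generalize v + (k + 2) * (j / (k + 2)) = m at *
  rcases r with _ | _ | r
  · simp [t0, b2]
  · simp [b1, s1]
  · have e : m + (r + 1 + 1) = m + 2 + r := by ring
    rw [e]
    simp [b3 r (by omega), b4 r (by omega)]

lemma eventuallyCode_spike (O : EvenOrbit β D τ σ g h) (hs : ∀ j, |σ j| ≤ 2)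
    (ht : ∀ j, τ (j + 1) = 1) {j : ℕ} (h0 : σ (j + 2) = 0) (h2 : σ (j + 3) = 2) :
    ∃ k, 1 ≤ k ∧ EventuallyCode τ σ (fun _ => 1) (spikeLabel (k + 1) 2) := by
  obtain ⟨h4, k, hz, hk, -⟩ := O.next_two hs h0 h2
  refine ⟨k + 1, by omega, j + 3, fun i => ?_⟩
  refine ⟨by rw [show j + 3 + i = j + 2 + i + 1 by ring]; exact ht _, ?_⟩
  have hQ := periodic_step (n := k + 1 + 1) (m := j + 3)
    (Q := fun m => σ m = 2 ∧ (∀ i < k + 1, σ (m + 1 + i) = 0) ∧ σ (m + k + 2) = 2)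
    ⟨h2, fun i hi => by
      rcases i with _ | i
      · exact h4
      · rw [show j + 3 + 1 + (i + 1) = j + 5 + i by ring]; exact hz i (by omega), by
      rw [show j + 3 + k + 2 = j + 5 + k by ring]; exact hk⟩
    (fun i ⟨a1, a2, a3⟩ => by
      rw [show j + 3 + i = j + 2 + i + 1 by ring] at *
      rw [show j + 2 + i + 1 + k + 2 = j + 2 + i + k + 3 by ring] at a3
      obtain ⟨c1, c2⟩ := O.two_gap hs a1 (fun i' hi' => a2 i' hi') a3
      rw [show j + 2 + i + 1 + (k + 1 + 1) = j + 2 + i + k + 3 by ring]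
      exact ⟨a3, c1, by rw [← c2]; congr 1; ring⟩)
  obtain ⟨b1, b2, -⟩ := hQ (i / (k + 1 + 1))
  have hi : j + 3 + i = j + 3 + (k + 1 + 1) * (i / (k + 1 + 1)) + i % (k + 1 + 1) := by
    rw [add_assoc (j + 3), Nat.div_add_mod]
  have hlt := Nat.mod_lt i (show 0 < k + 1 + 1 by omega)
  rw [hi]
  unfold spikeLabel
  generalize i % (k + 1 + 1) = r at *
  generalize j + 3 + (k + 1 + 1) * (i / (k + 1 + 1)) = m at *
  rcases r with _ | r
  · simp [b1]
  · rw [show m + (r + 1) = m + 1 + r by ring]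
    simp [b2 r (by omega)]

lemma classification_of_bounded (O : EvenOrbit β D τ σ g h) (h00 : ∀ j, τ j = 0 → τ (j + 1) = 1)
    (hs : ∀ j, |σ j| ≤ 2) : (∃ n, EventuallyCode τ σ (fun _ => 1) fun _ => n) ∨
      (∃ k a, 1 ≤ k ∧ (a = 2 ∨ a = -2) ∧
        EventuallyCode τ σ (fun _ => 1) (spikeLabel (k + 1) a)) ∨
      ∃ k a, (a = 1 ∨ a = -1) ∧
        EventuallyCode τ σ (gapVertex (k + 2)) (pairLabel (k + 2) a) := by
  have hs' : ∀ j, |-σ j| ≤ 2 := fun j => by rw [abs_neg]; exact hs j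
  by_cases cz : ∃ v, τ (v + 1) = 0
  · right; right
    obtain ⟨v, hv⟩ := cz
    have l := O.abs_label_le_left hv
    have p := O.parity v
    have t := O.zero_or_one v
    have t' := h00 v
    rw [hv, Int.even_iff] at p
    have : σ v = 1 ∨ σ v = -1 := by
      rcases t with t | t
      · have := t' t; omega
      · omega
    rcases this with e | e
    · obtain ⟨k, hk⟩ := O.eventuallyCode_pair hs h00 hv e
      exact ⟨k, 1, Or.inl rfl, hk⟩
    · obtain ⟨k, hk⟩ := O.neg.eventuallyCode_pair hs' h00 hv (by rw [e]; rfl)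
      have := hk.of_neg
      rw [neg_pairLabel] at this
      exact ⟨k, -1, Or.inr rfl, this⟩
  push Not at cz
  have ht : ∀ j, τ (j + 1) = 1 := fun j => (O.zero_or_one _).resolve_left (cz j)
  have hc : ∀ j, σ (j + 1) = 0 ∨ σ (j + 1) = 2 ∨ σ (j + 1) = -2 := by
    intro j
    have p := O.parity (j + 1)
    have := abs_le.1 (hs (j + 1))
    rw [ht, ht, Int.even_iff] at p
    omega
  by_cases cs : ∃ j, σ (j + 2) = 0 ∧ σ (j + 3) ≠ 0
  · right; left
    obtain ⟨j, h0, h3⟩ := cs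
    rcases (hc (j + 2)).resolve_left h3 with e | e
    · obtain ⟨k, hk1, hk⟩ := O.eventuallyCode_spike hs ht h0 e
      exact ⟨k, 2, hk1, Or.inl rfl, hk⟩
    · obtain ⟨k, hk1, hk⟩ := O.neg.eventuallyCode_spike hs' ht (j := j) (by rw [h0]; rfl)
        (by rw [show j + 3 = j + 2 + 1 from rfl, e]; rfl)
      have := hk.of_neg
      rw [neg_spikeLabel] at this
      exact ⟨k, -2, hk1, Or.inr rfl, this⟩
  push Not at cs
  left
  have const : ∀ m : ℕ, (∀ i, σ (m + 1 + i + 1) = σ (m + 1 + i)) →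
      ∃ n, EventuallyCode τ σ (fun _ => 1) fun _ => n := by
    intro m hm
    refine ⟨σ (m + 1), m + 1, fun i => ⟨?_, ?_⟩⟩
    · rw [show m + 1 + i = m + i + 1 by ring]; exact ht _
    · induction i with
      | zero => rfl
      | succ i ih => rw [← ih]; exact hm i
  by_cases cn : ∃ j, σ (j + 2) = 0
  · obtain ⟨j, hj⟩ := cn
    have hz : ∀ i, σ (j + 2 + i) = 0 := by
      intro i
      induction i with
      | zero => exact hj
      | succ i ih =>
        have := cs (j + i) (by rw [← ih]; congr 1; ring)
        rw [← this]; congr 1; ring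
    exact const (j + 1) fun i => by
      rw [show j + 1 + 1 + i = j + 2 + i by ring, hz i,
        show j + 2 + i + 1 = j + 2 + (i + 1) by ring, hz]
  -- All labels are now `±2`, and a change of sign would be a jump of `4`.
  · push Not at cn
    refine const 1 fun i => ?_
    rw [show 1 + 1 + i = i + 1 + 1 by ring]
    have d := O.label_diff (ht (i + 2))
    have c1 := (hc (i + 1)).resolve_left (cn i)
    have c2 := (hc (i + 2)).resolve_left (cn (i + 1))
    have e : i + 1 + 1 = i + 2 := rfl
    have e' : i + 2 + 1 = i + 3 := rfl
    rw [e] at *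
    rw [e'] at *
    omega

/-- The codes of orbits above the limit point, for even `b`. -/
theorem classification (O : EvenOrbit β D τ σ g h) :
    EventuallyCode τ σ (fun _ => 0) (fun _ => 0) ∨
    (∃ n, EventuallyCode τ σ (fun _ => 1) fun _ => n) ∨
    (∃ k a, 1 ≤ k ∧ (a = 2 ∨ a = -2) ∧ EventuallyCode τ σ (fun _ => 1) (spikeLabel (k + 1) a)) ∨
    ∃ k a, (a = 1 ∨ a = -1) ∧ EventuallyCode τ σ (gapVertex (k + 2)) (pairLabel (k + 2) a) := by
  by_cases c00 : ∃ j, τ j = 0 ∧ τ (j + 1) = 0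
  · obtain ⟨j, h0, h1⟩ := c00
    have := O.zero_of_zero_zero h0 h1
    exact Or.inl ⟨j, fun i => ⟨(this i).1, (this i).2.2⟩⟩
  by_cases cbig : ∃ j, 3 ≤ |σ (j + 1)|
  · right; left
    obtain ⟨j, hj⟩ := cbig
    have main : ∀ {σ' : ℕ → ℤ} {g' h' : ℕ → ℝ}, EvenOrbit β D τ σ' g' h' → 3 ≤ σ' (j + 1) →
        EventuallyCode τ σ' (fun _ => 1) fun _ => σ' (j + 1) := by
      intro σ' g' h' O' h3
      have t := O'.vertex_one_of_label (j := j + 1) (by omega)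
      have p := O'.parity (j + 1)
      rw [t.1, t.2, Int.even_iff] at p
      exact ⟨j + 1, O'.eq_of_large (by omega)⟩
    rcases le_abs.1 hj with h3 | h3
    · exact ⟨_, main O h3⟩
    · exact ⟨_, (main O.neg h3).of_neg⟩
  push Not at c00 cbig
  have M := (O.shift 1).classification_of_bounded (fun j hj => by
      have := c00 (1 + j) hj
      exact (O.zero_or_one _).resolve_left this) fun j => by
      have := cbig j
      rw [show j + 1 = 1 + j by ring] at this
      omega
  right
  rcases M with ⟨n, h⟩ | ⟨k, a, h1, h2, h⟩ | ⟨k, a, h2, h⟩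
  · exact Or.inl ⟨n, h.of_shift⟩
  · exact Or.inr (Or.inl ⟨k, a, h1, h2, h.of_shift⟩)
  · exact Or.inr (Or.inr ⟨k, a, h2, h.of_shift⟩)

end EvenOrbit

/-! ### Orbits above the limit point, `b` odd -/

/-- The constraints at the vertices of an orbit above the limit point, for odd `b`. -/
structure OddOrbit (β D : ℝ) (τ σ : ℕ → ℤ) (g h : ℕ → ℝ) : Prop where
  beta_pos : 0 < β
  beta_lt : β < 2255 / 10000
  D_mul : D * (2 - β) = β
  orbit : IsOrbit D σ g h
  zero_or_one : ∀ j, τ j = 0 ∨ τ j = 1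
  parity : ∀ j, Odd (σ j + τ j + τ (j + 1))
  one : ∀ j, τ j = 1 → h j - g j + β * (g j * h j) < 2 - β + β ^ 3 / 4 ∧
    g j - h j + β * (g j * h j) < 2 - β + β ^ 3 / 4 ∧
    (β * g j) ^ 2 < 2 * β ∧ (β * h j) ^ 2 < 2 * β
  zero : ∀ j, τ j = 0 → |g j| < β / 2 ∧ |h j| < β / 2 ∧
    (1 - β) * |g j + h j| < β * (β ^ 2 / 4 + g j * h j)

/-- The limit constant is now `(1 - β)² - β⁴/4`. At label `0` the balance lemma applies with `M =
β²/4`, which confines both coordinates to `|·| < β/2`; this is why edges at such vertices carry the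
label `0`. -/
lemma AboveOrbit.oddOrbit {b : ℕ} {β D : ℝ} {τ σ : ℕ → ℤ} {g h : ℕ → ℝ} (hb : Odd b)
    (h0 : 0 < β) (h1 : β < 2255 / 10000) (hD : D * (2 - β) = β)
    (A : AboveOrbit b β D ((1 - β) ^ 2 - β ^ 4 / 4) τ σ g h) : OddOrbit β D τ σ g h := by
  have p4 : β ^ 4 ≤ β ^ 2 / 16 := by
    have : β ^ 2 ≤ 1 / 16 := by nlinarith
    nlinarith [sq_nonneg β]
  have q1 : 1 - 2 * β ≤ (1 - β) ^ 2 - β ^ 4 / 4 := by nlinarith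
  have q2 : 4 * β * (1 - β) < ((1 - β) ^ 2 - β ^ 4 / 4) * (1 + β) := by
    have e1 : 0 < 1 - 5 * β + 3 * β ^ 2 := by nlinarith
    have e2 : β ^ 4 / 4 * (1 + β) ≤ β ^ 3 := by
      have : β ^ 3 * (β * (1 + β)) ≤ β ^ 3 * 1 :=
        mul_le_mul_of_nonneg_left (by nlinarith) (by positivity)
      linarith [pow_pos h0 3]
    linarith
  refine ⟨h0, h1, hD, A.orbit, A.coding.zero_or_one, fun j => ?_, fun j hj => ?_, fun j hj => ?_⟩
  · have := A.coding.parity j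
    have hb' : Odd (b : ℤ) := by exact_mod_cast hb
    rw [Int.even_iff] at this
    rw [Int.odd_iff] at *; omega
  · have a1 := A.one j hj
    have a2 := A.one' j hj
    have r1 := A.range_left j hj
    have r2 := A.range_right j hj
    have := sq_lt_of_products (β := β) (P := β * g j) (Q := β * h j)
      (abs_lt.2 ⟨r1.1, by linarith⟩) (abs_lt.2 ⟨r2.1, by linarith⟩) (by linarith) (by linarith)
    refine ⟨?_, ?_, this⟩
    · apply lt_of_mul_lt_mul_left _ h0.le; linarith
    · apply lt_of_mul_lt_mul_left _ h0.le; linarith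
  · have a1 := A.zero j hj
    have a2 := A.zero' j hj
    have r1 := A.range_left' j hj
    have r2 := A.range_right' j hj
    have hg := abs_lt_of_products (c := (1 - β) ^ 2 - β ^ 4 / 4) h0 (by linarith) q1 q2 r1 r2 a1 a2
    have hh := abs_lt_of_products (c := (1 - β) ^ 2 - β ^ 4 / 4) h0 (by linarith) q1 q2 r2 r1
      (by rwa [mul_comm (1 - β - β * h j)]) (by rwa [mul_comm (1 - β + β * h j)])
    have hg' := abs_lt.1 hg
    have hh' := abs_lt.1 hh
    rw [abs_of_pos (mul_pos (by linarith) (by linarith))] at a1 a2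
    have hbal : (1 - β) * |g j + h j| < β * (β ^ 2 / 4 + g j * h j) := by
      rcases abs_cases (g j + h j) with ⟨e, -⟩ | ⟨e, -⟩ <;> rw [e] <;>
        apply lt_of_mul_lt_mul_left _ h0.le <;> linarith
    have hM : 0 < β ^ 2 / 4 := by positivity
    have hM' : β ^ 2 / 4 ≤ 1 := by nlinarith
    have s1 := sq_lt_of_balance h0 (by linarith) hM hM' hg hbal
    have s2 := sq_lt_of_balance h0 (by linarith) hM hM' hh
      (by rwa [add_comm (h j), mul_comm (h j)])
    rw [show β ^ 2 / 4 = (β / 2) ^ 2 by ring] at s1 s2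
    exact ⟨abs_lt_of_sq_lt_sq s1 (by linarith), abs_lt_of_sq_lt_sq s2 (by linarith), hbal⟩

/-- The same use of `pq ≤ (p + q)² / 4` as for even `b`, with `0.672 > √(2β)` and the stronger
right-hand side. -/
lemma add_lt_of_product_lt' {β p q : ℝ} (hβ : 0 < β) (hβ' : β < 2255 / 10000)
    (hp' : β * p < 672 / 1000) (hq' : β * q < 672 / 1000)
    (h : p + q - β * (p * q) < 2 - β + β ^ 3 / 4) : p + q < 21 / 10 := by
  by_contra hcon
  push Not at hcon
  have e1 : β * (p * q) ≤ β * ((p + q) ^ 2 / 4) :=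
    mul_le_mul_of_nonneg_left (by linarith [sq_nonneg (p - q)]) hβ.le
  have e2 : 0 ≤ (p + q - 21 / 10) * (1344 / 1000 - β * (p + q)) :=
    mul_nonneg (by linarith) (by linarith)
  have e3 : 0 ≤ (p + q - 21 / 10) * (664 / 1000 - 525 / 1000 * β) :=
    mul_nonneg (by linarith) (by linarith)
  have e4 : β ^ 3 ≤ 1 / 16 * β := by nlinarith [sq_nonneg β]
  have e5 : β * ((p + q) ^ 2 / 4) = (1344 / 1000 * (p + q) - 21 / 10 * (1344 / 1000)
      + 21 / 10 * (β * (p + q)) - (p + q - 21 / 10) * (1344 / 1000 - β * (p + q))) / 4 := by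
    ring
  nlinarith

namespace OddOrbit

variable {β D : ℝ} {τ σ : ℕ → ℤ} {g h : ℕ → ℝ}

lemma neg (O : OddOrbit β D τ σ g h) :
    OddOrbit β D τ (fun j => -σ j) (fun j => -g j) fun j => -h j := by
  refine ⟨O.beta_pos, O.beta_lt, O.D_mul, O.orbit.neg, O.zero_or_one, fun j => ?_, fun j hj => ?_,
    fun j hj => ?_⟩
  · have := O.parity j
    rw [Int.odd_iff] at *; omega
  · obtain ⟨h1, h2, h3, h4⟩ := O.one j hj
    refine ⟨by linarith, by linarith, by linarith, by linarith⟩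
  · obtain ⟨h1, h2, h3⟩ := O.zero j hj
    rw [abs_neg, abs_neg, neg_mul_neg, ← neg_add, abs_neg]
    exact ⟨h1, h2, h3⟩

lemma D_pos (O : OddOrbit β D τ σ g h) : 0 < D := by
  have := O.D_mul; have := O.beta_pos; have := O.beta_lt
  by_contra hcon
  push Not at hcon
  nlinarith

lemma D_lt (O : OddOrbit β D τ σ g h) : D < 128 / 1000 := by
  have := O.D_mul; have := O.beta_pos; have := O.beta_lt
  by_contra hcon
  push Not at hcon
  nlinarith

lemma abs_D_mul_lt (O : OddOrbit β D τ σ g h) (j : ℕ) :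
    (|D * g j| < 379 / 1000) ∧ |D * h j| < 379 / 1000 := by
  have h1 := O.D_mul
  have h2 := O.beta_pos
  have h3 := O.beta_lt
  have h4 := O.D_pos
  have h5 := O.D_lt
  rcases O.zero_or_one j with hj | hj
  · obtain ⟨a, b, -⟩ := O.zero j hj
    rw [abs_mul, abs_mul, abs_of_pos h4]
    constructor <;> nlinarith
  · obtain ⟨-, -, a, b⟩ := O.one j hj
    have key : ∀ x : ℝ, (β * x) ^ 2 < 2 * β → |D * x| < 379 / 1000 := by
      intro x hx
      apply abs_lt_of_sq_lt_sq _ (by norm_num)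
      have e : (β * x) ^ 2 = (D * x) ^ 2 * (2 - β) ^ 2 := by
        linear_combination (-(β + D * (2 - β)) * x ^ 2) * h1
      have e2 : (3148 / 1000 : ℝ) ≤ (2 - β) ^ 2 := by nlinarith
      nlinarith [sq_nonneg (D * x)]
    exact ⟨key _ a, key _ b⟩

lemma right_near (O : OddOrbit β D τ σ g h) (j : ℕ) :
    (σ j : ℝ) - 379 / 1000 < h j ∧ h j < σ j + 379 / 1000 := by
  have := abs_lt.1 (O.abs_D_mul_lt (j + 1)).2
  have := O.orbit.right j
  constructor <;> linarith

lemma left_near (O : OddOrbit β D τ σ g h) (j : ℕ) :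
    (σ j : ℝ) - 379 / 1000 < g (j + 1) ∧ g (j + 1) < σ j + 379 / 1000 := by
  have := abs_lt.1 (O.abs_D_mul_lt j).1
  have := O.orbit.left j
  constructor <;> linarith

lemma label_zero_right (O : OddOrbit β D τ σ g h) {j : ℕ} (hj : τ j = 0) : σ j = 0 := by
  have h1 := abs_lt.1 (O.zero j hj).2.1
  have h2 := O.right_near j
  have := O.beta_lt
  have a : (σ j : ℝ) < 1 := by linarith
  have b : (-1 : ℝ) < σ j := by linarith
  have a' : σ j < 1 := by exact_mod_cast a
  have b' : -1 < σ j := by exact_mod_cast b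
  omega

lemma label_zero_left (O : OddOrbit β D τ σ g h) {j : ℕ} (hj : τ (j + 1) = 0) : σ j = 0 := by
  have h1 := abs_lt.1 (O.zero _ hj).1
  have h2 := O.left_near j
  have := O.beta_lt
  have a : (σ j : ℝ) < 1 := by linarith
  have b : (-1 : ℝ) < σ j := by linarith
  have a' : σ j < 1 := by exact_mod_cast a
  have b' : -1 < σ j := by exact_mod_cast b
  omega

lemma vertex_one_of_label (O : OddOrbit β D τ σ g h) {j : ℕ} (hj : σ j ≠ 0) :
    τ j = 1 ∧ τ (j + 1) = 1 :=
  ⟨(O.zero_or_one j).resolve_left fun t => hj (O.label_zero_right t),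
    (O.zero_or_one _).resolve_left fun t => hj (O.label_zero_left t)⟩

/-- Here `2.1 + 2 · 0.379 < 3`. -/
lemma label_diff (O : OddOrbit β D τ σ g h) {j : ℕ} (hj : τ (j + 1) = 1) :
    σ (j + 1) - σ j ≤ 2 ∧ σ j - σ (j + 1) ≤ 2 := by
  obtain ⟨h1, h2, h3, h4⟩ := O.one _ hj
  have hb := O.beta_pos
  have hb' := O.beta_lt
  have r := O.right_near (j + 1)
  have l := O.left_near j
  have hb3 : β ^ 3 ≤ β := by nlinarith [sq_nonneg β]
  have key : |h (j + 1) - g (j + 1)| < 21 / 10 := by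
    have hbg : |β * g (j + 1)| < 672 / 1000 :=
      abs_lt_of_sq_lt_sq (by linarith) (by norm_num)
    have hbh : |β * h (j + 1)| < 672 / 1000 :=
      abs_lt_of_sq_lt_sq (by linarith) (by norm_num)
    have a1 := abs_lt.1 hbg
    have a2 := abs_lt.1 hbh
    rw [abs_lt]
    rcases le_total 0 (g (j + 1)) with p | p <;> rcases le_total 0 (h (j + 1)) with q | q
    · have := mul_nonneg hb.le (mul_nonneg p q)
      constructor <;> linarith
    · have := add_lt_of_product_lt' (p := g (j + 1)) (q := -h (j + 1)) hb hb' (by linarith)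
        (by linarith) (by linarith)
      constructor <;> linarith
    · have := add_lt_of_product_lt' (p := -g (j + 1)) (q := h (j + 1)) hb hb' (by linarith)
        (by linarith) (by linarith)
      constructor <;> linarith
    · have := mul_nonneg_of_nonpos_of_nonpos p q
      have := mul_nonneg hb.le this
      constructor <;> linarith
  have k := abs_lt.1 key
  have a : ((σ (j + 1) - σ j : ℤ) : ℝ) < 3 := by push_cast; linarith
  have b : ((σ j - σ (j + 1) : ℤ) : ℝ) < 3 := by push_cast; linarith
  have a' : σ (j + 1) - σ j < 3 := by exact_mod_cast a
  have b' : σ j - σ (j + 1) < 3 := by exact_mod_cast b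
  omega

/-- Large labels are constant. -/
lemma large_label (O : OddOrbit β D τ σ g h) {j : ℕ} (hj : 2 ≤ σ (j + 1)) :
    σ (j + 2) = σ (j + 1) := by
  have hb := O.beta_pos
  have hb' := O.beta_lt
  have hD := O.D_pos
  have hm := O.D_mul
  have t1 := O.vertex_one_of_label (j := j + 1) (by omega)
  have p1 := O.parity (j + 1)
  rw [t1.1, t1.2, Int.odd_iff] at p1
  have d1 := O.label_diff t1.2
  have t2 := O.vertex_one_of_label (j := j + 2) (by show σ (j + 1 + 1) ≠ 0; omega)
  have d0 := O.label_diff t1.1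
  have d2 := O.label_diff t2.2
  have p2 := O.parity (j + 2)
  rw [t2.1, t2.2, Int.odd_iff] at p2
  have e1 : j + 1 + 1 = j + 2 := rfl
  have e2 : j + 2 + 1 = j + 3 := rfl
  rw [e1] at *
  rw [e2] at *
  obtain ⟨o1, o2, -, -⟩ := O.one _ t1.2
  have hg := O.orbit.left (j + 1)
  have hh := O.orbit.right (j + 2)
  have n1 := O.left_near (j + 1)
  have n2 := O.right_near (j + 2)
  have n3 := O.left_near j
  have n4 := O.right_near (j + 3)
  rw [e1] at *
  rw [e2] at *
  -- As for even `b`, a change of label by `±2` cancels the constant terms. The leftover `-β + β³/4`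
  -- is absorbed by `β = D (2 - β)`.
  have key : ∀ x y G H : ℝ, 162 / 100 ≤ G * H → x - y < 28 / 10 →
      D * (y - x) + β * (G * H) < -β + β ^ 3 / 4 → False := by
    intro x y G H h1 hxy hlt
    have h2 : D * ((y - x) + (2 - β) * (G * H + 1 - β ^ 2 / 4)) < 0 := by
      calc _ = D * (y - x) + β * (G * H) - (-β + β ^ 3 / 4) := by
            linear_combination (G * H + 1 - β ^ 2 / 4) * hm
        _ < 0 := by linarith
    have h3 : 0 < (y - x) + (2 - β) * (G * H + 1 - β ^ 2 / 4) := by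
      have : (2 : ℝ) ≤ G * H + 1 - β ^ 2 / 4 := by nlinarith
      nlinarith
    nlinarith
  have cs1 : (3 : ℝ) ≤ σ (j + 1) := by
    have : 3 ≤ σ (j + 1) := by omega
    exact_mod_cast this
  have cd0 : (σ j : ℝ) ≤ σ (j + 1) + 2 := by
    have : σ j ≤ σ (j + 1) + 2 := by omega
    exact_mod_cast this
  have cd0' : (σ (j + 1) : ℝ) ≤ σ j + 2 := by
    have : σ (j + 1) ≤ σ j + 2 := by omega
    exact_mod_cast this
  have cd2 : (σ (j + 2) : ℝ) ≤ σ (j + 3) + 2 := by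
    have : σ (j + 2) ≤ σ (j + 3) + 2 := by omega
    exact_mod_cast this
  have cd2' : (σ (j + 3) : ℝ) ≤ σ (j + 2) + 2 := by
    have : σ (j + 3) ≤ σ (j + 2) + 2 := by omega
    exact_mod_cast this
  have : σ (j + 2) = σ (j + 1) + 2 ∨ σ (j + 2) = σ (j + 1) - 2 ∨ σ (j + 2) = σ (j + 1) := by
    omega
  rcases this with e | e | e
  · exfalso
    have ce : (σ (j + 2) : ℝ) = σ (j + 1) + 2 := by rw [e]; push_cast; ring
    exact key (g (j + 1)) (h (j + 3)) (g (j + 2)) (h (j + 2)) (by nlinarith)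
      (by linarith) (by linarith)
  · exfalso
    have ce : (σ (j + 2) : ℝ) = σ (j + 1) - 2 := by rw [e]; push_cast; ring
    exact key (h (j + 3)) (g (j + 1)) (g (j + 2)) (h (j + 2)) (by nlinarith)
      (by linarith) (by linarith)
  · exact e

lemma eq_of_large (O : OddOrbit β D τ σ g h) {j : ℕ} (hj : 2 ≤ σ (j + 1)) (i : ℕ) :
    τ (j + 1 + i) = 1 ∧ σ (j + 1 + i) = σ (j + 1) := by
  induction i with
  | zero => exact ⟨(O.vertex_one_of_label (j := j + 1) (by omega)).1, rfl⟩
  | succ i ih =>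
    have e : 2 ≤ σ (j + i + 1) := by
      rw [show j + i + 1 = j + 1 + i by ring, ih.2]; exact hj
    have := O.large_label e
    rw [show j + i + 1 = j + 1 + i by ring, ih.2] at this
    refine ⟨(O.vertex_one_of_label (j := j + 1 + (i + 1)) ?_).1, ?_⟩ <;>
      rw [show j + 1 + (i + 1) = j + i + 2 by ring, this]
    omega

end OddOrbit

/-! ### Odd `b` with labels in `{-1, 0, 1}`: deviations from alternating words. -/

/-- Orbits above the limit point with labels in `{-1, 0, 1}`, for odd `b`, in the coordinates
`p = (1 + D) g`, `q = (1 + D) h`. -/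
structure OddWord (D κ : ℝ) (τ σ : ℕ → ℤ) (p q : ℕ → ℝ) : Prop where
  D_pos : 0 < D
  D_lt : D < 128 / 1000
  kappa_ge : 2 * D ^ 2 ≤ κ
  kappa_le : κ ≤ 21 / 10 * D ^ 2
  right : ∀ j, q j = (1 + D) * σ j + D * q (j + 1)
  left : ∀ j, p (j + 1) = (1 + D) * σ j + D * p j
  abs_right : ∀ j, |q j| < 13 / 10
  abs_left : ∀ j, |p j| < 13 / 10
  zero_or_one : ∀ j, τ j = 0 ∨ τ j = 1
  label : ∀ j, σ j = 0 ∨ σ j = 1 ∨ σ j = -1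
  label_eq_zero : ∀ j, σ j = 0 ↔ (τ j = 0 ∨ τ (j + 1) = 0)
  not_zero_zero : ∀ j, τ j = 0 → τ (j + 1) = 1
  up : ∀ j, σ j = -1 → σ (j + 1) = 1 → κ * (p j * q (j + 2) - 1) < p j - q (j + 2)
  down : ∀ j, σ j = 1 → σ (j + 1) = -1 → κ * (p j * q (j + 2) - 1) < q (j + 2) - p j
  zero : ∀ j, τ (j + 1) = 0 → |p j + q (j + 2)| < κ * (1 + p j * q (j + 2))

/-- Multiplying by `1 + D` gives an alternating word the coordinates `±1`. With `β = 2D / (1 + D)`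
and `1 - β = (1 - D) / (1 + D)` the vertex constraints then take one form, with the small constant
`κ = 2D² / (1 - D²)`. -/
lemma OddOrbit.oddWord {β D : ℝ} {τ σ : ℕ → ℤ} {g h : ℕ → ℝ} (O : OddOrbit β D τ σ g h)
    (hs : ∀ j, |σ j| ≤ 1) :
    OddWord D (2 * D ^ 2 / (1 - D ^ 2)) (fun j => τ (3 + j)) (fun j => σ (3 + j))
      (fun j => (1 + D) * g (3 + j)) fun j => (1 + D) * h (3 + j) := by
  have hD := O.D_pos
  have hD' := O.D_lt
  have hb := O.beta_pos
  have hb' := O.beta_lt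
  have hm := O.D_mul
  have hD2 : 0 < 1 - D ^ 2 := by nlinarith
  have hβ : β * (1 + D) = 2 * D := by linear_combination -hm
  have h1β : (1 - β) * (1 + D) = 1 - D := by linear_combination -hβ
  have bd := O.abs_D_mul_lt
  have hs' : ∀ j, |(σ j : ℝ)| ≤ 1 := fun j => by
    rw [← Int.cast_abs]; exact_mod_cast hs j
  have step : ∀ (C : ℝ) (s x : ℝ), |s| ≤ 1 → |x| < C → |s + D * x| < 1 + 128 / 1000 * C := by
    intro C s x h1 h2
    calc |s + D * x| ≤ |s| + |D * x| := abs_add_le _ _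
      _ = |s| + D * |x| := by rw [abs_mul, abs_of_pos hD]
      _ < _ := by nlinarith [abs_nonneg x]
  -- Each substitution into the recursion sharpens the bound on the coordinates. On the left it uses
  -- up one index, hence the shift by `3`.
  have r1 : ∀ j, |h j| < 1379 / 1000 := fun j => by
    have a := abs_lt.1 (bd (j + 1)).2
    have c := abs_le.1 (hs' j)
    rw [O.orbit.right j, abs_lt]; constructor <;> linarith
  have r2 : ∀ j, |h j| < 118 / 100 := fun j => by
    have := step _ _ _ (hs' j) (r1 (j + 1)); rw [O.orbit.right j]; linarith
  have r3 : ∀ j, |h j| < 1152 / 1000 := fun j => by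
    have := step _ _ _ (hs' j) (r2 (j + 1)); rw [O.orbit.right j]; linarith
  have l1 : ∀ j, |g (j + 1)| < 1379 / 1000 := fun j => by
    have a := abs_lt.1 (bd j).1
    have c := abs_le.1 (hs' j)
    rw [O.orbit.left j, abs_lt]; constructor <;> linarith
  have l2 : ∀ j, |g (j + 2)| < 118 / 100 := fun j => by
    have := step _ _ _ (hs' (j + 1)) (l1 j); rw [O.orbit.left (j + 1)]; linarith
  have l3 : ∀ j, |g (j + 3)| < 1152 / 1000 := fun j => by
    have := step _ _ _ (hs' (j + 2)) (l2 j); rw [O.orbit.left (j + 2)]; linarith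
  have sc : ∀ x : ℝ, |x| < 1152 / 1000 → |(1 + D) * x| < 13 / 10 := fun x hx => by
    rw [abs_mul, abs_of_pos (by linarith)]; nlinarith [abs_nonneg x]
  have key : ∀ s e z : ℝ, D * (1 - β) * s < β * (β ^ 2 / 4 * e - D ^ 2 * z) →
      (1 - D ^ 2) * ((1 + D) * s) < 2 * D ^ 2 * (e - (1 + D) ^ 2 * z) := by
    intro s e z hx
    have e1 : β ^ 2 * (1 + D) ^ 2 = 4 * D ^ 2 := by
      linear_combination (β * (1 + D) + 2 * D) * hβ
    have h2 := mul_lt_mul_of_pos_left hx (show 0 < (1 + D) ^ 3 by positivity)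
    have e2 : (1 + D) ^ 3 * (D * (1 - β) * s) = D * ((1 - D ^ 2) * ((1 + D) * s)) := by
      linear_combination D * (1 + D) ^ 2 * s * h1β
    have e3 : (1 + D) ^ 3 * (β * (β ^ 2 / 4 * e - D ^ 2 * z)) =
        D * (2 * D ^ 2 * (e - (1 + D) ^ 2 * z)) := by
      have : (1 + D) ^ 3 * (β * (β ^ 2 / 4 * e - D ^ 2 * z)) =
          (β * (1 + D)) * (β ^ 2 * (1 + D) ^ 2 / 4 * e - D ^ 2 * (1 + D) ^ 2 * z) := by ring
      rw [this, e1, hβ]; ring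
    rw [e2, e3] at h2
    exact lt_of_mul_lt_mul_left h2 hD.le
  have hlab : ∀ j, σ j = 0 ∨ σ j = 1 ∨ σ j = -1 := fun j => by
    have := abs_le.1 (hs j); omega
  have hz : ∀ j, σ j = 0 ↔ (τ j = 0 ∨ τ (j + 1) = 0) := by
    intro j
    constructor
    · intro h0
      have p := O.parity j
      have t1 := O.zero_or_one j
      have t2 := O.zero_or_one (j + 1)
      rw [h0, Int.odd_iff] at p
      omega
    · rintro (t | t)
      · exact O.label_zero_right t
      · exact O.label_zero_left t
  have h00 : ∀ j, τ j = 0 → τ (j + 1) = 1 := by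
    intro j hj
    have p := O.parity j
    have t2 := O.zero_or_one (j + 1)
    rw [O.label_zero_right hj, hj, Int.odd_iff] at p
    omega
  refine ⟨hD, hD', ?_, ?_, fun j => ?_, fun j => ?_, fun j => sc _ ((r3 _)), fun j => ?_,
    fun j => O.zero_or_one _, fun j => hlab _, fun j => hz _, fun j => h00 _, fun j h1 h2 => ?_,
    fun j h1 h2 => ?_, fun j h0 => ?_⟩
  · rw [le_div_iff₀ hD2]; linarith [sq_nonneg (D ^ 2)]
  · rw [div_le_iff₀ hD2]
    linarith [mul_nonneg (sq_nonneg D) (show 0 ≤ 1 / 10 - 21 / 10 * D ^ 2 by nlinarith)]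
  · show (1 + D) * h (3 + j) = _ + D * ((1 + D) * h (3 + j + 1))
    rw [O.orbit.right (3 + j)]; ring
  · show (1 + D) * g (3 + j + 1) = _
    rw [O.orbit.left (3 + j)]; ring
  · have := l3 j; rw [add_comm] at this; exact sc _ this
  · have t := (O.one _ (O.vertex_one_of_label (j := 3 + j) (by rw [h1]; decide)).2).1
    have e1 := O.orbit.left (3 + j)
    have e2 := O.orbit.right (3 + (j + 1))
    rw [h1] at e1
    rw [h2] at e2
    push_cast at e1 e2
    rw [show 3 + (j + 1) = 3 + j + 1 from rfl] at e2
    rw [show 3 + (j + 2) = 3 + j + 1 + 1 from rfl]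
    rw [e1, e2] at t
    have := key (h (3 + j + 1 + 1) - g (3 + j)) 1 (g (3 + j) * h (3 + j + 1 + 1)) (by linarith)
    rw [div_mul_eq_mul_div, div_lt_iff₀ hD2]
    linarith
  · have t := (O.one _ (O.vertex_one_of_label (j := 3 + j) (by rw [h1]; decide)).2).2.1
    have e1 := O.orbit.left (3 + j)
    have e2 := O.orbit.right (3 + (j + 1))
    rw [h1] at e1
    rw [h2] at e2
    push_cast at e1 e2
    rw [show 3 + (j + 1) = 3 + j + 1 from rfl] at e2
    rw [show 3 + (j + 2) = 3 + j + 1 + 1 from rfl]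
    rw [e1, e2] at t
    have := key (g (3 + j) - h (3 + j + 1 + 1)) 1 (g (3 + j) * h (3 + j + 1 + 1)) (by linarith)
    rw [div_mul_eq_mul_div, div_lt_iff₀ hD2]
    linarith
  · have h0 : τ (3 + j + 1) = 0 := h0
    have t := (O.zero _ h0).2.2
    have e1 := O.orbit.left (3 + j)
    have e2 := O.orbit.right (3 + j + 1)
    rw [O.label_zero_left h0] at e1
    rw [O.label_zero_right h0] at e2
    push_cast at e1 e2
    rw [zero_add] at e1 e2
    rw [show 3 + (j + 2) = 3 + j + 1 + 1 from rfl]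
    rw [e1, e2, ← mul_add, abs_mul, abs_of_pos hD] at t
    have := key |g (3 + j) + h (3 + j + 1 + 1)| 1 (-(g (3 + j) * h (3 + j + 1 + 1)))
      (by linarith)
    rw [← mul_add, abs_mul, abs_of_pos (show 0 < 1 + D by linarith), div_mul_eq_mul_div,
      lt_div_iff₀ hD2]
    linarith

/-- If `a ≥ 0` and `b ≥ 0` the right side is not positive; if `a ≥ 0 > b` it is at most `1.3 κ |b|`,
less than `|a - b|`. The roles of `a` and `b` are symmetric. -/
lemma neg_of_balance {κ a b : ℝ} (h0 : 0 < κ) (h1 : κ < 35 / 1000) (ha : |a| < 3 / 10)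
    (hb : |b| < 3 / 10) (h : |a - b| < κ * (-a - b - a * b)) : a < 0 ∧ b < 0 := by
  have main : ∀ x y : ℝ, |x| < 3 / 10 → |y| < 3 / 10 → |x - y| < κ * (-x - y - x * y) →
      x < 0 := by
    intro x y hx hy h
    have a1 := abs_lt.1 hx
    have a2 := abs_lt.1 hy
    have h2 := (le_abs_self (x - y)).trans_lt h
    by_contra hcon
    push Not at hcon
    rcases le_or_gt 0 y with hy0 | hy0
    · have : 0 ≤ κ * (x + y + x * y) := by positivity
      have := abs_nonneg (x - y)
      linarith
    · have e1 : κ * (-x - y - x * y) ≤ κ * (-y * (13 / 10)) :=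
        mul_le_mul_of_nonneg_left (by nlinarith) h0.le
      nlinarith
  exact ⟨main a b ha hb h, main b a hb ha (by
    rw [abs_sub_comm, show -b - a - b * a = -a - b - a * b by ring]; exact h)⟩

/-- The same diagonal dominance as in `pos_of_coupled`: each deviation dominates a multiple of about
`D²` of the other. -/
lemma pos_of_coupled' {D κ A B : ℝ} (hD : 0 < D) (hD' : D < 128 / 1000) (h0 : 0 < κ)
    (h1 : κ < 35 / 1000) (hA : |A| < 3 / 10) (hB : |B| < 3 / 10)
    (hAB : κ * ((1 + A) * (1 + D ^ 2 * B) - 1) < A - D ^ 2 * B)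
    (hBA : κ * ((1 + D ^ 2 * A) * (1 + B) - 1) < B - D ^ 2 * A) : 0 < A ∧ 0 < B := by
  have hD2 : D ^ 2 < 17 / 1000 := by nlinarith
  have hD2' : 0 < D ^ 2 := by positivity
  have key : ∀ z : ℝ, |z| < 3 / 10 → 9 / 10 ≤ 1 - κ - κ * (D ^ 2 * z) := by
    intro z hz
    have := abs_lt.1 hz
    have : D ^ 2 * z < 1 / 10 := by nlinarith
    nlinarith
  have f1 := key B hB
  have f2 := key A hA
  have c0 : 0 < D ^ 2 * (1 + κ) := by positivity
  have c1 : D ^ 2 * (1 + κ) < 2 / 100 := by nlinarith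
  have e1 : D ^ 2 * (1 + κ) * B < A * (1 - κ - κ * (D ^ 2 * B)) := by linarith
  have e2 : D ^ 2 * (1 + κ) * A < B * (1 - κ - κ * (D ^ 2 * A)) := by linarith
  set F := 1 - κ - κ * (D ^ 2 * B)
  set G := 1 - κ - κ * (D ^ 2 * A)
  set C := D ^ 2 * (1 + κ)
  have hBpos : 0 < B := by
    by_contra hcon
    push Not at hcon
    have hA0 : A < 0 := by
      by_contra hc
      push Not at hc
      nlinarith
    nlinarith
  refine ⟨?_, hBpos⟩
  by_contra hcon
  push Not at hcon
  nlinarith [mul_pos c0 hBpos]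

namespace OddWord

variable {D κ : ℝ} {τ σ : ℕ → ℤ} {p q : ℕ → ℝ}

lemma neg (W : OddWord D κ τ σ p q) :
    OddWord D κ τ (fun j => -σ j) (fun j => -p j) fun j => -q j where
  D_pos := W.D_pos
  D_lt := W.D_lt
  kappa_ge := W.kappa_ge
  kappa_le := W.kappa_le
  right j := by rw [W.right j]; push_cast; ring
  left j := by rw [W.left j]; push_cast; ring
  abs_right j := by rw [abs_neg]; exact W.abs_right j
  abs_left j := by rw [abs_neg]; exact W.abs_left j
  zero_or_one := W.zero_or_one
  label j := by have := W.label j; omega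
  label_eq_zero j := by rw [neg_eq_zero]; exact W.label_eq_zero j
  not_zero_zero := W.not_zero_zero
  up j h1 h2 := by
    have := W.down j (by omega) (by omega)
    rw [neg_mul_neg]; linarith
  down j h1 h2 := by
    have := W.up j (by omega) (by omega)
    rw [neg_mul_neg]; linarith
  zero j h := by
    have := W.zero j h
    rw [neg_mul_neg, ← neg_add, abs_neg]; exact this

lemma shift (W : OddWord D κ τ σ p q) (N : ℕ) :
    OddWord D κ (fun j => τ (N + j)) (fun j => σ (N + j)) (fun j => p (N + j))
      fun j => q (N + j) where
  D_pos := W.D_pos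
  D_lt := W.D_lt
  kappa_ge := W.kappa_ge
  kappa_le := W.kappa_le
  right _ := W.right _
  left _ := W.left _
  abs_right _ := W.abs_right _
  abs_left _ := W.abs_left _
  zero_or_one _ := W.zero_or_one _
  label _ := W.label _
  label_eq_zero _ := W.label_eq_zero _
  not_zero_zero _ := W.not_zero_zero _
  up _ := W.up _
  down _ := W.down _
  zero _ := W.zero _

lemma kappa_pos (W : OddWord D κ τ σ p q) : 0 < κ := by
  have := W.kappa_ge; have := W.D_pos; nlinarith

lemma kappa_lt (W : OddWord D κ τ σ p q) : κ < 35 / 1000 := by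
  have := W.kappa_le; have := W.D_pos; have := W.D_lt; nlinarith

lemma product_lower (W : OddWord D κ τ σ p q) (i j : ℕ) :
    -(95 / 1000) < κ * (p i * q j - 1) ∧ κ * (1 + p i * q j) < 95 / 1000 := by
  have h0 := W.kappa_pos
  have h1 := W.kappa_lt
  have : |p i * q j| < 169 / 100 := by
    rw [abs_mul]
    have := W.abs_left i
    have := W.abs_right j
    nlinarith [abs_nonneg (p i), abs_nonneg (q j)]
  have := abs_lt.1 this
  constructor <;> nlinarith

lemma left_bounds (W : OddWord D κ τ σ p q) (j : ℕ) :
    (1 + D) * σ j - 13 / 10 * D < p (j + 1) ∧ p (j + 1) < (1 + D) * σ j + 13 / 10 * D := by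
  have a := abs_lt.1 (W.abs_left j)
  have := W.D_pos
  rw [W.left j]
  constructor <;> nlinarith

lemma right_bounds (W : OddWord D κ τ σ p q) (j : ℕ) :
    (1 + D) * σ j - 13 / 10 * D < q j ∧ q j < (1 + D) * σ j + 13 / 10 * D := by
  have a := abs_lt.1 (W.abs_right (j + 1))
  have := W.D_pos
  rw [W.right j]
  constructor <;> nlinarith

/-- At the vertex between `-1` and `1` the difference `p - q` of the outer coordinates exceeds
`-0.095`. Each coordinate lies within `1.3 D` of `1 + D` times its label, so every other pair of
outer labels is ruled out. -/
lemma up_sides (W : OddWord D κ τ σ p q) {j : ℕ} (h1 : σ (j + 1) = -1) (h2 : σ (j + 2) = 1) :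
    σ j = 1 ∨ σ (j + 3) = -1 ∨ (σ j = 0 ∧ σ (j + 3) = 0) := by
  have u := W.up (j + 1) h1 h2
  have k := (W.product_lower (j + 1) (j + 3)).1
  have l := W.left_bounds j
  have r := W.right_bounds (j + 3)
  have hD := W.D_pos
  have hD' := W.D_lt
  rw [show j + 1 + 2 = j + 3 from rfl] at u
  rcases W.label j with e | e | e <;> rcases W.label (j + 3) with e' | e' | e' <;>
    simp only [e, e', true_or, or_true, true_and, and_self] <;>
    (exfalso; rw [e] at l; rw [e'] at r; push_cast at l r; linarith)

lemma down_sides (W : OddWord D κ τ σ p q) {j : ℕ} (h1 : σ (j + 1) = 1) (h2 : σ (j + 2) = -1) :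
    σ j = -1 ∨ σ (j + 3) = 1 ∨ (σ j = 0 ∧ σ (j + 3) = 0) := by
  have := W.neg.up_sides (j := j) (by omega) (by omega)
  omega

/-- The two zero edges reduce the balance condition to the outer coordinates, whose sum is tiny;
hence opposite labels. The deviations from `-1` and `1` satisfy the hypothesis of `neg_of_balance`.
-/
lemma zero_sides (W : OddWord D κ τ σ p q) {j : ℕ} (h0 : τ (j + 2) = 0) :
    σ (j + 3) = -σ j ∧ (σ j = -1 → -1 < p (j + 1) ∧ q (j + 3) < 1 ∧
      |(-p (j + 1) - 1) - (q (j + 3) - 1)| < κ * (-(-p (j + 1) - 1) - (q (j + 3) - 1) -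
        (-p (j + 1) - 1) * (q (j + 3) - 1))) := by
  have z := W.zero (j + 1) h0
  have k := (W.product_lower (j + 1) (j + 3)).2
  have l := W.left_bounds j
  have r := W.right_bounds (j + 3)
  have hD := W.D_pos
  have hD' := W.D_lt
  rw [show j + 1 + 2 = j + 3 from rfl] at z
  have z' := abs_lt.1 (z.trans k)
  have hsum : σ (j + 3) = -σ j := by
    rcases W.label j with e | e | e <;> rcases W.label (j + 3) with e' | e' | e' <;>
      simp only [e, e', neg_zero, neg_neg] <;>
      (exfalso; rw [e] at l; rw [e'] at r; push_cast at l r; linarith)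
  refine ⟨hsum, fun e => ?_⟩
  have z2 : |(-p (j + 1) - 1) - (q (j + 3) - 1)| < κ * (-(-p (j + 1) - 1) - (q (j + 3) - 1) -
        (-p (j + 1) - 1) * (q (j + 3) - 1)) := by
    rw [show (-p (j + 1) - 1) - (q (j + 3) - 1) = -(p (j + 1) + q (j + 3)) by ring, abs_neg]
    refine z.trans_eq ?_
    ring
  rw [e] at hsum l
  rw [hsum] at r
  push_cast at l r
  have b1 := abs_lt.1 (W.abs_left (j + 1))
  have b2 := abs_lt.1 (W.abs_right (j + 3))
  have := neg_of_balance W.kappa_pos W.kappa_lt (a := -p (j + 1) - 1) (b := q (j + 3) - 1)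
    (abs_lt.2 ⟨by linarith, by linarith⟩) (abs_lt.2 ⟨by linarith, by linarith⟩) z2
  exact ⟨by linarith, by linarith, z2⟩

lemma sign_mul_self {s : ℤ} (hs : s = 1 ∨ s = -1) : (s : ℝ) * s = 1 := by
  rcases hs with rfl | rfl <;> norm_num

/-- Since `±1` solves the recursion along alternating labels, the deviation from it is multiplied by
`-D` at each step. Its sign and size thus record the parity and length of an alternating run. -/
lemma right_alternating (W : OddWord D κ τ σ p q) {m k : ℕ} {s : ℤ} (hs : s = 1 ∨ s = -1)
    (ha : ∀ i < k, σ (m + i) = (-1) ^ i * s) :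
    s * q m - 1 = (-D) ^ k * ((-1) ^ k * s * q (m + k) - 1) := by
  induction k with
  | zero => simp
  | succ k ih =>
    have hss := sign_mul_self hs
    have h1 : ((-1 : ℝ) ^ k) * (-1) ^ k = 1 := by rw [← mul_pow]; simp
    rw [ih fun i hi => ha i (by omega), W.right (m + k), ha k (by omega)]
    push_cast
    rw [show m + (k + 1) = m + k + 1 from rfl, pow_succ, pow_succ]
    linear_combination ((-D) ^ k * (1 + D)) * ((-1 : ℝ) ^ k * (-1) ^ k * hss + h1)

lemma left_alternating (W : OddWord D κ τ σ p q) {m k : ℕ} {s : ℤ} (hs : s = 1 ∨ s = -1)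
    (ha : ∀ i ≤ k, σ (m + i) = (-1) ^ i * s) :
    (-1) ^ k * s * p (m + k + 1) - 1 = (-D) ^ k * (s * p (m + 1) - 1) := by
  induction k with
  | zero => simp
  | succ k ih =>
    have hss := sign_mul_self hs
    have h1 : ((-1 : ℝ) ^ (k + 1)) * (-1) ^ (k + 1) = 1 := by rw [← mul_pow]; simp
    have := ih fun i hi => ha i (by omega)
    have hl := W.left (m + (k + 1))
    rw [ha (k + 1) le_rfl] at hl
    push_cast at hl
    rw [hl, show m + (k + 1) = m + k + 1 from rfl]
    linear_combination (1 + D) * ((-1 : ℝ) ^ (k + 1) * (-1) ^ (k + 1) * hss + h1) + (-D) * this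

/-- Unless the right coordinate is that of an alternating word, the alternation ends. -/
lemma alternating_end (W : OddWord D κ τ σ p q) {m : ℕ} {s : ℤ} (hs : s = 1 ∨ s = -1)
    (hm : σ m = s) (hne : s * q m ≠ 1) : ∃ k, (∀ i ≤ k, σ (m + i) = (-1) ^ i * s) ∧
      σ (m + k + 1) ≠ (-1) ^ (k + 1) * s := by
  have hex : ∃ k, σ (m + k + 1) ≠ (-1) ^ (k + 1) * s := by
    by_contra hcon
    push Not at hcon
    have ha : ∀ i, σ (m + i) = (-1) ^ i * s := by
      intro i
      rcases i with _ | i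
      · simpa using hm
      · exact hcon i
    have hD := W.D_pos
    have hD1 : D < 1 := by linarith [W.D_lt]
    have h2 : Tendsto (fun k : ℕ => D ^ k * 3) atTop (𝓝 0) := by
      simpa using (tendsto_pow_atTop_nhds_zero_of_lt_one hD.le hD1).mul_const 3
    have h3 : 0 < |s * q m - 1| := abs_pos.2 (sub_ne_zero.2 hne)
    obtain ⟨k, hk⟩ := (h2.eventually (gt_mem_nhds h3)).exists
    rw [W.right_alternating hs (k := k) fun i _ => ha i, abs_mul, abs_pow, abs_neg,
      abs_of_pos hD] at hk
    have h4 := lt_of_mul_lt_mul_left hk (pow_pos hD k).le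
    have h5 : |(-1 : ℝ) ^ k * s * q (m + k)| < 13 / 10 := by
      rw [abs_mul, abs_mul]
      rcases hs with rfl | rfl <;> simpa using W.abs_right _
    have := abs_lt.1 h5
    rcases lt_abs.1 h4 with h | h <;> linarith
  classical
  refine ⟨Nat.find hex, fun i hi => ?_, Nat.find_spec hex⟩
  rcases i with _ | i
  · simpa using hm
  · exact not_not.1 (Nat.find_min hex (m := i) (by omega))

/-- An isolated pair of equal labels. -/
lemma double_sides (W : OddWord D κ τ σ p q) {j : ℕ} (h1 : σ (j + 1) = 1) (h2 : σ (j + 2) = -1)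
    (h3 : σ (j + 3) = -1) (h4 : σ (j + 4) = 1) : σ j = -1 ∧ σ (j + 5) = -1 ∧ p (j + 1) < -1 ∧
      q (j + 5) < -1 ∧
      κ * ((1 + (-p (j + 1) - 1)) * (1 + D ^ 2 * (-q (j + 5) - 1)) - 1) <
        (-p (j + 1) - 1) - D ^ 2 * (-q (j + 5) - 1) ∧
      κ * ((1 + D ^ 2 * (-p (j + 1) - 1)) * (1 + (-q (j + 5) - 1)) - 1) <
        (-q (j + 5) - 1) - D ^ 2 * (-p (j + 1) - 1) := by
  have d := W.down_sides h1 h2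
  have u := W.up_sides h3 h4
  rw [show j + 2 + 3 = j + 5 from rfl] at u
  have s0 : σ j = -1 := by omega
  have s5 : σ (j + 5) = -1 := by omega
  have c1 := W.down (j + 1) h1 h2
  have c2 := W.up (j + 3) h3 h4
  rw [show j + 1 + 2 = j + 3 from rfl] at c1
  rw [show j + 3 + 2 = j + 5 from rfl] at c2
  have r3 := W.right (j + 3)
  have r4 := W.right (j + 4)
  have l1 := W.left (j + 1)
  have l2 := W.left (j + 2)
  rw [h3] at r3
  rw [h4] at r4
  rw [h1] at l1
  rw [h2] at l2
  push_cast at r3 r4 l1 l2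
  rw [show j + 3 + 1 = j + 4 from rfl] at r3
  rw [show j + 4 + 1 = j + 5 from rfl] at r4
  rw [show j + 1 + 1 = j + 2 from rfl] at l1
  rw [show j + 2 + 1 = j + 3 from rfl] at l2
  -- Crossing the two labels `-1, 1` multiplies the deviation by `D²`, so both vertices of the pair
  -- are expressed through the same two deviations.
  have eq : q (j + 3) = -(1 + D ^ 2 * (-q (j + 5) - 1)) := by rw [r3, r4]; ring
  have ep : p (j + 3) = -(1 + D ^ 2 * (-p (j + 1) - 1)) := by rw [l2, l1]; ring
  have i2 : κ * ((1 + (-p (j + 1) - 1)) * (1 + D ^ 2 * (-q (j + 5) - 1)) - 1) <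
        (-p (j + 1) - 1) - D ^ 2 * (-q (j + 5) - 1) := by
    rw [eq] at c1
    linarith
  have i1 : κ * ((1 + D ^ 2 * (-p (j + 1) - 1)) * (1 + (-q (j + 5) - 1)) - 1) <
        (-q (j + 5) - 1) - D ^ 2 * (-p (j + 1) - 1) := by
    rw [ep] at c2
    linarith
  have b1 := W.left_bounds j
  have b2 := W.right_bounds (j + 5)
  have b1' := abs_lt.1 (W.abs_left (j + 1))
  have b2' := abs_lt.1 (W.abs_right (j + 5))
  have hD := W.D_pos
  have hD' := W.D_lt
  rw [s0] at b1
  rw [s5] at b2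
  push_cast at b1 b2
  have := pos_of_coupled' hD hD' W.kappa_pos W.kappa_lt
    (abs_lt.2 ⟨by linarith, by linarith⟩) (abs_lt.2 ⟨by linarith, by linarith⟩) i2 i1
  exact ⟨s0, s5, by linarith, by linarith, i2, i1⟩

/-- Half of `double_sides` that does not require the pair to be isolated: when the label after the
pair is not `1`, `q (j + 3) < -1` directly, and the vertex inequality transfers this to `p (j + 1)`.
-/
lemma double_left (W : OddWord D κ τ σ p q) {j : ℕ} (h1 : σ (j + 1) = 1) (h2 : σ (j + 2) = -1)
    (h3 : σ (j + 3) = -1) : σ j = -1 ∧ p (j + 1) < -1 := by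
  have d := W.down_sides h1 h2
  have s0 : σ j = -1 := by omega
  refine ⟨s0, ?_⟩
  by_cases h4 : σ (j + 4) = 1
  · exact (W.double_sides h1 h2 h3 h4).2.2.1
  have c1 := W.down (j + 1) h1 h2
  rw [show j + 1 + 2 = j + 3 from rfl] at c1
  have r3 := W.right (j + 3)
  have b4 := W.right_bounds (j + 4)
  have hD := W.D_pos
  have hD' := W.D_lt
  have hκ := W.kappa_pos
  have hκ' := W.kappa_lt
  rw [h3] at r3
  push_cast at r3
  rw [show j + 3 + 1 = j + 4 from rfl] at r3
  have hq4 : q (j + 4) < 1 := by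
    rcases W.label (j + 4) with e | e | e
    · rw [e] at b4; push_cast at b4; linarith
    · exact absurd e h4
    · rw [e] at b4; push_cast at b4; linarith
  have hq3 : q (j + 3) < -1 := by nlinarith
  have b3 := abs_lt.1 (W.abs_right (j + 3))
  by_contra hcon
  push Not at hcon
  have e1 : κ * (p (j + 1) * q (j + 3) - 1) < -1 - p (j + 1) + (q (j + 3) + 1) := by linarith
  have e2 : κ * (-1 * (p (j + 1) + 1) * (13 / 10)) ≤ κ * (p (j + 1) * q (j + 3) - 1) :=
    mul_le_mul_of_nonneg_left (by nlinarith) hκ.le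
  nlinarith

end OddWord

/-- Alternating labels, starting afresh with `a` in each period `n`. -/
def alternatingLabel (n : ℕ) (a : ℤ) (j : ℕ) : ℤ := (-1) ^ (j % n) * a

/-- Alternating labels, starting afresh with `0, 0, a` in each period `n`. -/
def gapLabel (n : ℕ) (a : ℤ) (j : ℕ) : ℤ := if j % n < 2 then 0 else (-1) ^ (j % n) * a

/-- The labels `a, -a, a, a`, repeated. -/
def quadLabel (a : ℤ) (j : ℕ) : ℤ := if j % 4 = 1 then -a else a

lemma neg_alternatingLabel (n : ℕ) (a : ℤ) :
    (fun j => -alternatingLabel n a j) = alternatingLabel n (-a) := by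
  funext j; simp [alternatingLabel]

lemma neg_gapLabel (n : ℕ) (a : ℤ) : (fun j => -gapLabel n a j) = gapLabel n (-a) := by
  funext j; unfold gapLabel; split_ifs <;> simp

lemma neg_quadLabel (a : ℤ) : (fun j => -quadLabel a j) = quadLabel (-a) := by
  funext j; unfold quadLabel; split_ifs <;> simp

/-- If `n' > n` then `D ^ n' * y` is at most a fifth of `D ^ n * x`. Their difference then exceeds
the right side, which is at most `0.035` times their sum. -/
lemma exponent_le_of_balance {D κ x y : ℝ} {n n' : ℕ} (hD : 0 < D) (hD' : D < 128 / 1000)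
    (h0 : 0 < κ) (h1 : κ < 35 / 1000) (hx : 83 / 100 * D < x) (hy : 83 / 100 * D < y)
    (hy' : y < 117 / 100 * D) (h : |(-(D ^ n * x)) - (-(D ^ n' * y))| <
      κ * (-(-(D ^ n * x)) - (-(D ^ n' * y)) - (-(D ^ n * x)) * (-(D ^ n' * y)))) :
    n' ≤ n := by
  by_contra hcon
  push Not at hcon
  have hx0 : 0 < x := by linarith
  have hy0 : 0 < y := by linarith
  have c1 : D ^ n' * y ≤ D ^ (n + 1) * y :=
    mul_le_mul_of_nonneg_right (pow_le_pow_of_le_one hD.le (by linarith) hcon) hy0.le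
  have c2 : D ^ (n + 1) * y ≤ D ^ n * x * (2 / 10) := by
    rw [pow_succ, mul_assoc, mul_assoc]
    exact mul_le_mul_of_nonneg_left (by nlinarith) (pow_pos hD n).le
  have px := mul_pos (pow_pos hD n) hx0
  have py := mul_pos (pow_pos hD n') hy0
  generalize D ^ n * x = u at *
  generalize D ^ n' * y = v at *
  have h2 := (neg_le_abs _).trans_lt h
  have c3 : κ * (-(-u) - (-v) - (-u) * (-v)) ≤ 35 / 1000 * (u + v) := by
    have e1 : κ * (-(-u) - (-v) - (-u) * (-v)) = κ * (u + v) - κ * (u * v) := by ring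
    have e2 : 0 < κ * (u * v) := mul_pos h0 (mul_pos px py)
    have e3 : κ * (u + v) ≤ 35 / 1000 * (u + v) :=
      mul_le_mul_of_nonneg_right h1.le (by linarith)
    linarith
  linarith

namespace OddWord

variable {D κ : ℝ} {τ σ : ℕ → ℤ} {p q : ℕ → ℝ}

lemma tau_of_label (W : OddWord D κ τ σ p q) {j : ℕ} (h : σ j ≠ 0) : τ j = 1 ∧ τ (j + 1) = 1 := by
  have := W.label_eq_zero j
  have := W.zero_or_one j
  have := W.zero_or_one (j + 1)
  grind

lemma label_of_tau (W : OddWord D κ τ σ p q) {j : ℕ} (h : τ (j + 1) = 0) :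
    σ j = 0 ∧ σ (j + 1) = 0 ∧ τ j = 1 ∧ τ (j + 2) = 1 := by
  have := W.not_zero_zero j
  have := W.zero_or_one j
  exact ⟨(W.label_eq_zero j).2 (Or.inr h), (W.label_eq_zero _).2 (Or.inl h), by grind,
    W.not_zero_zero _ h⟩

/-- From a vertex with label `0`, followed by the label `1`, to the next one. -/
lemma next_zero_vertex (W : OddWord D κ τ σ p q) {m : ℕ} (h0 : τ (m + 2) = 0)
    (h1 : σ (m + 3) = 1) : ∃ k, Odd k ∧ (∀ i ≤ k, σ (m + 3 + i) = (-1) ^ i) ∧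
      τ (m + 3 + k + 2) = 0 := by
  have hD := W.D_pos
  have hD' := W.D_lt
  obtain ⟨z1, z2⟩ := W.zero_sides h0
  obtain ⟨-, hq, -⟩ := z2 (by omega)
  obtain ⟨k, hk, hk'⟩ := W.alternating_end (Or.inl rfl) h1 (by push_cast; linarith)
  simp only [mul_one] at hk hk'
  have dev := W.right_alternating (m := m + 3) (k := k) (s := 1) (Or.inl rfl)
    fun i hi => by rw [hk i hi.le]; simp
  push_cast at dev
  simp only [one_mul, mul_one] at dev
  have hlab := W.label (m + 3 + k + 1)
  have r := W.right (m + 3 + k)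
  have rb := W.right_bounds (m + 3 + k + 1)
  -- The deviation of `q` is negative after the label-`0` vertex. An alternation ending on `1` would
  -- carry back a positive one through an even power of `-D`.
  have hodd : Odd k := by
    by_contra hcon
    have he : Even k := Nat.not_odd_iff_even.1 hcon
    have e1 := hk k le_rfl
    rw [he.neg_one_pow] at e1 dev
    rw [he.add_one.neg_one_pow] at hk'
    rw [e1] at r
    rw [he.neg_pow, one_mul] at dev
    push_cast at r
    have hpos : 0 < q (m + 3 + k) - 1 := by
      have : -1 < q (m + 3 + k + 1) := by
        rcases hlab with e | e | e
        · rw [e] at rb; push_cast at rb; linarith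
        · rw [e] at rb; push_cast at rb; linarith
        · exact absurd e hk'
      nlinarith
    have := mul_pos (pow_pos hD k) hpos
    linarith
  have e1 := hk k le_rfl
  rw [hodd.neg_one_pow] at e1
  rw [hodd.add_one.neg_one_pow] at hk'
  have hz : σ (m + 3 + k + 1) = 0 := by
    rcases hlab with e | e | e
    · exact e
    · exact absurd e hk'
    exfalso
    -- A repeated `-1` would give `p < -1` by `double_left`. But just after the label-`0` vertex the
    -- deviation of `p` is positive, and an odd power of `-D` turns it into `p > -1`. For `i = 0`
    -- the label before the run would have to be `-1` instead of `0`.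
    obtain ⟨i, rfl⟩ := hodd
    have e0 := hk (2 * i) (by omega)
    rw [(even_two_mul i).neg_one_pow] at e0
    have dl := W.double_left (j := m + 2 + 2 * i) (by rw [← e0]; congr 1; ring)
      (by rw [← e1]; congr 1; ring) (by rw [← e]; congr 1; ring)
    rcases i with _ | i
    · have := dl.1
      have := (W.label_eq_zero (m + 2)).2 (Or.inl h0)
      simp_all
    · have la := W.left_alternating (m := m + 3) (k := 2 * i + 1) (s := 1) (Or.inl rfl)
        fun i' hi => by rw [hk i' (by omega)]; simp
      rw [Odd.neg_one_pow ⟨i, rfl⟩, Odd.neg_pow ⟨i, rfl⟩,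
        show m + 3 + (2 * i + 1) + 1 = m + 2 + 2 * (i + 1) + 1 by ring] at la
      push_cast at la
      have l3 := W.left (m + 3)
      have lb := W.left_bounds (m + 2)
      rw [h1] at l3
      rw [(W.label_eq_zero (m + 2)).2 (Or.inl h0)] at lb
      push_cast at l3 lb
      have hpos : 0 < p (m + 3 + 1) - 1 := by
        rw [show m + 2 + 1 = m + 3 from rfl] at lb
        nlinarith
      have := mul_pos (pow_pos hD (2 * i + 1)) hpos
      linarith [dl.2]
  refine ⟨k, hodd, hk, ?_⟩
  have t := (W.tau_of_label (j := m + 3 + k) (by rw [e1]; decide)).2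
  have := (W.label_eq_zero (m + 3 + k + 1)).1 hz
  rcases this with t' | t'
  · omega
  · exact t'

/-- Consecutive vertices with label `0` are equidistant. -/
lemma zero_gap (W : OddWord D κ τ σ p q) {m k : ℕ} (h0 : τ (m + 2) = 0) (hk : Odd k)
    (ha : ∀ i ≤ k, σ (m + 3 + i) = (-1) ^ i) (h2 : τ (m + 3 + k + 2) = 0) :
    (∀ i ≤ k, σ (m + 3 + k + 3 + i) = (-1) ^ i) ∧ τ (m + 3 + k + 3 + k + 2) = 0 := by
  have hD := W.D_pos
  have hD' := W.D_lt
  have hκ := W.kappa_pos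
  have hκ' := W.kappa_lt
  obtain ⟨z1, z2⟩ := W.zero_sides h2
  have e1 := ha k le_rfl
  rw [hk.neg_one_pow] at e1
  have s1 : σ (m + 3 + k + 3) = 1 := by rw [z1, e1]; rfl
  obtain ⟨i1, i2, i3⟩ := z2 e1
  obtain ⟨k', hk', ha', h2'⟩ := W.next_zero_vertex h2 s1
  have dl := W.left_alternating (m := m + 3) (k := k) (s := 1) (Or.inl rfl)
    fun i' hi => by rw [ha i' (by omega)]; simp
  have dr := W.right_alternating (m := m + 3 + k + 3) (k := k') (s := 1) (Or.inl rfl)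
    fun i' hi => by rw [ha' i' (by omega)]; simp
  have e1' := ha' k' le_rfl
  rw [hk'.neg_one_pow] at e1'
  rw [hk.neg_one_pow, hk.neg_pow] at dl
  rw [hk'.neg_one_pow, hk'.neg_pow] at dr
  push_cast at dl dr
  have l3 := W.left (m + 3)
  have lb := W.left_bounds (m + 2)
  rw [show σ (m + 3) = 1 by simpa using ha 0 (Nat.zero_le _)] at l3
  rw [(W.label_eq_zero (m + 2)).2 (Or.inl h0)] at lb
  have r3 := W.right (m + 3 + k + 3 + k')
  have rb := W.right_bounds (m + 3 + k + 3 + k' + 1)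
  rw [e1'] at r3
  rw [(W.label_eq_zero _).2 (Or.inr h2')] at rb
  push_cast at l3 lb r3 rb
  rw [show m + 2 + 1 = m + 3 from rfl] at lb
  set X := p (m + 3 + 1) - 1 with hX
  set Y := -q (m + 3 + k + 3 + k') - 1 with hY
  -- `X` is `D` times one plus a coordinate next to a label `0`, and that coordinate is below `1.3 D
  -- < 0.17`. The same holds for `Y`.
  have X1 : 83 / 100 * D < X := by nlinarith
  have X2 : X < 117 / 100 * D := by nlinarith
  have Y1 : 83 / 100 * D < Y := by nlinarith
  have Y2 : Y < 117 / 100 * D := by nlinarith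
  have ea : -p (m + 3 + k + 1) - 1 = -(D ^ k * X) := by linarith
  have eb : q (m + 3 + k + 3) - 1 = -(D ^ k' * Y) := by linarith
  rw [ea, eb] at i3
  have u1 := exponent_le_of_balance hD hD' hκ hκ' X1 Y1 Y2 i3
  have u2 := exponent_le_of_balance hD hD' hκ hκ' Y1 X1 X2 (by
    rw [abs_sub_comm]; refine i3.trans_eq ?_; ring)
  have ek : k' = k := le_antisymm u1 u2
  subst ek
  exact ⟨ha', h2'⟩

lemma eventuallyCode_gap (W : OddWord D κ τ σ p q) {m : ℕ} (h0 : τ (m + 2) = 0)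
    (h1 : σ (m + 3) = 1) :
    ∃ k, EventuallyCode τ σ (gapVertex (2 * k + 2)) (gapLabel (2 * k + 2) 1) := by
  obtain ⟨k, hk, ha, h2⟩ := W.next_zero_vertex h0 h1
  obtain ⟨i, hi⟩ := hk
  refine ⟨i + 1, m + 1, fun j => ?_⟩
  have hn : 2 * (i + 1) + 2 = k + 3 := by omega
  rw [hn]
  have hQ := periodic_step (n := k + 3) (m := m)
    (Q := fun m => τ (m + 2) = 0 ∧ (∀ i ≤ k, σ (m + 3 + i) = (-1) ^ i) ∧ τ (m + 3 + k + 2) = 0)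
    ⟨h0, ha, h2⟩ (fun i' ⟨a1, a2, a3⟩ => by
      rw [show m + i' + (k + 3) + 2 = m + i' + 3 + k + 2 by ring,
        show m + i' + (k + 3) + 3 = m + i' + 3 + k + 3 by ring]
      exact ⟨a3, W.zero_gap a1 ⟨i, hi⟩ a2 a3⟩)
  obtain ⟨b1, b2, -⟩ := hQ (j / (k + 3))
  have hj : m + 1 + j = m + (k + 3) * (j / (k + 3)) + 1 + j % (k + 3) := by
    have := Nat.div_add_mod j (k + 3); omega
  have hlt := Nat.mod_lt j (show 0 < k + 3 by omega)
  rw [hj]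
  unfold gapVertex gapLabel
  generalize j % (k + 3) = r at *
  generalize m + (k + 3) * (j / (k + 3)) = m' at *
  obtain ⟨c1, c2, c3, -⟩ := W.label_of_tau b1
  rcases r with _ | _ | r
  · simp [c1, c3]
  · simp only [zero_add, if_true]
    exact ⟨b1, by simpa using c2⟩
  · have e : m' + 1 + (r + 1 + 1) = m' + 3 + r := by ring
    have := b2 r (by omega)
    rw [e, this]
    have hne : σ (m' + 3 + r) ≠ 0 := by rw [this]; exact pow_ne_zero _ (by decide)
    refine ⟨by simpa using (W.tau_of_label hne).1, ?_⟩
    rw [if_neg (by omega)]; ring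

/-- A label `0` on the next edge makes the vertex after it a label-`0` vertex again, and
`zero_sides` gives another edge label `0`: the vertex labels alternate for ever. -/
lemma eventuallyCode_zero (W : OddWord D κ τ σ p q) {m : ℕ} (h0 : τ (m + 2) = 0)
    (h1 : σ (m + 3) = 0) : EventuallyCode τ σ (gapVertex 2) (gapLabel 2 1) := by
  have step : ∀ i, τ (m + 2 + 2 * i) = 0 ∧ σ (m + 2 + 2 * i + 1) = 0 := by
    intro i
    induction i with
    | zero => exact ⟨h0, h1⟩
    | succ i ih =>
      obtain ⟨a, b⟩ := ih
      have t := W.not_zero_zero _ a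
      have t2 : τ (m + 2 + 2 * i + 2) = 0 := by
        have := (W.label_eq_zero _).1 b
        rcases this with t' | t'
        · omega
        · exact t'
      refine ⟨t2, ?_⟩
      have := (W.zero_sides (j := m + 2 + 2 * i) t2).1
      rw [(W.label_eq_zero _).2 (Or.inl a), neg_zero] at this
      rw [← this]; congr 1
  refine ⟨m + 1, fun j => ?_⟩
  unfold gapVertex gapLabel
  rw [if_pos (Nat.mod_lt _ (by decide))]
  rcases Nat.even_or_odd' j with ⟨i, rfl | rfl⟩
  · obtain ⟨c1, -, c3, -⟩ := W.label_of_tau (j := m + 1 + 2 * i) (by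
      rw [← (step i).1]; congr 1; ring)
    simp [c1, c3]
  · obtain ⟨a, b⟩ := step i
    rw [show m + 1 + (2 * i + 1) = m + 2 + 2 * i by ring, a, (W.label_eq_zero _).2 (Or.inl a)]
    simp [Nat.add_mod]

end OddWord

/-- The product on the left is at least `D (4 + x + y)`. With `κ ≥ 2D²`, division by `D` gives a gap
of at least `2D² (4 + x + y)`, and `2 · 3.8 = 7.6`. -/
lemma gap_of_deviation {D κ x y : ℝ} (hD : 0 < D) (hκ : 2 * D ^ 2 ≤ κ)
    (hx : -(1 / 10) ≤ x) (hy : -(1 / 10) ≤ y)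
    (h : κ * ((1 + D * (2 + x)) * (1 + D * (2 + y)) - 1) < D * (2 + x) - D * (2 + y)) :
    76 / 10 * D ^ 2 < x - y := by
  have h1 : 0 ≤ D * (2 + x) * (D * (2 + y)) := by
    apply mul_nonneg <;> apply mul_nonneg hD.le <;> linarith
  have h2 : 0 ≤ D * (4 + x + y) := mul_nonneg hD.le (by linarith)
  have h3 : 2 * D ^ 2 * (D * (4 + x + y)) ≤
      κ * ((1 + D * (2 + x)) * (1 + D * (2 + y)) - 1) := by
    have e : (1 + D * (2 + x)) * (1 + D * (2 + y)) - 1 =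
      D * (4 + x + y) + D * (2 + x) * (D * (2 + y)) := by ring
    rw [e]
    have hκ0 : 0 ≤ κ := le_trans (by positivity) hκ
    have := mul_le_mul_of_nonneg_right hκ h2
    have := mul_nonneg hκ0 h1
    linarith
  have h4 : D * (2 * D ^ 2 * (4 + x + y)) < D * (x - y) := by linarith
  have h5 := lt_of_mul_lt_mul_left h4 hD.le
  have : 0 < D ^ 2 := by positivity
  nlinarith

/-- Both exponents are even, so failure means `k ≥ k' + 2`, and in the extreme case the leading
terms coincide. Then `(2 + y)(1 + κ) < (2 + x)(1 - κ)`, impossible because `x - y < 2.6 D²` while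
`4κ ≥ 8D²`. -/
lemma exponent_le_of_double {D κ x y : ℝ} {k k' : ℕ} (hD : 0 < D) (hD' : D < 128 / 1000)
    (hκ : 2 * D ^ 2 ≤ κ) (hκ' : κ < 35 / 1000) (hk : Even k) (hk' : Even k')
    (hx : x < 3 / 10 * D ^ 2) (hx' : -(23 / 10 * D ^ 2) < x) (hy : -(23 / 10 * D ^ 2) < y)
    (h : κ * ((1 + D ^ k * (D * (2 + x))) * (1 + D ^ 2 * (D ^ k' * (D * (2 + y)))) - 1) <
      D ^ k * (D * (2 + x)) - D ^ 2 * (D ^ k' * (D * (2 + y)))) : k ≤ k' := by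
  by_contra hcon
  have hD2 : 0 < D ^ 2 := by positivity
  have hD2' : D ^ 2 < 17 / 1000 := by nlinarith
  have hκ0 : 0 < κ := by linarith
  have hkk : k' + 2 ≤ k := by
    rw [Nat.even_iff] at hk hk'; omega
  have px : 0 < D * (2 + x) := mul_pos hD (by linarith)
  have py : 0 < D * (2 + y) := mul_pos hD (by linarith)
  have e1 : D ^ k * (D * (2 + x)) ≤ D ^ 2 * (D ^ k' * (D * (2 + x))) := by
    rw [show D ^ 2 * (D ^ k' * (D * (2 + x))) = D ^ (k' + 2) * (D * (2 + x)) by ring]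
    exact mul_le_mul_of_nonneg_right (pow_le_pow_of_le_one hD.le (by linarith) hkk) px.le
  have pk := pow_pos hD k'
  have e2 : 0 < D ^ k * (D * (2 + x)) * (D ^ 2 * (D ^ k' * (D * (2 + y)))) := by positivity
  have e3 : D ^ 2 * (D ^ k' * (D * (2 + y))) * (1 + κ) <
      D ^ 2 * (D ^ k' * (D * (2 + x))) * (1 - κ) := by
    have := mul_le_mul_of_nonneg_right e1 (show 0 ≤ 1 - κ by linarith)
    have := mul_pos hκ0 e2
    linarith
  have e4 : D ^ 2 * (D ^ k' * D) * ((2 + y) * (1 + κ)) <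
      D ^ 2 * (D ^ k' * D) * ((2 + x) * (1 - κ)) := by linarith
  have e5 := lt_of_mul_lt_mul_left e4 (by positivity)
  nlinarith

/-- The left side is positive and the right side negative. -/
lemma not_lt_of_deviation {D κ x q : ℝ} (hD : 0 < D) (hD' : D < 128 / 1000) (hκ : 0 < κ)
    (hx : -(1 / 10) ≤ x) (hq : 96 / 100 < q) (hq' : q < 13 / 10)
    (h : κ * ((1 + D * (2 + x)) * (1 + D * (1 - q)) - 1) < D * (1 - q) - D * (2 + x)) :
    False := by
  have q5 : D * (1 - q) < D * (1 / 10) := mul_lt_mul_of_pos_left (by linarith) hD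
  have q5' : D * (-(3 / 10)) < D * (1 - q) := mul_lt_mul_of_pos_left (by linarith) hD
  have q1 : D * (19 / 10) ≤ D * (2 + x) := mul_le_mul_of_nonneg_left (by linarith) hD.le
  have q2 : 0 < κ * ((1 + D * (2 + x)) * (1 + D * (1 - q)) - 1) := by
    apply mul_pos hκ
    have c1 : 1 - 3 / 10 * D < 1 + D * (1 - q) := by linarith
    have c2 : 1 + 19 / 10 * D ≤ 1 + D * (2 + x) := by linarith
    have c3 := mul_le_mul c2 c1.le (by linarith) (by linarith)
    nlinarith
  linarith

namespace OddWord

variable {D κ : ℝ} {τ σ : ℕ → ℤ} {p q : ℕ → ℝ}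

/-- The three labels `-1` on the left make `p` deviate from `-1` by about `2D`. The inequality after
them forces a similar deviation on the right, hence again three labels `-1`. A fourth is excluded by
the next vertex, where `gap_of_deviation` asks for `7.6 D²` and only `2.6 D²` is available. -/
lemma triple_next (W : OddWord D κ τ σ p q) (hn : ∀ j, σ j ≠ 0) {j : ℕ} (h1 : σ (j + 1) = -1)
    (h2 : σ (j + 2) = -1) (h3 : σ (j + 3) = -1) (h4 : σ (j + 4) = 1) :
    σ (j + 5) = -1 ∧ σ (j + 6) = -1 ∧ σ (j + 7) = -1 ∧ σ (j + 8) = 1 := by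
  have hD := W.D_pos
  have hD' := W.D_lt
  have hκ := W.kappa_ge
  have hκ0 := W.kappa_pos
  have h5 : σ (j + 5) = -1 := by
    have := W.up_sides (j := j + 2) h3 h4
    rw [show j + 2 + 3 = j + 5 from rfl] at this
    omega
  have lab : ∀ i, σ i = 1 ∨ σ i = -1 := fun i => (W.label i).resolve_left (hn i)
  have up := W.up (j + 3) h3 h4
  have down := W.down (j + 4) h4 h5
  rw [show j + 3 + 2 = j + 5 from rfl] at up
  rw [show j + 4 + 2 = j + 6 from rfl] at down
  have l1 := W.left (j + 1)
  have l2 := W.left (j + 2)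
  have l3 := W.left (j + 3)
  have lb := W.left_bounds j
  have lb0 := abs_lt.1 (W.abs_left (j + 1))
  have r5 := W.right (j + 5)
  have r6 := W.right (j + 6)
  have r7 := W.right (j + 7)
  have b6 := W.right_bounds (j + 6)
  have b7 := W.right_bounds (j + 7)
  have b8 := W.right_bounds (j + 8)
  have a6 := abs_lt.1 (W.abs_right (j + 6))
  have a7 := abs_lt.1 (W.abs_right (j + 7))
  rw [show j + 1 + 1 = j + 2 from rfl, h1] at l1
  rw [show j + 2 + 1 = j + 3 from rfl, h2] at l2
  rw [show j + 3 + 1 = j + 4 from rfl, h3] at l3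
  rw [show j + 5 + 1 = j + 6 from rfl, h5] at r5
  rw [show j + 6 + 1 = j + 7 from rfl] at r6
  rw [show j + 7 + 1 = j + 8 from rfl] at r7
  have p1 : p (j + 1) < 1 + 23 / 10 * D := by
    rcases lab j with e | e <;> rw [e] at lb <;> push_cast at lb <;> linarith
  obtain ⟨x, hx⟩ : ∃ x, x = D * (1 - p (j + 1)) := ⟨_, rfl⟩
  have x1 : D * (-(23 / 10 * D)) < x := by
    rw [hx]; exact mul_lt_mul_of_pos_left (by linarith) hD
  have x2 : x < D * (23 / 10) := by rw [hx]; exact mul_lt_mul_of_pos_left (by linarith) hD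
  have hDD : D * D < D * (128 / 1000) := mul_lt_mul_of_pos_left hD' hD
  have x3 : -(1 / 10) ≤ x := by linarith
  push_cast at l1 l2 l3 r5
  have e2 : p (j + 2) = -1 - x := by rw [l1, hx]; ring
  have e3 : p (j + 3) = -(1 + D * (2 + x)) := by rw [l2, e2]; ring
  have e4 : p (j + 4) = -(1 + D * (2 + D * (2 + x))) := by rw [l3, e3]; ring
  have h6 : σ (j + 6) = -1 := by
    rcases lab (j + 6) with e | e
    · exfalso
      rw [e] at b6
      push_cast at b6
      have q5 : q (j + 5) = -(1 + D * (1 - q (j + 6))) := by rw [r5]; ring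
      rw [e3, q5] at up
      exact not_lt_of_deviation hD hD' hκ0 x3 (by linarith) a6.2 (by linarith)
    · exact e
  rw [h6] at r6
  push_cast at r6
  obtain ⟨y, hy⟩ : ∃ y, y = D * (1 - q (j + 7)) := ⟨_, rfl⟩
  have y0 : D * (-(3 / 10)) < y := by
    rw [hy]; exact mul_lt_mul_of_pos_left (by linarith) hD
  have y3 : -(1 / 10) ≤ y := by linarith
  have f6 : q (j + 6) = -1 - y := by rw [r6, hy]; ring
  have f5 : q (j + 5) = -(1 + D * (2 + y)) := by rw [r5, f6]; ring
  have g1 := gap_of_deviation hD hκ y3 x3 (by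
    rw [e3, f5] at up; linarith)
  have h7 : σ (j + 7) = -1 := by
    rcases lab (j + 7) with e | e
    · exfalso
      rw [e] at b7
      push_cast at b7
      have : y < D * (3 / 10 * D) := by
        rw [hy]; exact mul_lt_mul_of_pos_left (by linarith) hD
      linarith [mul_pos hD hD]
    · exact e
  rw [h7] at r7
  push_cast at r7
  refine ⟨h5, h6, h7, (lab _).resolve_right fun e => ?_⟩
  rw [e] at b8
  push_cast at b8
  obtain ⟨z, hz⟩ : ∃ z, z = D * (1 - q (j + 8)) := ⟨_, rfl⟩
  have f7 : q (j + 7) = -1 - z := by rw [r7, hz]; ring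
  have z1 : D * (2 - 3 / 10 * D) < z := by rw [hz]; exact mul_lt_mul_of_pos_left (by linarith) hD
  have f6' : q (j + 6) = -(1 + D * (2 + z)) := by rw [r6, f7]; ring
  have x4 : D * x < D * (D * (23 / 10)) := mul_lt_mul_of_pos_left x2 hD
  have x5 : D * (-(1 / 10)) ≤ D * x := mul_le_mul_of_nonneg_left x3 hD.le
  have g2 := gap_of_deviation (x := D * (2 + x)) (y := z) hD hκ (by linarith) (by linarith) (by
    rw [e4, f6'] at down; linarith)
  linarith [mul_pos hD hD]

/-- The right coordinate after an isolated pair deviates strictly from that of an alternating word,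
so another repetition follows. The sign of the deviation makes the intervening run of even length,
so the repeated label is again `-1`. -/
lemma next_double (W : OddWord D κ τ σ p q) (hn : ∀ j, σ j ≠ 0)
    (h3 : ∀ j, σ (j + 1) = σ j → σ (j + 2) ≠ σ j) {j : ℕ} (h1 : σ (j + 2) = -1)
    (h2 : σ (j + 3) = -1) : ∃ k, Even k ∧ (∀ i ≤ k + 2, σ (j + 3 + i) = (-1) ^ i * (-1)) ∧
      σ (j + 6 + k) = -1 := by
  have hD := W.D_pos
  have lab : ∀ i, σ i = 1 ∨ σ i = -1 := fun i => (W.label i).resolve_left (hn i)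
  have s1 : σ (j + 1) = 1 := by
    have := h3 (j + 1)
    rw [show j + 1 + 1 = j + 2 from rfl, show j + 1 + 2 = j + 3 from rfl] at this
    have := lab (j + 1)
    omega
  have s4 : σ (j + 4) = 1 := by
    have := h3 (j + 2)
    rw [show j + 2 + 1 = j + 3 from rfl, show j + 2 + 2 = j + 4 from rfl] at this
    have := lab (j + 4)
    omega
  obtain ⟨-, s5, -, hq, -⟩ := W.double_sides s1 h1 h2 s4
  obtain ⟨k, hk, hk'⟩ := W.alternating_end (m := j + 5) (s := -1) (Or.inr rfl) s5
    (by push_cast; linarith)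
  have dev := W.right_alternating (m := j + 5) (k := k) (s := -1) (Or.inr rfl)
    fun i hi => hk i hi.le
  have e1 := hk k le_rfl
  have l := lab (j + 5 + k + 1)
  have r := W.right (j + 5 + k)
  have rb := abs_lt.1 (W.abs_right (j + 5 + k + 1))
  have rb' := W.right_bounds (j + 5 + k + 1)
  push_cast at dev
  have hE : Even k := by
    by_contra hcon
    have ho : Odd k := Nat.not_even_iff_odd.1 hcon
    rw [ho.neg_one_pow] at e1 dev
    rw [ho.neg_pow] at dev
    rw [ho.add_one.neg_one_pow] at hk'
    have e2 : σ (j + 5 + k + 1) = 1 := by omega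
    rw [e1] at r
    rw [e2] at rb'
    push_cast at r rb'
    have hD' := W.D_lt
    have : 0 < q (j + 5 + k) - 1 := by nlinarith
    have := mul_pos (pow_pos hD k) this
    linarith
  refine ⟨k, hE, fun i hi => ?_, ?_⟩
  · rcases i with _ | _ | i
    · simpa using h2
    · simpa using s4
    · rw [show j + 3 + (i + 1 + 1) = j + 5 + i by ring, hk i (by omega)]; ring
  · rw [hE.add_one.neg_one_pow] at hk'
    rw [show j + 6 + k = j + 5 + k + 1 by ring]
    omega

/-- At the middle pair the deviations on the two sides are `D ^ k` and `D ^ k'` times a number near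
`2D`; the two inequalities give `k ≤ k'` and `k' ≤ k`. -/
lemma double_gap (W : OddWord D κ τ σ p q) (hn : ∀ j, σ j ≠ 0)
    (h3 : ∀ j, σ (j + 1) = σ j → σ (j + 2) ≠ σ j) {j k : ℕ} (hk : Even k) (h1 : σ (j + 2) = -1)
    (ha : ∀ i ≤ k + 2, σ (j + 3 + i) = (-1) ^ i * (-1)) (h2 : σ (j + 6 + k) = -1) :
    (∀ i ≤ k + 2, σ (j + 6 + k + i) = (-1) ^ i * (-1)) ∧ σ (j + 9 + k + k) = -1 := by
  have hD := W.D_pos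
  have hD' := W.D_lt
  have lab : ∀ i, σ i = 1 ∨ σ i = -1 := fun i => (W.label i).resolve_left (hn i)
  have s3 : σ (j + 3) = -1 := by simpa using ha 0 (by omega)
  have s5 : σ (j + 5 + k) = -1 := by
    have := ha (k + 2) le_rfl
    rw [show j + 3 + (k + 2) = j + 5 + k by ring, (hk.add even_two).neg_one_pow] at this
    simpa using this
  obtain ⟨k', hk', ha', h2'⟩ := W.next_double hn h3 (j := j + 3 + k)
    (by rw [← s5]; congr 1; ring) (by rw [← h2]; congr 1; ring)
  have d1 : σ (j + 4 + k) = 1 := by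
    have := ha (k + 1) (by omega)
    rw [show j + 3 + (k + 1) = j + 4 + k by ring, hk.add_one.neg_one_pow] at this
    simpa using this
  have d4 : σ (j + 7 + k) = 1 := by
    have := ha' 1 (by omega)
    rw [show j + 3 + k + 3 + 1 = j + 7 + k by ring] at this
    simpa using this
  obtain ⟨-, -, -, -, i2, i1⟩ := W.double_sides (j := j + 3 + k) (by rw [← d1]; congr 1; ring)
    (by rw [← s5]; congr 1; ring) (by rw [← h2]; congr 1; ring) (by rw [← d4]; congr 1; ring)
  have dl := W.left_alternating (m := j + 3) (k := k) (s := -1) (Or.inr rfl)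
    fun i hi => ha i (by omega)
  have dr := W.right_alternating (m := j + 3 + k + 5) (k := k') (s := -1) (Or.inr rfl)
    fun i hi => by
      have := ha' (i + 2) (by omega)
      rw [show j + 3 + k + 5 + i = j + 3 + k + 3 + (i + 2) by ring, this]; ring
  rw [hk.neg_one_pow, hk.neg_pow] at dl
  rw [hk'.neg_one_pow, hk'.neg_pow] at dr
  push_cast at dl dr
  have s1 : σ (j + 1) = 1 := by
    have := h3 (j + 1)
    rw [show j + 1 + 1 = j + 2 from rfl, show j + 1 + 2 = j + 3 from rfl] at this
    have := lab (j + 1)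
    omega
  have t5 : σ (j + 8 + k + k') = -1 := by
    have := ha' (k' + 2) le_rfl
    rw [show j + 3 + k + 3 + (k' + 2) = j + 8 + k + k' by ring,
      (hk'.add even_two).neg_one_pow] at this
    simpa using this
  have t6 : σ (j + 8 + k + k' + 1) = -1 := by rw [← h2']; congr 1; ring
  have t7 : σ (j + 8 + k + k' + 2) = 1 := by
    have := h3 (j + 8 + k + k')
    have := lab (j + 8 + k + k' + 2)
    omega
  have l2 := W.left (j + 2)
  have l3 := W.left (j + 3)
  have lb := W.left_bounds (j + 1)
  have r5 := W.right (j + 8 + k + k')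
  have r6 := W.right (j + 8 + k + k' + 1)
  have rb := W.right_bounds (j + 8 + k + k' + 2)
  rw [h1] at l2
  rw [s3] at l3
  rw [s1] at lb
  rw [t5] at r5
  rw [t6] at r6
  rw [t7] at rb
  push_cast at l2 l3 lb r5 r6 rb
  rw [show j + 2 + 1 = j + 3 from rfl] at l2
  rw [show j + 3 + 1 = j + 4 from rfl] at l3
  rw [show j + 1 + 1 = j + 2 from rfl] at lb
  rw [show j + 8 + k + k' + 1 + 1 = j + 8 + k + k' + 2 from rfl] at r6
  obtain ⟨x, hx⟩ : ∃ x, x = D * (1 - p (j + 2)) := ⟨_, rfl⟩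
  obtain ⟨y, hy⟩ : ∃ y, y = D * (1 - q (j + 8 + k + k' + 2)) := ⟨_, rfl⟩
  have x1 : -(23 / 10 * D ^ 2) < x := by rw [hx]; nlinarith
  have x2 : x < 3 / 10 * D ^ 2 := by rw [hx]; nlinarith
  have y1 : -(23 / 10 * D ^ 2) < y := by rw [hy]; nlinarith
  have y2 : y < 3 / 10 * D ^ 2 := by rw [hy]; nlinarith
  have e1 : -1 * p (j + 4) - 1 = D * (2 + x) := by rw [l3, l2, hx]; ring
  have e2 : -1 * q (j + 8 + k + k') - 1 = D * (2 + y) := by rw [r5, r6, hy]; ring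
  have eA : -p (j + 3 + k + 1) - 1 = D ^ k * (D * (2 + x)) := by
    rw [← e1, show j + 4 = j + 3 + 1 from rfl]; linarith
  have eB : -q (j + 3 + k + 5) - 1 = D ^ k' * (D * (2 + y)) := by
    rw [← e2, show j + 8 + k + k' = j + 3 + k + 5 + k' by ring]; linarith
  rw [eA, eB] at i1 i2
  have u1 := exponent_le_of_double hD hD' W.kappa_ge W.kappa_lt hk hk' x2 x1 y1 i2
  have u2 := exponent_le_of_double hD hD' W.kappa_ge W.kappa_lt hk' hk y2 y1 x1
    (by rw [mul_comm (1 + D ^ k' * (D * (2 + y)))]; exact i1)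
  have ek : k' = k := le_antisymm u2 u1
  subst ek
  refine ⟨fun i hi => ?_, ?_⟩
  · rw [← ha' i hi]; congr 1; ring
  · rw [← h2']; congr 1; ring

lemma eventuallyCode_alternating (W : OddWord D κ τ σ p q) (hn : ∀ j, σ j ≠ 0)
    (h3 : ∀ j, σ (j + 1) = σ j → σ (j + 2) ≠ σ j) {j : ℕ} (h1 : σ (j + 2) = -1)
    (h2 : σ (j + 3) = -1) : ∃ k, 1 ≤ k ∧
      EventuallyCode τ σ (fun _ => 1) (alternatingLabel (2 * k + 1) (-1)) := by
  obtain ⟨k, hk, ha, h6⟩ := W.next_double hn h3 h1 h2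
  obtain ⟨r, hr⟩ := hk
  refine ⟨r + 1, by omega, j + 3, fun i => ⟨(W.tau_of_label (hn _)).1, ?_⟩⟩
  rw [show 2 * (r + 1) + 1 = k + 3 by omega]
  have hQ := periodic_step (n := k + 3) (m := j)
    (Q := fun j => σ (j + 2) = -1 ∧ (∀ i ≤ k + 2, σ (j + 3 + i) = (-1) ^ i * (-1)) ∧
      σ (j + 6 + k) = -1)
    ⟨h1, ha, h6⟩ (fun i' ⟨a1, a2, a3⟩ => by
      obtain ⟨c1, c2⟩ := W.double_gap hn h3 ⟨r, hr⟩ a1 a2 a3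
      refine ⟨?_, fun i hi => ?_, ?_⟩
      · have := a2 (k + 2) le_rfl
        rw [(Even.add ⟨r, hr⟩ even_two).neg_one_pow] at this
        rw [show j + i' + (k + 3) + 2 = j + i' + 3 + (k + 2) by ring, this]; rfl
      · rw [← c1 i hi]; congr 1; ring
      · rw [← c2]; congr 1; ring)
  obtain ⟨-, b2, -⟩ := hQ (i / (k + 3))
  have hj : j + 3 + i = j + (k + 3) * (i / (k + 3)) + 3 + i % (k + 3) := by
    have := Nat.div_add_mod i (k + 3); omega
  have hlt := Nat.mod_lt i (show 0 < k + 3 by omega)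
  rw [hj, b2 _ (by omega)]
  rfl

/-- Either the run of `-1` never ends, or its last three members and the following `1` start the
period of `triple_next`. -/
lemma eventuallyCode_of_triple (W : OddWord D κ τ σ p q) (hn : ∀ j, σ j ≠ 0) {j : ℕ}
    (h1 : σ (j + 1) = -1) (h2 : σ (j + 2) = -1) (h3 : σ (j + 3) = -1) :
    EventuallyCode τ σ (fun _ => 1) (fun _ => -1) ∨
      EventuallyCode τ σ (fun _ => 1) (quadLabel (-1)) := by
  have lab : ∀ i, σ i = 1 ∨ σ i = -1 := fun i => (W.label i).resolve_left (hn i)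
  have ht : ∀ i, τ i = 1 := fun i => (W.tau_of_label (hn i)).1
  by_cases hall : ∀ i, σ (j + 4 + i) = -1
  · exact Or.inl ⟨j + 4, fun i => ⟨ht _, hall i⟩⟩
  right
  push Not at hall
  classical
  have hs := Nat.find_spec hall
  have hm := fun i hi => not_not.1 (Nat.find_min hall (m := i) hi)
  generalize Nat.find hall = n at *
  have prev : ∀ i < n + 3, σ (j + 1 + i) = -1 := by
    intro i hi
    rcases i with _ | _ | _ | i
    · exact h1
    · exact h2
    · exact h3
    · rw [← hm i (by omega)]; congr 1; ring
  have hQ := periodic_step (n := 4) (m := j + n)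
    (Q := fun m => σ (m + 1) = -1 ∧ σ (m + 2) = -1 ∧ σ (m + 3) = -1 ∧ σ (m + 4) = 1)
    ⟨by rw [← prev n (by omega)]; congr 1; ring, by rw [← prev (n + 1) (by omega)]; congr 1; ring,
      by rw [← prev (n + 2) (by omega)]; congr 1; ring, by
      rw [show j + n + 4 = j + 4 + n by ring]; exact (lab _).resolve_right hs⟩
    (fun i ⟨a1, a2, a3, a4⟩ => W.triple_next hn a1 a2 a3 a4)
  refine ⟨j + n + 3, fun i => ⟨ht _, ?_⟩⟩
  obtain ⟨a1, a2, a3, a4⟩ := hQ (i / 4)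
  obtain ⟨c1, c2, -, -⟩ := hQ (i / 4 + 1)
  have hi := Nat.div_add_mod i 4
  have hlt := Nat.mod_lt i (show 0 < 4 by omega)
  unfold quadLabel
  have hcase : i % 4 = 0 ∨ i % 4 = 1 ∨ i % 4 = 2 ∨ i % 4 = 3 := by omega
  rcases hcase with e | e | e | e <;> simp only [e] <;> norm_num
  · rw [← a3]; congr 1; omega
  · rw [← a4]; congr 1; omega
  · rw [← c1]; congr 1; omega
  · rw [← c2]; congr 1; omega

/-- The codes of orbits above the limit point with labels in `{-1, 0, 1}`, for odd `b`. -/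
theorem classification (W : OddWord D κ τ σ p q) :
    (∃ n, EventuallyCode τ σ (fun _ => 1) fun _ => n) ∨
    EventuallyCode τ σ (fun _ => 1) (alternatingLabel 2 1) ∨
    (∃ a, (a = 1 ∨ a = -1) ∧ EventuallyCode τ σ (fun _ => 1) (quadLabel a)) ∨
    (∃ k a, 1 ≤ k ∧ (a = 1 ∨ a = -1) ∧
      EventuallyCode τ σ (fun _ => 1) (alternatingLabel (2 * k + 1) a)) ∨
    ∃ k a, (a = 1 ∨ a = -1) ∧
      EventuallyCode τ σ (gapVertex (2 * k + 2)) (gapLabel (2 * k + 2) a) := by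
  by_cases hz : ∃ m, τ (m + 2) = 0
  · right; right; right; right
    obtain ⟨m, hm⟩ := hz
    rcases W.label (m + 3) with e | e | e
    · exact ⟨0, 1, Or.inl rfl, W.eventuallyCode_zero hm e⟩
    · obtain ⟨k, hk⟩ := W.eventuallyCode_gap hm e
      exact ⟨k, 1, Or.inl rfl, hk⟩
    · obtain ⟨k, hk⟩ := W.neg.eventuallyCode_gap hm (by rw [e]; rfl)
      have := hk.of_neg
      rw [neg_gapLabel] at this
      exact ⟨k, -1, Or.inr rfl, this⟩
  push Not at hz
  have main : ∀ {τ σ : ℕ → ℤ} {p q : ℕ → ℝ}, OddWord D κ τ σ p q → (∀ j, σ j ≠ 0) →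
      (∃ n, EventuallyCode τ σ (fun _ => 1) fun _ => n) ∨
      EventuallyCode τ σ (fun _ => 1) (alternatingLabel 2 1) ∨
      (∃ a, (a = 1 ∨ a = -1) ∧ EventuallyCode τ σ (fun _ => 1) (quadLabel a)) ∨
      (∃ k a, 1 ≤ k ∧ (a = 1 ∨ a = -1) ∧
        EventuallyCode τ σ (fun _ => 1) (alternatingLabel (2 * k + 1) a)) := by
    intro τ σ p q W hn
    have hn' : ∀ j, -σ j ≠ 0 := fun j => neg_ne_zero.2 (hn j)
    have lab : ∀ i, σ i = 1 ∨ σ i = -1 := fun i => (W.label i).resolve_left (hn i)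
    have ht : ∀ i, τ i = 1 := fun i => (W.tau_of_label (hn i)).1
    by_cases h3 : ∃ j, σ (j + 2) = σ (j + 1) ∧ σ (j + 3) = σ (j + 1)
    · obtain ⟨j, e2, e3⟩ := h3
      rcases lab (j + 1) with e | e
      · rcases W.neg.eventuallyCode_of_triple hn' (j := j) (by rw [e]) (by rw [e2, e])
          (by rw [e3, e]) with h | h
        · exact Or.inl ⟨_, h.of_neg⟩
        · have := h.of_neg
          rw [neg_quadLabel] at this
          exact Or.inr (Or.inr (Or.inl ⟨1, Or.inl rfl, this⟩))
      · rcases W.eventuallyCode_of_triple hn (j := j) e (by rw [e2, e])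
          (by rw [e3, e]) with h | h
        · exact Or.inl ⟨_, h⟩
        · exact Or.inr (Or.inr (Or.inl ⟨-1, Or.inr rfl, h⟩))
    push Not at h3
    right
    by_cases hd : ∃ j, σ (j + 4) = σ (j + 3)
    · right; right
      obtain ⟨j, hj⟩ := hd
      have hsh : ∀ i, σ (1 + (i + 1)) = σ (1 + i) → σ (1 + (i + 2)) ≠ σ (1 + i) := by
        intro i
        rw [show 1 + (i + 1) = i + 2 by ring, show 1 + (i + 2) = i + 3 by ring,
          show 1 + i = i + 1 by ring]
        exact h3 i
      rcases lab (j + 3) with e | e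
      · obtain ⟨k, hk, h⟩ := (W.neg.shift 1).eventuallyCode_alternating (fun _ => hn' _)
          (fun i hi => by
            have := hsh i (neg_inj.1 hi)
            exact fun h => this (neg_inj.1 h))
          (j := j) (by rw [show 1 + (j + 2) = j + 3 by ring, e])
          (by rw [show 1 + (j + 3) = j + 4 by ring, hj, e])
        have := (EventuallyCode.of_shift h).of_neg
        rw [neg_alternatingLabel] at this
        exact ⟨k, 1, hk, Or.inl rfl, this⟩
      · obtain ⟨k, hk, h⟩ := (W.shift 1).eventuallyCode_alternating (fun _ => hn _) hsh
          (j := j) (by rw [show 1 + (j + 2) = j + 3 by ring, e])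
          (by rw [show 1 + (j + 3) = j + 4 by ring, hj, e])
        exact ⟨k, -1, hk, Or.inr rfl, EventuallyCode.of_shift h⟩
    -- With no repetition left the labels alternate; the two possible phases differ by a shift.
    · left
      push Not at hd
      have step : ∀ i, σ (i + 4) = -σ (i + 3) := by
        intro i
        have := hd i
        have := lab (i + 3)
        have := lab (i + 4)
        omega
      have alt : ∀ N, σ (N + 3) = 1 →
          EventuallyCode τ σ (fun _ => 1) (alternatingLabel 2 1) := by
        intro N hN
        refine ⟨N + 3, fun i => ⟨ht _, ?_⟩⟩
        unfold alternatingLabel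
        have : σ (N + 3 + i) = (-1) ^ i := by
          induction i with
          | zero => simpa using hN
          | succ i ih =>
            rw [show N + 3 + (i + 1) = N + i + 4 by ring, step,
              show N + i + 3 = N + 3 + i by ring, ih]; ring
        rw [this, mul_one]
        conv_lhs => rw [← Nat.mod_add_div i 2, pow_add, pow_mul]
        simp
      rcases lab 3 with e | e
      · exact alt 0 e
      · exact alt 1 (by rw [show 1 + 3 = 0 + 4 from rfl, step]; simp [e])
  have hn : ∀ j, σ (2 + j) ≠ 0 := by
    intro j h
    rcases (W.label_eq_zero _).1 h with h | h
    · exact hz j (by rw [← h]; congr 1; ring)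
    · exact hz (j + 1) (by rw [← h]; congr 1; ring)
  rcases main (W.shift 2) hn with ⟨n, h⟩ | h | ⟨a, ha, h⟩ | ⟨k, a, hk, ha, h⟩
  · exact Or.inl ⟨n, h.of_shift⟩
  · exact Or.inr (Or.inl (EventuallyCode.of_shift h))
  · exact Or.inr (Or.inr (Or.inl ⟨a, ha, EventuallyCode.of_shift h⟩))
  · exact Or.inr (Or.inr (Or.inr (Or.inl ⟨k, a, hk, ha, EventuallyCode.of_shift h⟩)))

end OddWord

/-- The codes of orbits above the limit point, for odd `b`. -/
theorem OddOrbit.classification {β D : ℝ} {τ σ : ℕ → ℤ} {g h : ℕ → ℝ}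
    (O : OddOrbit β D τ σ g h) :
    (∃ n, EventuallyCode τ σ (fun _ => 1) fun _ => n) ∨
    EventuallyCode τ σ (fun _ => 1) (alternatingLabel 2 1) ∨
    (∃ a, (a = 1 ∨ a = -1) ∧ EventuallyCode τ σ (fun _ => 1) (quadLabel a)) ∨
    (∃ k a, 1 ≤ k ∧ (a = 1 ∨ a = -1) ∧
      EventuallyCode τ σ (fun _ => 1) (alternatingLabel (2 * k + 1) a)) ∨
    ∃ k a, (a = 1 ∨ a = -1) ∧
      EventuallyCode τ σ (gapVertex (2 * k + 2)) (gapLabel (2 * k + 2) a) := by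
  by_cases cbig : ∃ j, 2 ≤ |σ (j + 1)|
  · left
    obtain ⟨j, hj⟩ := cbig
    rcases le_abs.1 hj with h2 | h2
    · exact ⟨_, j + 1, O.eq_of_large h2⟩
    · have : EventuallyCode τ (fun j => -σ j) (fun _ => 1) fun _ => -σ (j + 1) :=
        ⟨j + 1, O.neg.eq_of_large h2⟩
      exact ⟨_, this.of_neg⟩
  push Not at cbig
  have O1 : OddOrbit β D (fun j => τ (1 + j)) (fun j => σ (1 + j)) (fun j => g (1 + j))
      fun j => h (1 + j) :=
    ⟨O.beta_pos, O.beta_lt, O.D_mul, ⟨fun j => O.orbit.right _, fun j => O.orbit.left _⟩,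
      fun _ => O.zero_or_one _, fun _ => O.parity _, fun _ => O.one _, fun _ => O.zero _⟩
  have W := O1.oddWord fun j => by
    have := cbig j
    rw [add_comm] at this
    omega
  have sh : ∀ {τ₀ σ₀ : ℕ → ℤ}, EventuallyCode (fun j => τ (1 + (3 + j))) (fun j => σ (1 + (3 + j)))
      τ₀ σ₀ → EventuallyCode τ σ τ₀ σ₀ := fun h =>
    EventuallyCode.of_shift (M := 1)
      (EventuallyCode.of_shift (τ := fun j => τ (1 + j)) (σ := fun j => σ (1 + j)) (M := 3) h)
  rcases W.classification with ⟨n, h⟩ | h | ⟨a, ha, h⟩ | ⟨k, a, hk, ha, h⟩ | ⟨k, a, ha, h⟩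
  · exact Or.inl ⟨n, sh h⟩
  · exact Or.inr (Or.inl (sh h))
  · exact Or.inr (Or.inr (Or.inl ⟨a, ha, sh h⟩))
  · exact Or.inr (Or.inr (Or.inr (Or.inl ⟨k, a, hk, ha, sh h⟩)))
  · exact Or.inr (Or.inr (Or.inr (Or.inr ⟨k, a, ha, sh h⟩)))

/-! ### Values on periodic codes -/

/-- The value of `M*` on the points following the code `(τ, σ)` is `α c`, by way of an orbit. -/
def HasValue (b : ℕ) (α β c : ℝ) (τ σ : ℕ → ℤ) : Prop :=
  ∃ g h, GoodOrbit b β (α * β) c τ σ g h ∧ 0 < c ∧ c ≤ 1 ∧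
    ∃ᶠ j in atTop, AttainedAt β c τ g h j

lemma AttainedAt.neg {β c : ℝ} {τ : ℕ → ℤ} {g h : ℕ → ℝ} {j : ℕ} (A : AttainedAt β c τ g h j) :
    AttainedAt β c τ (fun j => -g j) (fun j => -h j) j := by
  rcases A with ⟨t, h | h | h | h⟩ | ⟨t, h | h⟩
  · exact Or.inl ⟨t, Or.inr (Or.inl (by rw [← h]; ring))⟩
  · exact Or.inl ⟨t, Or.inl (by rw [← h]; ring)⟩
  · exact Or.inl ⟨t, Or.inr (Or.inr (Or.inr (by rw [← h]; ring)))⟩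
  · exact Or.inl ⟨t, Or.inr (Or.inr (Or.inl (by rw [← h]; ring)))⟩
  · exact Or.inr ⟨t, Or.inr (by rw [← h]; ring)⟩
  · exact Or.inr ⟨t, Or.inl (by rw [← h]; ring)⟩

lemma HasValue.neg {b : ℕ} {α β c : ℝ} {τ σ : ℕ → ℤ} (V : HasValue b α β c τ σ) :
    HasValue b α β c τ fun j => -σ j := by
  obtain ⟨g, h, O, h0, h1, ha⟩ := V
  exact ⟨_, _, O.neg, h0, h1, ha.mono fun j => AttainedAt.neg⟩

lemma succ_mod_cases (j N : ℕ) :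
    (j % (N + 1) < N ∧ (j + 1) % (N + 1) = j % (N + 1) + 1) ∨
      (j % (N + 1) = N ∧ (j + 1) % (N + 1) = 0) := by
  have h1 := Nat.div_add_mod j (N + 1)
  have h2 := Nat.mod_lt j (show 0 < N + 1 by omega)
  have h3 : (j + 1) % (N + 1) = (j % (N + 1) + 1) % (N + 1) := by simp
  rcases Nat.lt_or_ge (j % (N + 1)) N with h | h
  · exact Or.inl ⟨h, by rw [h3, Nat.mod_eq_of_lt (by omega)]⟩
  · have : j % (N + 1) = N := by omega
    exact Or.inr ⟨this, by rw [h3, this, Nat.mod_self]⟩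

lemma frequently_mod {p : ℕ → Prop} {n r : ℕ} (hn : r < n) (h : ∀ j, j % n = r → p j) :
    ∃ᶠ j in atTop, p j := by
  rw [frequently_atTop]
  intro a
  refine ⟨n * a + r, by nlinarith, h _ ?_⟩
  rw [Nat.mul_add_mod, Nat.mod_eq_of_lt hn]

/-- Periodic orbits. -/
lemma hasValue_of_periodic {b N : ℕ} {α β c : ℝ} {D : ℝ} {T S : ℕ → ℤ}
    {G H : ℕ → ℝ} (hD : α * β = D) (h0 : 0 < c) (h1 : c ≤ 1)
    (hH : ∀ r < N, H r = S r + D * H (r + 1)) (hH' : H N = S N + D * H 0)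
    (hG : ∀ r < N, G (r + 1) = S r + D * G r) (hG' : G 0 = S N + D * G N)
    (hT : ∀ r ≤ N, T r = 0 ∨ T r = 1)
    (hp : ∀ r < N, Even ((b : ℤ) + S r + T r + T (r + 1)))
    (hp' : Even ((b : ℤ) + S N + T N + T 0))
    (hone : ∀ r ≤ N, T r = 1 → VertexOne β c (β * G r) (β * H r))
    (hzero : ∀ r ≤ N, T r = 0 → VertexZero β c (β * G r) (β * H r))
    {r₀ : ℕ} (hr : r₀ ≤ N) (hatt : AttainedAt β c T G H r₀) :
    HasValue b α β c (fun j => T (j % (N + 1))) fun j => S (j % (N + 1)) := by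
  subst hD
  have hlt : ∀ j, j % (N + 1) ≤ N := fun j => Nat.lt_succ_iff.1 (Nat.mod_lt j (Nat.succ_pos N))
  refine ⟨fun j => G (j % (N + 1)), fun j => H (j % (N + 1)), ⟨⟨fun j => ?_, fun j => ?_⟩,
    ⟨fun j => hT _ (hlt j), fun j => ?_⟩, fun j => hone _ (hlt j), fun j => hzero _ (hlt j)⟩,
    h0, h1, frequently_mod (Nat.lt_succ_iff.2 hr) fun j hj => ?_⟩
  · rcases succ_mod_cases j N with ⟨a, e⟩ | ⟨a, e⟩ <;> simp only [e]
    · exact hH _ a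
    · rw [a]; exact hH'
  · rcases succ_mod_cases j N with ⟨a, e⟩ | ⟨a, e⟩ <;> simp only [e]
    · exact hG _ a
    · rw [a]; exact hG'
  · rcases succ_mod_cases j N with ⟨a, e⟩ | ⟨a, e⟩ <;> simp only [e]
    · exact hp _ a
    · rw [a]; exact hp'
  · unfold AttainedAt at *
    simp only [hj]; exact hatt

/-- With both coordinates at most `1` in size the main products are at least `(1 - β)²`, and the
side products are larger since `β < 1/4`. -/
lemma vertexOne_of_le_one {β c g h : ℝ} (h0 : 0 < β) (h1 : β < 1 / 4) (hg : |g| ≤ 1)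
    (hh : |h| ≤ 1) (hc : c ≤ (1 - β) ^ 2) : VertexOne β c (β * g) (β * h) := by
  have key : ∀ x : ℝ, |x| ≤ 1 → |β * x| ≤ β := fun x hx => by
    rw [abs_mul, abs_of_pos h0]; nlinarith
  have G := abs_le.1 (key g hg)
  have H := abs_le.1 (key h hh)
  have m : ∀ x y : ℝ, -β ≤ x → -β ≤ y → c ≤ (1 + x) * (1 + y) := fun x y hx hy => by nlinarith
  have s : ∀ x y : ℝ, -β ≤ x → -β ≤ y → c ≤ (1 - 2 * β + x) * (3 - 2 * β + y) := by
    intro x y hx hy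
    have : (1 - 3 * β) * (3 - 3 * β) ≤ (1 - 2 * β + x) * (3 - 2 * β + y) :=
      mul_le_mul (by linarith) (by linarith) (by linarith) (by linarith)
    nlinarith
  refine ⟨(key g hg).trans (by linarith), (key h hh).trans (by linarith), ?_, ?_, ?_, ?_, ?_, ?_⟩
  · have := m (-(β * g)) (β * h) (by linarith) (by linarith); linarith
  · have := m (β * g) (-(β * h)) (by linarith) (by linarith); linarith
  · have := s (-(β * g)) (-(β * h)) (by linarith) (by linarith); linarith
  · have := s (-(β * h)) (-(β * g)) (by linarith) (by linarith); linarith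
  · exact s _ _ (by linarith) (by linarith)
  · have := s (β * h) (β * g) (by linarith) (by linarith); linarith

/-- Coordinates up to `1.15` keep the side products above `1 - 2β + 2β²`, which exceeds the largest
value `(1 - β + β²/2)²` needed. Only the main products are then in question. -/
lemma vertexOne_of_main {β c g h : ℝ} (h0 : 0 < β) (h1 : β < 2255 / 10000) (hg : |g| ≤ 23 / 20)
    (hh : |h| ≤ 23 / 20) (hc : c ≤ (1 - β + β ^ 2 / 2) ^ 2)
    (hm : c ≤ (1 - β * g) * (1 + β * h)) (hm' : c ≤ (1 + β * g) * (1 - β * h)) :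
    VertexOne β c (β * g) (β * h) := by
  have key : ∀ x : ℝ, |x| ≤ 23 / 20 → |β * x| ≤ 23 / 20 * β := fun x hx => by
    rw [abs_mul, abs_of_pos h0]; nlinarith
  have G := abs_le.1 (key g hg)
  have H := abs_le.1 (key h hh)
  have s : ∀ x y : ℝ, -(23 / 20 * β) ≤ x → -(23 / 20 * β) ≤ y →
      c ≤ (1 - 2 * β + x) * (3 - 2 * β + y) := by
    intro x y hx hy
    have e : (1 - 63 / 20 * β) * (3 - 63 / 20 * β) ≤ (1 - 2 * β + x) * (3 - 2 * β + y) :=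
      mul_le_mul (by linarith) (by linarith) (by linarith) (by linarith)
    have e2 : (1 - β + β ^ 2 / 2) ^ 2 ≤ 1 - 2 * β + 2 * β ^ 2 := by
      have : 0 ≤ β ^ 3 * (1 - β / 4) := by
        apply mul_nonneg (by positivity); linarith
      nlinarith
    nlinarith
  refine ⟨(key g hg).trans (by linarith), (key h hh).trans (by linarith), hm, hm', ?_, ?_, ?_, ?_⟩
  · have := s (-(β * g)) (-(β * h)) (by linarith) (by linarith); linarith
  · have := s (-(β * h)) (-(β * g)) (by linarith) (by linarith); linarith
  · exact s _ _ (by linarith) (by linarith)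
  · have := s (β * h) (β * g) (by linarith) (by linarith); linarith

namespace CFPair

variable {b : ℕ} {α β : ℝ}

/-- The value of the class `-1`, `b` even. -/
lemma hasValue_zero (P : CFPair b α β) (hb : Even b) :
    HasValue b α β ((1 - β) ^ 2) (fun _ => 0) fun _ => 0 := by
  have h0 := P.beta_pos
  have h1 := P.beta_lt
  refine hasValue_of_periodic rfl (N := 0) (T := fun _ => 0) (S := fun _ => 0) (G := fun _ => 0)
    (H := fun _ => 0) (by nlinarith) (by nlinarith) (fun r hr => by simp) (by simp)
    (fun r hr => by simp) (by simp) (fun r _ => Or.inl rfl) (fun r hr => by simpa using hb)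
    (by simpa using hb) (fun r _ h => by simp at h) (fun r _ _ => ?_) le_rfl
    (Or.inr ⟨rfl, Or.inl (by ring)⟩)
  constructor <;> norm_num <;> nlinarith


end CFPair

/-! ### Periodic codes with isolated labels `2` or pairs `1, -1` for even `b`, and constant codes.
-/

/-- A vertex at an end of an edge with label `2`: `X` belongs to the side of that edge, and `Y` to
the other side, where the nearest `2` is further off by at least one factor `D`. -/
lemma vertexOne_spike {β X Y : ℝ} (h0 : 0 < β) (h1 : β < 1836 / 10000) (hX : 2 * β ≤ X)
    (hX' : X ≤ 2022 / 1000 * β) (hY : 0 ≤ Y) (hY' : Y ≤ X * (102 / 1000)) :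
    VertexOne β ((1 - X) * (1 + Y)) Y X := by
  have side : (1 - X) * (1 + Y) ≤ (1 - 2 * β - X) * (3 - 2 * β - Y) := by
    have e1 : (2 - 2 * β) * X ≤ (2 - 2 * β) * (2022 / 1000 * β) :=
      mul_le_mul_of_nonneg_left hX' (by linarith)
    have e2 : Y * (2 - 2 * β - 2 * X) ≤ 2063 / 10000 * β * (2 - 6 * β) :=
      mul_le_mul (by linarith) (by linarith) (by linarith) (by linarith)
    nlinarith
  have le : (1 - X) * (1 + Y) ≤ 1 := by nlinarith
  have m : ∀ x y : ℝ, 0 ≤ x → 0 ≤ y → 1 ≤ (1 - 2 * β + x) * (3 - 2 * β + y) := by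
    intro x y hx hy
    calc (1 : ℝ) ≤ (1 / 2) * 2 := by norm_num
      _ ≤ _ := mul_le_mul (by linarith) (by linarith) (by norm_num) (by linarith)
  refine ⟨?_, ?_, ?_, ?_, ?_, ?_, ?_, ?_⟩
  · rw [abs_of_nonneg hY]; linarith
  · rw [abs_of_nonneg (by linarith)]; linarith
  · nlinarith
  · linarith
  · nlinarith
  · linarith
  · exact le.trans (m _ _ hY (by linarith))
  · have := m X Y (by linarith) hY; linarith

lemma VertexOne.symm {β c G H : ℝ} (V : VertexOne β c G H) : VertexOne β c H G :=
  ⟨V.right, V.left, by linarith [V.main'], by linarith [V.main], by linarith [V.side'],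
    by linarith [V.side], by linarith [V.mirror'], by linarith [V.mirror]⟩

lemma vertexOne_between_spikes {β X Y x y : ℝ} (h0 : 0 < β) (h1 : β < 1836 / 10000)
    (hX : 2 * β ≤ X) (hX' : X ≤ 2022 / 1000 * β) (hY : 0 ≤ Y) (hY' : Y ≤ X * (102 / 1000))
    (hx : 0 ≤ x) (hx' : x ≤ X * (102 / 1000)) (hy : 0 ≤ y) (hy' : y ≤ X * (102 / 1000)) :
    VertexOne β ((1 - X) * (1 + Y)) x y := by
  have le : (1 - X) * (1 + Y) ≤ 1 - 179 / 100 * β := by nlinarith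
  have mn : ∀ x y : ℝ, 0 ≤ x → x ≤ X * (102 / 1000) → 0 ≤ y →
      (1 - X) * (1 + Y) ≤ (1 - x) * (1 + y) := fun x y hx hx' hy => by nlinarith
  have m : ∀ x y : ℝ, - (X * (102 / 1000)) ≤ x → -(X * (102 / 1000)) ≤ y →
      1 ≤ (1 - 2 * β + x) * (3 - 2 * β + y) := by
    intro x y hx hy
    calc (1 : ℝ) ≤ (1 / 2) * 2 := by norm_num
      _ ≤ _ := mul_le_mul (by linarith) (by linarith) (by norm_num) (by linarith)
  refine ⟨?_, ?_, mn _ _ hx hx' hy, ?_, ?_, ?_, ?_, ?_⟩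
  · rw [abs_of_nonneg hx]; linarith
  · rw [abs_of_nonneg hy]; linarith
  · have := mn _ _ hy hy' hx; linarith
  · have := m (-x) (-y) (by linarith) (by linarith); linarith
  · have := m (-y) (-x) (by linarith) (by linarith); linarith
  · have := m x y (by linarith) (by linarith); linarith
  · have := m y x (by linarith) (by linarith); linarith

namespace CFPair

variable {b : ℕ} {α β : ℝ}

/-- The value of the class `2k`, `b` even. -/
lemma hasValue_spike (P : CFPair b α β) (hb : Even b) (h6 : β < 1836 / 10000) {k : ℕ}
    (hk : 1 ≤ k) : HasValue b α β ((1 - β * (2 / (1 - (α * β) ^ (k + 1)))) *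
      (1 + β * (2 / (1 - (α * β) ^ (k + 1)) * (α * β) ^ k))) (fun _ => 1)
      (spikeLabel (k + 1) 2) := by
  have h0 := P.beta_pos
  have hD := P.D_pos
  have hDm := P.D_mul
  obtain ⟨D, hDdef⟩ : ∃ D, α * β = D := ⟨_, rfl⟩
  rw [hDdef] at hD hDm ⊢
  have hD' : D < 102 / 1000 := by
    by_contra hcon
    push Not at hcon
    nlinarith
  have hDn : D ^ (k + 1) ≤ D ^ 2 := pow_le_pow_of_le_one hD.le (by linarith) (by omega)
  have hD2 : D ^ 2 < 105 / 10000 := by nlinarith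
  have hDk : ∀ i, 1 ≤ i → D ^ i ≤ 102 / 1000 := fun i hi => by
    calc D ^ i ≤ D ^ 1 := pow_le_pow_of_le_one hD.le (by linarith) hi
      _ ≤ 102 / 1000 := by rw [pow_one]; exact hD'.le
  have hDn0 := pow_pos hD (k + 1)
  -- `E` is the geometric sum of `2 D ^ (i (k + 1))`, the coordinate at either end of a `2` looking
  -- across it.
  obtain ⟨E, hE⟩ : ∃ E, E = 2 / (1 - D ^ (k + 1)) := ⟨_, rfl⟩
  rw [← hE]
  have hEm : E = 2 + D ^ (k + 1) * E := by
    have : E * (1 - D ^ (k + 1)) = 2 := by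
      rw [hE]; exact div_mul_cancel₀ _ (by linarith)
    linarith
  have hE1 : 2 < E := by rw [hE, lt_div_iff₀ (by linarith)]; linarith
  have hE2 : E < 2022 / 1000 := by rw [hE, div_lt_iff₀ (by linarith)]; linarith
  have x1 : 2 * β ≤ β * E := by nlinarith
  have x2 : β * E ≤ 2022 / 1000 * β := by nlinarith
  have x0 : 0 < β * E := by linarith
  have y0 : ∀ i, 0 ≤ β * (E * D ^ i) := fun i => by positivity
  have y1 : ∀ i, 1 ≤ i → β * (E * D ^ i) ≤ β * E * (102 / 1000) := fun i hi => by
    rw [← mul_assoc]; exact mul_le_mul_of_nonneg_left (hDk i hi) x0.le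
  refine hasValue_of_periodic hDdef (N := k) (T := fun _ => 1) (S := fun r => if r = 0 then 2 else 0)
    (G := fun r => if r = 0 then E * D ^ k else E * D ^ (r - 1))
    (H := fun r => if r = 0 then E else E * D ^ (k + 1 - r))
    (mul_pos (by linarith) (by linarith [y0 k])) ?_ ?_ ?_ ?_ ?_
    (fun r _ => Or.inr rfl) ?_ ?_ ?_ (fun r _ h => by simp at h) (r₀ := 0) (Nat.zero_le _)
    (Or.inl ⟨rfl, Or.inr (Or.inl (by simp; ring))⟩)
  · nlinarith [y0 k, y1 k hk]
  · intro r hr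
    rcases r with _ | r
    · simp only [if_true, zero_add, one_ne_zero, if_false, Nat.add_sub_cancel]
      push_cast; linear_combination hEm
    · simp only [Nat.succ_ne_zero, if_false]
      rw [show k + 1 - (r + 1) = k + 1 - (r + 1 + 1) + 1 by omega, pow_succ]
      push_cast; ring
  · simp only [show k ≠ 0 by omega, if_false, if_true, Nat.add_sub_cancel_left]
    push_cast; ring
  · intro r hr
    rcases r with _ | r
    · simp only [if_true, zero_add, one_ne_zero, if_false, Nat.sub_self]
      push_cast; linear_combination hEm
    · simp only [Nat.succ_ne_zero, if_false, Nat.add_sub_cancel]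
      push_cast; ring
  · simp only [show k ≠ 0 by omega, if_false, if_true]
    obtain ⟨i, rfl⟩ := Nat.exists_eq_add_of_le' hk
    simp only [Nat.add_sub_cancel]; push_cast; ring
  · intro r hr
    split_ifs <;> (rw [Int.even_iff]; have := (Int.even_coe_nat b).2 hb; rw [Int.even_iff] at this; omega)
  · split_ifs <;> (rw [Int.even_iff]; have := (Int.even_coe_nat b).2 hb; rw [Int.even_iff] at this; omega)
  · intro r hr _
    rcases r with _ | _ | r
    · exact vertexOne_spike h0 h6 x1 x2 (y0 k) (y1 k hk)
    · simpa using (vertexOne_spike h0 h6 x1 x2 (y0 k) (y1 k hk)).symm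
    · simp only [Nat.succ_ne_zero, if_false]
      exact vertexOne_between_spikes h0 h6 x1 x2 (y0 k) (y1 k hk) (y0 _) (y1 _ (by omega)) (y0 _)
        (y1 _ (by omega))

end CFPair

namespace CFPair

variable {b : ℕ} {α β : ℝ}

/-- The value of the class `2k + 1`, `b` even. -/
lemma hasValue_pair (P : CFPair b α β) (hb : Even b) (k : ℕ) :
    HasValue b α β ((1 - β) ^ 2 -
      (β * (1 - (α * β) ^ (k + 1) * ((1 - α * β) / (1 - (α * β) ^ (k + 2))))) ^ 2)
      (gapVertex (k + 2)) (pairLabel (k + 2) 1) := by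
  have h0 := P.beta_pos
  have h1 := P.beta_lt
  have hD := P.D_pos
  have hD1 := P.D_lt
  obtain ⟨D, hDdef⟩ : ∃ D, α * β = D := ⟨_, rfl⟩
  rw [hDdef] at hD hD1 ⊢
  have hDn : D ^ (k + 2) ≤ D ^ 1 := pow_le_pow_of_le_one hD.le (by linarith) (by omega)
  rw [pow_one] at hDn
  have hDi : ∀ i, D ^ i ≤ 1 := fun i => pow_le_one₀ hD.le (by linarith)
  have hDi0 : ∀ i, 0 < D ^ i := fun i => pow_pos hD i
  obtain ⟨E, hE⟩ : ∃ E, E = (1 - D) / (1 - D ^ (k + 2)) := ⟨_, rfl⟩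
  rw [← hE]
  have hEm : E = 1 - D + D ^ (k + 2) * E := by
    have : E * (1 - D ^ (k + 2)) = 1 - D := by
      rw [hE]; exact div_mul_cancel₀ _ (by linarith)
    linarith
  have hE0 : 0 < E := by rw [hE]; exact div_pos (by linarith) (by linarith)
  have hE1 : E ≤ 1 := by rw [hE, div_le_one (by linarith)]; linarith
  have q0 : ∀ i, 0 < D ^ i * E := fun i => mul_pos (hDi0 i) hE0
  have q1 : ∀ i, D ^ i * E ≤ 1 := fun i => mul_le_one₀ (hDi i) hE0.le hE1
  -- The coordinates at the label-`0` vertex are `X` and `-X`, so its product is a difference of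
  -- squares.
  obtain ⟨X, hX⟩ : ∃ X, X = 1 - D ^ (k + 1) * E := ⟨_, rfl⟩
  have hX0 : 0 ≤ X := by linarith [q1 (k + 1)]
  have hX1 : X ≤ 1 := by linarith [q0 (k + 1)]
  have hβX : β * X ≤ β := by nlinarith
  have hβX0 : 0 ≤ β * X := by positivity
  rw [← hX]
  have be := (Int.even_coe_nat b).2 hb
  have hc : 0 < (1 - β) ^ 2 - (β * X) ^ 2 := by nlinarith
  refine hasValue_of_periodic hDdef (N := k + 1) (T := fun r => if r = 1 then 0 else 1)
    (S := fun r => if r = 0 then 1 else if r = 1 then -1 else 0)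
    (G := fun r => if r = 0 then -(D ^ k * E) else if r = 1 then X else -(D ^ (r - 2) * E))
    (H := fun r => if r = 0 then E else if r = 1 then -X else D ^ (k + 2 - r) * E)
    hc (by nlinarith) ?_ ?_ ?_ ?_ ?_ ?_ ?_ ?_ ?_ (r₀ := 1) (by omega)
    (Or.inr ⟨rfl, Or.inl (by simp; ring)⟩)
  · intro r hr
    rcases r with _ | _ | r
    · simp only [if_true, zero_add, one_ne_zero, if_false]
      rw [hX]; push_cast; linear_combination hEm
    · simp only [zero_add, one_ne_zero, if_true, if_false]
      rw [if_neg (by omega), if_neg (by omega), hX,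
        show k + 2 - (1 + 1) = k by omega]
      push_cast; ring
    · rw [if_neg (by omega), if_neg (by omega), if_neg (by omega), if_neg (by omega),
        if_neg (by omega), if_neg (by omega),
        show k + 2 - (r + 1 + 1) = k + 2 - (r + 1 + 1 + 1) + 1 by omega, pow_succ]
      push_cast; ring
  · rcases k with _ | k
    · simp [hX]; ring
    · simp
  · intro r hr
    rcases r with _ | _ | r
    · simp [hX]; ring
    · simp [hX]
      linear_combination -hEm
    · simp
      ring
  · rcases k with _ | k
    · simp [hX] at hEm ⊢
      linear_combination -hEm
    · simp
      ring
  · intro r _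
    by_cases h : r = 1 <;> simp [h]
  · intro r _
    rw [Int.even_iff] at be ⊢
    rcases r with _ | _ | r <;> simp <;> omega
  · rw [Int.even_iff] at be ⊢
    rcases k with _ | k <;> simp <;> omega
  · intro r _ _
    refine vertexOne_of_le_one h0 h1 ?_ ?_ (by nlinarith)
    · split_ifs
      · rw [abs_neg, abs_of_pos (q0 _)]; exact q1 _
      · rw [abs_of_nonneg hX0]; exact hX1
      · rw [abs_neg, abs_of_pos (q0 _)]; exact q1 _
    · split_ifs
      · rw [abs_of_pos hE0]; exact hE1
      · rw [abs_neg, abs_of_nonneg hX0]; exact hX1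
      · rw [abs_of_pos (q0 _)]; exact q1 _
  · intro r _ hr
    have : r = 1 := by by_contra h; simp [h] at hr
    subst this
    simp only [one_ne_zero, if_true, if_false]
    refine ⟨?_, ?_, ?_, ?_⟩
    · rw [abs_of_nonneg hβX0]; linarith
    · rw [mul_neg, abs_neg, abs_of_nonneg hβX0]; linarith
    · linarith
    · linarith

/-- `u = 1 / √(b² - 2b)`. -/
lemma sub_two_mul (P : CFPair b α β) : ((b : ℝ) - 2) * (β / (1 - α * β)) = 1 - β := by
  have hD := P.D_mul
  have h := P.b_mul_beta
  have := P.D_lt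
  rw [← mul_div_assoc, div_eq_iff (by linarith)]
  linear_combination h + hD

lemma sq_mul (P : CFPair b α β) : (β / (1 - α * β)) ^ 2 * ((b : ℝ) ^ 2 - 2 * b) = 1 := by
  have hD := P.D_mul
  have h := P.b_mul_beta
  have h3 := P.sub_two_mul
  have := P.D_lt
  have e : b * (β / (1 - α * β)) * (1 - β) = 1 := by
    rw [← mul_div_assoc, div_mul_eq_mul_div, div_eq_iff (by linarith)]
    linear_combination (1 - β) * h + hD
  calc _ = b * (β / (1 - α * β)) * ((b - 2) * (β / (1 - α * β))) := by ring
    _ = 1 := by rw [h3, e]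

/-- Values on constant codes. -/
lemma hasValue_const (P : CFPair b α β) {n : ℕ} (hn : Even (b + n)) {c x : ℝ}
    (hx : x = n * (β / (1 - α * β))) (hx1 : x ≤ 1 / 2) (hc : 0 < c) (hm : c ≤ 1 - x ^ 2)
    (hs : c ≤ (1 - 2 * β - x) * (3 - 2 * β - x))
    (hatt : c = 1 - x ^ 2 ∨ c = (1 - 2 * β - x) * (3 - 2 * β - x)) :
    HasValue b α β c (fun _ => 1) fun _ => n := by
  have h0 := P.beta_pos
  have h1 := P.beta_lt
  have hD1 := P.D_lt
  have hy : x = β * (n / (1 - α * β)) := by rw [hx]; ring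
  have hx0 : 0 ≤ x := by
    rw [hy]; exact mul_nonneg h0.le (div_nonneg (Nat.cast_nonneg _) (by linarith))
  obtain ⟨e, he⟩ : ∃ e, e = n / (1 - α * β) := ⟨_, rfl⟩
  rw [← he] at hy
  have hem : e = n + α * β * e := by
    have : e * (1 - α * β) = n := by rw [he]; exact div_mul_cancel₀ _ (by linarith)
    linarith
  have m : c ≤ (1 - 2 * β + x) * (3 - 2 * β + x) := by nlinarith
  have even : Even ((b : ℤ) + n + 1 + 1) := by
    have := (Int.even_coe_nat _).2 hn
    rw [Int.even_iff] at this ⊢; push_cast at this; omega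
  refine hasValue_of_periodic rfl (N := 0) (T := fun _ => 1) (S := fun _ => n) (G := fun _ => e)
    (H := fun _ => e) hc (by nlinarith) (fun r hr => by simpa using hem) (by simpa using hem)
    (fun r hr => by simpa using hem) (by simpa using hem) (fun r _ => Or.inr rfl)
    (fun r hr => by simpa using even) (by simpa using even) (fun r _ _ => ?_)
    (fun r _ h => by simp at h) le_rfl (Or.inl ⟨rfl, ?_⟩)
  · rw [← hy]
    refine ⟨?_, ?_, by linarith, by linarith, hs, by linarith, m, by linarith⟩ <;>
    · rw [abs_of_nonneg hx0]; exact hx1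
  · rcases hatt with h | h
    · exact Or.inl (by rw [← hy, h]; ring)
    · exact Or.inr (Or.inr (Or.inl (by rw [← hy, h])))

end CFPair

/-! ### Periodic codes for odd `b`. -/

lemma alternating_product_le {w T Q A B : ℝ} (w0 : 0 < w) (w1 : w ≤ 1 / 4) (hT0 : 0 < T)
    (hT : T ≤ 3 / 10) (hQ : 0 < Q) (hA : A ≤ T) (hB : Q ≤ B) :
    (1 - w * (1 + T)) * (1 - w * (1 - Q)) ≤ (1 - w * (1 + A)) * (1 - w * (1 - B)) := by
  have a : w * (1 + A) ≤ w * (1 + T) := mul_le_mul_of_nonneg_left (by linarith) w0.le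
  have b : w * (1 - B) ≤ w * (1 - Q) := mul_le_mul_of_nonneg_left (by linarith) w0.le
  have c : w * (1 + T) ≤ 1 / 4 * (1 + 3 / 10) :=
    mul_le_mul w1 (by linarith) (by linarith) (by norm_num)
  have d : w * (1 - Q) ≤ w * 1 := mul_le_mul_of_nonneg_left (by linarith) w0.le
  exact mul_le_mul (by linarith) (by linarith) (by linarith) (by linarith)

lemma alternating_product_le_sq {w T Q : ℝ} (w0 : 0 < w) (w1 : w ≤ 1 / 4) (hT0 : 0 < T)
    (hQ : 0 < Q) (hQT : Q ≤ T) :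
    (1 - w * (1 + T)) * (1 - w * (1 - Q)) ≤ (1 - w) ^ 2 := by
  have e : (1 - w * (1 + T)) * (1 - w * (1 - Q)) = (1 - w) ^ 2 -
      ((1 - w) * (w * (T - Q)) + w ^ 2 * (T * Q)) := by ring
  have : 0 ≤ (1 - w) * (w * (T - Q)) :=
    mul_nonneg (by linarith) (mul_nonneg w0.le (by linarith))
  have : 0 ≤ w ^ 2 * (T * Q) := mul_nonneg (sq_nonneg w) (mul_nonneg hT0.le hQ.le)
  linarith

lemma one_le_alternating_product {w A B : ℝ} (w0 : 0 < w) (hA : 0 ≤ A) (hB : B ≤ 1) :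
    1 ≤ (1 + w * (1 + A)) * (1 + w * (1 - B)) :=
  one_le_mul_of_one_le_of_one_le (by nlinarith) (by nlinarith)

lemma quad_mixed_product_le {β u v p q : ℝ} (h0 : 0 < β) (h1 : β < 2255 / 10000)
    (u0 : 17 / 20 ≤ u) (v0 : 17 / 20 ≤ v) (v1 : v ≤ 23 / 20)
    (p1 : p ≤ 23 / 20) (q0 : 17 / 20 ≤ q) :
    (1 - β * u) * (1 - β * v) ≤ (1 - β * p) * (1 + β * q) := by
  have hu := mul_le_mul_of_nonneg_left u0 h0.le
  have hv := mul_le_mul_of_nonneg_left v0 h0.le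
  have hv1 := mul_le_mul_of_nonneg_left v1 h0.le
  have hp := mul_le_mul_of_nonneg_left p1 h0.le
  have hq := mul_le_mul_of_nonneg_left q0 h0.le
  have e : (1 - β * u) * (1 - β * v) ≤ (1 - 17 / 20 * β) * (1 - 17 / 20 * β) :=
    mul_le_mul (by linarith) (by linarith) (by linarith) (by linarith)
  have f : (1 - 23 / 20 * β) * (1 + 17 / 20 * β) ≤ (1 - β * p) * (1 + β * q) :=
    mul_le_mul (by linarith) (by linarith) (by linarith) (by linarith)
  nlinarith

lemma quad_product_le {β u v p q : ℝ} (h0 : 0 < β) (h1 : β < 2255 / 10000)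
    (u0 : 17 / 20 ≤ u) (v0 : 17 / 20 ≤ v) (v1 : v ≤ 23 / 20)
    (p0 : 0 ≤ p) (q0 : 0 ≤ q) :
    (1 - β * u) * (1 - β * v) ≤ (1 + β * p) * (1 + β * q) := by
  have hu := mul_le_mul_of_nonneg_left u0 h0.le
  have hv := mul_le_mul_of_nonneg_left v0 h0.le
  have hv1 := mul_le_mul_of_nonneg_left v1 h0.le
  have hp := mul_nonneg h0.le p0
  have hq := mul_nonneg h0.le q0
  have e : (1 - β * u) * (1 - β * v) ≤ 1 * 1 :=
    mul_le_mul (by linarith) (by linarith) (by linarith) (by linarith)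
  have : 1 ≤ (1 + β * p) * (1 + β * q) :=
    one_le_mul_of_one_le_of_one_le (by linarith) (by linarith)
  linarith

lemma sq_one_sub_le_one {β : ℝ} (h0 : 0 < β) (h1 : β < 2255 / 10000) :
    (1 - β + β ^ 2 / 2) ^ 2 ≤ 1 := pow_le_one₀ (by nlinarith) (by nlinarith)

lemma quad_bounds {D Q : ℝ} (hD : 0 < D) (hD1 : D < 128 / 1000) (hQ : Q = 1 / (1 - D ^ 4)) :
    Q * (1 - D ^ 4) = 1 ∧ 1 ≤ Q ∧
      (17 / 20 ≤ (1 + D + D ^ 2 - D ^ 3) * Q ∧ (1 + D + D ^ 2 - D ^ 3) * Q ≤ 23 / 20) ∧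
      (17 / 20 ≤ (1 - D - D ^ 2 - D ^ 3) * Q ∧ (1 - D - D ^ 2 - D ^ 3) * Q ≤ 23 / 20) ∧
      (17 / 20 ≤ (1 + D - D ^ 2 + D ^ 3) * Q ∧ (1 + D - D ^ 2 + D ^ 3) * Q ≤ 23 / 20) ∧
      (17 / 20 ≤ (1 - D + D ^ 2 + D ^ 3) * Q ∧ (1 - D + D ^ 2 + D ^ 3) * Q ≤ 23 / 20) := by
  have hD2 : D ^ 2 ≤ 164 / 10000 := by nlinarith
  have hD2' : D ^ 2 ≤ 128 / 1000 * D := by nlinarith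
  have hD3 : D ^ 3 ≤ 164 / 10000 * D := by nlinarith
  have hD2p := pow_pos hD 2
  have hD3' := pow_pos hD 3
  have hD4 : D ^ 4 ≤ 3 / 10000 := by nlinarith
  have hD4' := pow_pos hD 4
  have hQm : Q * (1 - D ^ 4) = 1 := by rw [hQ]; exact div_mul_cancel₀ _ (by linarith)
  have hQ1 : 1 ≤ Q := by rw [hQ, le_div_iff₀ (by linarith)]; linarith
  have hQ2 : Q ≤ 1001 / 1000 := by rw [hQ, div_le_iff₀ (by linarith)]; linarith
  have mem : ∀ p : ℝ, 17 / 20 ≤ p → p ≤ 1146 / 1000 → 17 / 20 ≤ p * Q ∧ p * Q ≤ 23 / 20 := by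
    intro p h1 h2
    have := mul_le_mul_of_nonneg_left hQ1 (show 0 ≤ p by linarith)
    have := mul_le_mul h2 hQ2 (by linarith) (by norm_num)
    constructor <;> linarith
  exact ⟨hQm, hQ1, mem _ (by linarith) (by linarith), mem _ (by linarith) (by linarith),
    mem _ (by linarith) (by linarith), mem _ (by linarith) (by linarith)⟩

/-- The product is at most the square of its mean factor, and the mean of the two coordinates is at
least `1 / (1 + D)`, the coordinate of the alternating code. -/
lemma quad_product_le_sq {β D Q : ℝ} (h0 : 0 < β) (h1 : β < 2255 / 10000) (hD : 0 < D)
    (hD1 : D < 128 / 1000) (hQ : Q = 1 / (1 - D ^ 4))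
    (hw : β * (1 / (1 + D)) = β - β ^ 2 / 2) :
    (1 - β * ((1 + D + D ^ 2 - D ^ 3) * Q)) * (1 - β * ((1 - D - D ^ 2 - D ^ 3) * Q)) ≤
      (1 - β + β ^ 2 / 2) ^ 2 := by
  obtain ⟨hQm, hQ1, ⟨u0, u1⟩, ⟨v0, v1⟩, -, -⟩ := quad_bounds hD hD1 hQ
  have hw1 : (1 / (1 + D)) ≤ ((1 + D + D ^ 2 - D ^ 3) * Q + (1 - D - D ^ 2 - D ^ 3) * Q) / 2 := by
    rw [div_le_iff₀ (by linarith)]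
    have h3 : D ^ 3 ≤ D := by
      calc D ^ 3 ≤ D ^ 1 := pow_le_pow_of_le_one hD.le (by linarith) (by norm_num)
        _ = D := pow_one D
    have : 0 ≤ Q * (D - D ^ 3) := mul_nonneg (by linarith) (by linarith)
    linarith
  generalize (1 + D + D ^ 2 - D ^ 3) * Q = u at *
  generalize (1 - D - D ^ 2 - D ^ 3) * Q = v at *
  have e1 : (1 - β * u) * (1 - β * v) ≤ (1 - β * ((u + v) / 2)) ^ 2 := by
    linarith [sq_nonneg (β * (u - v))]
  have e2 : 1 - β * ((u + v) / 2) ≤ 1 - β + β ^ 2 / 2 := by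
    have := mul_le_mul_of_nonneg_left hw1 h0.le
    linarith
  have e3 : 0 ≤ 1 - β * ((u + v) / 2) := by
    have := mul_le_mul_of_nonneg_left (show (u + v) / 2 ≤ 23 / 20 by linarith) h0.le
    linarith
  exact e1.trans (pow_le_pow_left₀ e3 e2 2)

namespace CFPair

variable {b : ℕ} {α β : ℝ}

lemma beta_mul_inv (P : CFPair b α β) : β * (1 / (1 + α * β)) = β - β ^ 2 / 2 := by
  have hD := P.D_mul
  have := P.D_pos
  rw [mul_one_div, div_eq_iff (by linarith)]
  linear_combination (-β / 2) * hD

/-- The value of the class `-2`, `b` odd. -/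
lemma hasValue_alternating_two (P : CFPair b α β) (hb : Odd b) :
    HasValue b α β ((1 - β + β ^ 2 / 2) ^ 2) (fun _ => 1) (alternatingLabel 2 1) := by
  have h0 := P.beta_pos
  have h1 := P.beta_lt'
  have hD := P.D_pos
  have hw := P.beta_mul_inv
  obtain ⟨D, hDdef⟩ : ∃ D, α * β = D := ⟨_, rfl⟩
  rw [hDdef] at hD hw
  obtain ⟨I, hI⟩ : ∃ I, I = 1 / (1 + D) := ⟨_, rfl⟩
  rw [← hI] at hw
  have hIm : I * (1 + D) = 1 := by rw [hI]; exact div_mul_cancel₀ _ (by linarith)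
  have hI0 : 0 < I := by rw [hI]; positivity
  have hI1 : I ≤ 1 := by nlinarith
  have hI2 : |I| ≤ 23 / 20 := by rw [abs_of_pos hI0]; linarith
  have hI3 : |-I| ≤ 23 / 20 := by rw [abs_neg]; exact hI2
  have ho : Odd (b : ℤ) := by exact_mod_cast hb
  refine hasValue_of_periodic hDdef (N := 1) (T := fun _ => 1) (S := fun r => (-1) ^ r * 1)
    (G := fun r => if r = 0 then -I else I) (H := fun r => if r = 0 then I else -I)
    (pow_pos (by linarith [sq_nonneg β]) 2) (sq_one_sub_le_one h0 h1) (fun r hr => ?_) ?_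
    (fun r hr => ?_) ?_ (fun r _ => Or.inr rfl) (fun r hr => ?_) ?_ (fun r hr _ => ?_)
    (fun r _ h => by simp at h) (r₀ := 0) (by omega) (Or.inl ⟨rfl, ?_⟩)
  · obtain rfl : r = 0 := by omega
    simp; linarith
  · simp; linarith
  · obtain rfl : r = 0 := by omega
    simp; linarith
  · simp; linarith
  · obtain rfl : r = 0 := by omega
    rw [Int.odd_iff] at ho
    rw [Int.even_iff]; simp; omega
  · rw [Int.odd_iff] at ho
    rw [Int.even_iff]; simp; omega
  · have : r = 0 ∨ r = 1 := by omega
    rcases this with rfl | rfl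
    · simp only [if_true]
      exact vertexOne_of_main h0 h1 hI3 hI2 le_rfl (by rw [mul_neg, hw]; nlinarith)
        (by rw [mul_neg, hw]; apply le_of_eq; ring)
    · simp only [one_ne_zero, if_false]
      exact vertexOne_of_main h0 h1 hI2 hI3 le_rfl (by rw [mul_neg, hw]; apply le_of_eq; ring)
        (by rw [mul_neg, hw]; nlinarith)
  · right; left
    simp only [if_true]
    rw [mul_neg, hw]; ring

/-- The value of the class `2k`, `b` odd. -/
lemma hasValue_alternating (P : CFPair b α β) (hb : Odd b) {k : ℕ} (hk : 1 ≤ k) :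
    HasValue b α β
      ((1 - β * (1 / (1 + α * β)) * (1 + 2 * (α * β) / (1 - (α * β) ^ (2 * k + 1)))) *
        (1 - β * (1 / (1 + α * β)) *
          (1 - (α * β) ^ (2 * k - 1) * (2 * (α * β) / (1 - (α * β) ^ (2 * k + 1))))))
      (fun _ => 1) (alternatingLabel (2 * k + 1) (-1)) := by
  have h0 := P.beta_pos
  have h1 := P.beta_lt'
  have hD := P.D_pos
  have hD1 := P.D_lt
  have hw := P.beta_mul_inv
  obtain ⟨D, hDdef⟩ : ∃ D, α * β = D := ⟨_, rfl⟩
  rw [hDdef] at hD hD1 hw ⊢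
  obtain ⟨I, hI⟩ : ∃ I, I = 1 / (1 + D) := ⟨_, rfl⟩
  rw [← hI] at hw ⊢
  have hIm : I * (1 + D) = 1 := by rw [hI]; exact div_mul_cancel₀ _ (by linarith)
  have hI0 : 0 < I := by rw [hI]; positivity
  have hI1 : I ≤ 1 := by nlinarith
  have hDn : D ^ (2 * k + 1) ≤ D ^ 2 := pow_le_pow_of_le_one hD.le (by linarith) (by omega)
  have hD2 : D ^ 2 ≤ 164 / 10000 := by nlinarith
  -- In units of `1 / (1 + D)` unbroken alternation has coordinates `±1`. `T` is the deviation
  -- produced by the repeated label where two periods meet, and it shrinks by a factor `D` with each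
  -- step away.
  obtain ⟨T, hT⟩ : ∃ T, T = 2 * D / (1 - D ^ (2 * k + 1)) := ⟨_, rfl⟩
  rw [← hT]
  have hTm : T = 2 * D + D ^ (2 * k + 1) * T := by
    have : T * (1 - D ^ (2 * k + 1)) = 2 * D := by
      rw [hT]; exact div_mul_cancel₀ _ (by linarith)
    linarith
  have hT0 : 0 < T := by rw [hT]; exact div_pos (by linarith) (by linarith)
  have hT1 : T ≤ 204 / 100 * D := by
    rw [hT, div_le_iff₀ (by linarith)]; 
    have := mul_le_mul_of_nonneg_left (hDn.trans hD2) hD.le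
    linarith
  have hDi : ∀ i, D ^ i ≤ 1 := fun i => pow_le_one₀ hD.le (by linarith)
  have q0 : ∀ i, 0 < D ^ i * T := fun i => mul_pos (pow_pos hD i) hT0
  have q1 : ∀ i, D ^ i * T ≤ T := fun i => mul_le_of_le_one_left hT0.le (hDi i)
  have qm : ∀ i j, i ≤ j → D ^ j * T ≤ D ^ i * T := fun i j hij =>
    mul_le_mul_of_nonneg_right (pow_le_pow_of_le_one hD.le (by linarith) hij) hT0.le
  have hIT : (1 + T) * I ≤ 23 / 20 := by
    have : (1 + T) * I ≤ (23 / 20 * (1 + D)) * I :=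
      mul_le_mul_of_nonneg_right (by linarith) hI0.le
    linarith
  obtain ⟨w, hwd⟩ : ∃ w, w = β * I := ⟨_, rfl⟩
  have hw0 : 0 < w := by rw [hwd]; positivity
  have hw1 : w ≤ 1 / 4 := by rw [hwd, hw]; linarith [sq_nonneg β]
  rw [← hwd]
  have hab : ∀ s x : ℝ, (s = 1 ∨ s = -1) → 0 ≤ x → x ≤ T → |(s - x) * I| ≤ 23 / 20 := by
    intro s x hs hx hx'
    rw [abs_mul, abs_of_pos hI0]
    refine le_trans (mul_le_mul_of_nonneg_right ?_ hI0.le) hIT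
    rcases hs with rfl | rfl <;> rw [abs_le] <;> constructor <;> linarith
  have hqN := q1 (2 * k - 1)
  have hqN0 := q0 (2 * k - 1)
  have hc1 := alternating_product_le_sq hw0 hw1 hT0 hqN0 hqN
  have hcw : (1 - w) ^ 2 = (1 - β + β ^ 2 / 2) ^ 2 := by rw [hwd, hw]; ring
  have hwT : w * (1 + T) ≤ 23 / 20 * β := by
    
    have := mul_le_mul_of_nonneg_left hIT h0.le
    rw [hwd]; linarith
  have hT3 : T ≤ 3 / 10 := by linarith
  have hpos : 0 < 1 - w * (1 + T) := by linarith
  have hpos' : 0 < 1 - w * (1 - D ^ (2 * k - 1) * T) := by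
    have : w * (1 - D ^ (2 * k - 1) * T) ≤ w * 1 :=
      mul_le_mul_of_nonneg_left (by linarith) hw0.le
    linarith
  have hmain := fun A B (hA : A ≤ T) (hB : D ^ (2 * k - 1) * T ≤ B) =>
    alternating_product_le hw0 hw1 hT0 hT3 hqN0 hA hB
  have hw2 : (1 - w) ^ 2 ≤ 1 := pow_le_one₀ (by linarith) (by linarith)
  have hmain' : ∀ A B : ℝ, 0 ≤ A → 0 ≤ B → B ≤ T →
      (1 - w * (1 + T)) * (1 - w * (1 - D ^ (2 * k - 1) * T)) ≤
        (1 + w * (1 + A)) * (1 + w * (1 - B)) := fun A B hA _ hBT =>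
    (hc1.trans hw2).trans (one_le_alternating_product hw0 hA (by linarith))
  have ho : Odd (b : ℤ) := by exact_mod_cast hb
  have hpar : ∀ r : ℕ, Even ((b : ℤ) + (-1) ^ r * (-1) + 1 + 1) := fun r => by
    rw [Int.odd_iff] at ho
    rw [Int.even_iff]
    rcases neg_one_pow_eq_or ℤ r with h | h <;> rw [h] <;> omega
  have hone : ∀ r : ℕ, ((-1) ^ r = (1 : ℝ) ∨ (-1) ^ r = (-1 : ℝ)) := neg_one_pow_eq_or ℝ
  obtain ⟨N, hN, hN1⟩ : ∃ N, N = 2 * k ∧ 2 ≤ N := ⟨_, rfl, by omega⟩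
  have hNe : (-1 : ℝ) ^ N = 1 := by rw [hN]; simp
  simp only [← hN] at hTm hqN hqN0 hc1 hpos' hmain hmain' ⊢
  refine hasValue_of_periodic hDdef (N := N) (T := fun _ => 1) (S := fun r => (-1) ^ r * (-1))
    (G := fun r => if r = 0 then -(1 + D ^ N * T) * I else ((-1) ^ r - D ^ (r - 1) * T) * I)
    (H := fun r => -((-1) ^ r + D ^ (N - r) * T) * I)
    (mul_pos hpos hpos') (hc1.trans hw2) (fun r hr => ?_) ?_ (fun r hr => ?_) ?_
    (fun r _ => Or.inr rfl) (fun r hr => hpar r) (hpar N) (fun r hr _ => ?_)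
    (fun r _ h => by simp at h) (r₀ := 1) (by omega) (Or.inl ⟨rfl, ?_⟩)
  · obtain ⟨i, rfl⟩ : ∃ i, N = r + 1 + i := ⟨N - (r + 1), by omega⟩
    rw [show r + 1 + i - r = i + 1 by omega, Nat.add_sub_cancel_left]
    push_cast
    rw [pow_succ, pow_succ]
    linear_combination (-(-1) ^ r) * hIm
  · simp only [Nat.sub_self, Nat.sub_zero]
    push_cast
    rw [hNe]
    linear_combination (-1) * I * hTm + hIm * (-1) 
  · rcases r with _ | r
    · simp
      linear_combination (-1) * I * hTm + hIm * (-1) 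
    · simp only [Nat.succ_ne_zero, if_false, Nat.add_sub_cancel]
      push_cast
      rw [pow_succ (-1 : ℝ) (r + 1), pow_succ D]
      linear_combination (-(-1) ^ (r + 1)) * hIm
  · simp only [if_true, show N ≠ 0 by omega, if_false]
    push_cast
    rw [hNe]
    obtain ⟨i, rfl⟩ := Nat.exists_eq_add_of_le' hN1
    rw [show i + 2 - 1 = i + 1 by omega]
    linear_combination (-1) * hIm
  · have hβ : ∀ x : ℝ, β * (x * I) = w * x := fun x => by rw [hwd]; ring
    rcases r with _ | r
    · simp only [if_true, Nat.sub_zero, pow_zero]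
      have bound : |-(1 + D ^ N * T) * I| ≤ 23 / 20 := by
        have := hab (-1) (D ^ N * T) (Or.inr rfl) (q0 _).le (q1 _)
        rwa [show -(1 + D ^ N * T) = -1 - D ^ N * T by ring]
      have small : (1 - w) ^ 2 ≤ 1 - (w * (1 + D ^ N * T)) ^ 2 := by
        have : w * (1 + D ^ N * T) ≤ w * (13 / 10) := by
          apply mul_le_mul_of_nonneg_left _ hw0.le; linarith [q1 N]
        have p := pow_le_pow_left₀ (mul_nonneg hw0.le (by linarith [q0 N])) this 2
        have q : w * w ≤ w * (1 / 4) := mul_le_mul_of_nonneg_left hw1 hw0.le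
        linarith
      refine vertexOne_of_main h0 h1 bound bound (hcw ▸ hc1) ?_ ?_ <;> rw [hβ] <;> linarith
    · simp only [Nat.succ_ne_zero, if_false, Nat.add_sub_cancel]
      have b1 := hab ((-1) ^ (r + 1)) (D ^ r * T) (hone _) (q0 _).le (q1 _)
      have b2 : |-((-1) ^ (r + 1) + D ^ (N - (r + 1)) * T) * I| ≤ 23 / 20 := by
        have := hab (-(-1) ^ (r + 1)) (D ^ (N - (r + 1)) * T)
          ((hone (r + 1)).elim (fun h => Or.inr (by rw [h])) fun h => Or.inl (by rw [h]; ring))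
          (q0 _).le (q1 _)
        rwa [show -((-1) ^ (r + 1) + D ^ (N - (r + 1)) * T) =
          -(-1) ^ (r + 1) - D ^ (N - (r + 1)) * T by ring]
      refine vertexOne_of_main h0 h1 b1 b2 (hcw ▸ hc1) ?_ ?_ <;> rw [hβ, hβ] <;>
        rcases hone (r + 1) with e | e <;> rw [e]
      · have := hmain (D ^ (N - (r + 1)) * T) (D ^ r * T) (q1 _) (qm _ _ (by omega))
        linarith
      · have := hmain' (D ^ r * T) (D ^ (N - (r + 1)) * T) (q0 _).le (q0 _).le (q1 _)
        linarith
      · have := hmain' (D ^ (N - (r + 1)) * T) (D ^ r * T) (q0 _).le (q0 _).le (q1 _)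
        linarith
      · have := hmain (D ^ r * T) (D ^ (N - (r + 1)) * T) (q1 _) (qm _ _ (by omega))
        linarith
  · right; left
    simp only [one_ne_zero, if_false, Nat.sub_self, pow_zero, pow_one]
    rw [hwd]; ring

/-- The value of the class `2k + 1`, `b` odd. -/
lemma hasValue_gap (P : CFPair b α β) (hb : Odd b) (k : ℕ) :
    HasValue b α β ((1 - β) ^ 2 - (β * (α * β * ((1 - (α * β) ^ (2 * k) *
      ((1 - (α * β) ^ 2) / (1 - (α * β) ^ (2 * k + 2)))) * (1 / (1 + α * β))))) ^ 2)
      (gapVertex (2 * k + 2)) (gapLabel (2 * k + 2) 1) := by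
  have h0 := P.beta_pos
  have h1 := P.beta_lt
  have hD := P.D_pos
  have hD1 := P.D_lt
  obtain ⟨D, hDdef⟩ : ∃ D, α * β = D := ⟨_, rfl⟩
  rw [hDdef] at hD hD1 ⊢
  obtain ⟨I, hI⟩ : ∃ I, I = 1 / (1 + D) := ⟨_, rfl⟩
  rw [← hI]
  have hIm : I * (1 + D) = 1 := by rw [hI]; exact div_mul_cancel₀ _ (by linarith)
  have hI0 : 0 < I := by rw [hI]; positivity
  have hI1 : I ≤ 1 := by nlinarith
  have hDn : D ^ (2 * k + 2) ≤ D ^ 2 := pow_le_pow_of_le_one hD.le (by linarith) (by omega)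
  have hD2 : D ^ 2 ≤ 164 / 10000 := by nlinarith
  have hDi : ∀ i, D ^ i ≤ 1 := fun i => pow_le_one₀ hD.le (by linarith)
  have hDi1 : ∀ i, 1 ≤ i → D ^ i ≤ D := fun i hi => by
    calc D ^ i ≤ D ^ 1 := pow_le_pow_of_le_one hD.le (by linarith) hi
      _ = D := pow_one D
  have hDi0 : ∀ i, 0 < D ^ i := fun i => pow_pos hD i
  obtain ⟨E, hE⟩ : ∃ E, E = (1 - D ^ 2) / (1 - D ^ (2 * k + 2)) := ⟨_, rfl⟩
  rw [← hE]
  have hEm : E = 1 - D ^ 2 + D ^ (2 * k + 2) * E := by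
    have : E * (1 - D ^ (2 * k + 2)) = 1 - D ^ 2 := by
      rw [hE]; exact div_mul_cancel₀ _ (by linarith)
    linarith
  have hE0 : 0 < E := by rw [hE]; exact div_pos (by linarith) (by linarith)
  have hE1 : E ≤ 1 := by rw [hE, div_le_one (by linarith)]; linarith
  have q0 : ∀ i, 0 < D ^ i * E := fun i => mul_pos (hDi0 i) hE0
  have q1 : ∀ i, D ^ i * E ≤ 1 := fun i => mul_le_one₀ (hDi i) hE0.le hE1
  have qD : ∀ i, 1 ≤ i → D ^ i * E ≤ D := fun i hi => 
    (mul_le_of_le_one_right (hDi0 i).le hE1).trans (hDi1 i hi)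
  -- The coordinates at the label-`0` vertex are `-D Z` and `D Z`, again giving a difference of
  -- squares.
  obtain ⟨Z, hZ⟩ : ∃ Z, Z = (1 - D ^ (2 * k) * E) * I := ⟨_, rfl⟩
  rw [← hZ]
  have hZ0 : 0 ≤ Z := by rw [hZ]; exact mul_nonneg (by linarith [q1 (2 * k)]) hI0.le
  have hZ1 : Z ≤ 1 := by
    rw [hZ]; exact mul_le_one₀ (by linarith [q0 (2 * k)]) hI0.le hI1
  have hDZ0 : 0 ≤ D * Z := by positivity
  have hDZ1 : D * Z ≤ 1 := mul_le_one₀ (by linarith) hZ0 hZ1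
  have hDDZ0 : 0 ≤ D ^ 2 * Z := by positivity
  have hDDZ1 : D ^ 2 * Z ≤ 1 := mul_le_one₀ (by linarith) hZ0 hZ1
  have hβ0 : 0 ≤ β * (D * Z) := by positivity
  have hβ1 : β * (D * Z) ≤ β := mul_le_of_le_one_right h0.le hDZ1
  have hβ2 : β * β ≤ β * 1 := mul_le_mul_of_nonneg_left (by linarith) h0.le
  have hsq : (β * (D * Z)) ^ 2 ≤ β ^ 2 := pow_le_pow_left₀ hβ0 hβ1 2
  have hZE : D ^ 2 * Z = (1 - E) * I := by rw [hZ]; linear_combination I * hEm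
  have ho : Odd (b : ℤ) := by exact_mod_cast hb
  rw [Int.odd_iff] at ho
  have hone : ∀ r : ℕ, ((-1) ^ r = (1 : ℝ) ∨ (-1) ^ r = (-1 : ℝ)) := neg_one_pow_eq_or ℝ
  obtain ⟨N, hN, hN1⟩ : ∃ N, N = 2 * k + 1 ∧ 1 ≤ N := ⟨_, rfl, by omega⟩
  have hNe : (-1 : ℝ) ^ N = -1 := by rw [hN, pow_succ]; simp
  have hk : 2 * k = N - 1 := by omega
  have hNn : 2 * k + 2 = N + 1 := by omega
  rw [hk] at hZ
  rw [hNn] at hEm ⊢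
  have hnil : N = 1 → E = 1 ∧ Z = 0 := by
    rintro rfl
    have : E = 1 := by
      have : E * (1 - D ^ 2) = 1 - D ^ 2 := by norm_num at hEm; linarith
      exact mul_right_cancel₀ (show 1 - D ^ 2 ≠ 0 by linarith) (by linarith)
    exact ⟨this, by rw [hZ, this]; simp⟩
  refine hasValue_of_periodic hDdef (N := N) (T := fun r => if r = 1 then 0 else 1)
    (S := fun r => if r < 2 then 0 else (-1) ^ r * 1)
    (G := fun r => if r = 0 then -Z else if r = 1 then -(D * Z) else
      (-(-1) ^ r + D ^ (r - 2) * E) * I)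
    (H := fun r => if r = 0 then D ^ 2 * Z else if r = 1 then D * Z else
      ((-1) ^ r - D ^ (N + 1 - r) * E) * I)
    (by linarith) (by linarith [sq_nonneg (β * (D * Z))]) (fun r hr => ?_) ?_ (fun r hr => ?_) ?_
    (fun r _ => ?_) (fun r hr => ?_) ?_ (fun r hr _ => ?_) (fun r hr h => ?_) (r₀ := 1) hN1
    (Or.inr ⟨rfl, Or.inl (by simp; ring)⟩)
  · rcases r with _ | _ | r
    · simp; ring
    · simp [hZ]
    · simp only [Nat.succ_ne_zero, if_false, show ¬ (r + 1 + 1 < 2) by omega,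
        show r + 1 + 1 ≠ 1 by omega, show r + 1 + 1 + 1 ≠ 1 by omega]
      rw [show N + 1 - (r + 1 + 1) = N + 1 - (r + 1 + 1 + 1) + 1 by omega, pow_succ D]
      push_cast
      rw [pow_succ (-1 : ℝ) (r + 1 + 1)]
      linear_combination (-1) ^ (r + 1 + 1) * hIm
  · by_cases h : N = 1
    · obtain ⟨hE', hZ'⟩ := hnil h
      subst h; simp [hZ']
    · simp only [show N ≠ 0 by omega, h, if_true, if_false, show ¬ (N < 2) by omega,
        Nat.add_sub_cancel_left]
      push_cast
      rw [hNe, hZE]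
      linear_combination (-1) * hIm
  · rcases r with _ | _ | r
    · simp
    · simp
      linear_combination hZE
    · simp only [Nat.succ_ne_zero, if_false, show ¬ (r + 1 + 1 < 2) by omega,
        show r + 1 + 1 ≠ 1 by omega, show r + 1 + 1 + 1 ≠ 1 by omega]
      rw [show r + 1 + 1 + 1 - 2 = r + 1 by omega, show r + 1 + 1 - 2 = r by omega, pow_succ D]
      push_cast
      rw [pow_succ (-1 : ℝ) (r + 1 + 1)]
      linear_combination (-1) ^ (r + 1 + 1) * hIm
  · by_cases h : N = 1
    · obtain ⟨hE', hZ'⟩ := hnil h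
      subst h; simp [hZ']
    · simp only [show N ≠ 0 by omega, h, if_true, if_false, show ¬ (N < 2) by omega]
      obtain ⟨i, rfl⟩ : ∃ i, N = i + 2 := ⟨N - 2, by omega⟩
      push_cast
      rw [hNe, hZ, show i + 2 - 1 = i + 1 by omega]
      linear_combination (-1) * hIm
  · by_cases h : r = 1 <;> simp [h]
  · rw [Int.even_iff]
    rcases r with _ | _ | r
    · simp; omega
    · simp; omega
    · simp
      rcases neg_one_pow_eq_or ℤ (r + 1 + 1) with e | e <;> rw [e] <;> omega
  · rw [Int.even_iff]
    by_cases h : N = 1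
    · simp [h]; omega
    · simp [h, show ¬ (N < 2) by omega]
      rcases neg_one_pow_eq_or ℤ N with e | e <;> rw [e] <;> omega
  · have key : ∀ x : ℝ, |x| ≤ 1 + D → |x * I| ≤ 1 := fun x hx => by
      rw [abs_mul, abs_of_pos hI0]; 
      have := mul_le_mul_of_nonneg_right hx hI0.le
      linarith
    refine vertexOne_of_le_one h0 h1 ?_ ?_ (by linarith [sq_nonneg (β * (D * Z))])
    · split_ifs with c1 c2
      · rw [abs_neg, abs_of_nonneg hZ0]; exact hZ1
      · rw [abs_neg, abs_of_nonneg hDZ0]; exact hDZ1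
      · apply key
        by_cases c3 : r = 2
        · subst c3; norm_num
          rw [abs_le]; constructor <;> linarith
        · have := qD (r - 2) (by omega)
          have := q0 (r - 2)
          rcases hone r with e | e <;> rw [e, abs_le] <;> constructor <;> linarith
    · split_ifs with c1 c2
      · rw [abs_of_nonneg hDDZ0]; exact hDDZ1
      · rw [abs_of_nonneg hDZ0]; exact hDZ1
      · apply key
        have := qD (N + 1 - r) (by omega)
        have := q0 (N + 1 - r)
        rcases hone r with e | e <;> rw [e, abs_le] <;> constructor <;> linarith
  · have : r = 1 := by by_contra h'; simp [h'] at h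
    subst this
    simp only [one_ne_zero, if_true, if_false]
    refine ⟨?_, ?_, ?_, ?_⟩
    · rw [mul_neg, abs_neg, abs_of_nonneg hβ0]; linarith
    · rw [abs_of_nonneg hβ0]; linarith
    · linarith
    · linarith

/-- The value of the class `-1`, `b` odd. -/
lemma hasValue_quad (P : CFPair b α β) (hb : Odd b) :
    HasValue b α β ((1 - β * ((1 + α * β + (α * β) ^ 2 - (α * β) ^ 3) * (1 / (1 - (α * β) ^ 4)))) *
      (1 - β * ((1 - α * β - (α * β) ^ 2 - (α * β) ^ 3) * (1 / (1 - (α * β) ^ 4)))))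
      (fun _ => 1) (quadLabel (-1)) := by
  have h0 := P.beta_pos
  have h1 := P.beta_lt'
  have hD := P.D_pos
  have hD1 := P.D_lt
  have hw := P.beta_mul_inv
  obtain ⟨D, hDdef⟩ : ∃ D, α * β = D := ⟨_, rfl⟩
  rw [hDdef] at hD hD1 hw ⊢
  obtain ⟨Q, hQ⟩ : ∃ Q, Q = 1 / (1 - D ^ 4) := ⟨_, rfl⟩
  rw [← hQ]
  have hcw := quad_product_le_sq h0 h1 hD hD1 hQ hw
  obtain ⟨hQm, hQ1, bu, bv, bx, by'⟩ := quad_bounds hD hD1 hQ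
  -- `u`, `v`, `x`, `y` are the absolute values of the coordinates at the four vertices: one period
  -- of labels summed with weights `1, D, D², D³`, divided by `1 - D⁴`.
  obtain ⟨u, hu⟩ : ∃ u, u = (1 + D + D ^ 2 - D ^ 3) * Q := ⟨_, rfl⟩
  obtain ⟨v, hv⟩ : ∃ v, v = (1 - D - D ^ 2 - D ^ 3) * Q := ⟨_, rfl⟩
  obtain ⟨x, hx⟩ : ∃ x, x = (1 + D - D ^ 2 + D ^ 3) * Q := ⟨_, rfl⟩
  obtain ⟨y, hy⟩ : ∃ y, y = (1 - D + D ^ 2 + D ^ 3) * Q := ⟨_, rfl⟩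
  rw [← hu, ← hv] at hcw ⊢
  obtain ⟨u0, u1⟩ := hu ▸ bu
  obtain ⟨v0, v1⟩ := hv ▸ bv
  obtain ⟨x0, x1⟩ := hx ▸ bx
  obtain ⟨y0, y1⟩ := hy ▸ by'
  have hab : ∀ p : ℝ, 17 / 20 ≤ p → p ≤ 23 / 20 → |p| ≤ 23 / 20 ∧ |-p| ≤ 23 / 20 :=
    fun p h1 h2 => by rw [abs_neg, abs_of_pos (by linarith)]; exact ⟨h2, h2⟩
  have mix := fun p q (p1 : p ≤ 23 / 20) (q0 : 17 / 20 ≤ q) =>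
    quad_mixed_product_le h0 h1 u0 v0 v1 p1 q0
  have plus := fun p q (p0 : 0 ≤ p) (q0 : 0 ≤ q) => quad_product_le h0 h1 u0 v0 v1 p0 q0
  have pos : ∀ p, p ≤ 23 / 20 → 0 < 1 - β * p := fun p hp => by
    have := mul_le_mul_of_nonneg_left hp h0.le
    linarith
  have hc1 : (1 - β + β ^ 2 / 2) ^ 2 ≤ 1 := sq_one_sub_le_one h0 h1
  have ho : Odd (b : ℤ) := by exact_mod_cast hb
  rw [Int.odd_iff] at ho
  have lt3 : ∀ r, r < 3 → r = 0 ∨ r = 1 ∨ r = 2 := fun r h => by omega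
  refine hasValue_of_periodic hDdef (N := 3) (T := fun _ => 1)
    (S := fun r => if r = 1 then - (-1) else -1)
    (G := fun r => if r = 0 then -x else if r = 1 then -u else if r = 2 then v else -y)
    (H := fun r => if r = 0 then -y else if r = 1 then v else if r = 2 then -u else -x)
    (mul_pos (pos u u1) (pos v v1)) (hcw.trans hc1) (fun r hr => ?_) ?_
    (fun r hr => ?_) ?_ (fun r _ => Or.inr rfl) (fun r hr => ?_) ?_ (fun r hr _ => ?_)
    (fun r _ h => by simp at h) (r₀ := 2) (by omega)
    (Or.inl ⟨rfl, Or.inl (by simp; ring)⟩)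
  · rcases lt3 r hr with rfl | rfl | rfl <;> norm_num
    · rw [hy, hv]; linear_combination (-1) * hQm
    · rw [hu, hv]; linear_combination hQm
    · rw [hu, hx]; linear_combination (-1) * hQm
  · norm_num
    rw [hx, hy]; linear_combination (-1) * hQm
  · rcases lt3 r hr with rfl | rfl | rfl <;> norm_num
    · rw [hu, hx]; linear_combination (-1) * hQm
    · rw [hu, hv]; linear_combination hQm
    · rw [hy, hv]; linear_combination (-1) * hQm
  · norm_num
    rw [hx, hy]; linear_combination (-1) * hQm
  · rw [Int.even_iff]
    rcases lt3 r hr with rfl | rfl | rfl <;> norm_num <;> omega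
  · rw [Int.even_iff]; norm_num; omega
  · have : r = 0 ∨ r = 1 ∨ r = 2 ∨ r = 3 := by omega
    rcases this with rfl | rfl | rfl | rfl <;> norm_num
    · simp only [← mul_neg]
      refine vertexOne_of_main (g := -x) (h := -y) h0 h1 (hab x x0 x1).2 (hab y y0 y1).2 hcw ?_ ?_
      · have := mix y x y1 x0; linarith
      · have := mix x y x1 y0; linarith
    · simp only [← mul_neg]
      refine vertexOne_of_main (g := -u) h0 h1 (hab u u0 u1).2 (hab v v0 v1).1 hcw ?_ ?_
      · have := plus u v (by linarith) (by linarith); linarith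
      · linarith
    · simp only [← mul_neg]
      refine vertexOne_of_main (h := -u) h0 h1 (hab v v0 v1).1 (hab u u0 u1).2 hcw ?_ ?_
      · linarith
      · have := plus v u (by linarith) (by linarith); linarith
    · simp only [← mul_neg]
      refine vertexOne_of_main (g := -y) (h := -x) h0 h1 (hab y y0 y1).2 (hab x x0 x1).2 hcw ?_ ?_
      · have := mix x y x1 y0; linarith
      · have := mix y x y1 x0; linarith

end CFPair

/-! ### Period words and codes -/

/-- The word `f 0, g 0, f 1, g 1, …` with `n` pairs. -/
def pairWord (f g : ℕ → ℤ) (n : ℕ) : List ℤ := (List.range n).flatMap fun r => [f r, g r]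

lemma pairWord_succ (f g : ℕ → ℤ) (n : ℕ) :
    pairWord f g (n + 1) = pairWord f g n ++ [f n, g n] := by
  simp [pairWord, List.range_succ]

lemma length_pairWord (f g : ℕ → ℤ) (n : ℕ) : (pairWord f g n).length = 2 * n := by
  induction n with
  | zero => rfl
  | succ n ih => rw [pairWord_succ, List.length_append, ih]; simp; ring

lemma getElem?_pairWord (f g : ℕ → ℤ) {n r : ℕ} (h : r < n) :
    (pairWord f g n)[2 * r]? = some (f r) ∧ (pairWord f g n)[2 * r + 1]? = some (g r) := by
  induction n with
  | zero => omega
  | succ n ih =>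
    rw [pairWord_succ]
    rcases Nat.lt_or_ge r n with hr | hr
    · rw [List.getElem?_append_left (by rw [length_pairWord]; omega),
        List.getElem?_append_left (by rw [length_pairWord]; omega)]
      exact ih hr
    · obtain rfl : r = n := by omega
      rw [List.getElem?_append_right (by rw [length_pairWord]),
        List.getElem?_append_right (by rw [length_pairWord]; omega), length_pairWord,
        Nat.sub_self, Nat.add_sub_cancel_left]
      exact ⟨rfl, rfl⟩

/-- The dictionary between period words and codes: the entries at the quotients `2` are `2τ`, those
at the quotients `b` are `-σ - τ - τ'` with `τ'` the next vertex label. -/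
lemma hasPeriod_pairWord {b : ℕ} {α β γ : ℝ} {f g τ σ : ℕ → ℤ} {n : ℕ} (hn : 0 < n)
    (hf : ∀ j, f (j % n) = 2 * τ j) (hg : ∀ j, g (j % n) = -σ j - τ j - τ (j + 1)) :
    HasPeriod b α β γ (pairWord f g n) ↔ ∃ N, Follows b α β γ N τ σ := by
  have e1 : ∀ j, 2 * j % (2 * n) = 2 * (j % n) := fun j => Nat.mul_mod_mul_left 2 j n
  have e2 : ∀ j, (2 * j + 1) % (2 * n) = 2 * (j % n) + 1 := fun j => by
    have := Nat.mod_lt j hn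
    have h := Nat.div_add_mod j n
    rw [show 2 * j + 1 = 2 * n * (j / n) + (2 * (j % n) + 1) by
      rw [mul_assoc]; omega, Nat.mul_add_mod, Nat.mod_eq_of_lt (by omega)]
  have key := fun j => getElem?_pairWord f g (Nat.mod_lt j hn)
  simp only [hf, hg] at key
  unfold HasPeriod Follows
  rw [length_pairWord]
  refine exists_congr fun N => ⟨fun h j => ?_, fun h i => ?_⟩
  · have h1 := h (2 * j)
    have h2 := h (2 * j + 1)
    rw [e1, (key j).1] at h1
    rw [e2, (key j).2] at h2
    rw [mul_add, add_assoc]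
    exact ⟨(Option.some.inj h1).symm, (Option.some.inj h2).symm⟩
  · obtain ⟨h1, h2⟩ := h (i / 2)
    rcases Nat.even_or_odd' i with ⟨j, rfl | rfl⟩
    · rw [e1, (key j).1, ← mul_add, (h j).1]
    · rw [e2, (key j).2, ← add_assoc, ← mul_add, (h j).2]

lemma wordPow_succ (u : List ℤ) (k : ℕ) : wordPow u (k + 1) = wordPow u k ++ u := by
  simp [wordPow, List.replicate_succ', List.flatten_append]

lemma append_wordPow_one {f g : ℕ → ℤ} {v : List ℤ} {m : ℕ} {x y : ℤ}
    (hv : v = pairWord f g m) (hf : ∀ r, m ≤ r → f r = x) (hg : ∀ r, m ≤ r → g r = y) (k : ℕ) :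
    v ++ wordPow [x, y] k = pairWord f g (m + k) := by
  induction k with
  | zero => simp [wordPow, hv]
  | succ k ih =>
    rw [wordPow_succ, ← List.append_assoc, ih, ← add_assoc, pairWord_succ, hf _ (by omega),
      hg _ (by omega)]

lemma append_wordPow_two {f g : ℕ → ℤ} {v : List ℤ} {m : ℕ} {x y x' y' : ℤ}
    (hv : v = pairWord f g m) (hf : ∀ k, f (m + 2 * k) = x) (hg : ∀ k, g (m + 2 * k) = y)
    (hf' : ∀ k, f (m + 2 * k + 1) = x') (hg' : ∀ k, g (m + 2 * k + 1) = y') (k : ℕ) :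
    v ++ wordPow [x, y, x', y'] k = pairWord f g (m + 2 * k) := by
  induction k with
  | zero => simp [wordPow, hv]
  | succ k ih =>
    rw [wordPow_succ, ← List.append_assoc, ih,
      show m + 2 * (k + 1) = m + 2 * k + 1 + 1 by ring, pairWord_succ, pairWord_succ, hf, hg, hf',
      hg']
    simp

section words

variable {b : ℕ} {α β γ : ℝ}

lemma hasPeriod_const (n : ℤ) : HasPeriod b α β γ [2, -n - 2] ↔
    ∃ N, Follows b α β γ N (fun _ => 1) fun _ => n :=
  hasPeriod_pairWord (f := fun _ => 2) (g := fun _ => -n - 2) (n := 1) one_pos (fun _ => rfl)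
    fun _ => by ring

lemma hasPeriod_zero : HasPeriod b α β γ [0, 0] ↔
    ∃ N, Follows b α β γ N (fun _ => 0) fun _ => 0 :=
  hasPeriod_pairWord (f := fun _ => 0) (g := fun _ => 0) (n := 1) one_pos (fun _ => rfl)
    fun _ => rfl

lemma hasPeriod_spike (a : ℤ) (k : ℕ) :
    HasPeriod b α β γ ([2, -a - 2] ++ wordPow [2, -2] k) ↔
      ∃ N, Follows b α β γ N (fun _ => 1) (spikeLabel (k + 1) a) := by
  rw [append_wordPow_one (v := [2, -a - 2]) (f := fun _ => 2) (g := fun r => if r = 0 then -a - 2 else -2) (m := 1)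
    rfl (fun _ _ => rfl) (fun r hr => if_neg (by omega)), add_comm]
  refine hasPeriod_pairWord (by omega) (fun _ => rfl) fun j => ?_
  simp only [spikeLabel]; split_ifs <;> ring

lemma gapVertex_succ {n : ℕ} (hn : 2 ≤ n) (j : ℕ) :
    gapVertex n (j + 1) = if j % n = 0 then 0 else 1 := by
  unfold gapVertex
  obtain ⟨m, rfl⟩ : ∃ m, n = m + 1 := ⟨n - 1, by omega⟩
  rcases succ_mod_cases j m with ⟨h, e⟩ | ⟨h, e⟩ <;> rw [e]
  · simp
  · rw [if_neg (by omega), if_neg (by omega)]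

lemma hasPeriod_pair (a : ℤ) (k : ℕ) :
    HasPeriod b α β γ ([2, -a - 1, 0, a - 1] ++ wordPow [2, -2] k) ↔
      ∃ N, Follows b α β γ N (gapVertex (k + 2)) (pairLabel (k + 2) a) := by
  rw [append_wordPow_one (v := [2, -a - 1, 0, a - 1])
    (f := fun r => if r = 1 then 0 else 2)
    (g := fun r => if r = 0 then -a - 1 else if r = 1 then a - 1 else -2) (m := 2)
    rfl (fun r hr => if_neg (by omega))
    (fun r hr => by rw [if_neg (by omega), if_neg (by omega)]), add_comm]
  refine hasPeriod_pairWord (by omega) (fun j => ?_) fun j => ?_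
  · simp only [gapVertex]; split_ifs <;> rfl
  · rw [gapVertex_succ (by omega)]
    simp only [gapVertex, pairLabel]
    split_ifs <;> omega

lemma hasPeriod_alternating_two :
    HasPeriod b α β γ [2, -3, 2, -1] ↔
      ∃ N, Follows b α β γ N (fun _ => 1) (alternatingLabel 2 1) := by
  refine hasPeriod_pairWord (f := fun _ => 2) (g := fun r => -(-1) ^ r - 2) (τ := fun _ => 1)
    (σ := alternatingLabel 2 1) (n := 2) (by omega) (fun _ => rfl) fun j => ?_
  simp only [alternatingLabel]; ring

lemma hasPeriod_quad (a : ℤ) :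
    HasPeriod b α β γ [2, -a - 2, 2, a - 2, 2, -a - 2, 2, -a - 2] ↔
      ∃ N, Follows b α β γ N (fun _ => 1) (quadLabel a) := by
  refine hasPeriod_pairWord (f := fun _ => 2) (g := fun r => if r = 1 then a - 2 else -a - 2)
    (n := 4) (by omega) (fun _ => rfl) fun j => ?_
  simp only [quadLabel]; split_ifs <;> ring

lemma hasPeriod_alternating (a : ℤ) (k : ℕ) :
    HasPeriod b α β γ ([2, -a - 2] ++ wordPow [2, a - 2, 2, -a - 2] k) ↔
      ∃ N, Follows b α β γ N (fun _ => 1) (alternatingLabel (2 * k + 1) a) := by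
  rw [append_wordPow_two (f := fun _ => 2) (g := fun r => -((-1) ^ r * a) - 2) (m := 1)
    (by simp [pairWord]) (fun _ => rfl) (fun k => ?_) (fun _ => rfl) (fun k => ?_), add_comm]
  · refine hasPeriod_pairWord (by omega) (fun _ => rfl) fun j => ?_
    simp only [alternatingLabel]; ring
  · simp [pow_add]
  · simp [pow_add]

lemma hasPeriod_gap (a : ℤ) (k : ℕ) :
    HasPeriod b α β γ ([2, -1, 0, -1] ++ wordPow [2, -a - 2, 2, a - 2] k) ↔
      ∃ N, Follows b α β γ N (gapVertex (2 * k + 2)) (gapLabel (2 * k + 2) a) := by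
  rw [append_wordPow_two (v := [2, -1, 0, -1]) (f := fun r => if r = 1 then 0 else 2)
    (g := fun r => if r < 2 then -1 else -((-1) ^ r * a) - 2) (m := 2)
    rfl (fun k => if_neg (by omega)) (fun k => ?_) (fun k => if_neg (by omega)) (fun k => ?_),
    add_comm]
  · refine hasPeriod_pairWord (by omega) (fun j => ?_) fun j => ?_
    · simp only [gapVertex]; split_ifs <;> rfl
    · rw [gapVertex_succ (by omega)]
      simp only [gapVertex, gapLabel]
      split_ifs <;> omega
  · rw [if_neg (by omega)]; simp [pow_add]
  · rw [if_neg (by omega)]; simp [pow_add]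

end words

/-! ### The classes as codes up to sign. -/

/-- The vertex labels of a class. -/
def classTau (b : ℕ) : ClassIndex → ℕ → ℤ
  | .zero _ => fun _ => 1
  | .negTwo => fun _ => 1
  | .negOne => if Even b then fun _ => 0 else fun _ => 1
  | .even _ => fun _ => 1
  | .odd k => if Even b then gapVertex (k + 2) else gapVertex (2 * k + 2)

/-- The edge labels of a class, up to sign. -/
def classSigma (b : ℕ) : ClassIndex → ℕ → ℤ
  | .zero m => fun _ => (m : ℤ) - 2
  | .negTwo => alternatingLabel 2 1
  | .negOne => if Even b then fun _ => 0 else quadLabel (-1)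
  | .even k => if Even b then spikeLabel (k + 1) 2 else alternatingLabel (2 * k + 1) (-1)
  | .odd k => if Even b then pairLabel (k + 2) 1 else gapLabel (2 * k + 2) 1

lemma Follows.shift {b : ℕ} {α β γ : ℝ} {N : ℕ} {τ σ : ℕ → ℤ} (h : Follows b α β γ N τ σ) (s : ℕ) :
    Follows b α β γ (N + s) (fun j => τ (s + j)) fun j => σ (s + j) := fun j => by
  have := h (s + j)
  rw [← add_assoc] at this
  exact this

/-- Changing all signs of the alternating code shifts it by one place. This is why the class `-2`
has a single period word. -/
lemma exists_follows_neg_alternating_two {b : ℕ} {α β γ : ℝ} {N : ℕ}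
    (h : Follows b α β γ N (fun _ => 1) fun j => -alternatingLabel 2 1 j) :
    ∃ N, Follows b α β γ N (fun _ => 1) (alternatingLabel 2 1) := by
  refine ⟨N + 1, ?_⟩
  have e : (fun j => -alternatingLabel 2 1 (1 + j)) = alternatingLabel 2 1 := by
    funext j
    unfold alternatingLabel
    rcases Nat.mod_two_eq_zero_or_one j with h | h
    · rw [h, show (1 + j) % 2 = 1 by omega]; rfl
    · rw [h, show (1 + j) % 2 = 0 by omega]; rfl
  have := h.shift 1
  rw [e] at this
  exact this

theorem mem_periodClass_iff {b : ℕ} {α β γ : ℝ} {j : ClassIndex} (hj : j ∈ indexSet b) :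
    γ ∈ periodClass b α β j ↔ (∃ N, Follows b α β γ N (classTau b j) (classSigma b j)) ∨
      ∃ N, Follows b α β γ N (classTau b j) fun i => -classSigma b j i := by
  have hz : ∀ m : ℕ, (HasPeriod b α β γ [2, -(m : ℤ)] ∨ HasPeriod b α β γ [2, (m : ℤ) - 4]) ↔
      (∃ N, Follows b α β γ N (fun _ => 1) fun _ => (m : ℤ) - 2) ∨
        ∃ N, Follows b α β γ N (fun _ => 1) fun _ => -((m : ℤ) - 2) := fun m => by
    rw [← hasPeriod_const, ← hasPeriod_const]
    ring_nf
  unfold periodClass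
  by_cases hb : Even b
  · simp only [hb, if_true, Set.mem_ofPred_eq]
    rcases j with m | _ | _ | k | k
    · simpa [periodWordsEven, classTau, classSigma] using hz m
    · have : ¬ Odd b := Nat.not_odd_iff_even.2 hb
      simp [indexSet, topIndex, IsLowerIndex, this] at hj
    · simp [periodWordsEven, classTau, classSigma, hb, hasPeriod_zero]
    · have h1 := hasPeriod_spike (b := b) (α := α) (β := β) (γ := γ) 2 k
      have h2 := hasPeriod_spike (b := b) (α := α) (β := β) (γ := γ) (-2) k
      norm_num at h1 h2
      simp [periodWordsEven, classTau, classSigma, hb, h1, h2, neg_spikeLabel]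
    · have h1 := hasPeriod_pair (b := b) (α := α) (β := β) (γ := γ) 1 k
      have h2 := hasPeriod_pair (b := b) (α := α) (β := β) (γ := γ) (-1) k
      norm_num at h1 h2
      simp [periodWordsEven, classTau, classSigma, hb, h1, h2, neg_pairLabel]
  · simp only [hb, if_false, Set.mem_ofPred_eq]
    rcases j with m | _ | _ | k | k
    · simpa [periodWordsOdd, classTau, classSigma] using hz m
    · simp only [periodWordsOdd, classTau, classSigma, Set.mem_singleton_iff, exists_eq_left,
        hasPeriod_alternating_two]
      exact ⟨Or.inl, fun h => h.elim id fun ⟨N, h⟩ => exists_follows_neg_alternating_two h⟩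
    · have h1 := hasPeriod_quad (b := b) (α := α) (β := β) (γ := γ) (-1)
      have h2 := hasPeriod_quad (b := b) (α := α) (β := β) (γ := γ) 1
      norm_num at h1 h2
      simp [periodWordsOdd, classTau, classSigma, hb, h1, h2, neg_quadLabel]
    · have h1 := hasPeriod_alternating (b := b) (α := α) (β := β) (γ := γ) (-1) k
      have h2 := hasPeriod_alternating (b := b) (α := α) (β := β) (γ := γ) 1 k
      norm_num at h1 h2
      simp [periodWordsOdd, classTau, classSigma, hb, h1, h2, neg_alternatingLabel]
    · have h1 := hasPeriod_gap (b := b) (α := α) (β := β) (γ := γ) 1 k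
      have h2 := hasPeriod_gap (b := b) (α := α) (β := β) (γ := γ) (-1) k
      norm_num at h1 h2
      simp [periodWordsOdd, classTau, classSigma, hb, h1, h2, neg_gapLabel]

/-! ### The values and their order -/

/-- The values of the classes `2k`, `b` even. -/
noncomputable def spikeValue (β D : ℝ) (k : ℕ) : ℝ :=
  (1 - β * (2 / (1 - D ^ (k + 1)))) * (1 + β * (2 / (1 - D ^ (k + 1)) * D ^ k))

/-- The values of the classes `2k + 1`, `b` even. -/
noncomputable def pairValue (β D : ℝ) (k : ℕ) : ℝ :=
  (1 - β) ^ 2 - (β * (1 - D ^ (k + 1) * ((1 - D) / (1 - D ^ (k + 2))))) ^ 2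

/-- The values of the classes `2k`, `b` odd. -/
noncomputable def alternatingValue (β D : ℝ) (k : ℕ) : ℝ :=
  (1 - β * (1 / (1 + D)) * (1 + 2 * D / (1 - D ^ (2 * k + 1)))) *
    (1 - β * (1 / (1 + D)) * (1 - D ^ (2 * k - 1) * (2 * D / (1 - D ^ (2 * k + 1)))))

/-- The values of the classes `2k + 1`, `b` odd. -/
noncomputable def gapValue (β D : ℝ) (k : ℕ) : ℝ :=
  (1 - β) ^ 2 - (β * (D * ((1 - D ^ (2 * k) * ((1 - D ^ 2) / (1 - D ^ (2 * k + 2)))) *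
    (1 / (1 + D))))) ^ 2

/-- The value of the class `-1`, `b` odd. -/
noncomputable def quadValue (β D : ℝ) : ℝ :=
  (1 - β * ((1 + D + D ^ 2 - D ^ 3) * (1 / (1 - D ^ 4)))) *
    (1 - β * ((1 - D - D ^ 2 - D ^ 3) * (1 / (1 - D ^ 4))))

section order

variable {β D : ℝ}

lemma exists_inverse (hD : 0 < D) (hD1 : D < 128 / 1000) {t : ℝ} (ht : 0 < t) (ht1 : t ≤ 1) :
    ∃ r, r = 1 / (1 - D * t) ∧ r * (1 - D * t) = 1 ∧ 1 < r ∧ r ≤ 115 / 100 := by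
  have h : D * t ≤ D * 1 := mul_le_mul_of_nonneg_left ht1 hD.le
  have h' : 0 < D * t := mul_pos hD ht
  refine ⟨_, rfl, div_mul_cancel₀ _ (by linarith), ?_, ?_⟩
  · rw [lt_div_iff₀ (by linarith)]; linarith
  · rw [div_le_iff₀ (by linarith)]; linarith

/-- This normal form isolates the excess over the limit. It is governed by `t = D ^ k`, with `r`
near `1`. -/
lemma spikeValue_eq {t r : ℝ} {k : ℕ} (ht : t = D ^ k) (hr : r = 1 / (1 - D * t))
    (hrm : r * (1 - D * t) = 1) :
    spikeValue β D k = (1 - β) ^ 2 - β ^ 2 + 2 * β * (t * (1 - D) * r) - 4 * β ^ 2 * t * r ^ 2 := by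
  have e : 2 / (1 - D ^ (k + 1)) = 2 * r := by rw [hr, ht, pow_succ']; ring
  rw [spikeValue, e, ← ht]
  linear_combination (-2 * β) * hrm

lemma pairValue_eq {t r : ℝ} {k : ℕ} (ht : t = D ^ (k + 1)) (hr : r = 1 / (1 - D * t)) :
    pairValue β D k = (1 - β) ^ 2 - β ^ 2 +
      β ^ 2 * (t * (1 - D) * r) * (2 - t * (1 - D) * r) := by
  have e : (1 - D) / (1 - D ^ (k + 2)) = (1 - D) * r := by
    rw [hr, ht, pow_succ' D (k + 1)]; ring
  rw [pairValue, e, ← ht]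
  ring

/-- With the same `t` the excesses have leading terms `2βt` and `2β²t`. -/
lemma pairValue_lt_spikeValue (h0 : 0 < β) (h1 : β < 1836 / 10000) (hD : 0 < D)
    (hD1 : D < 128 / 1000) (k : ℕ) : pairValue β D k < spikeValue β D (k + 1) := by
  obtain ⟨t, ht⟩ : ∃ t, t = D ^ (k + 1) := ⟨_, rfl⟩
  have ht0 : 0 < t := ht ▸ pow_pos hD _
  have ht1 : t ≤ 1 := ht ▸ pow_le_one₀ hD.le (by linarith)
  obtain ⟨r, hr, hrm, r1, r2⟩ := exists_inverse hD hD1 ht0 ht1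
  rw [pairValue_eq ht hr, spikeValue_eq ht hr hrm]
  have hy : 0 < t * (1 - D) * r := mul_pos (mul_pos ht0 (by linarith)) (by linarith)
  have key : 0 < t * r * β * (2 * (1 - D) - 4 * β * r - β * (1 - D) * 2) := by
    refine mul_pos (mul_pos (mul_pos ht0 (by linarith)) h0) ?_
    have : β * r ≤ 1836 / 10000 * (115 / 100) := mul_le_mul h1.le r2 (by linarith) (by norm_num)
    have : β * (1 - D) ≤ 1836 / 10000 * 1 :=
      mul_le_mul h1.le (by linarith) (by linarith) (by norm_num)
    linarith
  have : 0 ≤ β ^ 2 * (t * (1 - D) * r) * (t * (1 - D) * r) := by positivity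
  linarith

/-- The exponent is now one larger: the leading term `2βDt`, about `β²t` because `2D = β(1 + D)`, is
beaten by `2β²t`. -/
lemma spikeValue_lt_pairValue (h0 : 0 < β) (hD : 0 < D) (hD1 : D < 128 / 1000)
    (hβ : β * (1 + D) = 2 * D) (k : ℕ) : spikeValue β D (k + 2) < pairValue β D k := by
  obtain ⟨t, ht⟩ : ∃ t, t = D ^ (k + 1) := ⟨_, rfl⟩
  have ht0 : 0 < t := ht ▸ pow_pos hD _
  have ht1 : t ≤ D := by
    rw [ht]
    calc D ^ (k + 1) ≤ D ^ 1 := pow_le_pow_of_le_one hD.le (by linarith) (by omega)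
      _ = D := pow_one D
  obtain ⟨r, hr, hrm, r1, r2⟩ := exists_inverse hD hD1 ht0 (by linarith)
  have ht' : D * t = D ^ (k + 2) := by rw [ht]; ring
  obtain ⟨s, hs, hsm, s1, s2⟩ := exists_inverse hD hD1 (mul_pos hD ht0) (by nlinarith)
  rw [pairValue_eq ht hr, spikeValue_eq ht' hs hsm]
  have hsr : s ≤ r := by
    rw [hs, hr]
    exact one_div_le_one_div_of_le (by nlinarith) (by nlinarith)
  obtain ⟨y, hy⟩ : ∃ y, y = t * (1 - D) * r := ⟨_, rfl⟩
  rw [← hy]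
  have hy0 : 0 < y := by rw [hy]; exact mul_pos (mul_pos ht0 (by linarith)) (by linarith)
  have hy1 : y ≤ 15 / 100 := by
    have : t * (1 - D) ≤ 128 / 1000 * 1 :=
      mul_le_mul (by linarith) (by linarith) (by linarith) (by norm_num)
    rw [hy]
    calc _ ≤ 128 / 1000 * 1 * (115 / 100) := mul_le_mul this r2 (by linarith) (by norm_num)
      _ ≤ _ := by norm_num
  have hy' : D * t * (1 - D) * s ≤ D * y := by
    calc D * t * (1 - D) * s ≤ D * t * (1 - D) * r :=
          mul_le_mul_of_nonneg_left hsr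
            (mul_nonneg (mul_pos hD ht0).le (by linarith))
      _ = D * y := by rw [hy]; ring
  have a1 : 2 * β * (D * t * (1 - D) * s) ≤ 2 * β * (D * y) :=
    mul_le_mul_of_nonneg_left hy' (by linarith)
  have a2 : 0 < 4 * β ^ 2 * (D * t) * s ^ 2 := by positivity
  have a3 : 2 * β * (D * y) ≤ β ^ 2 * y * (2 - y) := by
    have e : β ^ 2 * y * (2 - y) - 2 * β * (D * y) = β ^ 2 * y * (1 - D - y) := by
      linear_combination (β * y) * hβ
    have : 0 ≤ β ^ 2 * y * (1 - D - y) := mul_nonneg (by positivity) (by linarith)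
    linarith
  linarith

lemma spikeValue_one_lt (h0 : 0 < β) (hD : 0 < D) (hD1 : D < 128 / 1000)
    (hβ : β * (1 + D) = 2 * D) : spikeValue β D 1 < (1 - β) ^ 2 := by
  obtain ⟨r, hr, hrm, r1, r2⟩ := exists_inverse hD hD1 hD (by linarith)
  rw [spikeValue_eq (pow_one D).symm hr hrm]
  have e : 2 * (D * (1 - D) * r) = β := by
    linear_combination (r * D - r) * hβ + β * hrm
  have a : 0 < 4 * β ^ 2 * D * r ^ 2 := by positivity
  have : 2 * β * (D * (1 - D) * r) = β ^ 2 := by linear_combination β * e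
  linarith

lemma tendsto_pow_zero (hD : 0 < D) (hD1 : D < 128 / 1000) :
    Tendsto (fun k : ℕ => D ^ k) atTop (𝓝 0) :=
  tendsto_pow_atTop_nhds_zero_of_lt_one hD.le (by linarith)

lemma tendsto_spikeValue (hD : 0 < D) (hD1 : D < 128 / 1000) :
    Tendsto (spikeValue β D) atTop (𝓝 ((1 - β) ^ 2 - β ^ 2)) := by
  have p := tendsto_pow_zero hD hD1
  have p1 := (tendsto_add_atTop_iff_nat 1).2 p
  have E : Tendsto (fun k : ℕ => 2 / (1 - D ^ (k + 1))) atTop (𝓝 (2 / (1 - 0))) :=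
    tendsto_const_nhds.div (tendsto_const_nhds.sub p1) (by norm_num)
  have := (tendsto_const_nhds (x := (1 : ℝ)).sub (E.const_mul β)).mul
    (tendsto_const_nhds (x := (1 : ℝ)).add ((E.mul p).const_mul β))
  refine (this.congr fun k => ?_).trans (le_of_eq ?_)
  · rfl
  · congr 1; ring

lemma tendsto_pairValue (hD : 0 < D) (hD1 : D < 128 / 1000) :
    Tendsto (pairValue β D) atTop (𝓝 ((1 - β) ^ 2 - β ^ 2)) := by
  have p := tendsto_pow_zero hD hD1
  have p1 := (tendsto_add_atTop_iff_nat 1).2 p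
  have p2 := (tendsto_add_atTop_iff_nat 2).2 p
  have E : Tendsto (fun k : ℕ => (1 - D) / (1 - D ^ (k + 2))) atTop (𝓝 ((1 - D) / (1 - 0))) :=
    tendsto_const_nhds.div (tendsto_const_nhds.sub p2) (by norm_num)
  have := (tendsto_const_nhds (x := (1 - β) ^ 2)).sub
    (((tendsto_const_nhds (x := (1 : ℝ)).sub (p1.mul E)).const_mul β).pow 2)
  refine (this.congr fun k => ?_).trans (le_of_eq ?_)
  · rfl
  · congr 1; ring

lemma mul_inv_eq (hD : 0 < D) (hβ : β * (1 + D) = 2 * D) :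
    β * (1 / (1 + D)) = β - β ^ 2 / 2 := by
  rw [mul_one_div, div_eq_iff (by linarith)]
  linear_combination (β / 2) * hβ

lemma mul_mul_inv_eq (hβ : β * (1 + D) = 2 * D) :
    (β - β ^ 2 / 2) * D = β ^ 2 / 2 := by
  linear_combination (-β / 2) * hβ

lemma alternatingValue_eq (hD : 0 < D) (hβ : β * (1 + D) = 2 * D) {s r : ℝ} {k : ℕ} (hk : 1 ≤ k)
    (hs : s = D ^ (2 * k - 1)) (hr : r = 1 / (1 - D * (D * s)))
    (hrm : r * (1 - D * (D * s)) = 1) :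
    alternatingValue β D k = (1 - β) ^ 2 - β ^ 4 / 4 +
      β ^ 2 * s * ((1 - β + β ^ 2 / 2) * (1 - D ^ 2) * r - β ^ 2 * r ^ 2) := by
  have e : 2 * D / (1 - D ^ (2 * k + 1)) = 2 * D * r := by
    rw [hr, hs, ← pow_succ', ← pow_succ', show 2 * k - 1 + 1 + 1 = 2 * k + 1 by omega]; ring
  have w := mul_mul_inv_eq hβ
  have f : (1 - (β - β ^ 2 / 2) * (1 + 2 * D * r)) * (1 - (β - β ^ 2 / 2) * (1 - s * (2 * D * r))) =
      (1 - β + β ^ 2 / 2 - β ^ 2 * r) * (1 - β + β ^ 2 / 2 + β ^ 2 * r * s) := by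
    have f' : (1 - (β - β ^ 2 / 2) * (1 + 2 * D * r)) *
        (1 - (β - β ^ 2 / 2) * (1 - s * (2 * D * r))) =
        (1 - (β - β ^ 2 / 2) - 2 * ((β - β ^ 2 / 2) * D) * r) *
          (1 - (β - β ^ 2 / 2) + 2 * ((β - β ^ 2 / 2) * D) * r * s) := by ring
    rw [f', w]; ring
  rw [alternatingValue, e, ← hs, mul_inv_eq hD hβ, f]
  linear_combination (-(β ^ 2) * (1 - β + β ^ 2 / 2)) * hrm

lemma gapValue_eq (hD : 0 < D) (hβ : β * (1 + D) = 2 * D) {p r : ℝ} {k : ℕ}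
    (hp : p = D ^ (2 * k)) (hr : r = 1 / (1 - D * (D * p))) :
    gapValue β D k = (1 - β) ^ 2 - β ^ 4 / 4 +
      β ^ 4 / 4 * (p * (1 - D ^ 2) * r) * (2 - p * (1 - D ^ 2) * r) := by
  have e : (1 - D ^ 2) / (1 - D ^ (2 * k + 2)) = (1 - D ^ 2) * r := by
    rw [hr, hp, ← pow_succ', ← pow_succ']; ring
  have w := mul_mul_inv_eq hβ
  have f : β * (D * ((1 - p * ((1 - D ^ 2) * r)) * (1 / (1 + D)))) =
      β ^ 2 / 2 * (1 - p * ((1 - D ^ 2) * r)) := by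
    rw [← w, ← mul_inv_eq hD hβ]; ring
  rw [gapValue, e, ← hp, f]
  ring

lemma sq_inverse_le {x s : ℝ} (h : s * (1 - x) = 1) (hx : x ≤ 3 / 1000) (hs : 0 ≤ s) :
    s ^ 2 ≤ 102 / 100 := by
  have : s * (997 / 1000) ≤ s * (1 - x) := mul_le_mul_of_nonneg_left (by linarith) hs
  have : s ≤ 1004 / 1000 := by linarith
  have : s * s ≤ 1004 / 1000 * (1004 / 1000) := mul_le_mul this this hs (by norm_num)
  linarith

/-- The gap excess is at most `β⁴p/2`, while the alternating one is at least `0.7 β²Dp` with `D ≥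
β/2`. -/
lemma gapValue_lt_alternatingValue (h0 : 0 < β) (h1 : β < 2255 / 10000) (hD : 0 < D)
    (hD1 : D < 128 / 1000) (hβ : β * (1 + D) = 2 * D) (k : ℕ) :
    gapValue β D k < alternatingValue β D (k + 1) := by
  obtain ⟨p, hp⟩ : ∃ p, p = D ^ (2 * k) := ⟨_, rfl⟩
  have hp0 : 0 < p := hp ▸ pow_pos hD _
  have hp1 : p ≤ 1 := hp ▸ pow_le_one₀ hD.le (by linarith)
  have hs : D * p = D ^ (2 * (k + 1) - 1) := by
    rw [hp, show 2 * (k + 1) - 1 = 2 * k + 1 by omega]; ring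
  have hDp : D * p ≤ 128 / 1000 * 1 := mul_le_mul hD1.le hp1 hp0.le (by norm_num)
  have hDp0 := mul_pos hD hp0
  obtain ⟨r, hr, hrm, r1, r2⟩ := exists_inverse hD hD1 hDp0 (by linarith)
  obtain ⟨s, hs', hsm, s1, s2⟩ := exists_inverse hD hD1 (mul_pos hD hDp0) (by nlinarith)
  rw [gapValue_eq hD hβ hp hr, alternatingValue_eq hD hβ (by omega) hs hs' hsm]
  obtain ⟨z, hz⟩ : ∃ z, z = p * (1 - D ^ 2) * r := ⟨_, rfl⟩
  rw [← hz]
  have hD2 : D ^ 2 ≤ 164 / 10000 := by nlinarith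
  have hz0 : 0 ≤ z := by
    rw [hz]; exact mul_nonneg (mul_nonneg hp0.le (by linarith)) (by linarith)
  have hz1 : z ≤ p := by
    have : D ^ 2 * p ≤ D ^ 2 * 1 := mul_le_mul_of_nonneg_left hp1 (sq_nonneg D)
    have : (1 - D ^ 2) * r ≤ (1 - D * (D * p)) * r :=
      mul_le_mul_of_nonneg_right (by linarith) (by linarith)
    rw [hz, mul_assoc]
    exact mul_le_of_le_one_right hp0.le (by linarith)
  have hDβ : β / 2 ≤ D := by nlinarith
  have b2 : β ^ 2 ≤ 2255 / 10000 * (2255 / 10000) := by nlinarith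
  have bracket : 7 / 10 ≤ (1 - β + β ^ 2 / 2) * (1 - D ^ 2) * s - β ^ 2 * s ^ 2 := by
    have e1 : (7745 / 10000) * (9836 / 10000) ≤ (1 - β + β ^ 2 / 2) * (1 - D ^ 2) :=
      mul_le_mul (by linarith [sq_nonneg β]) (by linarith) (by norm_num)
        (by linarith [sq_nonneg β])
    have e2 : (1 - β + β ^ 2 / 2) * (1 - D ^ 2) * 1 ≤ (1 - β + β ^ 2 / 2) * (1 - D ^ 2) * s :=
      mul_le_mul_of_nonneg_left s1.le (by linarith)
    have s3 : s ^ 2 ≤ 102 / 100 := by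
      have : D * (D * p) ≤ D * (128 / 1000) := mul_le_mul_of_nonneg_left (by linarith) hD.le
      have : D * (D * (D * p)) ≤ 128 / 1000 * (128 / 1000 * (128 / 1000)) :=
        mul_le_mul hD1.le (by linarith) (by positivity) (by norm_num)
      exact sq_inverse_le hsm (by linarith) (by linarith)
    have e3 : β ^ 2 * s ^ 2 ≤ 2255 / 10000 * (2255 / 10000) * (102 / 100) :=
      mul_le_mul b2 s3 (sq_nonneg s) (by norm_num)
    linarith
  have up : β ^ 4 / 4 * z * (2 - z) ≤ β ^ 4 / 2 * p := by
    have : β ^ 4 / 4 * z * (2 - z) ≤ β ^ 4 / 4 * p * 2 :=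
      mul_le_mul (mul_le_mul_of_nonneg_left hz1 (by positivity)) (by linarith) (by linarith)
        (by positivity)
    linarith
  have low : β ^ 2 * (D * p) * (7 / 10) ≤ β ^ 2 * (D * p) *
      ((1 - β + β ^ 2 / 2) * (1 - D ^ 2) * s - β ^ 2 * s ^ 2) :=
    mul_le_mul_of_nonneg_left bracket (by positivity)
  have low' : β ^ 2 * p * (β / 2) ≤ β ^ 2 * p * D := mul_le_mul_of_nonneg_left hDβ (by positivity)
  have last : 0 < β ^ 2 * p * β * (7 / 10 - β) :=
    mul_pos (by positivity) (by linarith)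
  linarith

/-- Two further powers of `D` bring the alternating excess down to order `β²D³p`, and `D³ ≤ 0.05 β²`
puts this below the gap excess. -/
lemma alternatingValue_lt_gapValue (h0 : 0 < β) (h1 : β < 2255 / 10000) (hD : 0 < D)
    (hD1 : D < 128 / 1000) (hβ : β * (1 + D) = 2 * D) (k : ℕ) :
    alternatingValue β D (k + 2) < gapValue β D k := by
  obtain ⟨p, hp⟩ : ∃ p, p = D ^ (2 * k) := ⟨_, rfl⟩
  have hp0 : 0 < p := hp ▸ pow_pos hD _
  have hp1 : p ≤ 1 := hp ▸ pow_le_one₀ hD.le (by linarith)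
  have hs : D ^ 3 * p = D ^ (2 * (k + 2) - 1) := by
    rw [hp, show 2 * (k + 2) - 1 = 2 * k + 3 by omega]; ring
  have hDp : D * p ≤ 128 / 1000 * 1 := mul_le_mul hD1.le hp1 hp0.le (by norm_num)
  have hDp0 := mul_pos hD hp0
  have hD2 : D ^ 2 ≤ 164 / 10000 := by nlinarith
  have hD3 : D ^ 3 ≤ 3 / 1000 := by nlinarith
  have hDp3 : D ^ 3 * p ≤ 3 / 1000 * 1 := mul_le_mul hD3 hp1 hp0.le (by norm_num)
  have hDp3' : 0 < D ^ 3 * p := by positivity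
  obtain ⟨r, hr, hrm, r1, r2⟩ := exists_inverse hD hD1 hDp0 (by linarith)
  obtain ⟨s, hs', hsm, s1, s2⟩ := exists_inverse hD hD1 (mul_pos hD hDp3') (by nlinarith)
  rw [gapValue_eq hD hβ hp hr, alternatingValue_eq hD hβ (by omega) hs hs' hsm]
  obtain ⟨z, hz⟩ : ∃ z, z = p * (1 - D ^ 2) * r := ⟨_, rfl⟩
  rw [← hz]
  have hz0 : 98 / 100 * p ≤ z := by
    have : p * (98 / 100) ≤ p * (1 - D ^ 2) := mul_le_mul_of_nonneg_left (by linarith) hp0.le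
    have : p * (1 - D ^ 2) * 1 ≤ p * (1 - D ^ 2) * r :=
      mul_le_mul_of_nonneg_left r1.le (mul_nonneg hp0.le (by linarith))
    linarith
  have hz1 : z ≤ 1 := by
    have : D ^ 2 * p ≤ D ^ 2 * 1 := mul_le_mul_of_nonneg_left hp1 (sq_nonneg D)
    have : (1 - D ^ 2) * r ≤ (1 - D * (D * p)) * r :=
      mul_le_mul_of_nonneg_right (by linarith) (by linarith)
    rw [hz, mul_assoc]
    exact mul_le_one₀ hp1 (mul_nonneg (by linarith) (by linarith)) (by linarith)
  have hDβ : D ^ 2 ≤ β ^ 2 * (33 / 100) := by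
    have : 2 * D ≤ β * (1128 / 1000) := by rw [← hβ]; nlinarith
    nlinarith
  have up : (1 - β + β ^ 2 / 2) * (1 - D ^ 2) * s - β ^ 2 * s ^ 2 ≤ 115 / 100 := by
    have e1 : (1 - β + β ^ 2 / 2) * (1 - D ^ 2) ≤ 1 * 1 :=
      mul_le_mul (by nlinarith) (by linarith [sq_nonneg D]) (by linarith) (by norm_num)
    have : (1 - β + β ^ 2 / 2) * (1 - D ^ 2) * s ≤ 1 * 1 * s :=
      mul_le_mul_of_nonneg_right e1 (by linarith)
    have : 0 ≤ β ^ 2 * s ^ 2 := by positivity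
    linarith
  have a1 : β ^ 2 * (D ^ 3 * p) * ((1 - β + β ^ 2 / 2) * (1 - D ^ 2) * s - β ^ 2 * s ^ 2) ≤
      β ^ 2 * (D ^ 3 * p) * (115 / 100) := mul_le_mul_of_nonneg_left up (by positivity)
  have a2 : β ^ 4 / 4 * (98 / 100 * p) * 1 ≤ β ^ 4 / 4 * z * (2 - z) :=
    mul_le_mul (mul_le_mul_of_nonneg_left hz0 (by positivity)) (by linarith) (by norm_num)
      (by have : 0 ≤ z := by linarith
          positivity)
  have a3 : D ^ 3 ≤ β ^ 2 * (5 / 100) := by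
    have : D ^ 2 * D ≤ β ^ 2 * (33 / 100) * (128 / 1000) :=
      mul_le_mul hDβ hD1.le hD.le (by positivity)
    linarith [sq_nonneg β]
  have a4 : β ^ 2 * p * D ^ 3 ≤ β ^ 2 * p * (β ^ 2 * (5 / 100)) :=
    mul_le_mul_of_nonneg_left a3 (by positivity)
  have a5 : 0 < β ^ 4 * p := by positivity
  linarith

lemma alternatingValue_one_lt (h0 : 0 < β) (h1 : β < 2255 / 10000) (hD : 0 < D)
    (hD1 : D < 128 / 1000) (hβ : β * (1 + D) = 2 * D) :
    alternatingValue β D 1 < (1 - β + β ^ 2 / 2) ^ 2 := by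
  obtain ⟨r, hr, hrm, r1, r2⟩ := exists_inverse hD hD1 (mul_pos hD hD) (by nlinarith)
  rw [alternatingValue_eq hD hβ le_rfl (pow_one D).symm hr hrm]
  have e : (1 - D ^ 2) * D * r = 1 - (1 - D) * r := by linear_combination hrm
  have a : 0 < β ^ 2 * (1 - β + β ^ 2 / 2) * ((1 - D) * r) :=
    mul_pos (mul_pos (by positivity) (by nlinarith)) (mul_pos (by linarith) (by linarith))
  have b : 0 ≤ β ^ 2 * D * (β ^ 2 * r ^ 2) := by positivity
  have : β ^ 2 * D * ((1 - β + β ^ 2 / 2) * (1 - D ^ 2) * r) =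
    β ^ 2 * (1 - β + β ^ 2 / 2) * (1 - (1 - D) * r) := by rw [← e]; ring
  linarith

lemma gapValue_zero (hD : 0 < D) (hD1 : D < 128 / 1000) : gapValue β D 0 = (1 - β) ^ 2 := by
  have h : (1 : ℝ) - D ^ 2 ≠ 0 := by nlinarith
  simp [gapValue, div_self h]

/-- The product is `(1 - β(1 - A))² - (βB)²` with `A` of order `D³` and `B` of order `D`. Its
first-order gain over `(1 - β)²` is cancelled by `2A ≤ βB²`, and a strictly negative term remains.
-/
lemma quadValue_lt_gapValue (h0 : 0 < β) (hD : 0 < D) (hD1 : D < 128 / 1000)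
    (hβ : β * (1 + D) = 2 * D) : quadValue β D < gapValue β D 0 := by
  rw [gapValue_zero hD hD1]
  obtain ⟨Q, hQ⟩ : ∃ Q, Q = 1 / (1 - D ^ 4) := ⟨_, rfl⟩
  obtain ⟨hQm, hQ1, -⟩ := quad_bounds hD hD1 hQ
  rw [quadValue, ← hQ]
  obtain ⟨A, hA⟩ : ∃ A, A = D ^ 3 * (1 - D) * Q := ⟨_, rfl⟩
  obtain ⟨B, hB⟩ : ∃ B, B = D * (1 + D) * Q := ⟨_, rfl⟩
  have A0 : 0 < A := by rw [hA]; exact mul_pos (mul_pos (by positivity) (by linarith)) (by linarith)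
  have A1 : A ≤ 1 := by
    have e : A = 1 - (1 - D ^ 3) * Q := by rw [hA]; linear_combination hQm
    have : D ^ 3 ≤ 1 := pow_le_one₀ hD.le (by linarith)
    have : 0 ≤ (1 - D ^ 3) * Q := mul_nonneg (by linarith) (by linarith)
    linarith
  have e : (1 - β * ((1 + D + D ^ 2 - D ^ 3) * Q)) * (1 - β * ((1 - D - D ^ 2 - D ^ 3) * Q)) =
      (1 - β * (1 - A)) ^ 2 - (β * B) ^ 2 := by
    have : 1 - A = (1 - D ^ 3) * Q := by rw [hA]; linear_combination -hQm
    rw [this, hB]; ring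
  have hBA : 2 * A ≤ β * B ^ 2 := by
    have e1 : β * B ^ 2 = 2 * D ^ 3 * (1 + D) * Q * Q := by
      rw [hB]; linear_combination D ^ 2 * (1 + D) * Q ^ 2 * hβ
    rw [e1, hA]
    calc 2 * (D ^ 3 * (1 - D) * Q) ≤ 2 * D ^ 3 * (1 + D) * Q * 1 := by
          have : 0 ≤ D ^ 3 * D * Q := by positivity
          linarith
      _ ≤ _ := mul_le_mul_of_nonneg_left hQ1 (by positivity)
  rw [e]
  have : 0 < β ^ 2 * A * (2 - A) := mul_pos (by positivity) (by linarith)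
  have : β * (2 * A) ≤ β * (β * B ^ 2) := mul_le_mul_of_nonneg_left hBA h0.le
  linarith

/-- The left value exceeds the limit by at most `β²D³`. After clearing denominators by `β(1 + D) =
2D` the difference is a positive multiple of `D³` up to a small relative error. -/
lemma alternatingValue_lt_quadValue (h0 : 0 < β) (h1 : β < 2255 / 10000) (hD : 0 < D)
    (hD1 : D < 128 / 1000) (hβ : β * (1 + D) = 2 * D) :
    alternatingValue β D 2 < quadValue β D := by
  obtain ⟨Q, hQ⟩ : ∃ Q, Q = 1 / (1 - D ^ 4) := ⟨_, rfl⟩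
  obtain ⟨hQm, hQ1, -⟩ := quad_bounds hD hD1 hQ
  have hD2 : D ^ 2 ≤ 128 / 1000 * D := by nlinarith
  have hD3 := pow_pos hD 3
  have hD3' : D ^ 3 ≤ 3 / 1000 := by
    calc D ^ 3 ≤ (128 / 1000) ^ 3 := pow_le_pow_left₀ hD.le hD1.le 3
      _ ≤ _ := by norm_num
  have hD4 : D ^ 4 ≤ 3 / 10000 := by
    calc D ^ 4 ≤ (128 / 1000) ^ 4 := pow_le_pow_left₀ hD.le hD1.le 4
      _ ≤ _ := by norm_num
  obtain ⟨r, hr, hrm, r1, r2⟩ := exists_inverse hD hD1 (mul_pos hD hD3) (by linarith)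
  have up : alternatingValue β D 2 ≤ (1 - β) ^ 2 - β ^ 4 / 4 + β ^ 2 * D ^ 3 := by
    rw [alternatingValue_eq hD hβ (by norm_num) (show D ^ 3 = D ^ (2 * 2 - 1) by norm_num) hr hrm]
    have h5 : D * (D * D ^ 3) ≤ D ^ 2 * 1 := by
      rw [← mul_assoc, ← sq]; exact mul_le_mul_of_nonneg_left (by linarith) (sq_nonneg D)
    have a : (1 - D ^ 2) * r ≤ 1 := by
      have := mul_le_mul_of_nonneg_right (show 1 - D ^ 2 ≤ 1 - D * (D * D ^ 3) by linarith)
        (show 0 ≤ r by linarith)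
      linarith
    have a0 : 0 ≤ (1 - D ^ 2) * r := mul_nonneg (by linarith) (by linarith)
    have b : (1 - β + β ^ 2 / 2) * ((1 - D ^ 2) * r) ≤ 1 * 1 :=
      mul_le_mul (by nlinarith) a a0 (by norm_num)
    have c : 0 ≤ β ^ 2 * r ^ 2 := by positivity
    have d : β ^ 2 * D ^ 3 * ((1 - β + β ^ 2 / 2) * (1 - D ^ 2) * r - β ^ 2 * r ^ 2) ≤
        β ^ 2 * D ^ 3 * 1 := mul_le_mul_of_nonneg_left (by linarith) (by positivity)
    linarith
  refine up.trans_lt ?_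
  rw [quadValue, ← hQ]
  obtain ⟨A, hA⟩ : ∃ A, A = D ^ 3 * (1 - D) * Q := ⟨_, rfl⟩
  obtain ⟨B, hB⟩ : ∃ B, B = D * (1 + D) * Q := ⟨_, rfl⟩
  have hQ2 : Q * Q ≤ 1001 / 1000 := by
    have : Q * (9997 / 10000) ≤ Q * (1 - D ^ 4) :=
      mul_le_mul_of_nonneg_left (by linarith) (by linarith)
    have h : Q ≤ 10004 / 10000 := by linarith
    have := mul_le_mul h h (by linarith) (by norm_num)
    linarith
  have A1 : D ^ 3 * (1 - D) ≤ A := by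
    rw [hA]; exact le_mul_of_one_le_right (mul_nonneg hD3.le (by linarith)) hQ1
  have A2 : A ≤ D ^ 3 := by
    rw [hA, mul_assoc]
    refine mul_le_of_le_one_right hD3.le ?_
    have : (1 - D) * Q ≤ (1 - D ^ 4) * Q :=
      mul_le_mul_of_nonneg_right
        (by linarith [pow_le_of_le_one hD.le (by linarith : D ≤ 1) (show 4 ≠ 0 by norm_num)])
        (by linarith)
    linarith
  have B2 : B ^ 2 ≤ D ^ 2 * ((1 + D) ^ 2 * (1001 / 1000)) := by
    have : B ^ 2 = D ^ 2 * ((1 + D) ^ 2 * (Q * Q)) := by rw [hB]; ring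
    rw [this]
    exact mul_le_mul_of_nonneg_left (mul_le_mul_of_nonneg_left hQ2 (sq_nonneg _)) (sq_nonneg D)
  have e : (1 - β * ((1 + D + D ^ 2 - D ^ 3) * Q)) * (1 - β * ((1 - D - D ^ 2 - D ^ 3) * Q)) =
      (1 - β * (1 - A)) ^ 2 - (β * B) ^ 2 := by
    have : 1 - A = (1 - D ^ 3) * Q := by rw [hA]; linear_combination -hQm
    rw [this, hB]; ring
  have hβD : 2 * D * (1 - D) ≤ β := by
    have : (2 * D * (1 - D)) * (1 + D) ≤ β * (1 + D) := by rw [hβ]; linarith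
    exact le_of_mul_le_mul_right this (by linarith)
  have b2 : 4 * D ^ 2 * (1 - 2 * D) ≤ β ^ 2 := by
    have := pow_le_pow_left₀ (mul_nonneg (by linarith) (by linarith)) hβD 2
    have e : (2 * D * (1 - D)) ^ 2 = 4 * D ^ 2 * (1 - 2 * D) + 4 * D ^ 4 := by ring
    linarith [pow_pos hD 4]
  have key : 0 < D * β ^ 2 / 2 + 2 * A * (1 + D) - 2 * D * (2 * A + B ^ 2 + D ^ 3) := by
    have k1 : D * (4 * D ^ 2 * (1 - 2 * D)) ≤ D * β ^ 2 := mul_le_mul_of_nonneg_left b2 hD.le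
    have k2 : D ^ 3 * (1 - D) * (1 + D) ≤ A * (1 + D) :=
      mul_le_mul_of_nonneg_right A1 (by linarith)
    have k3 : D * A ≤ D * D ^ 3 := mul_le_mul_of_nonneg_left A2 hD.le
    have k4 : D * B ^ 2 ≤ D * (D ^ 2 * ((1 + D) ^ 2 * (1001 / 1000))) :=
      mul_le_mul_of_nonneg_left B2 hD.le
    have k5 : 0 < D ^ 3 * (2 - 2 * D - D ^ 2 - 3 * D - (1 + D) ^ 2 * (1001 / 1000)) := by
      refine mul_pos hD3 ?_
      linarith
    linarith
  have key2 : 0 < (1 + D) * (β ^ 3 / 4 + 2 * A - β * (2 * A + B ^ 2 + D ^ 3)) := by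
    have : (1 + D) * (β ^ 3 / 4 + 2 * A - β * (2 * A + B ^ 2 + D ^ 3)) =
        D * β ^ 2 / 2 + 2 * A * (1 + D) - 2 * D * (2 * A + B ^ 2 + D ^ 3) := by
      linear_combination (β ^ 2 / 4 - (2 * A + B ^ 2 + D ^ 3)) * hβ
    rw [this]; exact key
  have key3 := mul_pos h0 (pos_of_mul_pos_right key2 (by linarith))
  have : 0 ≤ β ^ 2 * A ^ 2 := by positivity
  rw [e]
  linarith

lemma tendsto_alternatingValue (hD : 0 < D) (hD1 : D < 128 / 1000) (hβ : β * (1 + D) = 2 * D) :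
    Tendsto (alternatingValue β D) atTop (𝓝 ((1 - β) ^ 2 - β ^ 4 / 4)) := by
  have p := tendsto_pow_zero hD hD1
  have p1 := p.comp (tendsto_atTop_mono (fun k : ℕ => show k ≤ 2 * k + 1 by omega) tendsto_id)
  have p2 := p.comp ((tendsto_sub_atTop_nat 1).comp
    (tendsto_atTop_mono (fun k : ℕ => show k ≤ 2 * k by omega) tendsto_id))
  have E : Tendsto (fun k : ℕ => 2 * D / (1 - D ^ (2 * k + 1))) atTop (𝓝 (2 * D / (1 - 0))) :=
    tendsto_const_nhds.div (tendsto_const_nhds.sub p1) (by norm_num)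
  have := (tendsto_const_nhds (x := (1 : ℝ)).sub
    ((tendsto_const_nhds (x := (1 : ℝ)).add E).const_mul (β * (1 / (1 + D))))).mul
    (tendsto_const_nhds (x := (1 : ℝ)).sub
    ((tendsto_const_nhds (x := (1 : ℝ)).sub (p2.mul E)).const_mul (β * (1 / (1 + D)))))
  refine (this.congr fun k => ?_).trans (le_of_eq ?_)
  · rfl
  · congr 1
    rw [mul_inv_eq hD hβ]
    have w := mul_mul_inv_eq hβ
    linear_combination (-2 * (1 - β + β ^ 2 / 2)) * w

lemma tendsto_gapValue (hD : 0 < D) (hD1 : D < 128 / 1000) (hβ : β * (1 + D) = 2 * D) :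
    Tendsto (gapValue β D) atTop (𝓝 ((1 - β) ^ 2 - β ^ 4 / 4)) := by
  have p := tendsto_pow_zero hD hD1
  have p1 := p.comp (tendsto_atTop_mono (fun k : ℕ => show k ≤ 2 * k by omega) tendsto_id)
  have p2 := p.comp (tendsto_atTop_mono (fun k : ℕ => show k ≤ 2 * k + 2 by omega) tendsto_id)
  have E : Tendsto (fun k : ℕ => (1 - D ^ 2) / (1 - D ^ (2 * k + 2))) atTop
      (𝓝 ((1 - D ^ 2) / (1 - 0))) :=
    tendsto_const_nhds.div (tendsto_const_nhds.sub p2) (by norm_num)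
  have := (tendsto_const_nhds (x := (1 - β) ^ 2)).sub
    (((((tendsto_const_nhds (x := (1 : ℝ)).sub (p1.mul E)).mul_const (1 / (1 + D))).const_mul
      D).const_mul β).pow 2)
  refine (this.congr fun k => ?_).trans (le_of_eq ?_)
  · rfl
  · congr 1
    have f : β * (D * ((1 - 0 * ((1 - D ^ 2) / (1 - 0))) * (1 / (1 + D)))) = β ^ 2 / 2 := by
      rw [← mul_mul_inv_eq hβ, ← mul_inv_eq hD hβ]; ring
    rw [f]; ring

end order

/-! ### The values of all classes, and the constant codes among them. -/

/-- The value of a class, divided by `α`. -/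
noncomputable def classValue (b : ℕ) (β D : ℝ) : ClassIndex → ℝ
  | .zero m => if b = 5 then 2 / 3 else 1 - ((m : ℝ) - 2) ^ 2 / ((b : ℝ) ^ 2 - 2 * b)
  | .negTwo => (1 - β + β ^ 2 / 2) ^ 2
  | .negOne => if Even b then (1 - β) ^ 2 else quadValue β D
  | .even k => if Even b then spikeValue β D k else alternatingValue β D k
  | .odd k => if Even b then pairValue β D k else gapValue β D k

lemma zero_mem_indexSet {b m : ℕ} (hb : 5 ≤ b) (h : ClassIndex.zero m ∈ indexSet b) :
    ∃ n, m = n + 2 ∧ n * n + 4 ≤ 2 * b ∧ (Even n ↔ Even b) ∧ (8 ≤ b ∨ n ≤ 1) := by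
  rcases h with h | ⟨h8, hp, h4, hm⟩
  · injection h with h
    by_cases e : Even b
    · refine ⟨0, by simp [h, e], by omega, by simp [e], by omega⟩
    · refine ⟨1, by simp [h, e], by omega, by simp [e], by omega⟩
  · obtain ⟨n, rfl⟩ : ∃ n, m = n + 2 := ⟨m - 2, by omega⟩
    have h1 : n ≤ Nat.sqrt (2 * b - 4) := by omega
    have h2 := Nat.le_sqrt.1 h1
    refine ⟨n, rfl, by omega, ?_, Or.inl h8⟩
    rw [← hp, Nat.even_add]; simp

/-- The arithmetic behind the constant codes: it says that the side product is not smaller than the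
main product. For small `b` the parity of `n` and the restriction to `n ≤ 1` are needed. -/
lemma two_mul_sub_le_sq {b n : ℕ} (hb : 6 ≤ b) (hn : n * n + 4 ≤ 2 * b) (hp : Even n ↔ Even b)
    (h8 : 8 ≤ b ∨ n ≤ 1) : 2 * ((b : ℤ) - 2) ≤ ((b : ℤ) - 2 - n) ^ 2 := by
  have hn' : (n : ℤ) * n + 4 ≤ 2 * b := by exact_mod_cast hn
  by_cases h10 : 10 ≤ b
  · have : (10 : ℤ) ≤ b := by exact_mod_cast h10
    by_contra hcon
    push Not at hcon
    nlinarith [sq_nonneg ((b : ℤ) - 2 - 2 * n)]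
  · have hn4 : n ≤ 3 := by nlinarith
    rw [Nat.even_iff, Nat.even_iff] at hp
    interval_cases b <;> interval_cases n <;> omega

namespace CFPair

variable {b : ℕ} {α β : ℝ}

lemma beta_lt_of_even (P : CFPair b α β) (hb : Even b) : β < 1836 / 10000 := by
  have h6 : 6 ≤ b := by
    have := P.five_le
    rcases hb with ⟨c, rfl⟩
    omega
  have h6' : (6 : ℝ) ≤ b := by exact_mod_cast h6
  have h := P.beta_mul
  have h0 := P.beta_pos
  have h1 := P.beta_lt
  by_contra hcon
  push Not at hcon
  have h2 : 1836 / 10000 * (2 - 1836 / 10000) ≤ β * (2 - β) := by nlinarith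
  have h3 : 6 * (1836 / 10000 * (2 - 1836 / 10000)) ≤ (b : ℝ) * (β * (2 - β)) :=
    mul_le_mul h6' h2 (by norm_num) (by linarith)
  rw [h] at h3
  norm_num at h3

lemma beta_mul_one_add (P : CFPair b α β) : β * (1 + α * β) = 2 * (α * β) := by
  linear_combination -P.D_mul

lemma hasValue_zero_class (P : CFPair b α β) {m : ℕ} (h : ClassIndex.zero m ∈ indexSet b) :
    HasValue b α β (classValue b β (α * β) (.zero m)) (fun _ => 1) fun _ => (m : ℤ) - 2 := by
  obtain ⟨n, rfl, hn, hp, h8⟩ := zero_mem_indexSet P.five_le h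
  have h0 := P.beta_pos
  have h1 := P.beta_lt
  have hu := P.sub_two_mul
  have hu2 := P.sq_mul
  have hu0 : 0 < β / (1 - α * β) := div_pos h0 (by linarith [P.D_lt])
  have hb2 := P.beta_mul
  have hb5 := P.five_le
  obtain ⟨u, hud⟩ : ∃ u, u = β / (1 - α * β) := ⟨_, rfl⟩
  rw [← hud] at hu hu2 hu0
  have hpar : Even (b + n) := by rw [Nat.even_add]; exact hp.symm
  have e : (fun _ : ℕ => ((n + 2 : ℕ) : ℤ) - 2) = fun _ => (n : ℤ) := by
    funext _; push_cast; ring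
  rw [e]
  have hbR : (5 : ℝ) ≤ b := P.b_ge
  -- For `b = 5` the order of the products is reversed: with `u² = 1/15` and `β = 1 - 3u` the side
  -- product `25u² - 1 = 2/3` is below the main product `14/15`. Hence the exceptional top value.
  by_cases h5 : b = 5
  · subst h5
    have hn1 : n = 1 := by
      rw [Nat.even_iff, Nat.even_iff] at hp
      omega
    subst hn1
    norm_num at hu hu2
    refine P.hasValue_const hpar (x := u) (by rw [hud]; simp) (by nlinarith) ?_ ?_ ?_ ?_ <;>
      simp only [classValue, if_true]
    · norm_num
    · nlinarith
    · nlinarith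
    · right; nlinarith
  · have hbb : 0 < (b : ℝ) ^ 2 - 2 * b := by nlinarith
    have hx2 : (n * u) ^ 2 = ((n + 2 : ℕ) - 2 : ℝ) ^ 2 / ((b : ℝ) ^ 2 - 2 * b) := by
      rw [eq_div_iff hbb.ne']
      push_cast
      linear_combination ((n : ℝ) ^ 2) * hu2
    have hc : classValue b β (α * β) (.zero (n + 2)) = 1 - (n * u) ^ 2 := by
      simp only [classValue, h5, if_false]
      rw [hx2]
    have hnR : (n : ℝ) * n + 4 ≤ 2 * b := by exact_mod_cast hn
    have hx0 : 0 ≤ n * u := by positivity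
    have hsq : (n * u) ^ 2 ≤ 1 / 4 := by
      rcases h8 with h8 | h8
      · have h8R : (8 : ℝ) ≤ b := by exact_mod_cast h8
        have : (n * u) ^ 2 * (b - 2) ≤ (2 / 8) * (b - 2) := by
          have : (n * u) ^ 2 ≤ (2 * b - 4) * u ^ 2 := by
            rw [mul_pow]; exact mul_le_mul_of_nonneg_right (by linarith) (sq_nonneg u)
          nlinarith
        exact (le_of_mul_le_mul_right this (by linarith)).trans (by norm_num)
      · have h8R : (n : ℝ) ≤ 1 := by exact_mod_cast h8
        have h1 : n * u ≤ u := mul_le_of_le_one_left hu0.le h8R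
        have h2 : u ^ 2 * 15 ≤ 1 := by
          rw [← hu2]; exact mul_le_mul_of_nonneg_left (by nlinarith) (sq_nonneg u)
        have := pow_le_pow_left₀ hx0 h1 2
        linarith
    have hx1 : n * u ≤ 1 / 2 := by nlinarith
    rw [hc]
    refine P.hasValue_const hpar (x := n * u) (by rw [hud]) hx1 (by linarith) le_rfl ?_ (Or.inl rfl)
    have hint := two_mul_sub_le_sq (by omega) hn hp h8
    have hintR : 2 * ((b : ℝ) - 2) ≤ ((b : ℝ) - 2 - n) ^ 2 := by exact_mod_cast hint
    -- Side product at least main product means `(1 - β - nu)² ≥ β(2 - β)`. Both sides are integer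
    -- multiples of `u²`.
    have e1 : (1 - β - n * u) = (b - 2 - n) * u := by rw [← hu]; ring
    have e2 : β * (2 - β) = 2 * (b - 2) * u ^ 2 := by
      have : (b : ℝ) * (β * (2 - β)) = b * (2 * (b - 2) * u ^ 2) := by
        rw [hb2]; linear_combination (-2) * hu2
      exact mul_left_cancel₀ (by positivity) this
    have : β * (2 - β) ≤ (1 - β - n * u) ^ 2 := by
      rw [e1, e2, mul_pow]; exact mul_le_mul_of_nonneg_right hintR (sq_nonneg u)
    nlinarith

theorem hasValue_class (P : CFPair b α β) {j : ClassIndex} (hj : j ∈ indexSet b) :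
    HasValue b α β (classValue b β (α * β) j) (classTau b j) (classSigma b j) := by
  by_cases hb : Even b
  · rcases j with m | _ | _ | k | k
    · exact P.hasValue_zero_class hj
    · have : ¬ Odd b := Nat.not_odd_iff_even.2 hb
      simp [indexSet, topIndex, IsLowerIndex, this] at hj
    · simpa [classValue, classTau, classSigma, hb] using P.hasValue_zero hb
    · have hk : 1 ≤ k := by simpa [indexSet, topIndex, IsLowerIndex] using hj
      simp only [classValue, classTau, classSigma, hb, if_true]
      exact P.hasValue_spike hb (P.beta_lt_of_even hb) hk
    · simp only [classValue, classTau, classSigma, hb, if_true]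
      exact P.hasValue_pair hb k
  · have ho := Nat.not_even_iff_odd.1 hb
    rcases j with m | _ | _ | k | k
    · exact P.hasValue_zero_class hj
    · exact P.hasValue_alternating_two ho
    · simp only [classValue, classTau, classSigma, hb, if_false]
      exact P.hasValue_quad ho
    · have hk : 1 ≤ k := by simpa [indexSet, topIndex, IsLowerIndex] using hj
      simp only [classValue, classTau, classSigma, hb, if_false]
      exact P.hasValue_alternating ho hk
    · simp only [classValue, classTau, classSigma, hb, if_false]
      exact P.hasValue_gap ho k

end CFPair

/-! ### The order of the values. -/

/-- The classes `2, 1, 4, 3, 6, 5, …`, in decreasing order of their values. -/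
def pairChain (n : ℕ) : ClassIndex := if Even n then .even (n / 2 + 1) else .odd (n / 2)

/-- The classes other than the `(0, m)`, `b` even, in decreasing order of their values. -/
def evenChain : ℕ → ClassIndex
  | 0 => .negOne
  | n + 1 => pairChain n

/-- The classes other than the `(0, m)`, `b` odd, in decreasing order of their values. -/
def oddChain : ℕ → ClassIndex
  | 0 => .negTwo
  | 1 => pairChain 0
  | 2 => pairChain 1
  | 3 => .negOne
  | n + 4 => pairChain (n + 2)

/-- The classes other than the `(0, m)`, in decreasing order of their values. -/
def lowerChain (b : ℕ) : ℕ → ClassIndex := if Even b then evenChain else oddChain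

lemma pairChain_even (k : ℕ) : pairChain (2 * k) = .even (k + 1) := by
  simp [pairChain]

lemma pairChain_odd (k : ℕ) : pairChain (2 * k + 1) = .odd k := by
  simp [pairChain]; omega

lemma exists_lowerChain {b : ℕ} {j : ClassIndex} (hj : j ∈ indexSet b) :
    (∃ m, j = .zero m) ∨ ∃ n, j = lowerChain b n := by
  by_cases hb : Even b
  · have hno : ¬ Odd b := Nat.not_odd_iff_even.2 hb
    rcases j with m | _ | _ | k | k
    · exact Or.inl ⟨m, rfl⟩
    · simp [indexSet, topIndex, IsLowerIndex, hno] at hj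
    · exact Or.inr ⟨0, by simp [lowerChain, hb, evenChain]⟩
    · have hk : 1 ≤ k := by simpa [indexSet, topIndex, IsLowerIndex] using hj
      obtain ⟨i, rfl⟩ := Nat.exists_eq_add_of_le' hk
      exact Or.inr ⟨2 * i + 1, by simp [lowerChain, hb, evenChain, pairChain_even]⟩
    · exact Or.inr ⟨2 * k + 1 + 1, by simp [lowerChain, hb, evenChain, pairChain_odd]⟩
  · rcases j with m | _ | _ | k | k
    · exact Or.inl ⟨m, rfl⟩
    · exact Or.inr ⟨0, by simp [lowerChain, hb, oddChain]⟩
    · exact Or.inr ⟨3, by simp [lowerChain, hb, oddChain]⟩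
    · have hk : 1 ≤ k := by simpa [indexSet, topIndex, IsLowerIndex] using hj
      obtain ⟨i, rfl⟩ := Nat.exists_eq_add_of_le' hk
      rcases i with _ | i
      · exact Or.inr ⟨1, by simp [lowerChain, hb, oddChain, pairChain]⟩
      · refine Or.inr ⟨2 * i + 4, ?_⟩
        simp only [lowerChain, hb, oddChain, if_false]
        rw [show 2 * i + 2 = 2 * (i + 1) by ring, pairChain_even]
    · rcases k with _ | k
      · exact Or.inr ⟨2, by simp [lowerChain, hb, oddChain, pairChain]⟩
      · refine Or.inr ⟨2 * k + 1 + 4, ?_⟩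
        simp only [lowerChain, hb, oddChain, if_false]
        rw [show 2 * k + 1 + 2 = 2 * (k + 1) + 1 by ring, pairChain_odd]

namespace CFPair

variable {b : ℕ} {α β : ℝ}

lemma classValue_pairChain_succ_lt (P : CFPair b α β) (n : ℕ) :
    classValue b β (α * β) (pairChain (n + 1)) < classValue b β (α * β) (pairChain n) := by
  have h0 := P.beta_pos
  have hD := P.D_pos
  have hD1 := P.D_lt
  have hβ := P.beta_mul_one_add
  rcases Nat.even_or_odd' n with ⟨k, rfl | rfl⟩
  · rw [pairChain_even, pairChain_odd]
    by_cases hb : Even b <;> simp only [classValue, hb, if_true, if_false]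
    · exact pairValue_lt_spikeValue h0 (P.beta_lt_of_even hb) hD hD1 k
    · exact gapValue_lt_alternatingValue h0 P.beta_lt' hD hD1 hβ k
  · rw [pairChain_odd, show 2 * k + 1 + 1 = 2 * (k + 1) by ring, pairChain_even]
    by_cases hb : Even b <;> simp only [classValue, hb, if_true, if_false]
    · exact spikeValue_lt_pairValue h0 hD hD1 hβ k
    · exact alternatingValue_lt_gapValue h0 P.beta_lt' hD hD1 hβ k

lemma strictAnti_pairChain (P : CFPair b α β) :
    StrictAnti fun n => classValue b β (α * β) (pairChain n) :=
  strictAnti_nat_of_succ_lt P.classValue_pairChain_succ_lt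

lemma strictAnti_lowerChain (P : CFPair b α β) :
    StrictAnti fun n => classValue b β (α * β) (lowerChain b n) := by
  have h0 := P.beta_pos
  have hD := P.D_pos
  have hD1 := P.D_lt
  have hβ := P.beta_mul_one_add
  refine strictAnti_nat_of_succ_lt fun n => ?_
  by_cases hb : Even b <;> simp only [lowerChain, hb, if_true, if_false]
  · rcases n with _ | n
    · simpa [evenChain, pairChain, classValue, hb] using spikeValue_one_lt h0 hD hD1 hβ
    · exact P.classValue_pairChain_succ_lt n
  · rcases n with _ | _ | _ | _ | n
    · simpa [oddChain, pairChain, classValue, hb] using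
        alternatingValue_one_lt h0 P.beta_lt' hD hD1 hβ
    · exact P.classValue_pairChain_succ_lt 0
    · simpa [oddChain, pairChain, classValue, hb] using quadValue_lt_gapValue h0 hD hD1 hβ
    · simpa [oddChain, pairChain, classValue, hb] using
        alternatingValue_lt_quadValue h0 P.beta_lt' hD hD1 hβ
    · exact P.classValue_pairChain_succ_lt (n + 2)

lemma tendsto_classValue_even (P : CFPair b α β) :
    Tendsto (fun k => classValue b β (α * β) (.even k)) atTop
      (𝓝 ((1 - β) ^ 2 - if Even b then β ^ 2 else β ^ 4 / 4)) := by
  by_cases hb : Even b <;> simp only [classValue, hb, if_true, if_false]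
  · exact tendsto_spikeValue P.D_pos P.D_lt
  · exact tendsto_alternatingValue P.D_pos P.D_lt P.beta_mul_one_add

lemma tendsto_classValue_odd (P : CFPair b α β) :
    Tendsto (fun k => classValue b β (α * β) (.odd k)) atTop
      (𝓝 ((1 - β) ^ 2 - if Even b then β ^ 2 else β ^ 4 / 4)) := by
  by_cases hb : Even b <;> simp only [classValue, hb, if_true, if_false]
  · exact tendsto_pairValue P.D_pos P.D_lt
  · exact tendsto_gapValue P.D_pos P.D_lt P.beta_mul_one_add

lemma strictAnti_classValue_even (P : CFPair b α β) :
    StrictAnti fun k => classValue b β (α * β) (.even (k + 1)) := fun i j h => by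
  have := P.strictAnti_pairChain (show 2 * i < 2 * j by omega)
  simpa only [pairChain_even] using this

lemma strictAnti_classValue_odd (P : CFPair b α β) :
    StrictAnti fun k => classValue b β (α * β) (.odd k) := fun i j h => by
  have := P.strictAnti_pairChain (show 2 * i + 1 < 2 * j + 1 by omega)
  simpa only [pairChain_odd] using this

/-- Odd-indexed classes occur arbitrarily far down the chain, and their values decrease strictly to
the limit. -/
lemma limit_lt_lowerChain (P : CFPair b α β) (n : ℕ) :
    ((1 - β) ^ 2 - if Even b then β ^ 2 else β ^ 4 / 4) <
      classValue b β (α * β) (lowerChain b n) := by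
  have h1 : ∀ k, ((1 - β) ^ 2 - if Even b then β ^ 2 else β ^ 4 / 4) <
      classValue b β (α * β) (.odd k) := fun k =>
    (P.strictAnti_classValue_odd.antitone.le_of_tendsto P.tendsto_classValue_odd (k + 1)).trans_lt
      (P.strictAnti_classValue_odd (Nat.lt_succ_self k))
  have h2 : ∃ m, n ≤ m ∧ ∃ k, lowerChain b m = .odd k := by
    by_cases hb : Even b
    · refine ⟨2 * n + 1 + 1, by omega, n, ?_⟩
      simp [lowerChain, hb, evenChain, pairChain_odd]
    · refine ⟨2 * n + 1 + 4, by omega, n + 1, ?_⟩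
      simp only [lowerChain, hb, oddChain, if_false]
      rw [show 2 * n + 1 + 2 = 2 * (n + 1) + 1 by ring, pairChain_odd]
  obtain ⟨m, hm, k, hk⟩ := h2
  have := P.strictAnti_lowerChain.antitone hm
  simp only [hk] at this
  exact (h1 k).trans_le this

lemma one_sub_sq (P : CFPair b α β) : (1 - β) ^ 2 = 1 - 2 / b := by
  have hb := P.b_ge
  rw [eq_sub_iff_add_eq, ← eq_sub_iff_add_eq', div_eq_iff (by linarith)]
  linear_combination -P.beta_mul

lemma one_sub_inv (P : CFPair b α β) : 1 - β + β ^ 2 / 2 = 1 - 1 / b := by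
  have hb := P.b_ge
  rw [eq_sub_iff_add_eq, ← eq_sub_iff_add_eq', div_eq_iff (by linarith)]
  linear_combination (-1 / 2) * P.beta_mul

/-- The head of the chain is `1 - 2/b` for even `b` and `(1 - 1/b)²` for odd `b`, to be compared
with `1 - n²/(b² - 2b)`. For even `b` this is `n² ≤ 2b - 4`, with equality as stated; for odd `b`
parity sharpens the bound to `n² ≤ 2b - 5` and the inequality is strict. -/
lemma lowerChain_zero_le (P : CFPair b α β) {m : ℕ} (h : ClassIndex.zero m ∈ indexSet b) :
    classValue b β (α * β) (lowerChain b 0) ≤ classValue b β (α * β) (.zero m) ∧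
      (classValue b β (α * β) (lowerChain b 0) = classValue b β (α * β) (.zero m) ↔
        Even b ∧ ((m : ℤ) - 2) ^ 2 = 2 * b - 4) := by
  obtain ⟨n, rfl, hn, hp, h8⟩ := zero_mem_indexSet P.five_le h
  have hbR := P.b_ge
  have hb0 : (0 : ℝ) < b := by linarith
  have hb2 : (0 : ℝ) < b - 2 := by linarith
  have hbb : (0 : ℝ) < (b : ℝ) ^ 2 - 2 * b := by nlinarith
  have hcast : (((n + 2 : ℕ) : ℝ) - 2) = n := by push_cast; ring
  have hcastZ : (((n + 2 : ℕ) : ℤ) - 2) = n := by push_cast; ring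
  rw [hcastZ]
  by_cases hb : Even b
  · have h5 : b ≠ 5 := by rintro rfl; revert hb; decide
    simp only [lowerChain, evenChain, classValue, hb, if_true, h5, if_false, P.one_sub_sq,
      true_and, hcast]
    have e : (2 : ℝ) / b = (2 * b - 4) / ((b : ℝ) ^ 2 - 2 * b) := by
      rw [div_eq_div_iff hb0.ne' hbb.ne']; ring
    rw [e]
    constructor
    · gcongr
      have : (n : ℝ) * n + 4 ≤ 2 * b := by exact_mod_cast hn
      nlinarith
    · rw [sub_right_inj, div_left_inj' hbb.ne']
      constructor
      · intro h; have : (n : ℝ) ^ 2 = 2 * b - 4 := h.symm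
        exact_mod_cast this
      · intro h; have : ((n : ℤ) : ℝ) ^ 2 = 2 * (b : ℤ) - 4 := by exact_mod_cast h
        simpa using this.symm
  · have key : classValue b β (α * β) (lowerChain b 0) <
        classValue b β (α * β) (.zero (n + 2)) := by
      simp only [lowerChain, oddChain, classValue, hb, if_false, P.one_sub_inv, hcast]
      by_cases h5 : b = 5
      · subst h5; norm_num
      · simp only [h5, if_false]
        have hn5 : n * n + 5 ≤ 2 * b := by
          have hno : Odd n := by rw [← Nat.not_even_iff_odd, hp]; exact hb
          have : Odd (n * n) := hno.mul hno
          rw [Nat.odd_iff] at this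
          omega
        have hnR : (n : ℝ) * n + 5 ≤ 2 * b := by exact_mod_cast hn5
        have : (n : ℝ) ^ 2 / ((b : ℝ) ^ 2 - 2 * b) < 2 / b - 1 / b ^ 2 := by
          rw [show (2 : ℝ) / b - 1 / b ^ 2 = (2 * b - 1) / b ^ 2 by field_simp,
            div_lt_div_iff₀ hbb (by positivity)]
          have : (n : ℝ) ^ 2 * b ^ 2 ≤ (2 * b - 5) * b ^ 2 :=
            mul_le_mul_of_nonneg_right (by linarith) (sq_nonneg _)
          nlinarith
        have e : (1 - 1 / (b : ℝ)) ^ 2 = 1 - (2 / b - 1 / b ^ 2) := by ring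
        rw [e]; linarith
    exact ⟨key.le, fun h => absurd h key.ne, fun h => absurd h.1 hb⟩

lemma zero_mem_indexSet_inj (P : CFPair b α β) {m m' : ℕ} (h : ClassIndex.zero m ∈ indexSet b)
    (h' : ClassIndex.zero m' ∈ indexSet b)
    (e : classValue b β (α * β) (.zero m) = classValue b β (α * β) (.zero m')) : m = m' := by
  obtain ⟨n, rfl, hn, hp, h8⟩ := zero_mem_indexSet P.five_le h
  obtain ⟨n', rfl, hn', hp', h8'⟩ := zero_mem_indexSet P.five_le h'
  by_cases h5 : b = 5
  · subst h5
    rw [Nat.even_iff, Nat.even_iff] at hp hp'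
    omega
  · have hbR := P.b_ge
    have hbb : (0 : ℝ) < (b : ℝ) ^ 2 - 2 * b := by nlinarith
    simp only [classValue, h5, if_false, sub_right_inj, div_left_inj' hbb.ne'] at e
    push_cast at e
    simp only [add_sub_cancel_right] at e
    have := (pow_left_inj₀ (Nat.cast_nonneg n) (Nat.cast_nonneg n') two_ne_zero).1 e
    have : n = n' := by exact_mod_cast this
    omega

lemma limit_lt_classValue (P : CFPair b α β) {j : ClassIndex} (hj : j ∈ indexSet b) :
    ((1 - β) ^ 2 - if Even b then β ^ 2 else β ^ 4 / 4) < classValue b β (α * β) j := by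
  rcases exists_lowerChain hj with ⟨m, rfl⟩ | ⟨n, rfl⟩
  · exact (P.limit_lt_lowerChain 0).trans_le (P.lowerChain_zero_le hj).1
  · exact P.limit_lt_lowerChain n

lemma lowerChain_zero_eq_negOne {b : ℕ} (hb : Even b) : lowerChain b 0 = .negOne := by
  simp [lowerChain, hb, evenChain]

/-- Two classes with the same value are equal or coincident. -/
lemma classValue_eq_iff (P : CFPair b α β) {j j' : ClassIndex} (hj : j ∈ indexSet b)
    (hj' : j' ∈ indexSet b) : classValue b β (α * β) j = classValue b β (α * β) j' ↔
      j' = j ∨ Coincident b j j' := by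
  have mix : ∀ {m n : ℕ}, ClassIndex.zero m ∈ indexSet b →
      classValue b β (α * β) (lowerChain b n) = classValue b β (α * β) (.zero m) →
      Even b ∧ ((m : ℤ) - 2) ^ 2 = 2 * b - 4 ∧ lowerChain b n = .negOne := by
    intro m n hm e
    obtain ⟨h1, h2⟩ := P.lowerChain_zero_le hm
    have hn : n = 0 := by
      by_contra hn
      have : _ < _ := P.strictAnti_lowerChain (Nat.pos_of_ne_zero hn)
      simp only at this
      linarith
    subst hn
    obtain ⟨hb, h⟩ := h2.1 e
    exact ⟨hb, h, lowerChain_zero_eq_negOne hb⟩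
  constructor
  · intro e
    rcases exists_lowerChain hj with ⟨m, rfl⟩ | ⟨n, rfl⟩ <;>
      rcases exists_lowerChain hj' with ⟨m', rfl⟩ | ⟨n', rfl⟩
    · rw [P.zero_mem_indexSet_inj hj hj' e]; exact Or.inl rfl
    · obtain ⟨hb, h, e'⟩ := mix hj e.symm
      exact Or.inr ⟨hb, m, h, Or.inr ⟨rfl, e'⟩⟩
    · obtain ⟨hb, h, e'⟩ := mix hj' e
      exact Or.inr ⟨hb, m', h, Or.inl ⟨e', rfl⟩⟩
    · rw [P.strictAnti_lowerChain.injective e]; exact Or.inl rfl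
  · rintro (rfl | ⟨hb, m, h, ⟨rfl, rfl⟩ | ⟨rfl, rfl⟩⟩)
    · rfl
    · rw [← lowerChain_zero_eq_negOne hb]
      exact (P.lowerChain_zero_le hj').2.2 ⟨hb, h⟩
    · rw [← lowerChain_zero_eq_negOne hb]
      exact ((P.lowerChain_zero_le hj).2.2 ⟨hb, h⟩).symm

lemma topIndex_mem (b : ℕ) : topIndex b ∈ indexSet b := Or.inl rfl

lemma classValue_le_top (P : CFPair b α β) {j : ClassIndex} (hj : j ∈ indexSet b) :
    classValue b β (α * β) j ≤ classValue b β (α * β) (topIndex b) := by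
  have zero : ∀ m, ClassIndex.zero m ∈ indexSet b →
      classValue b β (α * β) (.zero m) ≤ classValue b β (α * β) (topIndex b) := by
    intro m hm
    obtain ⟨n, rfl, hn, hp, h8⟩ := zero_mem_indexSet P.five_le hm
    unfold topIndex
    by_cases h5 : b = 5
    · simp [classValue, h5]
    · have hbR := P.b_ge
      have hbb : (0 : ℝ) < (b : ℝ) ^ 2 - 2 * b := by nlinarith
      simp only [classValue, h5, if_false]
      gcongr ?_ - ?_ / _
      by_cases hb : Even b
      · simp only [hb, if_true]; push_cast; nlinarith
      · have hno : Odd n := by rw [← Nat.not_even_iff_odd, hp]; exact hb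
        have h1 : (1 : ℝ) ≤ n := by exact_mod_cast hno.pos
        simp only [hb, if_false]; push_cast; nlinarith
  rcases exists_lowerChain hj with ⟨m, rfl⟩ | ⟨n, rfl⟩
  · exact zero m hj
  · have h1 : _ ≤ _ := P.strictAnti_lowerChain.antitone (Nat.zero_le n)
    have ht := topIndex_mem b
    unfold topIndex at ht ⊢
    exact h1.trans (P.lowerChain_zero_le ht).1

lemma rhoStar_eq (P : CFPair b α β) : α * classValue b β (α * β) (topIndex b) = rhoStar b α := by
  unfold rhoStar topIndex
  by_cases hb : Even b
  · have h5 : b ≠ 5 := by rintro rfl; revert hb; decide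
    simp [classValue, hb, h5]
  · by_cases h5 : b = 5
    · subst h5; simp [classValue, hb]; ring
    · simp only [classValue, hb, h5, if_false]; norm_num

end CFPair

/-! ### Constant codes above the limit point, and the theorem. -/

/-- Bounded solutions of the recursions with a constant label. -/
lemma IsOrbit.const_label {D : ℝ} {σ : ℕ → ℤ} {g h : ℕ → ℝ} (O : IsOrbit D σ g h) (hD : 0 < D)
    (hD1 : D < 1) {N : ℕ} {n : ℤ} (hσ : ∀ j, σ (N + j) = n) {B : ℝ} (hB : ∀ j, |h (N + j)| ≤ B) :
    (∀ j, h (N + j) = n / (1 - D)) ∧ Tendsto (fun j => g (N + j)) atTop (𝓝 (n / (1 - D))) := by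
  obtain ⟨e, he⟩ : ∃ e, e = n / (1 - D) := ⟨_, rfl⟩
  rw [← he]
  have hem : e = n + D * e := by
    have : e * (1 - D) = n := by rw [he]; exact div_mul_cancel₀ _ (by linarith)
    linarith
  have pow0 := tendsto_pow_atTop_nhds_zero_of_lt_one hD.le hD1
  constructor
  · intro j
    have hr : ∀ i, h (N + j) - e = D ^ i * (h (N + (j + i)) - e) := by
      intro i
      induction i with
      | zero => simp
      | succ i ih =>
        have := O.right (N + (j + i))
        rw [hσ, add_assoc] at this
        rw [ih, this, ← add_assoc j i 1]
        linear_combination D ^ i * (-hem)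
    have hlim : Tendsto (fun i => D ^ i * (h (N + (j + i)) - e)) atTop (𝓝 0) := by
      refine squeeze_zero_norm (a := fun i => D ^ i * (B + |e|)) (fun i => ?_) ?_
      · rw [Real.norm_eq_abs, abs_mul, abs_of_pos (pow_pos hD i)]
        exact mul_le_mul_of_nonneg_left ((abs_sub _ _).trans (by linarith [hB (j + i)]))
          (pow_pos hD i).le
      · simpa using pow0.mul_const (B + |e|)
    have : h (N + j) - e = 0 :=
      tendsto_nhds_unique (tendsto_const_nhds.congr hr) hlim
    linarith
  · have hl : ∀ i, g (N + i) = e + D ^ i * (g N - e) := by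
      intro i
      induction i with
      | zero => simp
      | succ i ih =>
        have := O.left (N + i)
        rw [hσ, ih] at this
        rw [← add_assoc, this]
        linear_combination -hem
    have := (tendsto_const_nhds (x := e)).add (pow0.mul_const (g N - e))
    simp only [zero_mul, add_zero] at this
    exact this.congr fun i => (hl i).symm

namespace CFPair

variable {b : ℕ} {α β : ℝ}

/-- A bounded right coordinate with constant label is exactly the fixed point `n / (1 - D)`, and the
left coordinate converges to it. The strict vertex inequalities hold along the sequence and become
weak in the limit. -/
lemma const_label_bounds (P : CFPair b α β) {c : ℝ} {τ σ : ℕ → ℤ} {g h : ℕ → ℝ}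
    (A : AboveOrbit b β (α * β) c τ σ g h) {N : ℕ} {n : ℤ} (hτ : ∀ j, τ (N + j) = 1)
    (hσ : ∀ j, σ (N + j) = n) {x : ℝ} (hx : x = n * (β / (1 - α * β))) :
    c ≤ 1 - x ^ 2 ∧ c ≤ |(1 - 2 * β - x) * (3 - 2 * β - x)| ∧
      c ≤ |(1 - 2 * β + x) * (3 - 2 * β + x)| := by
  have h0 := P.beta_pos
  have hB : ∀ j, |h (N + j)| ≤ 1 / β := fun j => by
    have := A.range_right _ (hτ j)
    have e : |h (N + j)| * β = |β * h (N + j)| := by rw [abs_mul, abs_of_pos h0, mul_comm]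
    rw [le_div_iff₀ h0, e, abs_le]
    constructor <;> linarith
  obtain ⟨hh, hg⟩ := A.orbit.const_label P.D_pos (by linarith [P.D_lt]) hσ hB
  have e : β * (n / (1 - α * β)) = x := by rw [hx]; ring
  have hg' : Tendsto (fun j => β * g (N + j)) atTop (𝓝 x) := e ▸ hg.const_mul β
  have hh' : ∀ j, β * h (N + j) = x := fun j => by rw [hh, e]
  refine ⟨?_, ?_, ?_⟩
  · have := ge_of_tendsto' ((tendsto_const_nhds (x := (1 : ℝ)).sub hg').mul_const (1 + x))
      fun j => by have := A.one _ (hτ j); rw [hh'] at this; exact this.le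
    linarith
  · exact ge_of_tendsto' ((tendsto_const_nhds.sub hg').mul_const _).abs
      fun j => by have := A.side _ (hτ j); rw [hh'] at this; exact this.le
  · exact ge_of_tendsto' ((tendsto_const_nhds.add hg').mul_const _).abs
      fun j => by have := A.mirror _ (hτ j); rw [hh'] at this; exact this.le

/-- The constant labels that occur above the limit point. -/
lemma const_label_mem (P : CFPair b α β) {τ σ : ℕ → ℤ} {g h : ℕ → ℝ}
    (A : AboveOrbit b β (α * β) ((1 - β) ^ 2 - if Even b then β ^ 2 else β ^ 4 / 4) τ σ g h)
    {N : ℕ} {n : ℤ} (hτ : ∀ j, τ (N + j) = 1) (hσ : ∀ j, σ (N + j) = n) :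
    ClassIndex.zero (n.natAbs + 2) ∈ indexSet b := by
  have h0 := P.beta_pos
  have h1 := P.beta_lt'
  have hD := P.D_pos
  have hb5 := P.five_le
  have hbR := P.b_ge
  have hu := P.sub_two_mul
  have hu2 := P.sq_mul
  have hu0 : 0 < β / (1 - α * β) := div_pos h0 (by linarith [P.D_lt])
  obtain ⟨c1, c2, c3⟩ := P.const_label_bounds A hτ hσ rfl
  obtain ⟨u, hud⟩ : ∃ u, u = β / (1 - α * β) := ⟨_, rfl⟩
  rw [← hud] at hu hu2 hu0 c1 c2 c3
  have hpar : (n.natAbs) % 2 = b % 2 := by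
    have := A.coding.parity (N + 0)
    rw [hσ, add_assoc N 0 1, hτ, hτ, Int.even_iff] at this
    omega
  have hb4 : β ^ 4 / 4 ≤ 1 / 1000 := by
    have : β ^ 4 ≤ (2255 / 10000) ^ 4 := pow_le_pow_left₀ h0.le h1.le 4
    norm_num at this; linarith
  have hc : 1 - 2 * β ≤ (1 - β) ^ 2 - if Even b then β ^ 2 else β ^ 4 / 4 := by
    split_ifs
    · linarith
    · have : β ^ 4 ≤ β ^ 2 := pow_le_pow_of_le_one h0.le (by linarith) (by norm_num)
      linarith [sq_nonneg β]
  -- The main product gives `(nu)² ≤ 2β`, and `2β(b² - 2b) = 2b - 4 + (1 - D)²` is less than `2b -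
  -- 3`; integrality does the rest.
  have hn : n * n + 4 ≤ 2 * b := by
    have hbb : 0 < (b : ℝ) ^ 2 - 2 * b := by nlinarith
    have e1 : (n * u) ^ 2 ≤ 2 * β := by linarith
    have e2 : (n : ℝ) ^ 2 ≤ 2 * β * ((b : ℝ) ^ 2 - 2 * b) := by
      calc (n : ℝ) ^ 2 = (n * u) ^ 2 * ((b : ℝ) ^ 2 - 2 * b) := by
            linear_combination (-(n : ℝ) ^ 2) * hu2
        _ ≤ _ := mul_le_mul_of_nonneg_right e1 hbb.le
    have e3 : 2 * β * ((b : ℝ) ^ 2 - 2 * b) = 2 * b - 4 + (1 - α * β) ^ 2 := by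
      have q1 := P.b_mul_beta
      have q2 := P.beta_mul_one_add
      have q3 : (b : ℝ) * (2 * (α * β)) = (1 + α * β) ^ 2 := by
        rw [← q2]; linear_combination (1 + α * β) * q1
      linear_combination 2 * (b - 2) * q1 + q3
    have e4 : (n : ℝ) * n + 3 < 2 * b := by nlinarith [P.D_lt]
    have : n * n + 3 < 2 * b := by exact_mod_cast e4
    omega
  have hna : n.natAbs * n.natAbs + 4 ≤ 2 * b := by
    have : ((n.natAbs * n.natAbs : ℕ) : ℤ) = n * n := Int.natAbs_mul_self
    omega
  have small : n.natAbs ≤ 1 → ClassIndex.zero (n.natAbs + 2) ∈ indexSet b := by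
    intro h
    left
    unfold topIndex
    by_cases he : Even b
    · rw [if_pos he]; rw [Nat.even_iff] at he; congr 1; omega
    · rw [if_neg he]; rw [Nat.even_iff] at he; congr 1; omega
  by_cases h8 : 8 ≤ b
  · by_cases hs : n.natAbs ≤ 1
    · exact small hs
    · refine Or.inr ⟨h8, ?_, by omega, ?_⟩
      · rw [Nat.even_iff, Nat.even_iff]; omega
      · have : n.natAbs ≤ Nat.sqrt (2 * b - 4) := Nat.le_sqrt.2 (by omega)
        omega
  · have hb : b = 5 ∨ b = 6 ∨ b = 7 := by omega
    have hn3 : n.natAbs ≤ 3 := by nlinarith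
    rcases hb with rfl | rfl | rfl
    · apply small
      have : n.natAbs ≤ 2 := by nlinarith
      omega
    · apply small
      -- For `b = 6` the labels `±2` pass the bound above. Their side product is exactly `1/2`, less
      -- than `1 - 2β`.
      by_contra hcon
      have hab : n = 2 ∨ n = -2 := by omega
      rw [if_pos (by decide)] at c1 c2 c3
      norm_num at hu hu2
      have hu3 : 19 / 100 < u := by nlinarith
      have e : |(1 - 2 * β - 2 * u) * (3 - 2 * β - 2 * u)| = 1 / 2 := by
        have : (1 - 2 * β - 2 * u) * (3 - 2 * β - 2 * u) = 1 / 2 := by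
          rw [show β = 1 - 4 * u by linarith]; linarith
        rw [this]; norm_num
      rcases hab with rfl | rfl
      · push_cast at c2
        rw [e] at c2
        nlinarith
      · rw [show (1 - 2 * β + ((-2 : ℤ) : ℝ) * u) * (3 - 2 * β + ((-2 : ℤ) : ℝ) * u) =
          (1 - 2 * β - 2 * u) * (3 - 2 * β - 2 * u) by push_cast; ring, e] at c3
        nlinarith
    · apply small
      -- For `b = 7` the labels `±3` remain, with side product exactly `2/5`.
      by_contra hcon
      have hab : n = 3 ∨ n = -3 := by omega
      rw [if_neg (by decide)] at c1 c2 c3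
      norm_num at hu hu2
      have e : |(1 - 2 * β - 3 * u) * (3 - 2 * β - 3 * u)| = 2 / 5 := by
        have : (1 - 2 * β - 3 * u) * (3 - 2 * β - 3 * u) = 2 / 5 := by
          rw [show β = 1 - 5 * u by linarith]; linarith
        rw [this]; norm_num
      rcases hab with rfl | rfl
      · push_cast at c2
        rw [e] at c2
        nlinarith
      · rw [show (1 - 2 * β + ((-3 : ℤ) : ℝ) * u) * (3 - 2 * β + ((-3 : ℤ) : ℝ) * u) =
          (1 - 2 * β - 3 * u) * (3 - 2 * β - 3 * u) by push_cast; ring, e] at c3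
        nlinarith

end CFPair

lemma Follows.of_eventuallyCode {b : ℕ} {α β γ : ℝ} {N : ℕ} {τ σ τ₀ σ₀ : ℕ → ℤ}
    (F : Follows b α β γ N τ σ) (E : EventuallyCode τ σ τ₀ σ₀) :
    ∃ N, Follows b α β γ N τ₀ σ₀ := by
  obtain ⟨M, hM⟩ := E
  have := F.shift M
  rw [funext fun j => (hM j).1, funext fun j => (hM j).2] at this
  exact ⟨_, this⟩

namespace CFPair

variable {b : ℕ} {α β : ℝ}

/-- Every point with a value above the limit point lies in one of the classes. -/
theorem exists_mem_periodClass (P : CFPair b α β) {γ : ℝ} (hγ : γ ∉ lattice α)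
    (hc : deltaInf b α β < approxConstStar α β γ) : ∃ j ∈ indexSet b, γ ∈ periodClass b α β j := by
  obtain ⟨N, τ, σ, g, h, F, A⟩ := P.exists_aboveOrbit hγ hc
  have lower : ∀ j, IsLowerIndex b j → j ∈ indexSet b := fun j hj => Or.inr hj
  have const : (∃ n, EventuallyCode τ σ (fun _ => 1) fun _ => n) →
      ∃ j ∈ indexSet b, γ ∈ periodClass b α β j := by
    rintro ⟨n, E⟩
    have hm : ClassIndex.zero (n.natAbs + 2) ∈ indexSet b := by
      obtain ⟨M, hM⟩ := E
      exact P.const_label_mem A (fun j => (hM j).1) fun j => (hM j).2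
    refine ⟨_, hm, (mem_periodClass_iff hm).2 ?_⟩
    have F' := F.of_eventuallyCode E
    have e : (((n.natAbs + 2 : ℕ) : ℤ) - 2 = n) ∨ (-(((n.natAbs + 2 : ℕ) : ℤ) - 2) = n) := by
      omega
    simp only [classTau, classSigma]
    rcases e with e | e
    · exact Or.inl (by rw [e]; exact F')
    · exact Or.inr (by rw [e]; exact F')
  by_cases hb : Even b
  · simp only [hb, if_true] at A
    rcases (A.evenOrbit hb P.beta_pos (P.beta_lt_of_even hb) P.D_mul).classification with
      E | E | ⟨k, a, hk, ha, E⟩ | ⟨k, a, ha, E⟩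
    · have hm := lower .negOne trivial
      refine ⟨_, hm, (mem_periodClass_iff hm).2 (Or.inl ?_)⟩
      simpa [classTau, classSigma, hb] using F.of_eventuallyCode E
    · exact const E
    · have hm := lower (.even k) hk
      refine ⟨_, hm, (mem_periodClass_iff hm).2 ?_⟩
      simp only [classTau, classSigma, hb, if_true, neg_spikeLabel]
      rcases ha with rfl | rfl
      · exact Or.inl (F.of_eventuallyCode E)
      · exact Or.inr (F.of_eventuallyCode E)
    · have hm := lower (.odd k) trivial
      refine ⟨_, hm, (mem_periodClass_iff hm).2 ?_⟩
      simp only [classTau, classSigma, hb, if_true, neg_pairLabel]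
      rcases ha with rfl | rfl
      · exact Or.inl (F.of_eventuallyCode E)
      · exact Or.inr (F.of_eventuallyCode E)
  · have ho := Nat.not_even_iff_odd.1 hb
    simp only [hb, if_false] at A
    rcases (A.oddOrbit ho P.beta_pos P.beta_lt' P.D_mul).classification with
      E | E | ⟨a, ha, E⟩ | ⟨k, a, hk, ha, E⟩ | ⟨k, a, ha, E⟩
    · exact const E
    · have hm := lower .negTwo ho
      exact ⟨_, hm, (mem_periodClass_iff hm).2 (Or.inl (F.of_eventuallyCode E))⟩
    · have hm := lower .negOne trivial
      refine ⟨_, hm, (mem_periodClass_iff hm).2 ?_⟩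
      simp only [classTau, classSigma, hb, if_false, neg_quadLabel]
      rcases ha with rfl | rfl
      · exact Or.inr (F.of_eventuallyCode E)
      · exact Or.inl (F.of_eventuallyCode E)
    · have hm := lower (.even k) hk
      refine ⟨_, hm, (mem_periodClass_iff hm).2 ?_⟩
      simp only [classTau, classSigma, hb, if_false, neg_alternatingLabel]
      rcases ha with rfl | rfl
      · exact Or.inr (F.of_eventuallyCode E)
      · exact Or.inl (F.of_eventuallyCode E)
    · have hm := lower (.odd k) trivial
      refine ⟨_, hm, (mem_periodClass_iff hm).2 ?_⟩
      simp only [classTau, classSigma, hb, if_false, neg_gapLabel]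
      rcases ha with rfl | rfl
      · exact Or.inl (F.of_eventuallyCode E)
      · exact Or.inr (F.of_eventuallyCode E)

theorem value_of_mem_periodClass (P : CFPair b α β) {j : ClassIndex} (hj : j ∈ indexSet b) {γ : ℝ}
    (hγ : γ ∈ periodClass b α β j) :
    γ ∉ lattice α ∧ approxConstStar α β γ = α * classValue b β (α * β) j := by
  have key : ∀ {τ σ : ℕ → ℤ}, HasValue b α β (classValue b β (α * β) j) τ σ →
      (∃ N, Follows b α β γ N τ σ) →
      γ ∉ lattice α ∧ approxConstStar α β γ = α * classValue b β (α * β) j := by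
    rintro τ σ ⟨g, h, O, c0, c1, ha⟩ ⟨N, hf⟩
    exact P.value_of_follows hf O c0 c1 ha
  have V := P.hasValue_class hj
  rcases (mem_periodClass_iff hj).1 hγ with h | h
  · exact key V h
  · exact key V.neg h

lemma periodClass_nonempty (P : CFPair b α β) {j : ClassIndex} (hj : j ∈ indexSet b) :
    (periodClass b α β j).Nonempty := by
  obtain ⟨g, h, O, -⟩ := P.hasValue_class hj
  obtain ⟨γ, hγ⟩ := O.exists_follows P
  exact ⟨γ, (mem_periodClass_iff hj).2 (Or.inl ⟨0, hγ⟩)⟩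

end CFPair

theorem theorem3 (b : ℕ) (hb : 5 ≤ b) (α β : ℝ)
    (hα : IsNegCF (partialQuotient b) α)
    (hβ : IsNegCF (fun i => partialQuotient b (i + 1)) β) :
    ∃ δ : ClassIndex → ℝ,
      (∀ j ∈ indexSet b, (periodClass b α β j).Nonempty ∧
        ∀ γ ∈ periodClass b α β j, γ ∉ lattice α ∧ approxConstStar α β γ = δ j) ∧
      IsGreatest (spectrumStar α β) (δ (topIndex b)) ∧
      δ (topIndex b) = rhoStar b α ∧
      {v ∈ spectrumStar α β | deltaInf b α β < v} = δ '' indexSet b ∧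
      StrictAnti (fun k : ℕ => δ (.even (k + 1))) ∧
      Tendsto (fun k : ℕ => δ (.even k)) atTop (𝓝 (deltaInf b α β)) ∧
      StrictAnti (fun k : ℕ => δ (.odd k)) ∧
      Tendsto (fun k : ℕ => δ (.odd k)) atTop (𝓝 (deltaInf b α β)) ∧
      ∀ j ∈ indexSet b, ∀ γ, γ ∉ lattice α →
        (approxConstStar α β γ = δ j ↔
          ∃ j' ∈ indexSet b, (j' = j ∨ Coincident b j j') ∧ γ ∈ periodClass b α β j') := by
  have P := CFPair.of_isNegCF hb hα hβ
  have ha := P.alpha_pos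
  have value := fun {j} (hj : j ∈ indexSet b) {γ} => P.value_of_mem_periodClass hj (γ := γ)
  have inSpec : ∀ j ∈ indexSet b, α * classValue b β (α * β) j ∈ spectrumStar α β := by
    intro j hj
    obtain ⟨γ, hγ⟩ := P.periodClass_nonempty hj
    exact ⟨γ, value hj hγ⟩
  have above : ∀ j ∈ indexSet b, deltaInf b α β < α * classValue b β (α * β) j := fun j hj =>
    mul_lt_mul_of_pos_left (P.limit_lt_classValue hj) ha
  refine ⟨fun j => α * classValue b β (α * β) j,
    fun j hj => ⟨P.periodClass_nonempty hj, fun γ => value hj⟩,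
    ⟨inSpec _ (CFPair.topIndex_mem b), ?_⟩, P.rhoStar_eq, ?_,
    fun i j h => mul_lt_mul_of_pos_left (P.strictAnti_classValue_even h) ha,
    -- The sequence begins with the value at `.even 0`, which labels no class; the limit does not
    -- see it.
    P.tendsto_classValue_even.const_mul α,
    fun i j h => mul_lt_mul_of_pos_left (P.strictAnti_classValue_odd h) ha,
    P.tendsto_classValue_odd.const_mul α, ?_⟩
  · rintro v ⟨γ, hγ, rfl⟩
    rcases le_or_gt (approxConstStar α β γ) (deltaInf b α β) with h | h
    · exact h.trans (above _ (CFPair.topIndex_mem b)).le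
    · obtain ⟨j, hj, hm⟩ := P.exists_mem_periodClass hγ h
      rw [(value hj hm).2]
      exact mul_le_mul_of_nonneg_left (P.classValue_le_top hj) ha.le
  · ext v
    constructor
    · rintro ⟨⟨γ, hγ, rfl⟩, h⟩
      obtain ⟨j, hj, hm⟩ := P.exists_mem_periodClass hγ h
      exact ⟨j, hj, (value hj hm).2.symm⟩
    · rintro ⟨j, hj, rfl⟩
      exact ⟨inSpec j hj, above j hj⟩
  · intro j hj γ hγ
    constructor
    · intro h
      obtain ⟨j', hj', hm⟩ := P.exists_mem_periodClass hγ (h ▸ above j hj)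
      have e := (value hj' hm).2
      rw [h] at e
      exact ⟨j', hj', (P.classValue_eq_iff hj hj').1 (mul_left_cancel₀ ha.ne' e), hm⟩
    · rintro ⟨j', hj', hc, hm⟩
      simp only
      rw [(value hj' hm).2, (P.classValue_eq_iff hj hj').2 hc]
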